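/- **Lemma 4.1.** Let $n\ge 1$, and let $p,\ell$ be positive integers with $\ell>\frac{3n}{2}-1$ and $p<\ell-\frac{3n}{2}+1$. Let $W$ be a bounded open neighborhood of the origin in $\mathbf C^n$, let $U$ be an open neighborhood of the closure of $W$, and let $f$ be a real-valued $C^p$ function on $U$ with $f(0)=0$ and $df$ nowhere zero on $U$. For real $\sigma$ let $S_\sigma=\{z\in W: f(z)=\sigma\}$, with its Euclidean surface measure. Assume that for some $\sigma^*>0$ there is a $C^p$ family of $C^p$ diffeomorphisms $\varphi_\sigma:S_0\to S_\sigma$, $\sigma\in(-\sigma^*,\sigma^*)$ (that is, $(\sigma,z)\mapsto\varphi_\sigma(z)$ is $C^p$ on $(-\sigma^*,\sigma^*)\times S_0$ and each $\varphi_\sigma$ is a bijection onto $S_\sigma$ with $C^p$ inverse), with $\varphi_0$ the identity. For a function $v$ defined on $S_\sigma$ for $0<|\sigma|<\sigma^*$, a function $v_0$ on $S_0$, and $A\subset S_0$, say that $v|_{S_\sigma}$ approaches $v_0$ in $L^1(A)$ if $v_0\in L^1(A)$, $v\circ\varphi_\sigma\in L^1(A)$ for all sufficiently small $\sigma\ne0$,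 and $\int_A|v\circ\varphi_\sigma-v_0|\to0$ as $\sigma\to0$, $\sigma\ne 0$. 1. Let $\alpha>1$ and let $u$ be a measurable complex-valued function on $W$ such that $u/|f|^\alpha$ is $L^1$ on $W$. Then there is a sequence $\sigma_\nu\to0$ with $0<\sigma_\nu<\sigma^*$ such that $u|_{S_{\sigma_\nu}}$ is $L^1$ for every $\nu$ and $\int_{S_{\sigma_\nu}}|u|\to0$ as $\nu\to\infty$. 2. Let $u$ be a complex-valued $L^2$ function on $W$, and let $K(z,\zeta)=\dfrac{K_1(z,\zeta)}{|z-\zeta|^{4n-2}}$, where $K_1$ is a complex-valued $C^p$ function on $U\times U$ with $|K_1(z,\zeta)|\le C|z-\zeta|^{2n-1}$ on $U\times U$ for some constant $C$. Let $r>0$ be such that the open ball $B(r)$ of radius $r$ centered at the origin is contained in $W$, and let $$v(z)=\int_{\zeta\in B(r)}K(z,\zeta)\,u(\zeta)\,d\lambda(\zeta),$$ where $d\lambda$ is Lebesgue measure. Then for every $\sigma$ the integral converges absolutely for almost every $z\in S_\sigma$ and $v|_{S_\sigma}$ is $L^1$ on $S_\sigma$. Moreover $v|_{S_\sigma}$ approaches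 $v|_{S_0}$ in $L^1(Q)$ for every compact $Q\subset S_0$, and in $L^1(S_0)$ if the closed ball of radius $r$ is contained in $W$. 3. Let $u$, $K_1$, $r$, $v$ be as in (2). Assume in addition that $u/|f|^\ell$ is $L^2$ on $W$, and that the order of vanishing of $K_1$ along the diagonal is inherited by its derivatives in $z$: for some constant $C'$, the $j$-th derivative of $K_1$ in $z$ satisfies $|D_z^jK_1(z,\zeta)|\le C'|z-\zeta|^{2n-1-j}$ on $W\times W$ for all integers $1\le j\le p$ with $j<2n-1$ (this is automatic if $K_1$ is $C^{2n-1}$ on $U\times U$, for example $C^\infty$). Then the integral defining $v(z)$ converges absolutely for every $z\in S_0$ and $v|_{S_0}$ is $C^p$ on $S_0$. 4. Let $\omega=\sum_j\omega_j\,d\bar z_j$ be a $\bar\partial$-closed $(0,1)$-current on $U$ whose coefficients are locally integrable functions, such that $\omega_j$ is $C^{p-1}$ on $U\setminus\{f=0\}$ and $\omega_j/|f|^\ell$ is $L^2$ on $U$ for each $j$. Let $v$ be a distribution on $W$ with $\bar\partial v=\omega$ on $W$ in the sense of distributions. Then $v$ is given by a locally integrable function on $W$ that is continuous on $W\setminus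 S_0$ (and again denoted by $v$), and there is a $C^p$ function $v_0$ on $S_0$ such that $v|_{S_\sigma}$ approaches $v_0$ in $L^1(Q)$ for every compact $Q\subset S_0$ and $\bar\partial_bv_0=0$ on $S_0$, i.e. at every $z\in S_0$ the differential of $v_0$ is complex linear on the complex tangent space $T_zS_0\cap iT_zS_0$. -/

import Mathlib

open MeasureTheory Set Filter Topology
open scoped Distributions LineDeriv

namespace LocalReg

/-- Complex Euclidean space of dimension `n`, with its Euclidean norm. -/
abbrev Cn (n : ℕ) : Type := EuclideanSpace ℂ (Fin n)

/-- The level hypersurface `{z ∈ W | f z = σ}`. -/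
def level {n : ℕ} (W : TopologicalSpace.Opens (Cn n)) (f : Cn n → ℝ) (σ : ℝ) : Set (Cn n) :=
  {z | z ∈ W ∧ f z = σ}

/-- The Euclidean surface measure of real hypersurfaces of `Cn n`, that is, the Hausdorff measure
of dimension `2 * n - 1` normalized so as to agree with Lebesgue measure on hyperplanes. -/
noncomputable def area (n : ℕ) : Measure (Cn n) :=
  Measure.euclideanHausdorffMeasure (2 * n - 1)

/-- `g` is of class `C^p` on the subset `s`: near every point of `s` it extends to a `C^p` map on an
open subset of the ambient space. On an embedded `C^p` submanifold this is the usual notion. -/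
def IsCpOn {X Y : Type*} [NormedAddCommGroup X] [NormedSpace ℝ X] [NormedAddCommGroup Y]
    [NormedSpace ℝ Y] (p : ℕ) (g : X → Y) (s : Set X) : Prop :=
  ∀ x ∈ s, ∃ V : Set X, IsOpen V ∧ x ∈ V ∧
    ∃ G : X → Y, ContDiffOn ℝ p G V ∧ EqOn G g (s ∩ V)

/-- `φ` is a `C^p` family (jointly in the parameter and the point) of `C^p` diffeomorphisms
`φ σ : S 0 → S σ`, for `σ ∈ (-σs, σs)`, with `φ 0` the identity. -/
structure IsDiffeoFamily {n : ℕ} (p : ℕ) (S : ℝ → Set (Cn n)) (σs : ℝ)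
    (φ : ℝ → Cn n → Cn n) : Prop where
  jointly_Cp : IsCpOn p (fun q : ℝ × Cn n => φ q.1 q.2) (Ioo (-σs) σs ×ˢ S 0)
  diffeo : ∀ σ ∈ Ioo (-σs) σs, MapsTo (φ σ) (S 0) (S σ) ∧
    ∃ ψ : Cn n → Cn n, MapsTo ψ (S σ) (S 0) ∧ InvOn ψ (φ σ) (S 0) (S σ) ∧ IsCpOn p ψ (S σ)
  at_zero : ∀ z ∈ S 0, φ 0 z = z

/-- `v ∘ φ σ` tends to `v₀` in the `L¹` norm on `A` (for the surface measure) as `σ → 0`, `σ ≠ 0`. -/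
def TendstoL1 {n : ℕ} (φ : ℝ → Cn n → Cn n) (v v₀ : Cn n → ℂ) (A : Set (Cn n)) : Prop :=
  IntegrableOn v₀ A (area n) ∧
  (∀ᶠ σ in 𝓝[≠] (0 : ℝ), IntegrableOn (fun z => v (φ σ z)) A (area n)) ∧
  Tendsto (fun σ => ∫ z in A, ‖v (φ σ z) - v₀ z‖ ∂(area n)) (𝓝[≠] 0) (𝓝 0)

/-- The kernel `K₁(z, ζ) / |z - ζ|^(4n-2)`. -/
noncomputable def kernel {n : ℕ} (K₁ : Cn n → Cn n → ℂ) (z ζ : Cn n) : ℂ :=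
  K₁ z ζ / ((‖z - ζ‖ ^ (4 * n - 2) : ℝ) : ℂ)

/-- The numerator `K₁` is `C^p` on `U × U` and `|K₁(z, ζ)| ≤ C |z - ζ|^(2n-1)` there. -/
def IsNumerator {n : ℕ} (p : ℕ) (U : Set (Cn n)) (K₁ : Cn n → Cn n → ℂ) : Prop :=
  ContDiffOn ℝ p (fun q : Cn n × Cn n => K₁ q.1 q.2) (U ×ˢ U) ∧
  ∃ C : ℝ, ∀ z ∈ U, ∀ ζ ∈ U, ‖K₁ z ζ‖ ≤ C * ‖z - ζ‖ ^ (2 * n - 1)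

/-- The `z`-derivatives of `K₁` of order `j` with `1 ≤ j ≤ p` and `j < 2n - 1` are bounded by
`C |z - ζ|^(2n-1-j)` on `W × W`: the vanishing of `K₁` to order `2n - 1` along the diagonal is
inherited by its derivatives. -/
def HasNumeratorDerivBounds {n : ℕ} (p : ℕ) (W : Set (Cn n)) (K₁ : Cn n → Cn n → ℂ) : Prop :=
  ∃ C : ℝ, ∀ j : ℕ, 1 ≤ j → j ≤ p → j < 2 * n - 1 → ∀ z ∈ W, ∀ ζ ∈ W,
    ‖iteratedFDeriv ℝ j (fun z' => K₁ z' ζ) z‖ ≤ C * ‖z - ζ‖ ^ (2 * n - 1 - j)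

/-- The function `v(z) = ∫_{B(r)} K(z, ζ) u(ζ) dλ(ζ)`. -/
noncomputable def kernelIntegral {n : ℕ} (K₁ : Cn n → Cn n → ℂ) (u : Cn n → ℂ) (r : ℝ)
    (z : Cn n) : ℂ :=
  ∫ ζ in Metric.ball (0 : Cn n) r, kernel K₁ z ζ * u ζ

/-- The distribution `T` on `Ω` is given by the locally integrable function `h`. -/
def IsGivenBy {n : ℕ} {Ω : TopologicalSpace.Opens (Cn n)} (T : 𝓓'(Ω, ℂ)) (h : Cn n → ℂ) : Prop :=
  LocallyIntegrableOn h (Ω : Set (Cn n)) ∧ ∀ χ : 𝓓(Ω, ℝ), T χ = ∫ z, χ z • h z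

/-- The distributional derivative `∂T/∂z̄_j = (∂T/∂x_j + i ∂T/∂y_j) / 2`. -/
noncomputable def dbar {n : ℕ} {Ω : TopologicalSpace.Opens (Cn n)} (j : Fin n) (T : 𝓓'(Ω, ℂ)) :
    𝓓'(Ω, ℂ) :=
  (1 / 2 : ℂ) • (∂_{EuclideanSpace.single j (1 : ℂ)} T +
    Complex.I • ∂_{EuclideanSpace.single j Complex.I} T)

/-- The tangential Cauchy–Riemann equation `∂̄_b v = 0` on the hypersurface `S` on which `f` is
constant and whose tangent space at `z` is the kernel of `df`: the differential of `v` is complex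
linear on the complex tangent space `ker df ∩ i ker df`. It is computed with a local `C¹` extension
of `v`; only derivatives tangential to `S` enter, so the choice of the extension is immaterial. -/
def IsCR {n : ℕ} (f : Cn n → ℝ) (v : Cn n → ℂ) (S : Set (Cn n)) : Prop :=
  ∀ z ∈ S, ∃ V : Set (Cn n), IsOpen V ∧ z ∈ V ∧
    ∃ G : Cn n → ℂ, ContDiffOn ℝ 1 G V ∧ EqOn G v (S ∩ V) ∧
      ∀ X : Cn n, fderiv ℝ f z X = 0 → fderiv ℝ f z (Complex.I • X) = 0 →
        fderiv ℝ G z (Complex.I • X) = Complex.I * fderiv ℝ G z X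

end LocalReg

open LocalReg

/-! Write d = 2n - 1 for the dimension of the level sets. The kernels in question have a singularity
of order d, which just fails to be integrable along a set of dimension d. The remedy is that f is
Lipschitz: for z on S_σ one has |f(ζ) - σ| ≤ L|z - ζ|, so a quarter power of the distance can be
traded for a quarter power of |f - σ|. What remains near the diagonal is a kernel of order d - 1/8,
integrable along level sets, the weight |f - σ|^(-1/4), square integrable uniformly in σ, and a gain
ε^(1/8) from the restriction to |z - ζ| < ε. By Cauchy–Schwarz with u in L² the near part of the
potential is O(ε^(1/8)) in L¹ of pieces of level sets (`LevelChart.exists_lintegral_potential_le`),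
while the far part is bounded and continuous. This gives (2), through
`IsWeakKernel.tendsto_potential_comp`.

Assertion (1) is a coarea argument: if the integrals of |u| over all S_σ with 0 < σ < b were bounded
below, then the integral of |u|/|f|^α would dominate a multiple of the divergent integral of σ^(-α).

For (3), let z lie on S_0. Then |f(ζ)| ≤ L|z - ζ|, so multiplying a singularity of order d + p by
|f|^l lowers its order to d + p - l, which is square integrable, and Cauchy–Schwarz against u/|f|^l
applies. To differentiate, the kernel is composed with a local C^p retraction onto S_0; the
integrals are then uniformly small near S_0 and dominated away from it (`LevelData.isTight`,
`IsSmoothKernel.exists_extension`).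

For (4), the Bochner–Martinelli kernel is cut off outside a ball of radius R. This represents v(z)
as a sum of potentials of the coefficients of ω minus v applied to translates of a smooth function,
the second term being smooth in z (`IsSolution.isGivenBy`). The methods of (2) and (3) apply to the
potentials. For the tangential equations, the derivatives of the potentials along the complex
tangent space are taken under the integral; closedness of ω converts their antilinear part into that
of the smooth term, and the two cancel (`sum_integral_dbarFun_cutBM`,
`LevelData.exists_extension_sol`). -/

namespace LocalReg
open scoped ENNReal NNReal

/-! ### Hausdorff measure under antilipschitz maps; Riesz potentials on balls -/

section

/-- On its image the restricted map has an inverse that is Lipschitz with constant `L`, and such a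
map enlarges `d`-dimensional measure by at most `L ^ d`. Only this one-sided inequality is needed to
compare level sets with hyperplanes, so no Jacobian appears. -/
theorem euclideanHausdorff_inter_preimage_le {X Y : Type*} [EMetricSpace X] [MeasurableSpace X]
    [BorelSpace X] [EMetricSpace Y] [MeasurableSpace Y] [BorelSpace Y] {A : Set X}
    {q : X → Y} {L : ℝ≥0} (d : ℕ)
    (hL : ∀ z ∈ A, ∀ w ∈ A, edist z w ≤ L * edist (q z) (q w)) (T : Set Y) :
    Measure.euclideanHausdorffMeasure d (A ∩ q ⁻¹' T) ≤
      (L : ℝ≥0∞) ^ d * Measure.euclideanHausdorffMeasure d T := by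
  have hq : AntilipschitzWith L (A.domRestrict q) := fun z w => hL z z.2 w w.2
  have h := hq.hausdorffMeasure_preimage_le (d := (d : ℝ)) (by positivity) T
  have himg : A ∩ q ⁻¹' T = Subtype.val '' (A.domRestrict q ⁻¹' T) := by
    ext z
    constructor
    · rintro ⟨h1, h2⟩
      exact ⟨⟨z, h1⟩, h2, rfl⟩
    · rintro ⟨⟨z, h1⟩, h2, rfl⟩
      exact ⟨h1, h2⟩
  rw [himg, isometry_subtype_coe.euclideanHausdorffMeasure_image]
  simp only [Measure.euclideanHausdorffMeasure_def, Measure.smul_apply, ENNReal.smul_def,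
    smul_eq_mul]
  rw [ENNReal.rpow_natCast] at h
  calc _ ≤ _ := mul_le_mul_right h _
    _ = _ := by ring

/-- Change of variables inequality along a map that is antilipschitz on `A`. -/
theorem lintegral_comp_le_of_antilipschitzOn {X Y : Type*} [EMetricSpace X] [MeasurableSpace X]
    [BorelSpace X] [EMetricSpace Y] [MeasurableSpace Y] [BorelSpace Y] {A : Set X}
    {q : X → Y} {L : ℝ≥0} (d : ℕ)
    (hq : AEMeasurable q ((Measure.euclideanHausdorffMeasure d).restrict A))
    (hA : MeasurableSet A)
    (hL : ∀ z ∈ A, ∀ w ∈ A, edist z w ≤ L * edist (q z) (q w)) {g : Y → ℝ≥0∞}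
    (hg : Measurable g) :
    ∫⁻ z in A, g (q z) ∂(Measure.euclideanHausdorffMeasure d) ≤
      (L : ℝ≥0∞) ^ d * ∫⁻ y, g y ∂(Measure.euclideanHausdorffMeasure d) := by
  rw [← lintegral_map' hg.aemeasurable hq, ← lintegral_const_mul _ hg]
  have : ((Measure.euclideanHausdorffMeasure d).restrict A).map q ≤
      ((L : ℝ≥0∞) ^ d) • (Measure.euclideanHausdorffMeasure d) := by
    refine Measure.le_iff.2 fun T hT => ?_
    rw [Measure.map_apply_of_aemeasurable hq hT, Measure.restrict_apply' hA, inter_comm]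
    simpa using euclideanHausdorff_inter_preimage_le d hL T
  calc _ ≤ _ := lintegral_mono' this le_rfl
    _ = _ := by rw [lintegral_smul_measure, lintegral_const_mul _ hg, smul_eq_mul]

/-- In polar coordinates this is the integral of `t ^ (dim - 1 - s)` over `(0, 1)`, whose exponent
exceeds `-1`. -/
theorem lintegral_ball_inv_enorm_rpow_lt_top {F : Type*} [NormedAddCommGroup F] [NormedSpace ℝ F]
    [FiniteDimensional ℝ F] [MeasurableSpace F] [BorelSpace F] (μ : Measure F) [μ.IsAddHaarMeasure]
    {s : ℝ} (hs0 : 0 ≤ s) (hs : s < Module.finrank ℝ F) :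
    ∫⁻ y in Metric.ball (0 : F) 1, (‖y‖ₑ ^ s)⁻¹ ∂μ < ∞ := by
  have hd : 0 < Module.finrank ℝ F := by
    rcases Nat.eq_zero_or_pos (Module.finrank ℝ F) with h | h
    · rw [h] at hs; simp at hs; linarith
    · exact h
  have : Nontrivial F := Module.nontrivial_of_finrank_pos hd
  have h1 : IntegrableOn (fun y : F => (fun t : ℝ => t ^ (-s)) ‖y‖) (Metric.ball (0 : F) 1) μ := by
    refine (integrableOn_fun_norm_addHaar (f := fun t : ℝ => t ^ (-s)) (r := 1) μ).2 ?_
    have h2 : IntegrableOn (fun t : ℝ => t ^ ((Module.finrank ℝ F - 1 : ℕ) - s : ℝ)) (Ioo 0 1) := by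
      rw [intervalIntegral.integrableOn_Ioo_rpow_iff one_pos]
      rw [Nat.cast_sub hd]; push_cast; linarith
    refine h2.congr_fun (fun t ht => ?_) measurableSet_Ioo
    simp only [smul_eq_mul]
    rw [sub_eq_add_neg, Real.rpow_add ht.1, Real.rpow_natCast]
  have h3 := h1.2
  rw [hasFiniteIntegral_iff_enorm] at h3
  refine lt_of_le_of_lt (lintegral_mono_ae ?_) h3
  have : ∀ᵐ y ∂(μ.restrict (Metric.ball (0 : F) 1)), y ≠ 0 := by
    refine ae_restrict_of_ae ?_
    simp [ae_iff]
  filter_upwards [this] with y hy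
  have hy' : 0 < ‖y‖ := norm_pos_iff.2 hy
  rw [Real.enorm_of_nonneg (by positivity), Real.rpow_neg hy'.le, ENNReal.ofReal_inv_of_pos
    (by positivity), ← ofReal_norm, ENNReal.ofReal_rpow_of_pos hy']

/-- Uniformity in the pole: within distance 1 of `x` the integrand is a translate of the model
singularity, and farther away it is at most 1. -/
theorem exists_lintegral_ball_inv_enorm_sub_rpow_le {F : Type*} [NormedAddCommGroup F]
    [NormedSpace ℝ F]
    [FiniteDimensional ℝ F] [MeasurableSpace F] [BorelSpace F] (μ : Measure F) [μ.IsAddHaarMeasure]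
    {s : ℝ} (hs0 : 0 ≤ s) (hs : s < Module.finrank ℝ F) (R : ℝ) :
    ∃ C : ℝ≥0, ∀ x : F, ∫⁻ y in Metric.ball (0 : F) R, (‖y - x‖ₑ ^ s)⁻¹ ∂μ ≤ C := by
  have h1 := lintegral_ball_inv_enorm_rpow_lt_top μ hs0 hs
  have h2 : μ (Metric.ball (0 : F) R) < ∞ := measure_ball_lt_top
  refine ⟨(∫⁻ y in Metric.ball (0 : F) 1, (‖y‖ₑ ^ s)⁻¹ ∂μ + μ (Metric.ball (0 : F) R)).toNNReal,
    fun x => ?_⟩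
  rw [ENNReal.coe_toNNReal (by finiteness)]
  calc ∫⁻ y in Metric.ball (0 : F) R, (‖y - x‖ₑ ^ s)⁻¹ ∂μ
      ≤ ∫⁻ y in Metric.ball (0 : F) R, ((Metric.ball x 1).indicator
        (fun y => (‖y - x‖ₑ ^ s)⁻¹) y + 1) ∂μ := by
        refine lintegral_mono fun y => ?_
        by_cases hy : y ∈ Metric.ball x 1
        · simp [hy]
        · simp only [hy, not_false_eq_true, indicator_of_notMem, zero_add]
          rw [ENNReal.inv_le_one]
          refine le_trans (by simp) (ENNReal.rpow_le_rpow (x := 1) ?_ hs0)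
          rw [Metric.mem_ball, not_lt, dist_eq_norm] at hy
          rw [← ofReal_norm, ENNReal.one_le_ofReal]; exact hy
    _ = ∫⁻ y in Metric.ball (0 : F) R, (Metric.ball x 1).indicator
        (fun y => (‖y - x‖ₑ ^ s)⁻¹) y ∂μ + μ (Metric.ball (0 : F) R) := by
        rw [lintegral_add_right _ measurable_const]; simp
    _ ≤ _ := by
        refine add_le_add_left ((setLIntegral_le_lintegral _ _).trans ?_) _
        rw [← lintegral_indicator measurableSet_ball,
          ← lintegral_add_right_eq_self (μ := μ) _ x]
        refine lintegral_mono fun y => ?_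
        by_cases hy : y ∈ Metric.ball (0 : F) 1
        · have : y + x ∈ Metric.ball x 1 := by simpa using hy
          simp [this, hy]
        · have : y + x ∉ Metric.ball x 1 := by simpa using hy
          simp [this]

end

/-! ### Local straightening of the level sets -/

section

/-- A local straightening of the level sets of `f`: the chart `z ↦ z + (f z - ℓ z) e`, which is
close to the identity and carries `f` to the linear form `ℓ`. -/
structure LevelChart {E : Type*} [NormedAddCommGroup E] [NormedSpace ℝ E] (p : ℕ) (U : Set E)
    (f : E → ℝ) where
  ℓ : E →L[ℝ] ℝ
  e : E
  ℓ_e : ℓ e = 1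
  Ψ : OpenPartialHomeomorph E E
  source_subset : Ψ.source ⊆ U
  isBounded_source : Bornology.IsBounded Ψ.source
  apply_eq : ∀ z, Ψ z = z + (f z - ℓ z) • e
  approx : ∀ z ∈ Ψ.source, ∀ w ∈ Ψ.source, ‖Ψ z - Ψ w - (z - w)‖ ≤ 1 / 2 * ‖z - w‖
  contDiffOn : ContDiffOn ℝ p Ψ Ψ.source
  contDiffOn_symm : ContDiffOn ℝ p Ψ.symm Ψ.target

/-- Neumann series in the algebra of operators. -/
theorem exists_equiv_of_norm_sub_id_lt {E : Type*} [NormedAddCommGroup E] [NormedSpace ℝ E]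
    [CompleteSpace E] (D : E →L[ℝ] E) (hD : ‖D - ContinuousLinearMap.id ℝ E‖ < 1) :
    ∃ D' : E ≃L[ℝ] E, (D' : E →L[ℝ] E) = D := by
  have h : ‖(1 : E →L[ℝ] E) - D‖ < 1 := by rw [norm_sub_rev]; exact hD
  have hu : IsUnit D := by
    have := (Units.oneSub ((1 : E →L[ℝ] E) - D) h).isUnit
    simpa using this
  exact ⟨ContinuousLinearEquiv.unitsEquiv ℝ E hu.unit, by ext x; rfl⟩

/-- With `ℓ = df z₀` and `ℓ e = 1`, the map `z + (f z - ℓ z) e` has the identity as derivative at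
`z₀`. After shrinking the domain it differs from the identity by a map with Lipschitz constant 1/2,
which yields the universal bi-Lipschitz constant 2 of all later estimates. -/
theorem exists_levelChart {E : Type*} [NormedAddCommGroup E] [NormedSpace ℝ E]
    [FiniteDimensional ℝ E] {p : ℕ} (hp : 0 < p) {U : Set E} (hU : IsOpen U) {f : E → ℝ}
    (hf : ContDiffOn ℝ p f U) {z₀ : E} (hz₀ : z₀ ∈ U) (hdf : fderiv ℝ f z₀ ≠ 0) :
    ∃ c : LevelChart p U f, z₀ ∈ c.Ψ.source ∧ c.ℓ = fderiv ℝ f z₀ := by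
  have : CompleteSpace E := FiniteDimensional.complete ℝ E
  set ℓ := fderiv ℝ f z₀ with hℓ
  obtain ⟨x, hx⟩ : ∃ x, ℓ x ≠ 0 := by
    by_contra! h
    exact hdf (ContinuousLinearMap.ext h)
  set e := (ℓ x)⁻¹ • x
  have he : ℓ e = 1 := by simp [e, hx]
  set ψ : E → E := fun z => z + (f z - ℓ z) • e with hψ
  have hψc : ContDiffOn ℝ p ψ U :=
    contDiffOn_id.add ((hf.sub ℓ.contDiff.contDiffOn).smul contDiffOn_const)
  have hp' : (p : WithTop ℕ∞) ≠ 0 := by exact_mod_cast hp.ne'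
  have hd : HasStrictFDerivAt ψ (ContinuousLinearMap.id ℝ E) z₀ := by
    have h1 : HasStrictFDerivAt f ℓ z₀ :=
      ((hf.contDiffAt (hU.mem_nhds hz₀)).hasStrictFDerivAt hp')
    have h2 := (hasStrictFDerivAt_id z₀ (𝕜 := ℝ)).add
      ((h1.sub ℓ.hasStrictFDerivAt).smul_const e)
    have h3 : ContinuousLinearMap.id ℝ E + (ℓ - ℓ).smulRight e = ContinuousLinearMap.id ℝ E := by
      ext x; simp
    rw [h3] at h2
    exact h2
  obtain ⟨s, hs, hap⟩ := hd.approximates_deriv_on_nhds (c := 1 / 2) (Or.inr (by norm_num))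
  obtain ⟨V, hVsub, hVo, hzV⟩ := mem_nhds_iff.1
    (inter_mem (inter_mem hs (hU.mem_nhds hz₀)) (Metric.ball_mem_nhds z₀ one_pos))
  have hap' : ApproximatesLinearOn ψ ((ContinuousLinearEquiv.refl ℝ E : E ≃L[ℝ] E) : E →L[ℝ] E) V
      (1 / 2) := by
    refine ApproximatesLinearOn.mono_set (t := s) (fun z hz => (hVsub hz).1.1) ?_
    simpa using hap
  -- The inverse function theorem asks that 1/2 be smaller than the inverse norm of the inverse
  -- linear part, here the identity of a nontrivial space.
  have hc : Subsingleton E ∨ (1 / 2 : ℝ≥0) <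
      ‖((ContinuousLinearEquiv.refl ℝ E).symm : E →L[ℝ] E)‖₊⁻¹ := by
    right
    have : ‖((ContinuousLinearEquiv.refl ℝ E).symm : E →L[ℝ] E)‖₊ ≤ 1 :=
      ContinuousLinearMap.norm_id_le
    have hne : ‖((ContinuousLinearEquiv.refl ℝ E).symm : E →L[ℝ] E)‖₊ ≠ 0 := by
      have hn : Nontrivial E := ⟨⟨x, 0, fun h => hx (by simp [h])⟩⟩
      have h1 : ‖ContinuousLinearMap.id ℝ E‖ = 1 := ContinuousLinearMap.norm_id
      intro h
      have h2 : ‖ContinuousLinearMap.id ℝ E‖ = 0 := congrArg NNReal.toReal h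
      rw [h1] at h2; norm_num at h2
    calc (1 / 2 : ℝ≥0) < 1 := by
          rw [div_lt_one] <;> norm_num
      _ ≤ _ := by
        rw [le_inv_comm₀ one_pos (pos_iff_ne_zero.2 hne)]; simpa using this
  set Ψ := hap'.toOpenPartialHomeomorph ψ V hc hVo with hΨ
  have hΨψ : ∀ z, Ψ z = ψ z := fun z => rfl
  have happ : ∀ z ∈ V, ∀ w ∈ V, ‖ψ z - ψ w - (z - w)‖ ≤ 1 / 2 * ‖z - w‖ := by
    intro z hz w hw
    simpa using hap' z hz w hw
  have hcd : ContDiffOn ℝ p ψ V := hψc.mono fun z hz => (hVsub hz).1.2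
  refine ⟨⟨ℓ, e, he, Ψ, fun z hz => (hVsub hz).1.2, ?_, hΨψ, happ, hcd, ?_⟩, hzV, rfl⟩
  · exact Metric.isBounded_ball.subset fun z hz => (hVsub hz).2
  · intro y hy
    have hsy : Ψ.symm y ∈ V := Ψ.map_target hy
    have hdiff : HasFDerivAt ψ (fderiv ℝ ψ (Ψ.symm y)) (Ψ.symm y) :=
      ((hcd.contDiffAt (hVo.mem_nhds hsy)).differentiableAt hp').hasFDerivAt
    -- The Lipschitz bound for `ψ - id` bounds its derivative at every point of the chart. So the
    -- derivative of `ψ` is invertible everywhere, and the inverse chart is `C^p` on the whole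
    -- target.
    have hle : ‖fderiv ℝ ψ (Ψ.symm y) - ContinuousLinearMap.id ℝ E‖ ≤ (1 / 2 : ℝ≥0) := by
      refine (hdiff.sub (hasFDerivAt_id (Ψ.symm y))).le_of_lipschitzOn (hVo.mem_nhds hsy) ?_
      refine LipschitzOnWith.of_dist_le_mul fun z hz w hw => ?_
      rw [dist_eq_norm, dist_eq_norm]
      refine le_of_eq_of_le ?_ (happ z hz w hw)
      congr 1
      simp only [Pi.sub_apply, id]
      abel
    obtain ⟨D', hD'⟩ := exists_equiv_of_norm_sub_id_lt (fderiv ℝ ψ (Ψ.symm y))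
      (hle.trans_lt (by norm_num))
    refine (Ψ.contDiffAt_symm (f₀' := D') hy ?_ ?_).contDiffWithinAt
    · rw [hD']; exact hdiff
    · exact hcd.contDiffAt (hVo.mem_nhds hsy)

namespace LevelChart

variable {E : Type*} [NormedAddCommGroup E] [NormedSpace ℝ E] {p : ℕ} {U : Set E} {f : E → ℝ}
  (c : LevelChart p U f)

/-- The linear hyperplane on which the chart models the level sets. -/
abbrev H : Submodule ℝ E := LinearMap.ker (c.ℓ : E →ₗ[ℝ] ℝ)

/-- The projection to the model hyperplane along `e`. -/
noncomputable def q : E →L[ℝ] c.H :=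
  (ContinuousLinearMap.id ℝ E - c.ℓ.smulRight c.e).codRestrict c.H (by
    intro x; simp [LinearMap.mem_ker, c.ℓ_e])

theorem q_apply (z : E) : (c.q z : E) = z - c.ℓ z • c.e := rfl

/-- In the splitting of `E` into the hyperplane and the line of `e`, the chart replaces the linear
coordinate by `f` and leaves the hyperplane coordinate alone. -/
theorem apply_eq_q (z : E) : c.Ψ z = c.q z + f z • c.e := by
  rw [c.apply_eq, q_apply, sub_smul]; abel

theorem ℓ_apply (z : E) : c.ℓ (c.Ψ z) = f z := by
  rw [c.apply_eq]; simp [c.ℓ_e]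

theorem q_Ψ (z : E) : c.q (c.Ψ z) = c.q z := by
  apply Subtype.ext
  rw [q_apply, ℓ_apply, apply_eq_q]; abel

theorem norm_sub_le_two_mul {z w : E} (hz : z ∈ c.Ψ.source) (hw : w ∈ c.Ψ.source) :
    ‖z - w‖ ≤ 2 * ‖c.Ψ z - c.Ψ w‖ := by
  have h1 := c.approx z hz w hw
  have h2 : ‖z - w‖ ≤ ‖c.Ψ z - c.Ψ w‖ + ‖c.Ψ z - c.Ψ w - (z - w)‖ := by
    have := norm_sub_le (c.Ψ z - c.Ψ w) (c.Ψ z - c.Ψ w - (z - w))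
    simpa using this
  linarith

theorem norm_Ψ_sub_le {z w : E} (hz : z ∈ c.Ψ.source) (hw : w ∈ c.Ψ.source) :
    ‖c.Ψ z - c.Ψ w‖ ≤ 2 * ‖z - w‖ := by
  have h1 := c.approx z hz w hw
  have h2 : ‖c.Ψ z - c.Ψ w‖ ≤ ‖z - w‖ + ‖c.Ψ z - c.Ψ w - (z - w)‖ := by
    have := norm_add_le (z - w) (c.Ψ z - c.Ψ w - (z - w))
    simpa using this
  have := norm_nonneg (z - w)
  linarith

/-- Along one level set the chart values differ only in the hyperplane component. Hence the fixed
linear projection `q` is antilipschitz there, with a constant independent of the level. -/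
theorem norm_sub_le_of_eq {z w : E} (hz : z ∈ c.Ψ.source) (hw : w ∈ c.Ψ.source)
    (h : f z = f w) : ‖z - w‖ ≤ 2 * ‖c.q z - c.q w‖ := by
  refine (c.norm_sub_le_two_mul hz hw).trans (le_of_eq ?_)
  rw [apply_eq_q, apply_eq_q, h, add_sub_add_right_eq_sub]
  rfl

theorem finrank_H [FiniteDimensional ℝ E] : Module.finrank ℝ c.H + 1 = Module.finrank ℝ E := by
  have h := LinearMap.finrank_range_add_finrank_ker (c.ℓ : E →ₗ[ℝ] ℝ)
  have hs : LinearMap.range (c.ℓ : E →ₗ[ℝ] ℝ) = ⊤ := by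
    rw [LinearMap.range_eq_top]
    intro y
    exact ⟨y • c.e, by simp [c.ℓ_e]⟩
  rw [hs, finrank_top, Module.finrank_self, add_comm] at h
  exact h

end LevelChart

/-- A linear projection enlarges distances by at most its norm, so the kernel can be compared with
the one on the hyperplane. The added 1 keeps the constant nonzero when `q` vanishes, as inversion in
`ℝ≥0∞` requires. -/
theorem inv_enorm_rpow_le {E F : Type*} [NormedAddCommGroup E] [NormedSpace ℝ E]
    [NormedAddCommGroup F] [NormedSpace ℝ F] (q : E →L[ℝ] F) {s : ℝ} (hs : 0 ≤ s) (x : E) :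
    (‖x‖ₑ ^ s)⁻¹ ≤ ((‖q‖₊ + 1 : ℝ≥0) : ℝ≥0∞) ^ s * (‖q x‖ₑ ^ s)⁻¹ := by
  have hK : ((‖q‖₊ + 1 : ℝ≥0) : ℝ≥0∞) ≠ 0 := by simp
  have h1 : ‖q x‖ₑ ≤ ((‖q‖₊ + 1 : ℝ≥0) : ℝ≥0∞) * ‖x‖ₑ := by
    refine (q.le_opENorm x).trans ?_
    gcongr
    rw [enorm_eq_nnnorm]
    exact_mod_cast le_self_add
  have h2 := ENNReal.rpow_le_rpow h1 hs
  rw [ENNReal.mul_rpow_of_nonneg _ _ hs] at h2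
  have hK1 : ((‖q‖₊ + 1 : ℝ≥0) : ℝ≥0∞) ^ s ≠ 0 := by
    simp only [ne_eq, ENNReal.rpow_eq_zero_iff, hK, false_and, ENNReal.coe_ne_top, or_self,
      not_false_eq_true]
  have hK2 : ((‖q‖₊ + 1 : ℝ≥0) : ℝ≥0∞) ^ s ≠ ∞ := by finiteness
  have h3 := ENNReal.inv_le_inv.2 h2
  rw [ENNReal.mul_inv (Or.inl hK1) (Or.inl hK2)] at h3
  calc (‖x‖ₑ ^ s)⁻¹ = ((‖q‖₊ + 1 : ℝ≥0) : ℝ≥0∞) ^ s *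
        ((((‖q‖₊ + 1 : ℝ≥0) : ℝ≥0∞) ^ s)⁻¹ * (‖x‖ₑ ^ s)⁻¹) := by
        rw [← mul_assoc, ENNReal.mul_inv_cancel hK1 hK2, one_mul]
    _ ≤ _ := by gcongr

/-- Riesz potentials of order less than the dimension are uniformly bounded along pieces of level
sets. -/
theorem LevelChart.exists_lintegral_inv_rpow_le {E : Type*} [NormedAddCommGroup E]
    [NormedSpace ℝ E] [FiniteDimensional ℝ E] [MeasurableSpace E] [BorelSpace E] {p : ℕ}
    {U : Set E} {f : E → ℝ} (c : LevelChart p U f) {d : ℕ} (hd : Module.finrank ℝ E = d + 1)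
    {s : ℝ} (hs0 : 0 ≤ s) (hs : s < d) :
    ∃ C : ℝ≥0, ∀ (A : Set E) (θ : E → E) (σ : ℝ), MeasurableSet A → Measurable θ →
      MapsTo θ A c.Ψ.source → (∀ z ∈ A, f (θ z) = σ) →
      (∀ z ∈ A, ∀ w ∈ A, ‖z - w‖ ≤ 2 * ‖θ z - θ w‖) → ∀ ζ : E,
      ∫⁻ z in A, (‖θ z - ζ‖ₑ ^ s)⁻¹ ∂(Measure.euclideanHausdorffMeasure d) ≤ C := by
  have hH : Module.finrank ℝ c.H = d := by have := c.finrank_H; omega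
  have hHaar : (Measure.euclideanHausdorffMeasure d : Measure c.H).IsAddHaarMeasure := by
    rw [← hH]; infer_instance
  obtain ⟨R, hR⟩ := (c.isBounded_source.image c.q).subset_ball 0
  obtain ⟨C, hC⟩ := exists_lintegral_ball_inv_enorm_sub_rpow_le
    (Measure.euclideanHausdorffMeasure d : Measure c.H) hs0 (by rw [hH]; exact hs) R
  refine ⟨(‖c.q‖₊ + 1) ^ s * ((4 : ℝ≥0) ^ d * C), fun A θ σ hA hθ hmaps hσ hanti ζ => ?_⟩
  have hqθ : Measurable (fun z => c.q (θ z)) := c.q.continuous.measurable.comp hθ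
  have hmeas : Measurable fun y : c.H => (Metric.ball (0 : c.H) R).indicator
      (fun y => (‖y - c.q ζ‖ₑ ^ s)⁻¹) y := by
    refine Measurable.indicator ?_ measurableSet_ball
    fun_prop
  -- The constant 4 is 2 for `θ` times 2 for `q` on the level set. In the applications `θ` is the
  -- identity or one of the maps `φ σ`.
  have key := lintegral_comp_le_of_antilipschitzOn (L := 4) d hqθ.aemeasurable hA (by
    intro z hz w hw
    have h1 := hanti z hz w hw
    have h2 := c.norm_sub_le_of_eq (hmaps hz) (hmaps hw) (by rw [hσ z hz, hσ w hw])
    rw [edist_dist, edist_dist, dist_eq_norm, dist_eq_norm]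
    have : ((4 : ℝ≥0) : ℝ≥0∞) = ENNReal.ofReal 4 := by simp
    rw [this, ← ENNReal.ofReal_mul (by norm_num)]
    apply ENNReal.ofReal_le_ofReal
    linarith) hmeas
  rw [lintegral_indicator measurableSet_ball] at key
  calc ∫⁻ z in A, (‖θ z - ζ‖ₑ ^ s)⁻¹ ∂(Measure.euclideanHausdorffMeasure d)
      ≤ ∫⁻ z in A, ((‖c.q‖₊ + 1 : ℝ≥0) : ℝ≥0∞) ^ s * ((Metric.ball (0 : c.H) R).indicator
      (fun y => (‖y - c.q ζ‖ₑ ^ s)⁻¹) (c.q (θ z))) ∂(Measure.euclideanHausdorffMeasure d) := by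
        refine setLIntegral_mono' hA fun z hz => ?_
        have : c.q (θ z) ∈ Metric.ball (0 : c.H) R := hR (mem_image_of_mem _ (hmaps hz))
        rw [indicator_of_mem this, ← map_sub]
        exact inv_enorm_rpow_le c.q hs0 _
    _ = ((‖c.q‖₊ + 1 : ℝ≥0) : ℝ≥0∞) ^ s * ∫⁻ z in A, ((Metric.ball (0 : c.H) R).indicator
      (fun y => (‖y - c.q ζ‖ₑ ^ s)⁻¹) (c.q (θ z))) ∂(Measure.euclideanHausdorffMeasure d) := by
        rw [lintegral_const_mul' _ _ (by finiteness)]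
    _ ≤ ((‖c.q‖₊ + 1 : ℝ≥0) : ℝ≥0∞) ^ s * ((4 : ℝ≥0) ^ d * C) := by
        gcongr
        refine key.trans ?_
        gcongr
        exact hC _
    _ = _ := by
        push_cast
        rw [ENNReal.coe_rpow_of_nonneg _ hs0]
        push_cast
        rfl

end

/-! ### Coarea inequalities in a chart -/

section

namespace LevelChart

variable {E : Type*} [NormedAddCommGroup E] [NormedSpace ℝ E] {p : ℕ} {U : Set E} {f : E → ℝ}
  (c : LevelChart p U f)

/-- The splitting of the ambient space along the model hyperplane. -/
noncomputable def splitting : E ≃L[ℝ] c.H × ℝ :=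
  ContinuousLinearEquiv.equivOfInverse (c.q.prod c.ℓ)
    ((c.H.subtypeL.comp (ContinuousLinearMap.fst ℝ c.H ℝ)) +
      (ContinuousLinearMap.snd ℝ c.H ℝ).smulRight c.e)
    (by intro z; simp [q_apply])
    (by
      rintro ⟨⟨h, hh⟩, t⟩
      have hh' : c.ℓ h = 0 := hh
      ext
      · simp [q_apply, c.ℓ_e, hh']
      · simp [c.ℓ_e, hh'])

variable [FiniteDimensional ℝ E] [MeasurableSpace E] [BorelSpace E]

/-- Both sides are Haar measures on `E`, hence proportional; the value of `κ` is irrelevant as long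
as it is not 0. -/
theorem exists_map_splitting_symm_eq {d : ℕ} (hd : Module.finrank ℝ E = d + 1) :
    ∃ κ : ℝ≥0, κ ≠ 0 ∧
      ((Measure.euclideanHausdorffMeasure d : Measure c.H).prod (volume : Measure ℝ)).map
        c.splitting.symm = κ • (Measure.euclideanHausdorffMeasure (d + 1) : Measure E) := by
  have hH : Module.finrank ℝ c.H = d := by have := c.finrank_H; omega
  have hHaar : (Measure.euclideanHausdorffMeasure d : Measure c.H).IsAddHaarMeasure := by
    rw [← hH]; infer_instance
  have hHaarE : (Measure.euclideanHausdorffMeasure (d + 1) : Measure E).IsAddHaarMeasure := by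
    rw [← hd]; infer_instance
  have h2 : (((Measure.euclideanHausdorffMeasure d : Measure c.H).prod
      (volume : Measure ℝ)).map c.splitting.symm).IsAddHaarMeasure :=
    ContinuousLinearEquiv.isAddHaarMeasure_map _ _
  refine ⟨_, ?_, Measure.isAddLeftInvariant_eq_smul _ _⟩
  intro h0
  have h3 := Measure.isAddLeftInvariant_eq_smul (((Measure.euclideanHausdorffMeasure d :
    Measure c.H).prod (volume : Measure ℝ)).map c.splitting.symm)
    (Measure.euclideanHausdorffMeasure (d + 1) : Measure E)
  rw [h0, zero_smul] at h3
  exact NeZero.ne _ h3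

theorem lintegral_prod_eq {d : ℕ} (hd : Module.finrank ℝ E = d + 1) :
    ∃ κ : ℝ≥0, κ ≠ 0 ∧ ∀ g : E → ℝ≥0∞, Measurable g →
      ∫⁻ t : ℝ, ∫⁻ h : c.H, g (h + t • c.e) ∂(Measure.euclideanHausdorffMeasure d) =
      κ * ∫⁻ y, g y ∂(Measure.euclideanHausdorffMeasure (d + 1)) := by
  obtain ⟨κ, hκ, h⟩ := c.exists_map_splitting_symm_eq hd
  have hH : Module.finrank ℝ c.H = d := by have := c.finrank_H; omega
  have hHaar : (Measure.euclideanHausdorffMeasure d : Measure c.H).IsAddHaarMeasure := by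
    rw [← hH]; infer_instance
  refine ⟨κ, hκ, fun g hg => ?_⟩
  have h1 : ∫⁻ y, g y ∂(((Measure.euclideanHausdorffMeasure d : Measure c.H).prod
      (volume : Measure ℝ)).map c.splitting.symm) = κ * ∫⁻ y, g y
      ∂(Measure.euclideanHausdorffMeasure (d + 1)) := by
    rw [h, show κ • (Measure.euclideanHausdorffMeasure (d + 1) : Measure E) = (κ : ℝ≥0∞) •
      (Measure.euclideanHausdorffMeasure (d + 1) : Measure E) from rfl, lintegral_smul_measure]
    rfl
  rw [← h1, lintegral_map hg c.splitting.symm.continuous.measurable, lintegral_prod_symm]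
  · rfl
  · exact (hg.comp c.splitting.symm.continuous.measurable).aemeasurable

/-- A coarea inequality on the domain of a chart: integrals over level sets are dominated by a
measurable function whose integral is controlled by the integral over the domain. -/
theorem exists_coarea_bound {d : ℕ} (hd : Module.finrank ℝ E = d + 1) :
    ∃ C : ℝ≥0, ∀ g : E → ℝ≥0∞, Measurable g → ∃ G : ℝ → ℝ≥0∞, Measurable G ∧
      (∀ σ, ∫⁻ z in {z | z ∈ c.Ψ.source ∧ f z = σ}, g z ∂(Measure.euclideanHausdorffMeasure d) ≤
        G σ) ∧
      ∫⁻ σ, G σ ≤ C * ∫⁻ z in c.Ψ.source, g z ∂(Measure.euclideanHausdorffMeasure (d + 1)) := by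
  obtain ⟨κ, -, hκ⟩ := c.lintegral_prod_eq hd
  have hH : Module.finrank ℝ c.H = d := by have := c.finrank_H; omega
  have hHaar : (Measure.euclideanHausdorffMeasure d : Measure c.H).IsAddHaarMeasure := by
    rw [← hH]; infer_instance
  refine ⟨2 ^ d * (κ * 2 ^ (d + 1)), fun g hg => ?_⟩
  classical
  -- The inverse chart extended by 0 is globally measurable, so `γ`, the transport of `g` to the
  -- straightened picture, is measurable on all of `E`.
  set ψ : E → E := c.Ψ.target.piecewise c.Ψ.symm (fun _ => 0) with hψ
  have hψm : Measurable ψ := c.Ψ.continuousOn_symm.measurable_piecewise continuousOn_const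
    c.Ψ.open_target.measurableSet
  set γ : E → ℝ≥0∞ := c.Ψ.target.indicator (fun y => g (ψ y)) with hγ
  have hγm : Measurable γ := (hg.comp hψm).indicator c.Ψ.open_target.measurableSet
  have hγΨ : ∀ z ∈ c.Ψ.source, γ (c.Ψ z) = g z := by
    intro z hz
    have := c.Ψ.map_source hz
    simp [hγ, hψ, this, c.Ψ.left_inv hz]
  have hcont : ContinuousOn f c.Ψ.source := by
    have : ContinuousOn (fun z => c.ℓ (c.Ψ z)) c.Ψ.source :=
      c.ℓ.continuous.comp_continuousOn c.contDiffOn.continuousOn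
    simpa only [ℓ_apply] using this
  have hγs : Measurable fun x : ℝ × c.H => γ (x.2 + x.1 • c.e) := by
    refine hγm.comp ?_
    fun_prop
  -- The dominating function is the integral of `γ` over the affine hyperplane at height `σ`,
  -- measurable in `σ` by Tonelli; 2 is the antilipschitz constant of `q` along a level set.
  refine ⟨fun σ => 2 ^ d * ∫⁻ h : c.H, γ (h + σ • c.e) ∂(Measure.euclideanHausdorffMeasure d),
    ?_, fun σ => ?_, ?_⟩
  · exact (hγs.lintegral_prod_right).const_mul _
  · have hA : MeasurableSet {z | z ∈ c.Ψ.source ∧ f z = σ} := by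
      obtain ⟨u, hu, hu'⟩ := (continuousOn_iff_isClosed.1 hcont) {σ} isClosed_singleton
      have : {z | z ∈ c.Ψ.source ∧ f z = σ} = u ∩ c.Ψ.source := by
        rw [← hu']; ext z; simp [and_comm]
      rw [this]
      exact hu.measurableSet.inter c.Ψ.open_source.measurableSet
    have key := lintegral_comp_le_of_antilipschitzOn (L := 2) (q := c.q) d
      (c.q.continuous.measurable.aemeasurable) hA (by
        rintro z ⟨hz, hzσ⟩ w ⟨hw, hwσ⟩
        have h2 := c.norm_sub_le_of_eq hz hw (by rw [hzσ, hwσ])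
        rw [edist_dist, edist_dist, dist_eq_norm, dist_eq_norm]
        have : ((2 : ℝ≥0) : ℝ≥0∞) = ENNReal.ofReal 2 := by simp
        rw [this, ← ENNReal.ofReal_mul (by norm_num)]
        exact ENNReal.ofReal_le_ofReal h2) (g := fun h : c.H => γ (h + σ • c.e))
        (hγm.comp (by fun_prop))
    refine le_trans (le_of_eq ?_) key
    refine setLIntegral_congr_fun hA fun z hz => ?_
    rw [← hγΨ z hz.1, apply_eq_q, hz.2]
  · rw [lintegral_const_mul _ (hγs.lintegral_prod_right), hκ γ hγm]
    have key := lintegral_comp_le_of_antilipschitzOn (L := 2) (A := c.Ψ.target) (q := c.Ψ.symm)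
      (d + 1) (c.Ψ.continuousOn_symm.aemeasurable c.Ψ.open_target.measurableSet)
      c.Ψ.open_target.measurableSet (by
        intro z hz w hw
        have h2 := c.norm_Ψ_sub_le (c.Ψ.map_target hz) (c.Ψ.map_target hw)
        rw [c.Ψ.right_inv hz, c.Ψ.right_inv hw] at h2
        rw [edist_dist, edist_dist, dist_eq_norm, dist_eq_norm]
        have : ((2 : ℝ≥0) : ℝ≥0∞) = ENNReal.ofReal 2 := by simp
        rw [this, ← ENNReal.ofReal_mul (by norm_num)]
        exact ENNReal.ofReal_le_ofReal h2) (g := c.Ψ.source.indicator g)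
        (hg.indicator c.Ψ.open_source.measurableSet)
    rw [lintegral_indicator c.Ψ.open_source.measurableSet] at key
    have h3 : ∫⁻ y, γ y ∂(Measure.euclideanHausdorffMeasure (d + 1)) =
        ∫⁻ z in c.Ψ.target, c.Ψ.source.indicator g (c.Ψ.symm z)
          ∂(Measure.euclideanHausdorffMeasure (d + 1)) := by
      rw [hγ, lintegral_indicator c.Ψ.open_target.measurableSet]
      refine setLIntegral_congr_fun c.Ψ.open_target.measurableSet fun y hy => ?_
      simp [hψ, hy, c.Ψ.map_target hy]
    rw [h3]
    calc _ ≤ 2 ^ d * ((κ : ℝ≥0∞) * (((2 : ℝ≥0) : ℝ≥0∞) ^ (d + 1) * ∫⁻ z in c.Ψ.source, g z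
          ∂(Measure.euclideanHausdorffMeasure (d + 1)))) := by gcongr
      _ = _ := by push_cast; ring

/-- The image of volume under `f` on the domain of a chart has bounded density. -/
theorem exists_lintegral_comp_le {d : ℕ} (hd : Module.finrank ℝ E = d + 1) :
    ∃ C : ℝ≥0, ∀ g : ℝ → ℝ≥0∞, Measurable g →
      ∫⁻ z in c.Ψ.source, g (f z) ∂(Measure.euclideanHausdorffMeasure (d + 1)) ≤
        C * ∫⁻ t, g t := by
  obtain ⟨κ, hκ0, hκ⟩ := c.lintegral_prod_eq hd
  have hH : Module.finrank ℝ c.H = d := by have := c.finrank_H; omega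
  have hHaar : (Measure.euclideanHausdorffMeasure d : Measure c.H).IsAddHaarMeasure := by
    rw [← hH]; infer_instance
  obtain ⟨R, hR⟩ := (c.isBounded_source.image c.q).subset_ball 0
  have hfin : (Measure.euclideanHausdorffMeasure d : Measure c.H) (Metric.ball 0 R) < ∞ :=
    measure_ball_lt_top
  set M : ℝ≥0 := ((Measure.euclideanHausdorffMeasure d : Measure c.H) (Metric.ball 0 R)).toNNReal
    with hM
  have hM' : (M : ℝ≥0∞) = (Measure.euclideanHausdorffMeasure d : Measure c.H) (Metric.ball 0 R) :=
    ENNReal.coe_toNNReal hfin.ne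
  refine ⟨2 ^ (d + 1) * (κ⁻¹ * M), fun g hg => ?_⟩
  -- A cylinder over a ball, containing the image of the chart. It cuts off `g ∘ ℓ`, which is
  -- constant along the hyperplanes parallel to `H` and would have no finite integral there.
  set B : Set E := {y | c.q y ∈ Metric.ball (0 : c.H) R}
  have hB : MeasurableSet B := c.q.continuous.measurable measurableSet_ball
  set γ : E → ℝ≥0∞ := B.indicator fun y => g (c.ℓ y) with hγ
  have hγm : Measurable γ := (hg.comp c.ℓ.continuous.measurable).indicator hB
  have key := lintegral_comp_le_of_antilipschitzOn (L := 2) (A := c.Ψ.source) (q := c.Ψ)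
    (d + 1) (c.contDiffOn.continuousOn.aemeasurable c.Ψ.open_source.measurableSet)
    c.Ψ.open_source.measurableSet (by
      intro z hz w hw
      have h2 := c.norm_sub_le_two_mul hz hw
      rw [edist_dist, edist_dist, dist_eq_norm, dist_eq_norm]
      have : ((2 : ℝ≥0) : ℝ≥0∞) = ENNReal.ofReal 2 := by simp
      rw [this, ← ENNReal.ofReal_mul (by norm_num)]
      exact ENNReal.ofReal_le_ofReal h2) hγm
  have h1 : ∫⁻ z in c.Ψ.source, γ (c.Ψ z) ∂(Measure.euclideanHausdorffMeasure (d + 1)) =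
      ∫⁻ z in c.Ψ.source, g (f z) ∂(Measure.euclideanHausdorffMeasure (d + 1)) := by
    refine setLIntegral_congr_fun c.Ψ.open_source.measurableSet fun z hz => ?_
    have : c.Ψ z ∈ B := by
      simp only [B, mem_ofPred_eq, q_Ψ]
      exact hR (mem_image_of_mem _ hz)
    simp [hγ, this, ℓ_apply]
  have h2 : κ * ∫⁻ y, γ y ∂(Measure.euclideanHausdorffMeasure (d + 1)) = M * ∫⁻ t, g t := by
    rw [← hκ γ hγm, ← lintegral_const_mul _ hg]
    refine lintegral_congr fun t => ?_
    have : ∀ h : c.H, γ (h + t • c.e) =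
        (Metric.ball (0 : c.H) R).indicator (fun _ => g t) h := by
      intro h
      have hh : c.ℓ h = 0 := h.2
      have h3 : c.q (h + t • c.e) = h := by
        apply Subtype.ext
        simp [q_apply, hh, c.ℓ_e]
      have h5 : c.ℓ (h + t • c.e) = t := by simp [hh, c.ℓ_e]
      have h6 : (h : E) + t • c.e ∈ B ↔ h ∈ Metric.ball (0 : c.H) R := by
        change c.q (h + t • c.e) ∈ Metric.ball (0 : c.H) R ↔ _
        rw [h3]
      by_cases hm : h ∈ Metric.ball (0 : c.H) R
      · rw [indicator_of_mem hm, hγ, indicator_of_mem (h6.2 hm), h5]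
      · rw [indicator_of_notMem hm, hγ, indicator_of_notMem (fun h' => hm (h6.1 h'))]
    simp_rw [this]
    rw [lintegral_indicator_const measurableSet_ball, hM', mul_comm]
  have hκ' : (κ : ℝ≥0∞) ≠ 0 := by simpa using hκ0
  have h4 : ∫⁻ y, γ y ∂(Measure.euclideanHausdorffMeasure (d + 1)) =
      (κ : ℝ≥0∞)⁻¹ * (M * ∫⁻ t, g t) := by
    rw [← h2, ← mul_assoc, ENNReal.inv_mul_cancel hκ' ENNReal.coe_ne_top, one_mul]
  rw [← h1]
  refine key.trans (le_of_eq ?_)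
  rw [h4]
  push_cast [ENNReal.coe_inv hκ0]
  ring

/-- The image of volume under `f` has bounded density, and `|t - σ| ^ (-1/2)` is integrable near `σ`
with an integral independent of `σ`; where `|f - σ| ≥ 1` the integrand is at most 1. -/
theorem exists_lintegral_inv_sqrt_le {d : ℕ} (hd : Module.finrank ℝ E = d + 1) :
    ∃ C : ℝ≥0, ∀ σ : ℝ, ∫⁻ z in c.Ψ.source, (‖f z - σ‖ₑ ^ (1 / 2 : ℝ))⁻¹
      ∂(Measure.euclideanHausdorffMeasure (d + 1)) ≤ C := by
  have hHaarE : (Measure.euclideanHausdorffMeasure (d + 1) : Measure E).IsAddHaarMeasure := by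
    rw [← hd]; infer_instance
  obtain ⟨C, hC⟩ := c.exists_lintegral_comp_le hd
  have h1 := lintegral_ball_inv_enorm_rpow_lt_top (volume : Measure ℝ) (s := 1 / 2) (by norm_num)
    (by simp; norm_num)
  have h2 : (Measure.euclideanHausdorffMeasure (d + 1) : Measure E) c.Ψ.source < ∞ :=
    c.isBounded_source.measure_lt_top
  refine ⟨(C * (∫⁻ y in Metric.ball (0 : ℝ) 1, (‖y‖ₑ ^ (1 / 2 : ℝ))⁻¹) +
    (Measure.euclideanHausdorffMeasure (d + 1) : Measure E) c.Ψ.source).toNNReal, fun σ => ?_⟩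
  rw [ENNReal.coe_toNNReal (by finiteness)]
  set g : ℝ → ℝ≥0∞ := (Metric.ball σ 1).indicator fun t => (‖t - σ‖ₑ ^ (1 / 2 : ℝ))⁻¹ with hg
  have hgm : Measurable g := by
    refine Measurable.indicator ?_ measurableSet_ball
    fun_prop
  have hgi : ∫⁻ t, g t = ∫⁻ y in Metric.ball (0 : ℝ) 1, (‖y‖ₑ ^ (1 / 2 : ℝ))⁻¹ := by
    rw [← lintegral_indicator measurableSet_ball, ← lintegral_add_right_eq_self _ σ]
    refine lintegral_congr fun y => ?_
    simp only [hg, indicator, Metric.mem_ball, Real.dist_eq, add_sub_cancel_right, sub_zero]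
  calc _ ≤ ∫⁻ z in c.Ψ.source, (g (f z) + 1) ∂(Measure.euclideanHausdorffMeasure (d + 1)) := by
        refine lintegral_mono fun z => ?_
        by_cases hy : f z ∈ Metric.ball σ 1
        · simp [hg, hy]
        · simp only [hg, hy, not_false_eq_true, indicator_of_notMem, zero_add]
          rw [ENNReal.inv_le_one]
          refine ENNReal.one_le_rpow ?_ (by norm_num)
          rw [Metric.mem_ball, not_lt, dist_eq_norm] at hy
          rw [← ofReal_norm, ENNReal.one_le_ofReal]; exact hy
    _ = ∫⁻ z in c.Ψ.source, g (f z) ∂(Measure.euclideanHausdorffMeasure (d + 1)) +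
        (Measure.euclideanHausdorffMeasure (d + 1) : Measure E) c.Ψ.source := by
        rw [lintegral_add_right _ measurable_const]; simp
    _ ≤ _ := by
        rw [← hgi]
        exact add_le_add_left (hC g hgm) _

end LevelChart

end

/-! ### The global setting and the basic estimate at the critical order -/

section

/-- A function without critical points on a neighbourhood `U` of the closure of a bounded open
set `W`. -/
structure LevelData {E : Type*} [NormedAddCommGroup E] [NormedSpace ℝ E] (p : ℕ) (U W : Set E)
    (f : E → ℝ) : Prop where
  p_pos : 0 < p
  isOpen_U : IsOpen U
  isOpen_W : IsOpen W
  isBounded : Bornology.IsBounded W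
  closure_subset : closure W ⊆ U
  contDiffOn : ContDiffOn ℝ p f U
  fderiv_ne_zero : ∀ z ∈ U, fderiv ℝ f z ≠ 0

namespace LevelData

universe u
variable {E : Type u} [NormedAddCommGroup E] [NormedSpace ℝ E] {p : ℕ} {U W : Set E} {f : E → ℝ}

theorem subset (S : LevelData p U W f) : W ⊆ U := subset_closure.trans S.closure_subset

theorem isCompact_closure [FiniteDimensional ℝ E] (S : LevelData p U W f) : IsCompact (closure W) := by
  have : ProperSpace E := FiniteDimensional.proper ℝ E
  exact S.isBounded.isCompact_closure

theorem continuousOn (S : LevelData p U W f) : ContinuousOn f U := S.contDiffOn.continuousOn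

theorem cast_p_ne_zero (S : LevelData p U W f) : (p : WithTop ℕ∞) ≠ 0 := by
  exact_mod_cast S.p_pos.ne'

theorem exists_cover [FiniteDimensional ℝ E] (S : LevelData p U W f) :
    ∃ (ι : Type u) (_ : Fintype ι) (c : ι → LevelChart p U f),
      closure W ⊆ ⋃ i, (c i).Ψ.source := by
  have h : ∀ x : U, ∃ c : LevelChart p U f, (x : E) ∈ c.Ψ.source := fun x => by
    obtain ⟨c, hc, -⟩ := exists_levelChart S.p_pos S.isOpen_U S.contDiffOn x.2
      (S.fderiv_ne_zero x x.2)
    exact ⟨c, hc⟩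
  choose c hc using h
  obtain ⟨t, ht⟩ := S.isCompact_closure.elim_finite_subcover (fun x => (c x).Ψ.source)
    (fun x => (c x).Ψ.open_source)
    (fun x hx => mem_iUnion.2 ⟨⟨x, S.closure_subset hx⟩, hc ⟨x, _⟩⟩)
  refine ⟨t, inferInstance, fun x => c x, fun x hx => ?_⟩
  obtain ⟨y, hy, hxy⟩ := mem_iUnion₂.1 (ht hx)
  exact mem_iUnion.2 ⟨⟨y, hy⟩, hxy⟩

theorem exists_lipschitzOnWith [FiniteDimensional ℝ E] (S : LevelData p U W f) :
    ∃ L : ℝ≥0, 0 < L ∧ LipschitzOnWith L f (closure W) := by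
  have h : LocallyLipschitzOn (closure W) f := by
    intro x hx
    obtain ⟨K, t, ht, hK⟩ := (S.contDiffOn.contDiffAt
      (S.isOpen_U.mem_nhds (S.closure_subset hx))).hasStrictFDerivAt S.cast_p_ne_zero
      |>.exists_lipschitzOnWith
    exact ⟨K, t, mem_nhdsWithin_of_mem_nhds ht, hK⟩
  obtain ⟨K, hK⟩ := h.exists_lipschitzOnWith_of_compact S.isCompact_closure
  -- Adding 1 makes the constant positive, since it is inverted in `ℝ≥0∞` later.
  exact ⟨K + 1, by positivity, hK.weaken le_self_add⟩

variable [MeasurableSpace E] [BorelSpace E]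

theorem measurableSet_level (S : LevelData p U W f) (σ : ℝ) :
    MeasurableSet {z | z ∈ W ∧ f z = σ} := by
  obtain ⟨u, hu, hu'⟩ := (continuousOn_iff_isClosed.1 (S.continuousOn.mono S.subset)) {σ}
    isClosed_singleton
  have : {z | z ∈ W ∧ f z = σ} = u ∩ W := by
    rw [← hu']; ext z; simp [and_comm]
  rw [this]
  exact hu.measurableSet.inter S.isOpen_W.measurableSet

variable [FiniteDimensional ℝ E]

theorem exists_lintegral_inv_sqrt_le (S : LevelData p U W f) {d : ℕ}
    (hd : Module.finrank ℝ E = d + 1) :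
    ∃ C : ℝ≥0, ∀ σ : ℝ, ∫⁻ z in W, (‖f z - σ‖ₑ ^ (1 / 2 : ℝ))⁻¹
      ∂(Measure.euclideanHausdorffMeasure (d + 1)) ≤ C := by
  obtain ⟨ι, _, c, hc⟩ := S.exists_cover
  choose C hC using fun i => (c i).exists_lintegral_inv_sqrt_le hd
  refine ⟨∑ i, C i, fun σ => ?_⟩
  calc _ ≤ ∫⁻ z in ⋃ i, (c i).Ψ.source, (‖f z - σ‖ₑ ^ (1 / 2 : ℝ))⁻¹
        ∂(Measure.euclideanHausdorffMeasure (d + 1)) :=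
        lintegral_mono_set (subset_closure.trans hc)
    _ ≤ _ := lintegral_iUnion_le _ _
    _ ≤ _ := by
      rw [tsum_fintype]
      push_cast
      exact Finset.sum_le_sum fun i _ => hC i σ

end LevelData

/-- The exponents satisfy `-(d - 1/8) - 1/4 + 1/8 = -d`. The first factor is to be integrated over a
level set, the second exchanged for a power of `|f - σ|`, and the third is the gain. -/
theorem inv_rpow_eq_mul {t : ℝ≥0∞} (ht : t ≠ 0) (ht' : t ≠ ∞) (d : ℝ) :
    (t ^ d)⁻¹ = (t ^ (d - 1 / 8))⁻¹ * (t ^ (1 / 4 : ℝ))⁻¹ * t ^ (1 / 8 : ℝ) := by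
  rw [← ENNReal.rpow_neg, ← ENNReal.rpow_neg, ← ENNReal.rpow_neg, ← ENNReal.rpow_add _ _ ht ht',
    ← ENNReal.rpow_add _ _ ht ht']
  congr 1; ring

/-- Here `t` stands for the distance from a point of the level `σ` to `ζ`, and `b` for `|f ζ - σ|`,
so that `b ≤ L t` is the Lipschitz bound. Part of the singularity in `t` is paid for by a weight
that does not depend on the point of the level set. -/
theorem truncated_inv_rpow_le {t ε b : ℝ≥0∞} {L : ℝ≥0} (hL : L ≠ 0) (ht' : t ≠ ∞) (hε : 0 < ε)
    (hb : b ≤ L * t) {d : ℝ} (hd : 1 / 8 < d) :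
    (if t < ε then (t ^ d)⁻¹ else 0) ≤
      ε ^ (1 / 8 : ℝ) * ((L : ℝ≥0∞) ^ (1 / 4 : ℝ) * (b ^ (1 / 4 : ℝ))⁻¹) *
        (t ^ (d - 1 / 8))⁻¹ := by
  split_ifs with h
  swap
  · exact zero_le
  have hL' : (L : ℝ≥0∞) ≠ 0 := by simpa using hL
  have hL4 : (L : ℝ≥0∞) ^ (1 / 4 : ℝ) ≠ 0 := by
    simp [hL]
  have hL4' : (L : ℝ≥0∞) ^ (1 / 4 : ℝ) ≠ ∞ := by finiteness
  -- At `t = 0` also `b = 0`, and the right side is infinite.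
  rcases eq_or_ne t 0 with rfl | ht
  · have hb0 : b = 0 := by simpa using hb
    have h8 : (0 : ℝ) < d - 1 / 8 := by linarith
    rw [hb0, ENNReal.zero_rpow_of_pos h8, ENNReal.zero_rpow_of_pos (by norm_num : (0 : ℝ) < 1 / 4),
      ENNReal.inv_zero, ENNReal.mul_top hL4, ENNReal.mul_top]
    · exact le_top
    · have : ε ≠ 0 := hε.ne'
      refine mul_ne_zero ?_ ENNReal.top_ne_zero
      intro h0
      rw [ENNReal.rpow_eq_zero_iff] at h0
      rcases h0 with h0 | h0
      · exact this h0.1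
      · linarith [h0.2]
  · rw [inv_rpow_eq_mul ht ht']
    have h1 : (t ^ (1 / 4 : ℝ))⁻¹ ≤ (L : ℝ≥0∞) ^ (1 / 4 : ℝ) * (b ^ (1 / 4 : ℝ))⁻¹ := by
      have h2 := ENNReal.inv_le_inv.2 (ENNReal.rpow_le_rpow hb (by norm_num : (0 : ℝ) ≤ 1 / 4))
      rw [ENNReal.mul_rpow_of_nonneg _ _ (by norm_num), ENNReal.mul_inv (Or.inl hL4)
        (Or.inl hL4')] at h2
      calc (t ^ (1 / 4 : ℝ))⁻¹ = (L : ℝ≥0∞) ^ (1 / 4 : ℝ) * (((L : ℝ≥0∞) ^ (1 / 4 : ℝ))⁻¹ *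
            (t ^ (1 / 4 : ℝ))⁻¹) := by
            rw [← mul_assoc, ENNReal.mul_inv_cancel hL4 hL4', one_mul]
        _ ≤ _ := by gcongr
    have h3 : t ^ (1 / 8 : ℝ) ≤ ε ^ (1 / 8 : ℝ) := ENNReal.rpow_le_rpow h.le (by norm_num)
    calc _ = t ^ (1 / 8 : ℝ) * (t ^ (1 / 4 : ℝ))⁻¹ * (t ^ (d - 1 / 8))⁻¹ := by ring
      _ ≤ _ := by gcongr

/-- The basic estimate for the weakly singular integral operator of order `d` along a piece of a
level set. -/
theorem LevelChart.exists_lintegral_potential_le {E : Type*} [NormedAddCommGroup E]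
    [NormedSpace ℝ E] [FiniteDimensional ℝ E] [MeasurableSpace E] [BorelSpace E] {p : ℕ}
    {U W : Set E} {f : E → ℝ} (S : LevelData p U W f) (c : LevelChart p U f) {d : ℕ}
    (hd0 : 0 < d) (hd : Module.finrank ℝ E = d + 1) :
    ∃ C : ℝ≥0, ∀ (A : Set E) (θ : E → E) (σ : ℝ), MeasurableSet A → Measurable θ →
      MapsTo θ A (c.Ψ.source ∩ W) → (∀ z ∈ A, f (θ z) = σ) →
      (∀ z ∈ A, ∀ w ∈ A, ‖z - w‖ ≤ 2 * ‖θ z - θ w‖) → ∀ (g : E → ℝ≥0∞), Measurable g →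
      ∀ ε : ℝ≥0∞, 0 < ε →
      ∫⁻ z in A, ∫⁻ ζ in W, (if ‖θ z - ζ‖ₑ < ε then (‖θ z - ζ‖ₑ ^ (d : ℝ))⁻¹ else 0) * g ζ
        ∂(Measure.euclideanHausdorffMeasure (d + 1)) ∂(Measure.euclideanHausdorffMeasure d) ≤
      C * ε ^ (1 / 8 : ℝ) * (∫⁻ ζ in W, g ζ ^ (2 : ℝ)
        ∂(Measure.euclideanHausdorffMeasure (d + 1))) ^ (1 / 2 : ℝ) := by
  have hHaarE : (Measure.euclideanHausdorffMeasure (d + 1) : Measure E).IsAddHaarMeasure := by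
    rw [← hd]; infer_instance
  have hd1 : (1 : ℝ) ≤ d := by exact_mod_cast hd0
  -- The exponent 0 bounds the area of `A`; its finiteness is what Tonelli needs below.
  obtain ⟨C₀, hC₀⟩ := c.exists_lintegral_inv_rpow_le hd (s := 0) le_rfl (by linarith)
  obtain ⟨C₁, hC₁⟩ := c.exists_lintegral_inv_rpow_le hd (s := d - 1 / 8) (by linarith)
    (by linarith)
  obtain ⟨C₂, hC₂⟩ := S.exists_lintegral_inv_sqrt_le hd
  obtain ⟨L, hL, hLip⟩ := S.exists_lipschitzOnWith
  refine ⟨C₁ * L ^ (1 / 4 : ℝ) * C₂ ^ (1 / 2 : ℝ),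
    fun A θ σ hA hθ hmaps hσ hanti g hg ε hε => ?_⟩
  have hfin : IsFiniteMeasure ((Measure.euclideanHausdorffMeasure d).restrict A) := by
    constructor
    have := hC₀ A θ σ hA hθ (fun z hz => (hmaps hz).1) hσ hanti 0
    simp only [ENNReal.rpow_zero, inv_one, lintegral_one] at this
    exact this.trans_lt ENNReal.coe_lt_top
  have hfm : AEMeasurable f ((Measure.euclideanHausdorffMeasure (d + 1)).restrict W) :=
    (S.continuousOn.mono S.subset).aemeasurable S.isOpen_W.measurableSet
  have hm : Measurable fun x : E × E => (if ‖θ x.1 - x.2‖ₑ < ε then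
      (‖θ x.1 - x.2‖ₑ ^ (d : ℝ))⁻¹ else 0) := by
    have h0 : Measurable fun x : E × E => ‖θ x.1 - x.2‖ₑ :=
      ((hθ.comp measurable_fst).sub measurable_snd).enorm
    exact Measurable.ite (measurableSet_lt h0 measurable_const) (by fun_prop) measurable_const
  -- Integrate over the level set first. For fixed `ζ` the kernel of order `d - 1/8` contributes a
  -- constant, and only the weight `|f ζ - σ| ^ (-1/4)` remains.
  rw [lintegral_lintegral_swap ((hm.mul (hg.comp measurable_snd)).aemeasurable)]
  calc ∫⁻ ζ in W, ∫⁻ z in A, (if ‖θ z - ζ‖ₑ < ε then (‖θ z - ζ‖ₑ ^ (d : ℝ))⁻¹ else 0) * g ζ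
        ∂(Measure.euclideanHausdorffMeasure d) ∂(Measure.euclideanHausdorffMeasure (d + 1))
      ≤ ∫⁻ ζ in W, (C₁ * ε ^ (1 / 8 : ℝ) * (L : ℝ≥0∞) ^ (1 / 4 : ℝ)) *
          (g ζ * (‖f ζ - σ‖ₑ ^ (1 / 4 : ℝ))⁻¹)
          ∂(Measure.euclideanHausdorffMeasure (d + 1)) := by
        refine setLIntegral_mono' S.isOpen_W.measurableSet fun ζ hζ => ?_
        rw [lintegral_mul_const _ (by
          exact hm.comp (measurable_id.prodMk measurable_const))]
        have : ∫⁻ z in A, (if ‖θ z - ζ‖ₑ < ε then (‖θ z - ζ‖ₑ ^ (d : ℝ))⁻¹ else 0)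
            ∂(Measure.euclideanHausdorffMeasure d) ≤
            ε ^ (1 / 8 : ℝ) * ((L : ℝ≥0∞) ^ (1 / 4 : ℝ) * (‖f ζ - σ‖ₑ ^ (1 / 4 : ℝ))⁻¹) * C₁ := by
          refine le_trans ?_ (mul_le_mul_right (hC₁ A θ σ hA hθ (fun z hz => (hmaps hz).1) hσ
            hanti ζ) _)
          rw [← lintegral_const_mul _ (by fun_prop)]
          refine setLIntegral_mono' hA fun z hz => ?_
          refine truncated_inv_rpow_le hL.ne' enorm_ne_top hε ?_ (by linarith)
          have h1 := hLip (subset_closure hζ) (subset_closure (hmaps hz).2)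
          rw [edist_eq_enorm_sub, edist_eq_enorm_sub, hσ z hz, ← enorm_neg (ζ - θ z), neg_sub] at h1
          exact h1
        calc _ ≤ ε ^ (1 / 8 : ℝ) * ((L : ℝ≥0∞) ^ (1 / 4 : ℝ) *
              (‖f ζ - σ‖ₑ ^ (1 / 4 : ℝ))⁻¹) * C₁ * g ζ := by gcongr
          _ = _ := by ring
    _ = (C₁ * ε ^ (1 / 8 : ℝ) * (L : ℝ≥0∞) ^ (1 / 4 : ℝ)) *
          ∫⁻ ζ in W, g ζ * (‖f ζ - σ‖ₑ ^ (1 / 4 : ℝ))⁻¹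
          ∂(Measure.euclideanHausdorffMeasure (d + 1)) := by
        rw [lintegral_const_mul'']
        exact hg.aemeasurable.mul (by fun_prop)
    _ ≤ (C₁ * ε ^ (1 / 8 : ℝ) * (L : ℝ≥0∞) ^ (1 / 4 : ℝ)) *
          ((∫⁻ ζ in W, g ζ ^ (2 : ℝ) ∂(Measure.euclideanHausdorffMeasure (d + 1))) ^ (1 / 2 : ℝ) *
          (C₂ : ℝ≥0∞) ^ (1 / 2 : ℝ)) := by
        gcongr
        -- The square of the weight is `|f - σ| ^ (-1/2)`, with integral bounded uniformly in `σ`: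
        -- this is what the exponent 1/4 was chosen for.
        refine (ENNReal.lintegral_mul_le_Lp_mul_Lq _ (p := 2) (q := 2)
          Real.HolderConjugate.two_two hg.aemeasurable (by fun_prop)).trans ?_
        gcongr
        refine le_trans (le_of_eq ?_) (hC₂ σ)
        refine lintegral_congr fun ζ => ?_
        rw [ENNReal.inv_rpow, ← ENNReal.rpow_mul]
        norm_num
    _ = _ := by
        push_cast
        rw [ENNReal.coe_rpow_of_nonneg _ (by norm_num), ENNReal.coe_rpow_of_nonneg _ (by norm_num)]
        ring

end

/-! ### Levels with small integral: the first assertion -/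

section

namespace LevelData

universe u
variable {E : Type u} [NormedAddCommGroup E] [NormedSpace ℝ E] {p : ℕ} {U W : Set E} {f : E → ℝ}
  [FiniteDimensional ℝ E] [MeasurableSpace E] [BorelSpace E] {d : ℕ}

theorem exists_coarea_bound (S : LevelData p U W f) (hd : Module.finrank ℝ E = d + 1) :
    ∃ C : ℝ≥0, ∀ g : E → ℝ≥0∞, Measurable g → ∃ G : ℝ → ℝ≥0∞, Measurable G ∧
      (∀ σ, ∫⁻ z in {z | z ∈ W ∧ f z = σ}, g z ∂(Measure.euclideanHausdorffMeasure d) ≤ G σ) ∧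
      ∫⁻ σ, G σ ≤ C * ∫⁻ z in W, g z ∂(Measure.euclideanHausdorffMeasure (d + 1)) := by
  obtain ⟨ι, _, c, hc⟩ := S.exists_cover
  choose C hC using fun i => (c i).exists_coarea_bound hd
  refine ⟨∑ i, C i, fun g hg => ?_⟩
  have hgW : Measurable (W.indicator g) := hg.indicator S.isOpen_W.measurableSet
  choose G hG hG1 hG2 using fun i => hC i (W.indicator g) hgW
  refine ⟨fun σ => ∑ i, G i σ, Finset.measurable_fun_sum _ fun i _ => hG i, fun σ => ?_, ?_⟩
  · calc _ = ∫⁻ z in {z | z ∈ W ∧ f z = σ}, W.indicator g z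
          ∂(Measure.euclideanHausdorffMeasure d) := by
          refine setLIntegral_congr_fun (S.measurableSet_level σ) fun z hz => ?_
          rw [indicator_of_mem hz.1]
      _ ≤ ∫⁻ z in ⋃ i, {z | z ∈ (c i).Ψ.source ∧ f z = σ}, W.indicator g z
          ∂(Measure.euclideanHausdorffMeasure d) := by
          refine lintegral_mono_set fun z hz => ?_
          obtain ⟨i, hi⟩ := mem_iUnion.1 (hc (subset_closure hz.1))
          exact mem_iUnion.2 ⟨i, hi, hz.2⟩
      _ ≤ _ := lintegral_iUnion_le _ _
      _ ≤ _ := by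
        rw [tsum_fintype]
        exact Finset.sum_le_sum fun i _ => hG1 i σ
  · rw [lintegral_finsetSum _ fun i _ => hG i]
    push_cast
    rw [Finset.sum_mul]
    refine Finset.sum_le_sum fun i _ => (hG2 i).trans ?_
    refine mul_le_mul_right ?_ _
    rw [setLIntegral_indicator S.isOpen_W.measurableSet]
    exact lintegral_mono_set inter_subset_left

/-- `|f| ^ (-1/2)` has a finite integral over `W` and is infinite where `f` vanishes. -/
theorem ae_ne_zero (S : LevelData p U W f) (hd : Module.finrank ℝ E = d + 1) :
    ∀ᵐ z ∂((Measure.euclideanHausdorffMeasure (d + 1)).restrict W), f z ≠ 0 := by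
  obtain ⟨C, hC⟩ := S.exists_lintegral_inv_sqrt_le hd
  have hfm : AEMeasurable f ((Measure.euclideanHausdorffMeasure (d + 1)).restrict W) :=
    (S.continuousOn.mono S.subset).aemeasurable S.isOpen_W.measurableSet
  have := ae_lt_top' (f := fun z => (‖f z - 0‖ₑ ^ (1 / 2 : ℝ))⁻¹) (by fun_prop)
    ((hC 0).trans_lt ENNReal.coe_lt_top).ne
  filter_upwards [this] with z hz hz0
  rw [hz0] at hz
  simp at hz

/-- Small level sets along which a function that is integrable against a nonintegrable power of
`1 / |f|` has arbitrarily small integral. -/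
theorem exists_small_level (S : LevelData p U W f) (hd : Module.finrank ℝ E = d + 1) {α : ℝ}
    (hα : 1 < α) {g : E → ℝ≥0∞} (hg : Measurable g)
    (hgi : ∫⁻ z in W, (‖f z‖ₑ ^ α)⁻¹ * g z ∂(Measure.euclideanHausdorffMeasure (d + 1)) ≠ ∞)
    {δ : ℝ≥0} (hδ : 0 < δ) {b : ℝ} (hb : 0 < b) :
    ∃ σ ∈ Ioo 0 b, ∫⁻ z in {z | z ∈ W ∧ f z = σ}, g z
      ∂(Measure.euclideanHausdorffMeasure d) ≤ δ := by
  classical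
  obtain ⟨C, hC⟩ := S.exists_coarea_bound hd
  set F : E → ℝ := W.piecewise f (fun _ => 0) with hF
  have hFm : Measurable F := (S.continuousOn.mono S.subset).measurable_piecewise
    continuousOn_const S.isOpen_W.measurableSet
  have hFf : ∀ z ∈ W, F z = f z := fun z hz => by simp [hF, hz]
  obtain ⟨G, hG, hG1, hG2⟩ := hC (fun z => (‖F z‖ₑ ^ α)⁻¹ * g z) (by fun_prop)
  have hGfin : ∫⁻ σ, G σ < ∞ := by
    refine hG2.trans_lt (ENNReal.mul_lt_top ENNReal.coe_lt_top ?_)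
    rw [setLIntegral_congr_fun S.isOpen_W.measurableSet (g := fun z => (‖f z‖ₑ ^ α)⁻¹ * g z)]
    · exact hgi.lt_top
    · intro z hz
      simp only [hFf z hz]
  -- If every level in `(0, b)` carried more than `δ`, the coarea bound would make `δ` times the
  -- integral of `σ ^ (-α)` over `(0, b)` finite, against `α > 1`.
  by_contra! hcon
  have hlow : ∀ σ ∈ Ioo 0 b, δ * ENNReal.ofReal (σ ^ (-α)) ≤ G σ := by
    intro σ hσ
    have h1 := hG1 σ
    have h2 : ∫⁻ z in {z | z ∈ W ∧ f z = σ}, (‖F z‖ₑ ^ α)⁻¹ * g z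
        ∂(Measure.euclideanHausdorffMeasure d) = ENNReal.ofReal (σ ^ (-α)) *
        ∫⁻ z in {z | z ∈ W ∧ f z = σ}, g z ∂(Measure.euclideanHausdorffMeasure d) := by
      rw [← lintegral_const_mul _ hg]
      refine setLIntegral_congr_fun (S.measurableSet_level σ) fun z hz => ?_
      simp only [hFf z hz.1, hz.2]
      rw [Real.enorm_of_nonneg hσ.1.le, Real.rpow_neg hσ.1.le, ENNReal.ofReal_inv_of_pos
        (Real.rpow_pos_of_pos hσ.1 _), ENNReal.ofReal_rpow_of_pos hσ.1]
    rw [h2] at h1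
    refine le_trans ?_ h1
    rw [mul_comm]
    gcongr
    exact (hcon σ hσ).le
  have h3 : ∫⁻ σ in Ioo 0 b, ENNReal.ofReal (σ ^ (-α)) < ∞ := by
    have h4 : δ * ∫⁻ σ in Ioo 0 b, ENNReal.ofReal (σ ^ (-α)) < ∞ := by
      rw [← lintegral_const_mul' _ _ ENNReal.coe_ne_top]
      exact (setLIntegral_mono' measurableSet_Ioo hlow).trans_lt
        ((setLIntegral_le_lintegral _ _).trans_lt hGfin)
    rcases ENNReal.mul_lt_top_iff.1 h4 with h | h | h
    · exact h.2
    · simp [hδ.ne'] at h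
    · simp [h]
  have h5 : IntegrableOn (fun σ : ℝ => σ ^ (-α)) (Ioo 0 b) := by
    refine ⟨by fun_prop, ?_⟩
    rw [hasFiniteIntegral_iff_ofReal]
    · exact h3
    · filter_upwards [ae_restrict_mem measurableSet_Ioo] with σ hσ
      exact Real.rpow_nonneg hσ.1.le _
  rw [intervalIntegral.integrableOn_Ioo_rpow_iff hb] at h5
  linarith

theorem exists_seq_small_level (S : LevelData p U W f) (hd : Module.finrank ℝ E = d + 1) {α : ℝ}
    (hα : 1 < α) {u : E → ℂ}
    (hu : AEStronglyMeasurable u ((Measure.euclideanHausdorffMeasure (d + 1)).restrict W))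
    (hui : IntegrableOn (fun z => u z / ((|f z| ^ α : ℝ) : ℂ)) W
      (Measure.euclideanHausdorffMeasure (d + 1))) {b : ℝ} (hb : 0 < b) :
    ∃ s : ℕ → ℝ, (∀ ν, 0 < s ν ∧ s ν < b) ∧ Tendsto s atTop (𝓝 0) ∧
      (∀ ν, IntegrableOn u {z | z ∈ W ∧ f z = s ν} (Measure.euclideanHausdorffMeasure d)) ∧
      Tendsto (fun ν => ∫ z in {z | z ∈ W ∧ f z = s ν}, ‖u z‖
        ∂(Measure.euclideanHausdorffMeasure d)) atTop (𝓝 0) := by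
  classical
  set u' := hu.mk u with hu'
  have hu'm : StronglyMeasurable u' := hu.stronglyMeasurable_mk
  have hae : ∀ᵐ z ∂((Measure.euclideanHausdorffMeasure (d + 1)).restrict W), u z = u' z :=
    hu.ae_eq_mk
  set N := toMeasurable ((Measure.euclideanHausdorffMeasure (d + 1)).restrict W)
    {z | ¬ u z = u' z} with hN
  have hN0 : ((Measure.euclideanHausdorffMeasure (d + 1)).restrict W) N = 0 := by
    rw [hN, measure_toMeasurable]; exact hae
  have hNm : MeasurableSet N := measurableSet_toMeasurable _ _
  have hNsub : ∀ z ∉ N, u z = u' z := fun z hz => by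
    by_contra h
    exact hz (subset_toMeasurable _ _ h)
  -- `u` agrees with `u'` only off the null set `N`, which may meet a level set in positive area.
  -- Infinite weight on `N` costs nothing in the volume integral, while a finite integral of `g`
  -- over a level forces `N` to be null there, so `u` is measurable along the chosen levels.
  set g : E → ℝ≥0∞ := fun z => ‖u' z‖ₑ + N.indicator (fun _ => ∞) z with hg
  have hgm : Measurable g := hu'm.measurable.enorm.add (measurable_const.indicator hNm)
  have hle : ∀ z, ‖u z‖ₑ ≤ g z := by
    intro z
    by_cases hz : z ∈ N
    · simp [hg, hz]
    · simp [hg, hz, hNsub z hz]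
  have hgi : ∫⁻ z in W, (‖f z‖ₑ ^ α)⁻¹ * g z ∂(Measure.euclideanHausdorffMeasure (d + 1)) ≠ ∞ := by
    have h1 := hui.2
    rw [hasFiniteIntegral_iff_enorm] at h1
    refine ne_of_lt (lt_of_le_of_lt (lintegral_mono_ae ?_) h1)
    have hNae : ∀ᵐ z ∂((Measure.euclideanHausdorffMeasure (d + 1)).restrict W), z ∉ N :=
      measure_eq_zero_iff_ae_notMem.1 hN0
    filter_upwards [S.ae_ne_zero hd, hNae] with z hz hzN
    have hpos : 0 < |f z| := abs_pos.2 hz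
    have hpos' : 0 < |f z| ^ α := Real.rpow_pos_of_pos hpos _
    simp only [hg, hzN, not_false_eq_true, indicator_of_notMem, add_zero, ← hNsub z hzN]
    rw [div_eq_mul_inv, enorm_mul, mul_comm]
    gcongr
    rw [enorm_inv (by exact_mod_cast hpos'.ne')]
    have h2 : ‖((|f z| ^ α : ℝ) : ℂ)‖ₑ = ENNReal.ofReal (|f z| ^ α) := by
      rw [← ofReal_norm, Complex.norm_real, Real.norm_of_nonneg hpos'.le]
    rw [h2, ← ENNReal.ofReal_rpow_of_pos hpos, ← Real.norm_eq_abs, ofReal_norm]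
  have hex : ∀ ν : ℕ, ∃ σ ∈ Ioo 0 (min b (1 / ((ν : ℝ) + 1))),
      ∫⁻ z in {z | z ∈ W ∧ f z = σ}, g z ∂(Measure.euclideanHausdorffMeasure d) ≤
        ((1 / ((ν : ℝ≥0) + 1) : ℝ≥0) : ℝ≥0∞) := fun ν =>
    S.exists_small_level hd hα hgm hgi (by positivity) (lt_min hb (by positivity))
  choose s hs hsg using hex
  have hint : ∀ ν, ∫⁻ z in {z | z ∈ W ∧ f z = s ν}, ‖u z‖ₑ
      ∂(Measure.euclideanHausdorffMeasure d) ≤ ((1 / ((ν : ℝ≥0) + 1) : ℝ≥0) : ℝ≥0∞) := fun ν =>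
    (lintegral_mono hle).trans (hsg ν)
  have hmeas : ∀ ν, AEStronglyMeasurable u ((Measure.euclideanHausdorffMeasure d).restrict
      {z | z ∈ W ∧ f z = s ν}) := by
    intro ν
    refine ⟨u', hu'm, ?_⟩
    have h1 := ae_lt_top hgm ((hsg ν).trans_lt ENNReal.coe_lt_top).ne
    filter_upwards [h1] with z hz
    refine hNsub z fun hzN => ?_
    simp [hg, hzN] at hz
  refine ⟨s, fun ν => ⟨(hs ν).1, (hs ν).2.trans_le (min_le_left _ _)⟩, ?_, fun ν => ?_, ?_⟩
  · exact squeeze_zero (fun ν => (hs ν).1.le) (fun ν => (hs ν).2.le.trans (min_le_right _ _))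
      tendsto_one_div_add_atTop_nhds_zero_nat
  · exact ⟨hmeas ν, (hint ν).trans_lt ENNReal.coe_lt_top⟩
  · refine squeeze_zero (fun ν => integral_nonneg fun _ => norm_nonneg _) (fun ν => ?_)
      tendsto_one_div_add_atTop_nhds_zero_nat
    rw [integral_norm_eq_lintegral_enorm (hmeas ν)]
    refine (ENNReal.toReal_mono ENNReal.coe_ne_top (hint ν)).trans (le_of_eq ?_)
    rw [ENNReal.coe_toReal]
    push_cast
    rfl

end LevelData

end

/-! ### Weakly singular kernels and the integrability of their potentials on level sets -/

section

/-- A kernel on `W`, continuous off the diagonal, with a singularity of order `d` at the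
diagonal. -/
structure IsWeakKernel {E : Type*} [NormedAddCommGroup E] (d : ℕ) (W : Set E) (k : E → E → ℂ) :
    Prop where
  continuousOn : ContinuousOn (fun q : E × E => k q.1 q.2) ((W ×ˢ W) ∩ {q | q.1 ≠ q.2})
  bound : ∃ C : ℝ≥0, ∀ z ∈ W, ∀ ζ ∈ W, ‖k z ζ‖ ≤ C * (‖z - ζ‖ ^ d)⁻¹

/-- The integral operator with kernel `k` on `W`. -/
noncomputable def potential {E : Type*} [NormedAddCommGroup E] [MeasurableSpace E] [BorelSpace E]
    (d : ℕ) (W : Set E) (k : E → E → ℂ) (u : E → ℂ) (z : E) : ℂ :=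
  ∫ ζ in W, k z ζ * u ζ ∂(μHE[d + 1])

/-- The absolute value of the part of the potential coming from an `ε`-neighbourhood. -/
noncomputable def nearPotential {E : Type*} [NormedAddCommGroup E] [MeasurableSpace E]
    [BorelSpace E] (d : ℕ) (W : Set E) (k : E → E → ℂ) (u : E → ℂ) (ε : ℝ≥0∞) (z : E) : ℝ≥0∞ :=
  ∫⁻ ζ in W, (if ‖z - ζ‖ₑ < ε then ‖k z ζ * u ζ‖ₑ else 0) ∂(μHE[d + 1])

/-- A continuous cutoff, equal to `0` for `t ≤ ε / 2` and to `1` for `t ≥ ε`. -/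
noncomputable def cutoff (ε t : ℝ) : ℝ := max 0 (min 1 (2 * t / ε - 1))

theorem continuous_cutoff (ε : ℝ) : Continuous (cutoff ε) := by
  unfold cutoff; fun_prop

theorem cutoff_nonneg (ε t : ℝ) : 0 ≤ cutoff ε t := le_max_left _ _

theorem cutoff_le_one (ε t : ℝ) : cutoff ε t ≤ 1 := max_le zero_le_one (min_le_left _ _)

theorem cutoff_eq_zero {ε t : ℝ} (hε : 0 < ε) (ht : t ≤ ε / 2) : cutoff ε t = 0 := by
  unfold cutoff
  refine max_eq_left ((min_le_right _ _).trans ?_)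
  rw [sub_nonpos, div_le_one hε]; linarith

theorem cutoff_eq_one {ε t : ℝ} (hε : 0 < ε) (ht : ε ≤ t) : cutoff ε t = 1 := by
  unfold cutoff
  have : 1 ≤ 2 * t / ε - 1 := by
    rw [le_sub_iff_add_le, le_div_iff₀ hε]; linarith
  rw [min_eq_left this]; simp

variable {E : Type*} [NormedAddCommGroup E] [NormedSpace ℝ E] {p : ℕ} {U W : Set E} {f : E → ℝ}
  [FiniteDimensional ℝ E] [MeasurableSpace E] [BorelSpace E] {d : ℕ} {k : E → E → ℂ} {u : E → ℂ}

namespace IsWeakKernel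

omit [NormedSpace ℝ E] [FiniteDimensional ℝ E] [MeasurableSpace E] [BorelSpace E] in
-- Because `0⁻¹ = 0`, the bound in `IsWeakKernel` forces the kernel to vanish on the diagonal.
theorem apply_self (hk : IsWeakKernel d W k) (hd0 : 0 < d) {z : E} (hz : z ∈ W) : k z z = 0 := by
  obtain ⟨C, hC⟩ := hk.bound
  have := hC z hz z hz
  rw [sub_self, norm_zero, zero_pow hd0.ne', inv_zero, mul_zero] at this
  simpa using this

theorem exists_measurable (hk : IsWeakKernel d W k) (hd0 : 0 < d) (hW : IsOpen W) :
    ∃ k' : E × E → ℂ, Measurable k' ∧ ∀ z ∈ W, ∀ ζ ∈ W, k' (z, ζ) = k z ζ := by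
  classical
  have ho : IsOpen ((W ×ˢ W) ∩ {q : E × E | q.1 ≠ q.2}) :=
    (hW.prod hW).inter (isOpen_ne_fun continuous_fst continuous_snd)
  refine ⟨((W ×ˢ W) ∩ {q : E × E | q.1 ≠ q.2}).piecewise (fun q => k q.1 q.2) (fun _ => 0),
    hk.continuousOn.measurable_piecewise continuousOn_const ho.measurableSet, ?_⟩
  intro z hz ζ hζ
  by_cases h : z = ζ
  · subst h
    rw [piecewise_eq_of_notMem _ _ _ (by simp), hk.apply_self hd0 hz]
  · exact piecewise_eq_of_mem _ _ _ (show (z, ζ) ∈ _ from ⟨⟨hz, hζ⟩, h⟩)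

theorem aestronglyMeasurable (hk : IsWeakKernel d W k) (hd0 : 0 < d) (hW : IsOpen W)
    (hu : AEStronglyMeasurable u (μHE[d + 1].restrict W)) {z : E} (hz : z ∈ W) :
    AEStronglyMeasurable (fun ζ => k z ζ * u ζ) (μHE[d + 1].restrict W) := by
  obtain ⟨k', hk', hkk'⟩ := hk.exists_measurable hd0 hW
  refine AEStronglyMeasurable.mul ?_ hu
  refine AEStronglyMeasurable.congr (f := fun ζ => k' (z, ζ)) ?_ ?_
  · exact (hk'.comp (measurable_const.prodMk measurable_id)).aestronglyMeasurable
  · filter_upwards [ae_restrict_mem hW.measurableSet] with ζ hζ using hkk' z hz ζ hζ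

/-- Agreement at every point of `W`, not merely almost everywhere, is essential: the potential will
be restricted to level sets, which have volume 0. It holds because only the values of `u` at a null
set of `ζ` are altered. -/
theorem exists_stronglyMeasurable_potential (hk : IsWeakKernel d W k) (hd0 : 0 < d)
    (hW : IsOpen W) (hd : Module.finrank ℝ E = d + 1)
    (hu : AEStronglyMeasurable u (μHE[d + 1].restrict W)) :
    ∃ v : E → ℂ, StronglyMeasurable v ∧ ∀ z ∈ W, potential d W k u z = v z := by
  have hHaarE : (μHE[d + 1] : Measure E).IsAddHaarMeasure := by
    rw [← hd]; infer_instance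
  obtain ⟨k', hk', hkk'⟩ := hk.exists_measurable hd0 hW
  refine ⟨fun z => ∫ ζ in W, k' (z, ζ) * hu.mk u ζ ∂(μHE[d + 1]), ?_, fun z hz => ?_⟩
  · refine StronglyMeasurable.integral_prod_right 
      (f := fun z ζ => k' (z, ζ) * hu.mk u ζ) ?_
    exact hk'.stronglyMeasurable.mul (hu.stronglyMeasurable_mk.comp_measurable measurable_snd)
  · refine integral_congr_ae ?_
    filter_upwards [ae_restrict_mem hW.measurableSet, hu.ae_eq_mk] with ζ hζ hζu
    rw [hkk' z hz ζ hζ, ← hζu]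

omit [NormedSpace ℝ E] [FiniteDimensional ℝ E] [MeasurableSpace E] [BorelSpace E] in
theorem enorm_le (hk : IsWeakKernel d W k) : ∃ C : ℝ≥0, ∀ z ∈ W, ∀ ζ ∈ W,
    ‖k z ζ‖ₑ ≤ C * (‖z - ζ‖ₑ ^ (d : ℝ))⁻¹ := by
  obtain ⟨C, hC⟩ := hk.bound
  refine ⟨C, fun z hz ζ hζ => ?_⟩
  have h := hC z hz ζ hζ
  rw [← ofReal_norm]
  refine (ENNReal.ofReal_le_ofReal h).trans ?_
  rw [ENNReal.ofReal_mul C.coe_nonneg, ENNReal.ofReal_coe_nnreal]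
  gcongr
  rcases eq_or_ne (‖z - ζ‖) 0 with h0 | h0
  · rcases Nat.eq_zero_or_pos d with rfl | hd
    · simp
    · rw [h0, zero_pow hd.ne']; simp
  · rw [ENNReal.ofReal_inv_of_pos (by positivity), ENNReal.rpow_natCast, ← ofReal_norm,
      ENNReal.ofReal_pow (norm_nonneg _)]

/-- Uniform smallness of the near part of the potential along pieces of level sets. -/
theorem exists_lintegral_nearPotential_le (hk : IsWeakKernel d W k) (S : LevelData p U W f)
    (c : LevelChart p U f) (hd0 : 0 < d) (hd : Module.finrank ℝ E = d + 1)
    (hu : MemLp u 2 (μHE[d + 1].restrict W)) :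
    ∃ C : ℝ≥0, ∀ (A : Set E) (θ : E → E) (σ : ℝ), MeasurableSet A → Measurable θ →
      MapsTo θ A (c.Ψ.source ∩ W) → (∀ z ∈ A, f (θ z) = σ) →
      (∀ z ∈ A, ∀ w ∈ A, ‖z - w‖ ≤ 2 * ‖θ z - θ w‖) → ∀ ε : ℝ≥0∞, 0 < ε →
      ∫⁻ z in A, nearPotential d W k u ε (θ z) ∂(μHE[d]) ≤ C * ε ^ (1 / 8 : ℝ) := by
  obtain ⟨C, hC⟩ := c.exists_lintegral_potential_le S hd0 hd
  obtain ⟨C', hC'⟩ := hk.enorm_le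
  set g : E → ℝ≥0∞ := hu.1.enorm.mk _ with hg
  have hgm : Measurable g := hu.1.enorm.measurable_mk
  have hgu : ∀ᵐ ζ ∂(μHE[d + 1].restrict W), ‖u ζ‖ₑ = g ζ := hu.1.enorm.ae_eq_mk
  have hfin : (∫⁻ ζ in W, g ζ ^ (2 : ℝ) ∂(μHE[d + 1])) ^ (1 / 2 : ℝ) ≠ ∞ := by
    have h1 := hu.2
    rw [eLpNorm_eq_lintegral_rpow_enorm_toReal (by norm_num) (by norm_num)] at h1
    rw [lintegral_congr_ae (g := fun ζ => ‖u ζ‖ₑ ^ (2 : ℝ))]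
    · simpa using h1.ne
    · filter_upwards [hgu] with ζ hζ
      rw [hζ]
  refine ⟨C' * C * ((∫⁻ ζ in W, g ζ ^ (2 : ℝ) ∂(μHE[d + 1])) ^ (1 / 2 : ℝ)).toNNReal,
    fun A θ σ hA hθ hmaps hσ hanti ε hε => ?_⟩
  calc ∫⁻ z in A, nearPotential d W k u ε (θ z) ∂(μHE[d])
      ≤ ∫⁻ z in A, C' * ∫⁻ ζ in W, (if ‖θ z - ζ‖ₑ < ε then (‖θ z - ζ‖ₑ ^ (d : ℝ))⁻¹ else 0) *
        g ζ ∂(μHE[d + 1]) ∂(μHE[d]) := by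
        refine setLIntegral_mono' hA fun z hz => ?_
        rw [← lintegral_const_mul' _ _ ENNReal.coe_ne_top]
        refine lintegral_mono_ae ?_
        filter_upwards [ae_restrict_mem S.isOpen_W.measurableSet, hgu] with ζ hζ hζg
        split_ifs with h
        · rw [enorm_mul, hζg, ← mul_assoc]
          gcongr
          exact hC' _ (hmaps hz).2 _ hζ
        · exact zero_le
    _ = C' * ∫⁻ z in A, ∫⁻ ζ in W, (if ‖θ z - ζ‖ₑ < ε then (‖θ z - ζ‖ₑ ^ (d : ℝ))⁻¹ else 0) *
        g ζ ∂(μHE[d + 1]) ∂(μHE[d]) := by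
        rw [lintegral_const_mul' _ _ ENNReal.coe_ne_top]
    _ ≤ C' * (C * ε ^ (1 / 8 : ℝ) *
          (∫⁻ ζ in W, g ζ ^ (2 : ℝ) ∂(μHE[d + 1])) ^ (1 / 2 : ℝ)) := by
        gcongr
        exact hC A θ σ hA hθ hmaps hσ hanti g hgm ε hε
    _ = _ := by
        push_cast
        rw [ENNReal.coe_toNNReal hfin]
        ring

end IsWeakKernel

omit [NormedSpace ℝ E] [FiniteDimensional ℝ E] in
theorem nearPotential_eq {ε : ℝ≥0∞} {z : E} (hW : MeasurableSet W)
    (h : ∀ ζ ∈ W, ‖z - ζ‖ₑ < ε) :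
    nearPotential d W k u ε z = ∫⁻ ζ in W, ‖k z ζ * u ζ‖ₑ ∂(μHE[d + 1]) := by
  refine setLIntegral_congr_fun hW fun ζ hζ => ?_
  simp only [h ζ hζ, if_true]

/-- The Riesz bound with exponent 0, summed over a finite cover by charts. -/
theorem LevelData.exists_area_level_le (S : LevelData p U W f)
    (hd : Module.finrank ℝ E = d + 1) (hd0 : 0 < d) :
    ∃ C : ℝ≥0, ∀ σ : ℝ, μHE[d] {z | z ∈ W ∧ f z = σ} ≤ C := by
  obtain ⟨ι, _, c, hc⟩ := S.exists_cover
  choose C hC using fun i => (c i).exists_lintegral_inv_rpow_le hd (s := 0) le_rfl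
    (by exact_mod_cast hd0)
  refine ⟨∑ i, C i, fun σ => ?_⟩
  have hsub : {z | z ∈ W ∧ f z = σ} ⊆ ⋃ i, {z | z ∈ W ∧ f z = σ} ∩ (c i).Ψ.source := by
    intro z hz
    obtain ⟨i, hi⟩ := mem_iUnion.1 (hc (subset_closure hz.1))
    exact mem_iUnion.2 ⟨i, hz, hi⟩
  refine (measure_mono hsub).trans ((measure_iUnion_le _).trans ?_)
  rw [tsum_fintype]
  push_cast
  refine Finset.sum_le_sum fun i _ => ?_
  have := hC i ({z | z ∈ W ∧ f z = σ} ∩ (c i).Ψ.source) id σ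
    ((S.measurableSet_level σ).inter (c i).Ψ.open_source.measurableSet) measurable_id
    (fun z hz => hz.2) (fun z hz => hz.1.2)
    (fun z _ w _ => by
      have := norm_nonneg (z - w)
      simp only [id]; linarith) 0
  simpa using this

theorem IsWeakKernel.lintegral_level_lt_top (hk : IsWeakKernel d W k) (S : LevelData p U W f)
    (hd0 : 0 < d) (hd : Module.finrank ℝ E = d + 1)
    (hu : MemLp u 2 (μHE[d + 1].restrict W)) (σ : ℝ) :
    ∫⁻ z in {z | z ∈ W ∧ f z = σ}, ∫⁻ ζ in W, ‖k z ζ * u ζ‖ₑ ∂(μHE[d + 1]) ∂(μHE[d]) < ∞ := by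
  obtain ⟨ι, _, c, hc⟩ := S.exists_cover
  obtain ⟨R, hR⟩ := S.isBounded.subset_ball 0
  -- Larger than the diameter of `W`, so the near part is the whole potential and the basic estimate
  -- becomes plain integrability.
  set ε : ℝ≥0∞ := ENNReal.ofReal (2 * |R| + 1)
  have hε : 0 < ε := by
    rw [ENNReal.ofReal_pos]; positivity
  have hlt : ∀ z ∈ W, ∀ ζ ∈ W, ‖z - ζ‖ₑ < ε := by
    intro z hz ζ hζ
    rw [← ofReal_norm, ENNReal.ofReal_lt_ofReal_iff (by positivity)]
    have h1 := mem_ball_zero_iff.1 (hR hz)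
    have h2 := mem_ball_zero_iff.1 (hR hζ)
    have := norm_sub_le z ζ
    have := le_abs_self R
    linarith
  choose C hC using fun i => hk.exists_lintegral_nearPotential_le S (c i) hd0 hd hu
  have hsub : {z | z ∈ W ∧ f z = σ} ⊆ ⋃ i, {z | z ∈ W ∧ f z = σ} ∩ (c i).Ψ.source := by
    intro z hz
    obtain ⟨i, hi⟩ := mem_iUnion.1 (hc (subset_closure hz.1))
    exact mem_iUnion.2 ⟨i, hz, hi⟩
  rw [setLIntegral_congr_fun (S.measurableSet_level σ)
    (g := fun z => nearPotential d W k u ε z) (fun z hz =>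
      (nearPotential_eq S.isOpen_W.measurableSet (hlt z hz.1)).symm)]
  refine (lintegral_mono_set hsub).trans_lt ((lintegral_iUnion_le _ _).trans_lt ?_)
  rw [tsum_fintype, ENNReal.sum_lt_top]
  intro i _
  refine (hC i ({z | z ∈ W ∧ f z = σ} ∩ (c i).Ψ.source) id σ
    ((S.measurableSet_level σ).inter (c i).Ψ.open_source.measurableSet) measurable_id
    (fun z hz => ⟨hz.2, hz.1.1⟩) (fun z hz => hz.1.2)
    (fun z _ w _ => by
      have := norm_nonneg (z - w)
      simp only [id]; linarith) ε hε).trans_lt ?_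
  finiteness

theorem IsWeakKernel.integrableOn_level (hk : IsWeakKernel d W k) (S : LevelData p U W f)
    (hd0 : 0 < d) (hd : Module.finrank ℝ E = d + 1)
    (hu : MemLp u 2 (μHE[d + 1].restrict W)) (σ : ℝ) :
    (∀ᵐ z ∂(μHE[d].restrict {z | z ∈ W ∧ f z = σ}),
      IntegrableOn (fun ζ => k z ζ * u ζ) W (μHE[d + 1])) ∧
    IntegrableOn (potential d W k u) {z | z ∈ W ∧ f z = σ} (μHE[d]) := by
  have hHaarE : (μHE[d + 1] : Measure E).IsAddHaarMeasure := by
    rw [← hd]; infer_instance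
  have hfin := hk.lintegral_level_lt_top S hd0 hd hu σ
  obtain ⟨k', hk', hkk'⟩ := hk.exists_measurable hd0 S.isOpen_W
  have hm : Measurable fun z => ∫⁻ ζ in W, ‖k' (z, ζ) * hu.1.mk u ζ‖ₑ ∂(μHE[d + 1]) := by
    refine Measurable.lintegral_prod_right' (f := fun q : E × E => ‖k' q * hu.1.mk u q.2‖ₑ) ?_
    exact (hk'.mul (hu.1.stronglyMeasurable_mk.measurable.comp measurable_snd)).enorm
  have heq : ∀ z ∈ {z | z ∈ W ∧ f z = σ}, ∫⁻ ζ in W, ‖k z ζ * u ζ‖ₑ ∂(μHE[d + 1]) =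
      ∫⁻ ζ in W, ‖k' (z, ζ) * hu.1.mk u ζ‖ₑ ∂(μHE[d + 1]) := by
    intro z hz
    refine lintegral_congr_ae ?_
    filter_upwards [ae_restrict_mem S.isOpen_W.measurableSet, hu.1.ae_eq_mk] with ζ hζ hζu
    rw [hkk' z hz.1 ζ hζ, ← hζu]
  constructor
  · have h1 := hfin
    rw [setLIntegral_congr_fun (S.measurableSet_level σ) heq] at h1
    filter_upwards [ae_lt_top hm h1.ne, ae_restrict_mem (S.measurableSet_level σ)] with z hz hzσ
    refine ⟨hk.aestronglyMeasurable hd0 S.isOpen_W hu.1 hzσ.1, ?_⟩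
    rw [hasFiniteIntegral_iff_enorm, heq z hzσ]
    exact hz
  · obtain ⟨v, hv, hvp⟩ := hk.exists_stronglyMeasurable_potential hd0 S.isOpen_W hd hu.1
    refine ⟨⟨v, hv, ?_⟩, ?_⟩
    · filter_upwards [ae_restrict_mem (S.measurableSet_level σ)] with z hz using hvp z hz.1
    · rw [hasFiniteIntegral_iff_enorm]
      exact (lintegral_mono fun z => enorm_integral_le_lintegral_enorm _).trans_lt hfin

end

/-! ### Truncation near the diagonal and convergence in L¹ -/

section

variable {E : Type*} [NormedAddCommGroup E] [NormedSpace ℝ E] {p : ℕ} {U W : Set E} {f : E → ℝ}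
  [FiniteDimensional ℝ E] [MeasurableSpace E] [BorelSpace E] {d : ℕ} {k : E → E → ℂ} {u : E → ℂ}

/-- The kernel `k` cut off near the diagonal. -/
noncomputable def cutKernel (ε : ℝ) (k : E → E → ℂ) (z ζ : E) : ℂ :=
  (cutoff ε ‖z - ζ‖ : ℂ) * k z ζ

namespace IsWeakKernel

omit [NormedSpace ℝ E] [FiniteDimensional ℝ E] [MeasurableSpace E] [BorelSpace E] in
theorem norm_cutKernel_le (hk : IsWeakKernel d W k) {ε : ℝ} (hε : 0 < ε) :
    ∃ M : ℝ≥0, ∀ z ∈ W, ∀ ζ ∈ W, ‖cutKernel ε k z ζ‖ ≤ M := by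
  obtain ⟨C, hC⟩ := hk.bound
  refine ⟨C * ⟨((ε / 2) ^ d)⁻¹, by positivity⟩, fun z hz ζ hζ => ?_⟩
  rw [cutKernel, norm_mul, Complex.norm_real, Real.norm_of_nonneg (cutoff_nonneg _ _)]
  rcases le_or_gt (‖z - ζ‖) (ε / 2) with h | h
  · rw [cutoff_eq_zero hε h, zero_mul]
    change 0 ≤ (C : ℝ) * ((ε / 2) ^ d)⁻¹
    positivity
  · calc cutoff ε ‖z - ζ‖ * ‖k z ζ‖ ≤ 1 * (C * (‖z - ζ‖ ^ d)⁻¹) :=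
          mul_le_mul (cutoff_le_one _ _) (hC z hz ζ hζ) (norm_nonneg _) zero_le_one
      _ ≤ C * ((ε / 2) ^ d)⁻¹ := by
          rw [one_mul]
          gcongr

omit [NormedSpace ℝ E] [FiniteDimensional ℝ E] [MeasurableSpace E] [BorelSpace E] in
-- Off the diagonal this is the continuity of `k`; at the diagonal the cutoff vanishes in a whole
-- neighbourhood.
theorem continuousOn_cutKernel (hk : IsWeakKernel d W k) (hW : IsOpen W) {ε : ℝ} (hε : 0 < ε)
    {ζ : E} (hζ : ζ ∈ W) : ContinuousOn (fun z => cutKernel ε k z ζ) W := by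
  intro z hz
  refine ContinuousAt.continuousWithinAt ?_
  by_cases h : z = ζ
  · have : (fun z => cutKernel ε k z ζ) =ᶠ[𝓝 z] fun _ => 0 := by
      filter_upwards [Metric.ball_mem_nhds z (half_pos hε)] with w hw
      rw [cutKernel, cutoff_eq_zero hε, Complex.ofReal_zero, zero_mul]
      rw [Metric.mem_ball, dist_eq_norm, h] at hw
      exact hw.le
    exact continuousAt_const.congr this.symm
  · refine ContinuousAt.mul ?_ ?_
    · have := continuous_cutoff ε
      fun_prop
    · have ho : IsOpen ((W ×ˢ W) ∩ {q : E × E | q.1 ≠ q.2}) :=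
        (hW.prod hW).inter (isOpen_ne_fun continuous_fst continuous_snd)
      have h1 : ContinuousAt (fun q : E × E => k q.1 q.2) (z, ζ) :=
        hk.continuousOn.continuousAt (ho.mem_nhds
          (show (z, ζ) ∈ (W ×ˢ W) ∩ {q : E × E | q.1 ≠ q.2} from ⟨⟨hz, hζ⟩, h⟩))
      exact ContinuousAt.comp (f := fun z : E => (z, ζ)) (x := z) h1 (by fun_prop)

end IsWeakKernel

theorem integrableOn_of_memLp_two (S : LevelData p U W f) [(μHE[d + 1] : Measure E).IsAddHaarMeasure]
    (hu : MemLp u 2 (μHE[d + 1].restrict W)) : IntegrableOn u W (μHE[d + 1]) := by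
  have : ProperSpace E := FiniteDimensional.proper ℝ E
  have : IsFiniteMeasure ((μHE[d + 1] : Measure E).restrict W) :=
    ⟨by rw [Measure.restrict_apply_univ]; exact S.isBounded.measure_lt_top⟩
  exact hu.integrable (by norm_num)

namespace IsWeakKernel

theorem integrableOn_cutKernel (hk : IsWeakKernel d W k) (S : LevelData p U W f) (hd0 : 0 < d)
    (hd : Module.finrank ℝ E = d + 1)
    (hu : MemLp u 2 (μHE[d + 1].restrict W)) {ε : ℝ} (hε : 0 < ε) {z : E} (hz : z ∈ W) :
    IntegrableOn (fun ζ => cutKernel ε k z ζ * u ζ) W (μHE[d + 1]) := by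
  have hHaarE : (μHE[d + 1] : Measure E).IsAddHaarMeasure := by
    rw [← hd]; infer_instance
  obtain ⟨M, hM⟩ := hk.norm_cutKernel_le hε
  have hu1 := integrableOn_of_memLp_two S hu
  refine Integrable.mono' (hu1.norm.const_mul M) ?_ ?_
  · have h1 := hk.aestronglyMeasurable hd0 S.isOpen_W hu.1 hz
    have h2 : AEStronglyMeasurable (fun ζ => (cutoff ε ‖z - ζ‖ : ℂ))
        (μHE[d + 1].restrict W) := by
      refine Continuous.aestronglyMeasurable ?_
      have := continuous_cutoff ε
      fun_prop
    refine (h2.mul h1).congr (Eventually.of_forall fun ζ => ?_)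
    simp [cutKernel, mul_assoc]
  · filter_upwards [ae_restrict_mem S.isOpen_W.measurableSet] with ζ hζ
    rw [norm_mul]
    exact mul_le_mul_of_nonneg_right (hM z hz ζ hζ) (norm_nonneg _)

theorem exists_norm_potential_cutKernel_le (hk : IsWeakKernel d W k) (S : LevelData p U W f)
    (hd : Module.finrank ℝ E = d + 1)
    (hu : MemLp u 2 (μHE[d + 1].restrict W)) {ε : ℝ} (hε : 0 < ε) :
    ∃ M : ℝ, ∀ z ∈ W, ‖potential d W (cutKernel ε k) u z‖ ≤ M := by
  have hHaarE : (μHE[d + 1] : Measure E).IsAddHaarMeasure := by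
    rw [← hd]; infer_instance
  obtain ⟨M, hM⟩ := hk.norm_cutKernel_le hε
  have hu1 := integrableOn_of_memLp_two S hu
  refine ⟨∫ ζ in W, M * ‖u ζ‖ ∂(μHE[d + 1]), fun z hz => ?_⟩
  refine norm_integral_le_of_norm_le (hu1.norm.const_mul M) ?_
  filter_upwards [ae_restrict_mem S.isOpen_W.measurableSet] with ζ hζ
  rw [norm_mul]
  exact mul_le_mul_of_nonneg_right (hM z hz ζ hζ) (norm_nonneg _)

theorem continuousOn_potential_cutKernel (hk : IsWeakKernel d W k) (S : LevelData p U W f)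
    (hd0 : 0 < d) (hd : Module.finrank ℝ E = d + 1)
    (hu : MemLp u 2 (μHE[d + 1].restrict W)) {ε : ℝ} (hε : 0 < ε) :
    ContinuousOn (potential d W (cutKernel ε k) u) W := by
  have hHaarE : (μHE[d + 1] : Measure E).IsAddHaarMeasure := by
    rw [← hd]; infer_instance
  obtain ⟨M, hM⟩ := hk.norm_cutKernel_le hε
  have hu1 := integrableOn_of_memLp_two S hu
  refine continuousOn_of_dominated (bound := fun ζ => M * ‖u ζ‖)
    (fun z hz => (hk.integrableOn_cutKernel S hd0 hd hu hε hz).1) (fun z hz => ?_)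
    (hu1.norm.const_mul M) ?_
  · filter_upwards [ae_restrict_mem S.isOpen_W.measurableSet] with ζ hζ
    rw [norm_mul]
    exact mul_le_mul_of_nonneg_right (hM z hz ζ hζ) (norm_nonneg _)
  · filter_upwards [ae_restrict_mem S.isOpen_W.measurableSet] with ζ hζ
    exact (hk.continuousOn_cutKernel S.isOpen_W hε hζ).mul continuousOn_const

theorem enorm_potential_sub_le (hk : IsWeakKernel d W k) (S : LevelData p U W f)
    (hd0 : 0 < d) (hd : Module.finrank ℝ E = d + 1)
    (hu : MemLp u 2 (μHE[d + 1].restrict W)) {ε : ℝ} (hε : 0 < ε) {z : E} (hz : z ∈ W) :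
    ‖potential d W k u z - potential d W (cutKernel ε k) u z‖ₑ ≤
      nearPotential d W k u (ENNReal.ofReal ε) z := by
  have hcut := hk.integrableOn_cutKernel S hd0 hd hu hε hz
  have hm := hk.aestronglyMeasurable hd0 S.isOpen_W hu.1 hz
  have hpt : ∀ ζ, ‖k z ζ * u ζ - cutKernel ε k z ζ * u ζ‖ₑ ≤
      if ‖z - ζ‖ₑ < ENNReal.ofReal ε then ‖k z ζ * u ζ‖ₑ else 0 := by
    intro ζ
    have h0 : k z ζ * u ζ - cutKernel ε k z ζ * u ζ =
        ((1 - cutoff ε ‖z - ζ‖ : ℝ) : ℂ) * (k z ζ * u ζ) := by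
      rw [cutKernel]; push_cast; ring
    rw [h0]
    have hiff : ‖z - ζ‖ₑ < ENNReal.ofReal ε ↔ ‖z - ζ‖ < ε := by
      rw [← ofReal_norm (z - ζ), ENNReal.ofReal_lt_ofReal_iff hε]
    split_ifs with h
    · rw [enorm_mul]
      refine mul_le_of_le_one_left zero_le ?_
      rw [← ofReal_norm, Complex.norm_real, Real.norm_of_nonneg
        (sub_nonneg.2 (cutoff_le_one _ _)), ENNReal.ofReal_le_one]
      linarith [cutoff_nonneg ε ‖z - ζ‖]
    · rw [cutoff_eq_one hε (not_lt.1 (hiff.not.1 h))]; simp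
  by_cases hint : IntegrableOn (fun ζ => k z ζ * u ζ) W (μHE[d + 1])
  · rw [potential, potential, ← integral_sub hint hcut]
    exact (enorm_integral_le_lintegral_enorm _).trans (lintegral_mono hpt)
  -- Where the integral diverges the potential takes the default value 0. The truncated integral
  -- still converges, so the near part must be infinite and the inequality survives.
  · have hnot : ¬ IntegrableOn (fun ζ => k z ζ * u ζ - cutKernel ε k z ζ * u ζ) W
        (μHE[d + 1]) := by
      intro h
      refine hint ((h.add hcut).congr (Eventually.of_forall fun ζ => ?_))
      simp
    have htop : nearPotential d W k u (ENNReal.ofReal ε) z = ∞ := by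
      by_contra hne
      refine hnot ⟨hm.sub hcut.1, ?_⟩
      rw [hasFiniteIntegral_iff_enorm]
      exact (lintegral_mono hpt).trans_lt (lt_top_iff_ne_top.2 hne)
    rw [htop]; exact le_top

/-- Convergence in `L¹` of potentials on nearby level sets, given uniform smallness of the near
parts. -/
theorem tendsto_potential_comp (hk : IsWeakKernel d W k) (S : LevelData p U W f)
    (hd0 : 0 < d) (hd : Module.finrank ℝ E = d + 1)
    (hu : MemLp u 2 (μHE[d + 1].restrict W)) {φ : ℝ → E → E} {A : Set E}
    (hA : MeasurableSet A) (hAS : A ⊆ {z | z ∈ W ∧ f z = 0})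
    (hcont : ∀ᶠ σ in 𝓝 (0 : ℝ), ContinuousOn (φ σ) A ∧ MapsTo (φ σ) A W)
    (hlim : ∀ z ∈ A, Tendsto (fun σ => φ σ z) (𝓝 0) (𝓝 z))
    (hzero : ∀ z ∈ A, φ 0 z = z) {C : ℝ≥0} {ε₀ : ℝ} (hε₀ : 0 < ε₀)
    (hnear : ∀ᶠ σ in 𝓝 (0 : ℝ), ∀ ε : ℝ, 0 < ε → ε < ε₀ →
      ∫⁻ z in A, nearPotential d W k u (ENNReal.ofReal ε) (φ σ z) ∂(μHE[d]) ≤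
        C * ENNReal.ofReal ε ^ (1 / 8 : ℝ)) :
    IntegrableOn (potential d W k u) A (μHE[d]) ∧
    (∀ᶠ σ in 𝓝 (0 : ℝ), IntegrableOn (fun z => potential d W k u (φ σ z)) A (μHE[d])) ∧
    Tendsto (fun σ => ∫ z in A, ‖potential d W k u (φ σ z) - potential d W k u z‖ ∂(μHE[d]))
      (𝓝 0) (𝓝 0) := by
  classical
  have hHaarE : (μHE[d + 1] : Measure E).IsAddHaarMeasure := by
    rw [← hd]; infer_instance
  obtain ⟨Ca, hCa⟩ := S.exists_area_level_le hd hd0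
  have hAfin : μHE[d] A < ∞ :=
    ((measure_mono hAS).trans (hCa 0)).trans_lt ENNReal.coe_lt_top
  have hAW : A ⊆ W := fun z hz => (hAS hz).1
  have hint0 : IntegrableOn (potential d W k u) A (μHE[d]) :=
    (hk.integrableOn_level S hd0 hd hu 0).2.mono_set hAS
  obtain ⟨v, hv, hvp⟩ := hk.exists_stronglyMeasurable_potential hd0 S.isOpen_W hd hu.1
  have hmeas : ∀ᶠ σ in 𝓝 (0 : ℝ), AEStronglyMeasurable
      (fun z => potential d W k u (φ σ z)) (μHE[d].restrict A) := by
    filter_upwards [hcont] with σ hσ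
    set θ : E → E := A.piecewise (φ σ) (fun _ => 0) with hθ
    have hθm : Measurable θ := hσ.1.measurable_piecewise continuousOn_const hA
    refine ⟨fun z => v (θ z), hv.comp_measurable hθm, ?_⟩
    filter_upwards [ae_restrict_mem hA] with z hz
    rw [hvp _ (hσ.2 hz)]
    simp [hθ, hz]
  -- The uniform bound includes `σ = 0`, where `φ 0` is the identity, so it also controls the near
  -- part of the limit function.
  have hnear0 : ∀ ε : ℝ, 0 < ε → ε < ε₀ →
      ∫⁻ z in A, nearPotential d W k u (ENNReal.ofReal ε) z ∂(μHE[d]) ≤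
        C * ENNReal.ofReal ε ^ (1 / 8 : ℝ) := by
    intro ε h1 h2
    refine le_trans (le_of_eq ?_) (hnear.self_of_nhds ε h1 h2)
    refine setLIntegral_congr_fun hA fun z hz => ?_
    rw [hzero z hz]
  have hnm : ∀ ε : ℝ≥0∞, AEMeasurable (fun z => nearPotential d W k u ε z)
      (μHE[d].restrict A) := by
    intro ε
    obtain ⟨k', hk', hkk'⟩ := hk.exists_measurable hd0 S.isOpen_W
    refine ⟨fun z => ∫⁻ ζ in W, (if ‖z - ζ‖ₑ < ε then ‖k' (z, ζ) * hu.1.mk u ζ‖ₑ else 0)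
      ∂(μHE[d + 1]), ?_, ?_⟩
    · refine Measurable.lintegral_prod_right' (f := fun q : E × E =>
        (if ‖q.1 - q.2‖ₑ < ε then ‖k' q * hu.1.mk u q.2‖ₑ else 0)) ?_
      refine Measurable.ite ?_ ?_ measurable_const
      · exact measurableSet_lt (measurable_fst.sub measurable_snd).enorm measurable_const
      · exact (hk'.mul (hu.1.stronglyMeasurable_mk.measurable.comp measurable_snd)).enorm
    · filter_upwards [ae_restrict_mem hA] with z hz
      refine lintegral_congr_ae ?_
      filter_upwards [ae_restrict_mem S.isOpen_W.measurableSet, hu.1.ae_eq_mk] with ζ hζ hζu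
      rw [hkk' z (hAW hz) ζ hζ, ← hζu]
  have hlint : Tendsto (fun σ => ∫⁻ z in A, ‖potential d W k u (φ σ z) - potential d W k u z‖ₑ
      ∂(μHE[d])) (𝓝 0) (𝓝 0) := by
    rw [ENNReal.tendsto_nhds_zero]
    intro η hη
    -- An `η / 3` argument: two thirds cover the near parts at `z` and at `φ σ z`, uniformly in `σ`,
    -- and the last third covers the potential truncated at this fixed `ε`.
    obtain ⟨ε, hε0, hεε₀, hεη⟩ : ∃ ε : ℝ, 0 < ε ∧ ε < ε₀ ∧
        C * ENNReal.ofReal ε ^ (1 / 8 : ℝ) ≤ η / 3 := by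
      have h1 : Tendsto (fun ε : ℝ => (C : ℝ≥0∞) * ENNReal.ofReal ε ^ (1 / 8 : ℝ)) (𝓝 0)
          (𝓝 0) := by
        have h2 : Tendsto (fun ε : ℝ => ENNReal.ofReal ε ^ (1 / 8 : ℝ)) (𝓝 0) (𝓝 0) := by
          have := (ENNReal.continuous_rpow_const (y := 1 / 8)).comp ENNReal.continuous_ofReal
          have h3 := this.tendsto 0
          simpa [Function.comp_def] using h3
        simpa using ENNReal.Tendsto.const_mul h2 (Or.inr ENNReal.coe_ne_top)
      have hη3 : 0 < η / 3 := ENNReal.div_pos hη.ne' (by norm_num)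
      have h4 := (ENNReal.tendsto_nhds_zero.1 h1 _ hη3).filter_mono
        (nhdsWithin_le_nhds (s := Ioi (0 : ℝ)))
      obtain ⟨ε, hε⟩ := (h4.and (Ioo_mem_nhdsGT hε₀)).exists
      exact ⟨ε, hε.2.1, hε.2.2, hε.1⟩
    obtain ⟨M, hM⟩ := hk.exists_norm_potential_cutKernel_le S hd hu hε0
    have hvc := hk.continuousOn_potential_cutKernel S hd0 hd hu hε0
    set vε := potential d W (cutKernel ε k) u with hvε
    -- The truncated potential is bounded and continuous on `W` and `A` has finite area, so
    -- dominated convergence applies along every sequence of levels.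
    have hdom : Tendsto (fun σ => ∫⁻ z in A, ‖vε (φ σ z) - vε z‖ₑ ∂(μHE[d])) (𝓝 0) (𝓝 0) := by
      have h0 : (0 : ℝ≥0∞) = ∫⁻ z in A, 0 ∂(μHE[d]) := by simp
      rw [h0]
      refine tendsto_of_seq_tendsto fun s hs => ?_
      obtain ⟨N, hN⟩ := eventually_atTop.1 (hs.eventually hcont)
      rw [← tendsto_add_atTop_iff_nat N]
      refine tendsto_lintegral_of_dominated_convergence'
        (fun _ => ENNReal.ofReal (2 * M)) ?_ ?_ ?_ ?_
      · intro m
        have hσ := hN (m + N) (Nat.le_add_left _ _)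
        exact (((hvc.comp hσ.1 hσ.2).sub (hvc.mono hAW)).aemeasurable hA).enorm
      · intro m
        have hσ := hN (m + N) (Nat.le_add_left _ _)
        filter_upwards [ae_restrict_mem hA] with z hz
        rw [← ofReal_norm]
        apply ENNReal.ofReal_le_ofReal
        have h1 := hM _ (hσ.2 hz)
        have h2 := hM _ (hAW hz)
        have := norm_sub_le (vε (φ (s (m + N)) z)) (vε z)
        linarith
      · rw [lintegral_const, Measure.restrict_apply_univ]
        finiteness
      · filter_upwards [ae_restrict_mem hA] with z hz
        have h1 : Tendsto (fun σ => vε (φ σ z)) (𝓝 0) (𝓝 (vε z)) :=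
          ((hvc.continuousAt (S.isOpen_W.mem_nhds (hAW hz))).tendsto).comp (hlim z hz)
        have h2 := (h1.sub_const (vε z)).enorm
        rw [sub_self, enorm_zero] at h2
        exact (h2.comp hs).comp (tendsto_add_atTop_nat N)
    have hη3 : 0 < η / 3 := ENNReal.div_pos hη.ne' (by norm_num)
    filter_upwards [ENNReal.tendsto_nhds_zero.1 hdom _ hη3, hcont, hnear] with σ h1 h2 h3
    have hm1 : AEMeasurable (fun z => ‖vε (φ σ z) - vε z‖ₑ) (μHE[d].restrict A) :=
      (((hvc.comp h2.1 h2.2).sub (hvc.mono hAW)).aemeasurable hA).enorm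
    have hm2 : AEMeasurable (fun z => ‖vε (φ σ z) - vε z‖ₑ +
        nearPotential d W k u (ENNReal.ofReal ε) z) (μHE[d].restrict A) := hm1.add (hnm _)
    calc ∫⁻ z in A, ‖potential d W k u (φ σ z) - potential d W k u z‖ₑ ∂(μHE[d])
        ≤ ∫⁻ z in A, (‖vε (φ σ z) - vε z‖ₑ + nearPotential d W k u (ENNReal.ofReal ε) z +
          nearPotential d W k u (ENNReal.ofReal ε) (φ σ z)) ∂(μHE[d]) := by
          refine setLIntegral_mono' hA fun z hz => ?_
          have e1 := hk.enorm_potential_sub_le S hd0 hd hu hε0 (h2.2 hz)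
          have e2 := hk.enorm_potential_sub_le S hd0 hd hu hε0 (hAW hz)
          have e3 : potential d W k u (φ σ z) - potential d W k u z =
              (vε (φ σ z) - vε z) + -(potential d W k u z - vε z) +
              (potential d W k u (φ σ z) - vε (φ σ z)) := by ring
          rw [e3]
          refine (enorm_add_le _ _).trans (add_le_add ((enorm_add_le _ _).trans ?_) e1)
          rw [enorm_neg]
          gcongr
      _ = (∫⁻ z in A, ‖vε (φ σ z) - vε z‖ₑ ∂(μHE[d])) +
          (∫⁻ z in A, nearPotential d W k u (ENNReal.ofReal ε) z ∂(μHE[d])) +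
          ∫⁻ z in A, nearPotential d W k u (ENNReal.ofReal ε) (φ σ z) ∂(μHE[d]) := by
          rw [lintegral_add_left' hm2, lintegral_add_left' hm1]
      _ ≤ η / 3 + η / 3 + η / 3 := by
          gcongr
          · exact (hnear0 ε hε0 hεε₀).trans hεη
          · exact (h3 ε hε0 hεε₀).trans hεη
      _ = η := ENNReal.add_thirds η
  have hint : ∀ᶠ σ in 𝓝 (0 : ℝ), IntegrableOn (fun z => potential d W k u (φ σ z)) A
      (μHE[d]) := by
    filter_upwards [ENNReal.tendsto_nhds_zero.1 hlint 1 one_pos, hmeas] with σ h1 h2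
    have h3 : IntegrableOn (fun z => potential d W k u (φ σ z) - potential d W k u z) A
        (μHE[d]) := ⟨h2.sub hint0.1, by
          rw [hasFiniteIntegral_iff_enorm]; exact h1.trans_lt ENNReal.one_lt_top⟩
    refine (h3.add hint0).congr (Eventually.of_forall fun z => ?_)
    simp
  refine ⟨hint0, hint, ?_⟩
  have h5 := (ENNReal.tendsto_toReal ENNReal.zero_ne_top).comp hlint
  rw [ENNReal.toReal_zero] at h5
  refine h5.congr' ?_
  filter_upwards [hmeas] with σ h2
  exact (integral_norm_eq_lintegral_enorm (h2.sub hint0.1)).symm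

end IsWeakKernel

end

/-! ### Families of maps between level sets -/

section

/-- A jointly `C^p` family of injections `φ σ` of the zero set of `f` into its level sets, starting
at the identity. -/
structure LevelFamily {E : Type*} [NormedAddCommGroup E] [NormedSpace ℝ E] (p : ℕ) (W : Set E)
    (f : E → ℝ) (σs : ℝ) (φ : ℝ → E → E) : Prop where
  pos : 0 < σs
  joint : IsCpOn p (fun q : ℝ × E => φ q.1 q.2) (Ioo (-σs) σs ×ˢ {z | z ∈ W ∧ f z = 0})
  mapsTo : ∀ σ ∈ Ioo (-σs) σs, MapsTo (φ σ) {z | z ∈ W ∧ f z = 0} {z | z ∈ W ∧ f z = σ}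
  injOn : ∀ σ ∈ Ioo (-σs) σs, InjOn (φ σ) {z | z ∈ W ∧ f z = 0}
  at_zero : ∀ z, z ∈ W → f z = 0 → φ 0 z = z

theorem IsCpOn.continuousOn {X Y : Type*} [NormedAddCommGroup X] [NormedSpace ℝ X]
    [NormedAddCommGroup Y] [NormedSpace ℝ Y] {p : ℕ} {g : X → Y} {s : Set X} (h : IsCpOn p g s) :
    ContinuousOn g s := by
  intro x hx
  obtain ⟨V, hV, hxV, G, hG, hGg⟩ := h x hx
  have h1 : ContinuousWithinAt G (s ∩ V) x :=
    (hG.continuousOn.continuousAt (hV.mem_nhds hxV)).continuousWithinAt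
  rw [← continuousWithinAt_inter (hV.mem_nhds hxV)]
  exact h1.congr (fun y hy => (hGg hy).symm) (hGg ⟨hx, hxV⟩).symm

namespace LevelChart

variable {E : Type*} [NormedAddCommGroup E] [NormedSpace ℝ E] {p : ℕ} {U : Set E} {f : E → ℝ}
  (c : LevelChart p U f)

/-- The local retraction onto the zero set of `f` along the fibres of the chart. -/
noncomputable def retract (z : E) : E := c.Ψ.symm (c.q z)

/-- The domain of the retraction. -/
def retractDomain : Set E := {z | (c.q z : E) ∈ c.Ψ.target}

theorem isOpen_retractDomain : IsOpen c.retractDomain :=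
  c.Ψ.open_target.preimage (continuous_subtype_val.comp c.q.continuous)

theorem Ψ_retract {z : E} (hz : z ∈ c.retractDomain) : c.Ψ (c.retract z) = c.q z :=
  c.Ψ.right_inv hz

theorem f_retract {z : E} (hz : z ∈ c.retractDomain) : f (c.retract z) = 0 := by
  rw [← c.ℓ_apply, c.Ψ_retract hz]
  exact (c.q z).2

theorem Ψ_eq_q {z : E} (h : f z = 0) : c.Ψ z = c.q z := by
  rw [c.apply_eq_q, h, zero_smul, add_zero]

theorem mem_retractDomain {z : E} (hz : z ∈ c.Ψ.source) (h : f z = 0) : z ∈ c.retractDomain := by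
  change (c.q z : E) ∈ c.Ψ.target
  rw [← c.Ψ_eq_q h]; exact c.Ψ.map_source hz

theorem retract_eq {z : E} (hz : z ∈ c.Ψ.source) (h : f z = 0) : c.retract z = z := by
  rw [retract, ← c.Ψ_eq_q h]; exact c.Ψ.left_inv hz

theorem contDiffOn_retract : ContDiffOn ℝ p c.retract c.retractDomain :=
  c.contDiffOn_symm.comp (c.H.subtypeL.contDiff.comp c.q.contDiff).contDiffOn fun _ h => h

theorem hasFDerivAt_Ψ (hp : (p : WithTop ℕ∞) ≠ 0) {z : E} (hz : z ∈ c.Ψ.source) :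
    HasFDerivAt c.Ψ (fderiv ℝ c.Ψ z) z :=
  ((c.contDiffOn.contDiffAt (c.Ψ.open_source.mem_nhds hz)).differentiableAt hp).hasFDerivAt

theorem hasFDerivAt_symm (hp : (p : WithTop ℕ∞) ≠ 0) {y : E} (hy : y ∈ c.Ψ.target) :
    HasFDerivAt c.Ψ.symm (fderiv ℝ c.Ψ.symm y) y :=
  ((c.contDiffOn_symm.contDiffAt (c.Ψ.open_target.mem_nhds hy)).differentiableAt hp).hasFDerivAt

theorem fderiv_symm_fderiv (hp : (p : WithTop ℕ∞) ≠ 0) {z : E} (hz : z ∈ c.Ψ.source) (X : E) :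
    fderiv ℝ c.Ψ.symm (c.Ψ z) (fderiv ℝ c.Ψ z X) = X := by
  have h1 := (c.hasFDerivAt_symm hp (c.Ψ.map_source hz)).comp z (c.hasFDerivAt_Ψ hp hz)
  have h2 : HasFDerivAt (c.Ψ.symm ∘ c.Ψ) (ContinuousLinearMap.id ℝ E) z := by
    refine (hasFDerivAt_id z).congr_of_eventuallyEq ?_
    filter_upwards [c.Ψ.open_source.mem_nhds hz] with w hw using c.Ψ.left_inv hw
  simpa using DFunLike.congr_fun (h1.unique h2) X

theorem fderiv_fderiv_symm (hp : (p : WithTop ℕ∞) ≠ 0) {z : E} (hz : z ∈ c.Ψ.source) (X : E) :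
    fderiv ℝ c.Ψ z (fderiv ℝ c.Ψ.symm (c.Ψ z) X) = X := by
  have h0 := c.hasFDerivAt_Ψ hp hz
  rw [← c.Ψ.left_inv hz] at h0
  have h1 := h0.comp (c.Ψ z) (c.hasFDerivAt_symm hp (c.Ψ.map_source hz))
  have h2 : HasFDerivAt (c.Ψ ∘ c.Ψ.symm) (ContinuousLinearMap.id ℝ E) (c.Ψ z) := by
    refine (hasFDerivAt_id _).congr_of_eventuallyEq ?_
    filter_upwards [c.Ψ.open_target.mem_nhds (c.Ψ.map_source hz)] with w hw
      using c.Ψ.right_inv hw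
  have h3 := DFunLike.congr_fun (h1.unique h2) X
  rw [c.Ψ.left_inv hz] at h3
  simpa using h3

theorem fderiv_Ψ_apply {z : E}
    (hfd : DifferentiableAt ℝ f z) (X : E) : fderiv ℝ c.Ψ z X = c.q X + fderiv ℝ f z X • c.e := by
  have h1 := (c.H.subtypeL.hasFDerivAt.comp z c.q.hasFDerivAt).add (hfd.hasFDerivAt.smul_const c.e)
  have h2 : HasFDerivAt c.Ψ _ z := h1.congr_of_eventuallyEq
    (Eventually.of_forall fun w => c.apply_eq_q w)
  rw [h2.fderiv]
  simp

/-- The retraction is tangent to the identity along the zero set. -/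
theorem fderiv_retract (hp : (p : WithTop ℕ∞) ≠ 0) {z : E} (hz : z ∈ c.Ψ.source) (h : f z = 0)
    (hfd : DifferentiableAt ℝ f z) {X : E} (hX : fderiv ℝ f z X = 0) :
    fderiv ℝ c.retract z X = X := by
  have h0 : HasFDerivAt c.Ψ.symm (fderiv ℝ c.Ψ.symm (c.q z)) (c.q z : E) := by
    refine c.hasFDerivAt_symm hp ?_
    exact c.mem_retractDomain hz h
  have h1 : HasFDerivAt c.retract _ z :=
    h0.comp z (c.H.subtypeL.hasFDerivAt.comp z c.q.hasFDerivAt)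
  rw [h1.fderiv]
  -- For `X` tangent to the level set `dΨ X = q X`, so the derivative of the inverse chart carries
  -- `q X` back to `X`.
  have h2 := c.fderiv_Ψ_apply hfd X
  rw [hX, zero_smul, add_zero] at h2
  have h3 := c.fderiv_symm_fderiv hp hz X
  rw [h2, c.Ψ_eq_q h] at h3
  simpa using h3

end LevelChart

namespace LevelFamily

variable {E : Type*} [NormedAddCommGroup E] [NormedSpace ℝ E] {p : ℕ} {U W : Set E} {f : E → ℝ}
  {σs : ℝ} {φ : ℝ → E → E}

theorem zero_mem (F : LevelFamily p W f σs φ) : (0 : ℝ) ∈ Ioo (-σs) σs := by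
  have := F.pos
  constructor <;> linarith

theorem eventually_mem (F : LevelFamily p W f σs φ) : ∀ᶠ σ in 𝓝 (0 : ℝ), σ ∈ Ioo (-σs) σs :=
  isOpen_Ioo.mem_nhds F.zero_mem

theorem continuousOn (F : LevelFamily p W f σs φ) {σ : ℝ} (hσ : σ ∈ Ioo (-σs) σs) :
    ContinuousOn (φ σ) {z | z ∈ W ∧ f z = 0} :=
  F.joint.continuousOn.comp (f := fun z => (σ, z)) (by fun_prop) fun _ hz => ⟨hσ, hz⟩

theorem tendsto (F : LevelFamily p W f σs φ) {z : E} (hz : z ∈ W) (h : f z = 0) :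
    Tendsto (fun σ => φ σ z) (𝓝 0) (𝓝 z) := by
  have h1 : ContinuousOn (fun σ => φ σ z) (Ioo (-σs) σs) :=
    F.joint.continuousOn.comp (f := fun σ => (σ, z)) (by fun_prop) fun _ hσ => ⟨hσ, hz, h⟩
  have h2 := (h1.continuousAt (isOpen_Ioo.mem_nhds F.zero_mem)).tendsto
  rwa [F.at_zero z hz h] at h2

/-- Near a point of the zero set the maps `φ σ` with `σ` small are close to isometric. -/
theorem exists_nhds (F : LevelFamily p W f σs φ) (hp : (p : WithTop ℕ∞) ≠ 0) {z₀ : E}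
    (hz₀ : z₀ ∈ W) (h : f z₀ = 0) {O : Set E} (hO : O ∈ 𝓝 z₀) :
    ∃ N : Set E, IsOpen N ∧ z₀ ∈ N ∧ ∀ᶠ σ in 𝓝 (0 : ℝ), ∀ z ∈ N, z ∈ W → f z = 0 → φ σ z ∈ O ∧
      ∀ w ∈ N, w ∈ W → f w = 0 → ‖z - w‖ ≤ 2 * ‖φ σ z - φ σ w‖ := by
  obtain ⟨V, hV, hzV, G, hG, hGφ⟩ := F.joint (0, z₀) ⟨F.zero_mem, hz₀, h⟩
  have hGs : HasStrictFDerivAt G (fderiv ℝ G (0, z₀)) (0, z₀) :=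
    (hG.contDiffAt (hV.mem_nhds hzV)).hasStrictFDerivAt hp
  -- `i (σ, z) = (0, z)`. The local extension `G` of the family need not be the identity at `σ = 0`
  -- off the zero set. The corrected map `G (σ, z) - G (0, z) + z` still equals `φ σ z` on the zero
  -- set, and its derivative at `(0, z₀)` is the identity in the directions of `z`.
  set i : ℝ × E →L[ℝ] ℝ × E :=
    (0 : ℝ × E →L[ℝ] ℝ).prod (ContinuousLinearMap.snd ℝ ℝ E) with hi
  have hG0 : HasStrictFDerivAt (fun q => G (i q)) ((fderiv ℝ G (0, z₀)).comp i) (0, z₀) := by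
    refine HasStrictFDerivAt.comp (0, z₀) ?_ i.hasStrictFDerivAt
    simpa [hi] using hGs
  have hΦ := (hGs.sub hG0).add (ContinuousLinearMap.snd ℝ ℝ E).hasStrictFDerivAt
  obtain ⟨s, hs, hap⟩ := hΦ.approximates_deriv_on_nhds (c := 1 / 2) (Or.inr (by norm_num))
  have hc : Tendsto (fun q : ℝ × E => G q - G (i q) + q.2) (𝓝 (0, z₀)) (𝓝 z₀) := by
    have := hΦ.continuousAt.tendsto
    simpa [hi, Pi.add_def, Pi.sub_def] using this
  have hi0 : Tendsto i (𝓝 (0, z₀)) (𝓝 (0, z₀)) := by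
    have := i.continuous.tendsto (0, z₀)
    simpa [hi] using this
  have hall : ∀ᶠ q : ℝ × E in 𝓝 ((0 : ℝ), z₀), q ∈ s ∧ q ∈ V ∧ i q ∈ V ∧
      G q - G (i q) + q.2 ∈ O ∧ q.1 ∈ Ioo (-σs) σs := by
    filter_upwards [hs, hV.mem_nhds hzV, hi0 (hV.mem_nhds hzV), hc hO,
      (continuous_fst.tendsto ((0 : ℝ), z₀)) F.eventually_mem] with q h1 h2 h3 h4 h5
    exact ⟨h1, h2, h3, h4, h5⟩
  rw [nhds_prod_eq, eventually_prod_iff] at hall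
  obtain ⟨pa, hpa, pb, hpb, hab⟩ := hall
  obtain ⟨N, hNsub, hN, hzN⟩ := mem_nhds_iff.1 hpb
  refine ⟨N, hN, hzN, ?_⟩
  filter_upwards [hpa] with σ hσ
  have key : ∀ z ∈ N, z ∈ W → f z = 0 → φ σ z = G (σ, z) - G (i (σ, z)) + z := by
    intro z hz hzW hfz
    obtain ⟨-, h2, h3, -, h5⟩ := hab hσ (hNsub hz)
    have e1 : G (σ, z) = φ σ z := hGφ ⟨⟨h5, hzW, hfz⟩, h2⟩
    have hiz : i (σ, z) = (0, z) := by simp [hi]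
    have e2 : G (i (σ, z)) = z := by
      rw [hiz] at h3 ⊢
      exact (hGφ ⟨⟨F.zero_mem, hzW, hfz⟩, h3⟩).trans (F.at_zero z hzW hfz)
    rw [e1, e2]; abel
  intro z hz hzW hfz
  obtain ⟨h1, -, -, h4, -⟩ := hab hσ (hNsub hz)
  refine ⟨by rw [key z hz hzW hfz]; exact h4, fun w hw hwW hfw => ?_⟩
  have h2 := hap (x := (σ, z)) h1 (y := (σ, w)) (hab hσ (hNsub hw)).1
  have h3 : ‖φ σ z - φ σ w - (z - w)‖ ≤ 1 / 2 * ‖z - w‖ := by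
    rw [key z hz hzW hfz, key w hw hwW hfw]
    have e : ‖((σ, z) : ℝ × E) - (σ, w)‖ = ‖z - w‖ := by
      simp [Prod.norm_def]
    rw [e] at h2
    refine le_trans (le_of_eq ?_) h2
    congr 1
    simp [hi]
  have h4 : ‖z - w‖ ≤ ‖φ σ z - φ σ w‖ + ‖φ σ z - φ σ w - (z - w)‖ := by
    have := norm_sub_le (φ σ z - φ σ w) (φ σ z - φ σ w - (z - w))
    simpa using this
  linarith

/-- The maps `φ σ` with `σ` small cover the points of the level sets in a given compact set, using
only points near that compact set. -/
theorem eventually_surj (F : LevelFamily p W f σs φ) [FiniteDimensional ℝ E]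
    (S : LevelData p U W f) {K O : Set E} (hK : IsCompact K) (hKW : K ⊆ W) (hO : IsOpen O)
    (hKO : K ⊆ O) :
    ∀ᶠ σ in 𝓝 (0 : ℝ), ∀ y ∈ K, f y = σ → ∃ w, w ∈ W ∧ f w = 0 ∧ w ∈ O ∧ φ σ w = y := by
  have : CompleteSpace E := FiniteDimensional.complete ℝ E
  have hp := S.cast_p_ne_zero
  refine hK.eventually_forall_of_forall_eventually fun y₀ hy₀ => ?_
  have hy₀W := hKW hy₀
  have hfc : ContinuousAt f y₀ := S.continuousOn.continuousAt (S.isOpen_U.mem_nhds (S.subset hy₀W))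
  by_cases hf0 : f y₀ = 0
  swap
  · have h1 : ∀ᶠ q : ℝ × E in 𝓝 ((0 : ℝ), y₀), f q.2 ≠ q.1 := by
      have h2 : ContinuousAt (fun q : ℝ × E => f q.2 - q.1) (0, y₀) :=
        (hfc.comp_of_eq continuousAt_snd rfl).sub continuousAt_fst
      have h3 := h2.eventually_ne (y := 0) (by simpa using hf0)
      filter_upwards [h3] with q hq heq
      exact hq (by rw [heq, sub_self])
    filter_upwards [h1] with q hq heq using absurd heq hq
  obtain ⟨c, hyc, -⟩ := exists_levelChart S.p_pos S.isOpen_U S.contDiffOn (S.subset hy₀W)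
    (S.fderiv_ne_zero _ (S.subset hy₀W))
  obtain ⟨V, hV, hyV, G, hG, hGφ⟩ := F.joint (0, y₀) ⟨F.zero_mem, hy₀W, hf0⟩
  have hret : c.retract y₀ = y₀ := c.retract_eq hyc hf0
  have hdom : y₀ ∈ c.retractDomain := c.mem_retractDomain hyc hf0
  have hGy : G (0, y₀) = y₀ :=
    (hGφ ⟨⟨F.zero_mem, hy₀W, hf0⟩, hyV⟩).trans (F.at_zero _ hy₀W hf0)
  have hrc : ContDiffAt ℝ p (fun q : ℝ × E => ((q.1, c.retract q.2) : ℝ × E)) (0, y₀) :=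
    contDiffAt_fst.prodMk (ContDiffAt.comp (g := c.retract) (0, y₀)
      (c.contDiffOn_retract.contDiffAt (c.isOpen_retractDomain.mem_nhds hdom)) contDiffAt_snd)
  have hg : ContDiffAt ℝ p (fun q : ℝ × E => G (q.1, c.retract q.2)) (0, y₀) := by
    refine ContDiffAt.comp (0, y₀) ?_ hrc
    rw [hret]; exact hG.contDiffAt (hV.mem_nhds hyV)
  -- At parameter 0 the second component is `Ψ z`, because `retract z` lies on the zero set and `φ
  -- 0` is the identity there. So the derivative is onto and `Θ` is locally surjective. The term `f
  -- z • e` supplies the transversal direction: in `Θ (σ, z) = (σ, Ψ y)` with `f y = σ`, comparing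
  -- `ℓ`-components forces `f z = 0`, and then `φ σ (retract z) = y`.
  set Θ : ℝ × E → ℝ × E := fun q => (q.1, c.Ψ (G (q.1, c.retract q.2)) + f q.2 • c.e) with hΘ
  have hΘc : ContDiffAt ℝ p Θ (0, y₀) := by
    refine contDiffAt_fst.prodMk (ContDiffAt.add ?_ ?_)
    · refine ContDiffAt.comp (0, y₀) ?_ hg
      rw [hret, hGy]
      exact c.contDiffOn.contDiffAt (c.Ψ.open_source.mem_nhds hyc)
    · exact ((S.contDiffOn.contDiffAt (S.isOpen_U.mem_nhds (S.subset hy₀W))).comp (0, y₀)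
        contDiffAt_snd).smul contDiffAt_const
  have hΘd := hΘc.hasStrictFDerivAt hp
  set D := fderiv ℝ Θ (0, y₀) with hD
  have hWn : ∀ᶠ z in 𝓝 y₀, z ∈ W := S.isOpen_W.mem_nhds hy₀W
  have hretc : Tendsto c.retract (𝓝 y₀) (𝓝 y₀) := by
    have := (c.contDiffOn_retract.continuousOn.continuousAt
      (c.isOpen_retractDomain.mem_nhds hdom)).tendsto
    rwa [hret] at this
  have hD2 : ∀ X : E, D (0, X) = (0, fderiv ℝ c.Ψ y₀ X) := by
    intro X
    have h1 : HasFDerivAt (fun z : E => Θ (0, z)) (D.comp (ContinuousLinearMap.inr ℝ ℝ E)) y₀ :=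
      HasFDerivAt.comp y₀ (g := Θ) (f := fun z : E => ((0 : ℝ), z)) hΘd.hasFDerivAt
        (ContinuousLinearMap.inr ℝ ℝ E).hasFDerivAt
    have h2 : HasFDerivAt (fun z : E => Θ (0, z))
        ((ContinuousLinearMap.inr ℝ ℝ E).comp (fderiv ℝ c.Ψ y₀)) y₀ := by
      have h3 := (ContinuousLinearMap.inr ℝ ℝ E).hasFDerivAt.comp y₀ (c.hasFDerivAt_Ψ hp hyc)
      refine h3.congr_of_eventuallyEq ?_
      have hVn : ∀ᶠ z in 𝓝 y₀, ((0 : ℝ), c.retract z) ∈ V := by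
        have : Tendsto (fun z => ((0 : ℝ), c.retract z)) (𝓝 y₀) (𝓝 (0, y₀)) :=
          tendsto_const_nhds.prodMk_nhds hretc
        exact this (hV.mem_nhds hyV)
      filter_upwards [hretc.eventually hWn, hVn, c.isOpen_retractDomain.mem_nhds hdom]
        with z h4 h5 h6
      have h7 : G (0, c.retract z) = c.retract z :=
        (hGφ ⟨⟨F.zero_mem, h4, c.f_retract h6⟩, h5⟩).trans (F.at_zero _ h4 (c.f_retract h6))
      simp only [hΘ, h7, c.Ψ_retract h6, Function.comp_apply, ContinuousLinearMap.inr_apply]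
      rw [c.apply_eq_q z]
    simpa using DFunLike.congr_fun (h1.unique h2) X
  have hD1 : ∀ v, (D v).1 = v.1 := by
    intro v
    have h1 := (ContinuousLinearMap.fst ℝ ℝ E).hasFDerivAt.comp (0, y₀) hΘd.hasFDerivAt
    have h2 : HasFDerivAt (Prod.fst ∘ Θ) (ContinuousLinearMap.fst ℝ ℝ E) (0, y₀) :=
      (ContinuousLinearMap.fst ℝ ℝ E).hasFDerivAt
    simpa using DFunLike.congr_fun (h1.unique h2) v
  have hsurj : D.range = ⊤ := by
    rw [LinearMap.range_eq_top]
    rintro ⟨τ, Y⟩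
    refine ⟨(τ, fderiv ℝ c.Ψ.symm (c.Ψ y₀) (Y - (D (τ, 0)).2)), ?_⟩
    have e : ((τ, fderiv ℝ c.Ψ.symm (c.Ψ y₀) (Y - (D (τ, 0)).2)) : ℝ × E) = (τ, 0) +
        (0, fderiv ℝ c.Ψ.symm (c.Ψ y₀) (Y - (D (τ, 0)).2)) := by simp
    rw [e]
    change D _ = _
    rw [map_add, hD2, c.fderiv_fderiv_symm hp hyc]
    apply Prod.ext
    · simp [hD1]
    · simp
  have hmap := hΘd.map_nhds_eq_of_surj hsurj
  have hΘ0 : Θ (0, y₀) = (0, c.Ψ y₀) := by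
    simp [hΘ, hret, hGy, hf0]
  rw [hΘ0] at hmap
  have hgood : ∀ᶠ q : ℝ × E in 𝓝 ((0 : ℝ), y₀), q.1 ∈ Ioo (-σs) σs ∧ q ∈ V ∧
      q.2 ∈ c.Ψ.source ∧ q.2 ∈ c.retractDomain ∧ c.retract q.2 ∈ W ∧ c.retract q.2 ∈ O ∧
      (q.1, c.retract q.2) ∈ V ∧ G (q.1, c.retract q.2) ∈ c.Ψ.source := by
    have hs := continuous_snd.tendsto ((0 : ℝ), y₀)
    have h8 : Tendsto (fun q : ℝ × E => G (q.1, c.retract q.2)) (𝓝 (0, y₀)) (𝓝 y₀) := by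
      have := hg.continuousAt.tendsto
      simpa [hret, hGy] using this
    have h7 : Tendsto (fun q : ℝ × E => ((q.1, c.retract q.2) : ℝ × E)) (𝓝 (0, y₀))
        (𝓝 (0, y₀)) := by
      have := hrc.continuousAt.tendsto
      simpa [hret] using this
    filter_upwards [(continuous_fst.tendsto ((0 : ℝ), y₀)) F.eventually_mem, hV.mem_nhds hyV,
      hs (c.Ψ.open_source.mem_nhds hyc), hs (c.isOpen_retractDomain.mem_nhds hdom),
      (hretc.comp hs).eventually hWn, (hretc.comp hs).eventually (hO.mem_nhds (hKO hy₀)),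
      h7.eventually (hV.mem_nhds hyV), h8.eventually (c.Ψ.open_source.mem_nhds hyc)]
      with q a1 a2 a3 a4 a5 a6 a7 a8
    exact ⟨a1, a2, a3, a4, a5, a6, a7, a8⟩
  have himg : Θ '' {q | q.1 ∈ Ioo (-σs) σs ∧ q ∈ V ∧
      q.2 ∈ c.Ψ.source ∧ q.2 ∈ c.retractDomain ∧ c.retract q.2 ∈ W ∧ c.retract q.2 ∈ O ∧
      (q.1, c.retract q.2) ∈ V ∧ G (q.1, c.retract q.2) ∈ c.Ψ.source} ∈ 𝓝 ((0 : ℝ), c.Ψ y₀) := by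
    rw [← hmap]; exact image_mem_map hgood
  have hcont : Tendsto (fun q : ℝ × E => (q.1, c.Ψ q.2)) (𝓝 (0, y₀)) (𝓝 (0, c.Ψ y₀)) :=
    (continuous_fst.tendsto ((0 : ℝ), y₀)).prodMk_nhds
      ((c.Ψ.continuousAt hyc).tendsto.comp (continuous_snd.tendsto ((0 : ℝ), y₀)))
  filter_upwards [hcont himg, (continuous_snd.tendsto ((0 : ℝ), y₀))
    (c.Ψ.open_source.mem_nhds hyc)] with q hq hqs hfq
  obtain ⟨⟨τ, z⟩, ⟨b1, b2, b3, b4, b5, b6, b7, b8⟩, hz⟩ := hq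
  obtain ⟨rfl, hz2⟩ : τ = q.1 ∧ c.Ψ (G (τ, c.retract z)) + f z • c.e = c.Ψ q.2 :=
    ⟨congrArg Prod.fst hz, congrArg Prod.snd hz⟩
  have e1 : G (q.1, c.retract z) = φ q.1 (c.retract z) :=
    hGφ ⟨⟨b1, b5, c.f_retract b4⟩, b7⟩
  have e2 : f (φ q.1 (c.retract z)) = q.1 := (F.mapsTo _ b1 ⟨b5, c.f_retract b4⟩).2
  have e3 := congrArg c.ℓ hz2
  rw [map_add, c.ℓ_apply, c.ℓ_apply, e1, e2, hfq, map_smul, c.ℓ_e, smul_eq_mul, mul_one,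
    add_eq_left] at e3
  rw [e3, zero_smul, add_zero, e1] at hz2
  rw [e1] at b8
  exact ⟨c.retract z, b5, c.f_retract b4, b6, c.Ψ.injOn b8 hqs hz2⟩

variable [FiniteDimensional ℝ E] [MeasurableSpace E] [BorelSpace E] {d : ℕ} {k : E → E → ℂ}
  {u : E → ℂ}

/-- Near each point of `Q` the maps `φ σ` with small `σ` are antilipschitz with constant 2 and land
in a single chart, as the basic estimate demands. Compactness makes the constant and the range of
`σ` uniform. -/
theorem exists_lintegral_nearPotential_comp_le (F : LevelFamily p W f σs φ)
    (S : LevelData p U W f) (hk : IsWeakKernel d W k) (hd0 : 0 < d)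
    (hd : Module.finrank ℝ E = d + 1) (hu : MemLp u 2 (μHE[d + 1].restrict W)) {Q : Set E}
    (hQ : IsCompact Q) (hQS : Q ⊆ {z | z ∈ W ∧ f z = 0}) :
    ∃ C : ℝ≥0, ∀ᶠ σ in 𝓝 (0 : ℝ), ∀ ε : ℝ≥0∞, 0 < ε →
      ∫⁻ z in Q, nearPotential d W k u ε (φ σ z) ∂(μHE[d]) ≤ C * ε ^ (1 / 8 : ℝ) := by
  classical
  refine hQ.induction_on (p := fun s => ∃ C : ℝ≥0, ∀ᶠ σ in 𝓝 (0 : ℝ), ∀ ε : ℝ≥0∞, 0 < ε →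
      ∫⁻ z in s, nearPotential d W k u ε (φ σ z) ∂(μHE[d]) ≤ C * ε ^ (1 / 8 : ℝ)) ?_ ?_ ?_ ?_
  · exact ⟨0, by simp⟩
  · rintro s t hst ⟨C, hC⟩
    refine ⟨C, hC.mono fun σ h ε hε => (lintegral_mono_set hst).trans (h ε hε)⟩
  · rintro s t ⟨C, hC⟩ ⟨C', hC'⟩
    refine ⟨C + C', ?_⟩
    filter_upwards [hC, hC'] with σ h h' ε hε
    refine (lintegral_union_le _ _ _).trans ?_
    push_cast
    rw [add_mul]
    exact add_le_add (h ε hε) (h' ε hε)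
  · intro z₀ hz₀
    have hz₀W := (hQS hz₀).1
    obtain ⟨c, hzc, -⟩ := exists_levelChart S.p_pos S.isOpen_U S.contDiffOn (S.subset hz₀W)
      (S.fderiv_ne_zero _ (S.subset hz₀W))
    obtain ⟨N, hN, hzN, hNφ⟩ := F.exists_nhds S.cast_p_ne_zero hz₀W (hQS hz₀).2
      (c.Ψ.open_source.mem_nhds hzc)
    obtain ⟨C, hC⟩ := hk.exists_lintegral_nearPotential_le S c hd0 hd hu
    refine ⟨Q ∩ N, inter_mem_nhdsWithin _ (hN.mem_nhds hzN), C, ?_⟩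
    filter_upwards [hNφ, F.eventually_mem] with σ hσ hσs ε hε
    have hA : MeasurableSet (Q ∩ N) := hQ.isClosed.measurableSet.inter hN.measurableSet
    have hsub : Q ∩ N ⊆ {z | z ∈ W ∧ f z = 0} := fun z hz => hQS hz.1
    set θ : E → E := (Q ∩ N).piecewise (φ σ) (fun _ => 0) with hθ
    have hθm : Measurable θ :=
      ((F.continuousOn hσs).mono hsub).measurable_piecewise continuousOn_const hA
    have hθe : ∀ z ∈ Q ∩ N, θ z = φ σ z := fun z hz => by simp only [hθ, hz, piecewise_eq_of_mem]
    rw [setLIntegral_congr_fun hA (g := fun z => nearPotential d W k u ε (θ z))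
      (fun z hz => by simp only [hθe z hz])]
    refine hC (Q ∩ N) θ σ hA hθm (fun z hz => ?_) (fun z hz => ?_) (fun z hz w hw => ?_) ε hε
    · rw [hθe z hz]
      exact ⟨(hσ z hz.2 (hsub hz).1 (hsub hz).2).1, (F.mapsTo σ hσs (hsub hz)).1⟩
    · rw [hθe z hz]; exact (F.mapsTo σ hσs (hsub hz)).2
    · rw [hθe z hz, hθe w hw]
      exact (hσ z hz.2 (hsub hz).1 (hsub hz).2).2 w hw.2 (hsub hw).1 (hsub hw).2

theorem tendsto_potential (F : LevelFamily p W f σs φ)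
    (S : LevelData p U W f) (hk : IsWeakKernel d W k) (hd0 : 0 < d)
    (hd : Module.finrank ℝ E = d + 1) (hu : MemLp u 2 (μHE[d + 1].restrict W)) {Q : Set E}
    (hQ : IsCompact Q) (hQS : Q ⊆ {z | z ∈ W ∧ f z = 0}) :
    IntegrableOn (potential d W k u) Q (μHE[d]) ∧
    (∀ᶠ σ in 𝓝 (0 : ℝ), IntegrableOn (fun z => potential d W k u (φ σ z)) Q (μHE[d])) ∧
    Tendsto (fun σ => ∫ z in Q, ‖potential d W k u (φ σ z) - potential d W k u z‖ ∂(μHE[d]))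
      (𝓝 0) (𝓝 0) := by
  obtain ⟨C, hC⟩ := F.exists_lintegral_nearPotential_comp_le S hk hd0 hd hu hQ hQS
  refine hk.tendsto_potential_comp S hd0 hd hu hQ.isClosed.measurableSet hQS ?_
    (fun z hz => F.tendsto (hQS hz).1 (hQS hz).2) (fun z hz => F.at_zero z (hQS hz).1 (hQS hz).2)
    one_pos (C := C) ?_
  · filter_upwards [F.eventually_mem] with σ hσ
    exact ⟨(F.continuousOn hσ).mono hQS, fun z hz => (F.mapsTo σ hσ (hQS hz)).1⟩
  · filter_upwards [hC] with σ hσ ε hε _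
    exact hσ _ (ENNReal.ofReal_pos.2 hε)

/-- For a density supported in a compact subset of `W` the convergence holds on the whole zero
set. -/
theorem tendsto_potential_of_support (F : LevelFamily p W f σs φ)
    (S : LevelData p U W f) (hk : IsWeakKernel d W k) (hd0 : 0 < d)
    (hd : Module.finrank ℝ E = d + 1) (hu : MemLp u 2 (μHE[d + 1].restrict W)) {K : Set E}
    (hK : IsCompact K) (hKW : K ⊆ W) (huK : ∀ ζ ∉ K, u ζ = 0) :
    IntegrableOn (potential d W k u) {z | z ∈ W ∧ f z = 0} (μHE[d]) ∧
    (∀ᶠ σ in 𝓝 (0 : ℝ), IntegrableOn (fun z => potential d W k u (φ σ z))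
      {z | z ∈ W ∧ f z = 0} (μHE[d])) ∧
    Tendsto (fun σ => ∫ z in {z | z ∈ W ∧ f z = 0},
      ‖potential d W k u (φ σ z) - potential d W k u z‖ ∂(μHE[d])) (𝓝 0) (𝓝 0) := by
  have : ProperSpace E := FiniteDimensional.proper ℝ E
  obtain ⟨δ, hδ, hδW⟩ := hK.exists_cthickening_subset_open S.isOpen_W hKW
  have hK1 : IsCompact (Metric.cthickening δ K) := hK.cthickening
  -- `K2` is a compact neighbourhood of the `δ`-thickening of the support. Off `Q`, its part in the
  -- zero set, the near potential will vanish, so the estimate on the compact set `Q` suffices.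
  obtain ⟨K2, hK2, hK12, hK2W⟩ := exists_compact_between hK1 S.isOpen_W hδW
  set Q := K2 ∩ {z | z ∈ W ∧ f z = 0} with hQdef
  have hQeq : Q = K2 ∩ f ⁻¹' {0} := by
    ext z
    exact ⟨fun h => ⟨h.1, h.2.2⟩, fun h => ⟨h.1, hK2W h.1, h.2⟩⟩
  have hQ : IsCompact Q := by
    refine hK2.of_isClosed_subset ?_ inter_subset_left
    rw [hQeq]
    exact (S.continuousOn.mono (hK2W.trans S.subset)).preimage_isClosed_of_isClosed
      hK2.isClosed isClosed_singleton
  have hQS : Q ⊆ {z | z ∈ W ∧ f z = 0} := inter_subset_right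
  obtain ⟨C, hC⟩ := F.exists_lintegral_nearPotential_comp_le S hk hd0 hd hu hQ hQS
  refine hk.tendsto_potential_comp S hd0 hd hu (S.measurableSet_level 0) subset_rfl ?_
    (fun z hz => F.tendsto hz.1 hz.2) (fun z hz => F.at_zero z hz.1 hz.2) hδ (C := C) ?_
  · filter_upwards [F.eventually_mem] with σ hσ
    exact ⟨F.continuousOn hσ, fun z hz => (F.mapsTo σ hσ hz).1⟩
  filter_upwards [hC, F.eventually_mem,
    F.eventually_surj S hK1 hδW isOpen_interior hK12] with σ hσ hσs hsurj ε hε hεδ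
  refine le_trans ?_ (hσ _ (ENNReal.ofReal_pos.2 hε))
  rw [← lintegral_inter_add_sdiff (μ := μHE[d]) (fun z => nearPotential d W k u _ (φ σ z))
    {z | z ∈ W ∧ f z = 0} hQ.isClosed.measurableSet, inter_eq_right.2 hQS]
  have hz0 : ∀ z ∈ {z | z ∈ W ∧ f z = 0} \ Q,
      nearPotential d W k u (ENNReal.ofReal ε) (φ σ z) = 0 := by
    intro z hz
    -- A point of the level `σ` inside the thickening is the image of a point of `Q`, by
    -- `eventually_surj`; injectivity of `φ σ` then excludes images of points outside `Q`.
    have hout : φ σ z ∉ Metric.cthickening δ K := by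
      intro hmem
      obtain ⟨w, hwW, hfw, hwO, hww⟩ := hsurj _ hmem (F.mapsTo σ hσs hz.1).2
      have := F.injOn σ hσs ⟨hwW, hfw⟩ hz.1 hww
      rw [this] at hwO
      exact hz.2 ⟨interior_subset hwO, hz.1⟩
    refine (lintegral_congr fun ζ => ?_).trans lintegral_zero
    split_ifs with h
    · have hζ : ζ ∉ K := by
        intro hζK
        refine hout (Metric.mem_cthickening_of_dist_le _ ζ δ K hζK ?_)
        rw [← ofReal_norm, ENNReal.ofReal_lt_ofReal_iff hε] at h
        rw [dist_eq_norm]; linarith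
      simp [huK ζ hζ]
    · rfl
  rw [setLIntegral_congr_fun (g := fun _ => 0)
    ((S.measurableSet_level 0).diff hQ.isClosed.measurableSet) hz0, lintegral_zero, add_zero]

end LevelFamily

end

/-! ### Differentiation under the integral with a moving singularity -/

section

/-- The family of functions `B z`, `z ∈ N`, is dominated by integrable functions off sets on which
its integrals are uniformly small. -/
def IsTight {E α : Type*} [MeasurableSpace α] (N : Set E) (B : E → α → ℝ) (μ : Measure α) : Prop :=
  ∃ (Y : ℕ → Set α) (b : ℕ → α → ℝ) (δ : ℕ → ℝ), (∀ k, MeasurableSet (Y k)) ∧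
    (∀ k, IntegrableOn (b k) (Y k) μ) ∧ (∀ k, ∀ᵐ a ∂μ, a ∈ Y k → ∀ z ∈ N, B z a ≤ b k a) ∧
    Tendsto δ atTop (𝓝 0) ∧ (∀ k, 0 ≤ δ k) ∧
    ∀ k, ∀ z ∈ N, ∫⁻ a in (Y k)ᶜ, ENNReal.ofReal (B z a) ∂μ ≤ ENNReal.ofReal (δ k)

section

variable {E α F : Type} [NormedAddCommGroup F] [NormedSpace ℝ F] [MeasurableSpace α]
  {μ : Measure α} {N : Set E} {B : E → α → ℝ} {g : E → α → F}

omit [NormedSpace ℝ F] in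
theorem IsTight.integrable (hT : IsTight N B μ)
    (hm : ∀ z ∈ N, AEStronglyMeasurable (g z) μ)
    (hB : ∀ᵐ a ∂μ, ∀ z ∈ N, ‖g z a‖ ≤ B z a) {z : E} (hz : z ∈ N) : Integrable (g z) μ := by
  obtain ⟨Y, b, δ, hY, hb, hBb, -, -, hsmall⟩ := hT
  rw [← integrableOn_univ, ← union_compl_self (Y 0)]
  refine IntegrableOn.union ?_ ?_
  · refine Integrable.mono' (hb 0) (hm z hz).restrict ?_
    filter_upwards [ae_restrict_of_ae hB, ae_restrict_of_ae (hBb 0), ae_restrict_mem (hY 0)]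
      with a h1 h2 h3
    exact (h1 z hz).trans (h2 h3 z hz)
  · refine ⟨(hm z hz).restrict, ?_⟩
    rw [hasFiniteIntegral_iff_norm]
    refine lt_of_le_of_lt (lintegral_mono_ae ?_) ((hsmall 0 z hz).trans_lt ENNReal.ofReal_lt_top)
    filter_upwards [ae_restrict_of_ae hB] with a h1
    exact ENNReal.ofReal_le_ofReal (h1 z hz)

theorem norm_setIntegral_compl_le {Y : Set α} {δ : ℝ} (hδ : 0 ≤ δ)
    (hB : ∀ᵐ a ∂μ, ∀ z ∈ N, ‖g z a‖ ≤ B z a) {z : E} (hz : z ∈ N)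
    (h : ∫⁻ a in Yᶜ, ENNReal.ofReal (B z a) ∂μ ≤ ENNReal.ofReal δ) :
    ‖∫ a in Yᶜ, g z a ∂μ‖ ≤ δ := by
  rw [← ENNReal.ofReal_le_ofReal_iff hδ, ofReal_norm]
  refine (enorm_integral_le_lintegral_enorm _).trans (le_trans (lintegral_mono_ae ?_) h)
  filter_upwards [ae_restrict_of_ae hB] with a h1
  rw [← ofReal_norm]
  exact ENNReal.ofReal_le_ofReal (h1 z hz)

/-- This replaces domination by a single integrable function, which need not exist when the
singularity moves with `z`: on each `Y k` ordinary domination works, and the remainders tend to 0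
uniformly in `z`. -/
theorem tendstoUniformlyOn_setIntegral {Y : ℕ → Set α} {δ : ℕ → ℝ} (hY : ∀ k, MeasurableSet (Y k))
    (hint : ∀ z ∈ N, Integrable (g z) μ)
    (hδ : Tendsto δ atTop (𝓝 0)) (hδ0 : ∀ k, 0 ≤ δ k) (hB : ∀ᵐ a ∂μ, ∀ z ∈ N, ‖g z a‖ ≤ B z a)
    (hsmall : ∀ k, ∀ z ∈ N, ∫⁻ a in (Y k)ᶜ, ENNReal.ofReal (B z a) ∂μ ≤ ENNReal.ofReal (δ k)) :
    TendstoUniformlyOn (fun k z => ∫ a in Y k, g z a ∂μ) (fun z => ∫ a, g z a ∂μ) atTop N := by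
  rw [Metric.tendstoUniformlyOn_iff]
  intro ε hε
  filter_upwards [hδ.eventually_lt_const hε] with k hk z hz
  rw [dist_eq_norm, ← integral_add_compl (hY k) (hint z hz), add_sub_cancel_left]
  exact (norm_setIntegral_compl_le (hδ0 k) hB hz (hsmall k z hz)).trans_lt hk

variable [NormedAddCommGroup E]

theorem IsTight.continuousOn_integral (hT : IsTight N B μ)
    (hm : ∀ z ∈ N, AEStronglyMeasurable (g z) μ)
    (hB : ∀ᵐ a ∂μ, ∀ z ∈ N, ‖g z a‖ ≤ B z a)
    (hc : ∀ᵐ a ∂μ, ContinuousOn (fun z => g z a) N) :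
    ContinuousOn (fun z => ∫ a, g z a ∂μ) N := by
  have hint := fun z (hz : z ∈ N) => hT.integrable hm hB hz
  obtain ⟨Y, b, δ, hY, hb, hBb, hδ, hδ0, hsmall⟩ := hT
  refine (tendstoUniformlyOn_setIntegral hY hint hδ hδ0 hB hsmall).continuousOn
    (Eventually.frequently (Eventually.of_forall fun k => ?_))
  refine continuousOn_of_dominated (fun z hz => (hm z hz).restrict) (fun z hz => ?_) (hb k)
    (ae_restrict_of_ae hc)
  filter_upwards [ae_restrict_of_ae hB, ae_restrict_of_ae (hBb k), ae_restrict_mem (hY k)]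
    with a h1 h2 h3
  exact (h1 z hz).trans (h2 h3 z hz)

theorem IsTight.hasFDerivAt_integral [NormedSpace ℝ E] (hT : IsTight N B μ) (hN : IsOpen N)
    (hm : ∀ z ∈ N, AEStronglyMeasurable (g z) μ)
    (hm' : ∀ z ∈ N, AEStronglyMeasurable (fun a => fderiv ℝ (fun z => g z a) z) μ)
    (hB : ∀ᵐ a ∂μ, ∀ z ∈ N, ‖g z a‖ ≤ B z a)
    (hB' : ∀ᵐ a ∂μ, ∀ z ∈ N, ‖fderiv ℝ (fun z => g z a) z‖ ≤ B z a)
    (hd : ∀ᵐ a ∂μ, DifferentiableOn ℝ (fun z => g z a) N) {z : E} (hz : z ∈ N) :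
    HasFDerivAt (fun z => ∫ a, g z a ∂μ) (∫ a, fderiv ℝ (fun z => g z a) z ∂μ) z := by
  have hint := fun z (hz : z ∈ N) => hT.integrable hm hB hz
  have hint' := fun z (hz : z ∈ N) =>
    hT.integrable (g := fun z a => fderiv ℝ (fun z => g z a) z) hm' hB' hz
  obtain ⟨Y, b, δ, hY, hb, hBb, hδ, hδ0, hsmall⟩ := hT
  -- The derivatives of the integrals over `Y k` converge uniformly and the integrals themselves
  -- converge pointwise.
  refine hasFDerivAt_of_tendstoUniformlyOn (l := atTop) (𝕜 := ℝ) hN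
    (tendstoUniformlyOn_setIntegral (g := fun z a => fderiv ℝ (fun z => g z a) z)
      hY hint' hδ hδ0 hB' hsmall) (fun k x hx => ?_)
    (fun x hx => (tendstoUniformlyOn_setIntegral hY hint hδ hδ0 hB hsmall).tendsto_at hx) hz
  refine hasFDerivAt_integral_of_dominated_of_fderiv_le (bound := b k)
    (F' := fun z a => fderiv ℝ (fun z => g z a) z) (hN.mem_nhds hx) ?_
    (hint x hx).integrableOn (hm' x hx).restrict ?_ (hb k) ?_
  · filter_upwards [hN.mem_nhds hx] with y hy using (hm y hy).restrict
  · filter_upwards [ae_restrict_of_ae hB', ae_restrict_of_ae (hBb k), ae_restrict_mem (hY k)]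
      with a h1 h2 h3 y hy
    exact (h1 y hy).trans (h2 h3 y hy)
  · filter_upwards [ae_restrict_of_ae hd] with a ha y hy
    exact (ha.differentiableAt (hN.mem_nhds hy)).hasFDerivAt

end

/-- Differentiation under the integral sign, up to order `p`. -/
theorem IsTight.contDiffOn_integral {E α : Type} [NormedAddCommGroup E] [NormedSpace ℝ E]
    [MeasurableSpace α] {μ : Measure α} {N : Set E} {B : E → α → ℝ} (hT : IsTight N B μ)
    (hN : IsOpen N) (p : ℕ) {F : Type} [NormedAddCommGroup F] [NormedSpace ℝ F] {g : E → α → F}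
    (hg : ∀ᵐ a ∂μ, ContDiffOn ℝ p (fun z => g z a) N)
    (hm : ∀ j ≤ p, ∀ z ∈ N,
      AEStronglyMeasurable (fun a => iteratedFDeriv ℝ j (fun z => g z a) z) μ)
    (hB : ∀ j ≤ p, ∀ᵐ a ∂μ, ∀ z ∈ N, ‖iteratedFDeriv ℝ j (fun z => g z a) z‖ ≤ B z a) :
    ContDiffOn ℝ p (fun z => ∫ a, g z a ∂μ) N := by
  -- The inductive step applies the lower order to the derivative with the same tight family, since
  -- one `B` bounds all orders; the target changes to a space of linear maps.
  induction p generalizing F with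
  | zero =>
    rw [Nat.cast_zero, contDiffOn_zero]
    refine hT.continuousOn_integral (fun z hz => ?_) ?_ ?_
    · have := (continuousMultilinearCurryFin0 ℝ E F).continuous.comp_aestronglyMeasurable
        (hm 0 le_rfl z hz)
      simpa [iteratedFDeriv_zero_eq_comp] using this
    · simpa using hB 0 le_rfl
    · filter_upwards [hg] with a ha using ha.continuousOn
  | succ p ih =>
    have hB1 : ∀ᵐ a ∂μ, ∀ z ∈ N, ‖fderiv ℝ (fun z => g z a) z‖ ≤ B z a := by
      filter_upwards [hB 1 (by omega)] with a ha z hz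
      have := ha z hz
      rwa [← norm_iteratedFDeriv_fderiv, norm_iteratedFDeriv_zero] at this
    have hm0 : ∀ z ∈ N, AEStronglyMeasurable (g z) μ := fun z hz => by
      have := (continuousMultilinearCurryFin0 ℝ E F).continuous.comp_aestronglyMeasurable
        (hm 0 (by omega) z hz)
      simpa [iteratedFDeriv_zero_eq_comp] using this
    have hmd : ∀ j ≤ p, ∀ z ∈ N, AEStronglyMeasurable
        (fun a => iteratedFDeriv ℝ j (fun z => fderiv ℝ (fun z => g z a) z) z) μ := by
      intro j hj z hz
      have := (continuousMultilinearCurryRightEquiv' ℝ j E F).continuous.comp_aestronglyMeasurable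
        (hm (j + 1) (by omega) z hz)
      simpa [iteratedFDeriv_succ_eq_comp_right] using this
    have hm1 : ∀ z ∈ N, AEStronglyMeasurable (fun a => fderiv ℝ (fun z => g z a) z) μ :=
      fun z hz => by
        have := (continuousMultilinearCurryFin0 ℝ E (E →L[ℝ] F)).continuous.comp_aestronglyMeasurable
          (hmd 0 (by omega) z hz)
        simpa [iteratedFDeriv_zero_eq_comp] using this
    have hd : ∀ z ∈ N, HasFDerivAt (fun z => ∫ a, g z a ∂μ)
        (∫ a, fderiv ℝ (fun z => g z a) z ∂μ) z := fun z hz =>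
      hT.hasFDerivAt_integral hN hm0 hm1 (by simpa using hB 0 (by omega)) hB1
        (hg.mono fun a ha => ha.differentiableOn (by simp)) hz
    push_cast
    rw [contDiffOn_succ_iff_fderiv_of_isOpen hN]
    refine ⟨fun z hz => (hd z hz).differentiableAt.differentiableWithinAt, by simp, ?_⟩
    refine (ih (g := fun z a => fderiv ℝ (fun z => g z a) z) ?_ hmd ?_).congr
      fun z hz => (hd z hz).fderiv
    · filter_upwards [hg] with a ha
      push_cast at ha
      exact ((contDiffOn_succ_iff_fderiv_of_isOpen hN).1 ha).2.2
    · intro j hj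
      filter_upwards [hB (j + 1) (by omega)] with a ha z hz
      rw [norm_iteratedFDeriv_fderiv]
      exact ha z hz

/-- Partial derivatives of a jointly `C^p` map are jointly continuous. -/
theorem continuousOn_iteratedFDeriv_left {E E' F : Type*} [NormedAddCommGroup E] [NormedSpace ℝ E]
    [NormedAddCommGroup E'] [NormedSpace ℝ E'] [NormedAddCommGroup F] [NormedSpace ℝ F] {p j : ℕ}
    (hj : j ≤ p) {O : Set (E × E')} (hO : IsOpen O) {H : E → E' → F}
    (hH : ContDiffOn ℝ p (fun q : E × E' => H q.1 q.2) O) :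
    ContinuousOn (fun q : E × E' => iteratedFDeriv ℝ j (fun z => H z q.2) q.1) O := by
  have hjp : (j : WithTop ℕ∞) ≤ p := by exact_mod_cast hj
  have key : ∀ q ∈ O, iteratedFDeriv ℝ j (fun z => H z q.2) q.1 =
      (iteratedFDerivWithin ℝ j (fun q : E × E' => H q.1 q.2) O q).compContinuousLinearMap
        (fun _ => ContinuousLinearMap.inl ℝ E E') := by
    intro q hq
    -- Translation by `(0, q.2)` turns the slice through `q` into the linear subspace `E × 0`, so
    -- the partial derivative is the full one composed with `inl`.
    set O' : Set (E × E') := (fun x => x + (0, q.2)) ⁻¹' O with hO'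
    have hO'o : IsOpen O' := hO.preimage (by fun_prop)
    have h1 : ContDiffOn ℝ p (fun x : E × E' => H (x + (0, q.2)).1 (x + (0, q.2)).2) O' :=
      hH.comp (contDiff_id.add contDiff_const).contDiffOn fun x hx => hx
    have hq' : ContinuousLinearMap.inl ℝ E E' q.1 ∈ O' := by
      simpa [hO'] using hq
    have ho : IsOpen (ContinuousLinearMap.inl ℝ E E' ⁻¹' O') :=
      hO'o.preimage (ContinuousLinearMap.inl ℝ E E').continuous
    have h2 := (ContinuousLinearMap.inl ℝ E E').iteratedFDerivWithin_comp_right h1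
      hO'o.uniqueDiffOn ho.uniqueDiffOn hq' hjp
    rw [iteratedFDerivWithin_of_isOpen _ ho hq', iteratedFDerivWithin_of_isOpen _ hO'o hq',
      iteratedFDeriv_comp_add_right (f := fun q : E × E' => H q.1 q.2)] at h2
    have e : ContinuousLinearMap.inl ℝ E E' q.1 + (0, q.2) = q := by simp
    rw [e] at h2
    rw [iteratedFDerivWithin_of_isOpen _ hO hq, ← h2]
    congr 1
    ext z
    simp
  refine ContinuousOn.congr ?_ key
  exact (ContinuousMultilinearMap.compContinuousLinearMapL (𝕜 := ℝ) (F := F)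
    (fun _ : Fin j => ContinuousLinearMap.inl ℝ E E')).continuous.comp_continuousOn
    (hH.continuousOn_iteratedFDerivWithin hjp hO.uniqueDiffOn)

/-- Derivatives of homogeneous functions. -/
theorem exists_norm_iteratedFDeriv_le_of_homogeneous {E F : Type*} [NormedAddCommGroup E]
    [NormedSpace ℝ E] [FiniteDimensional ℝ E] [NormedAddCommGroup F] [NormedSpace ℝ F] {g : E → F}
    {m : ℕ} (p : ℕ) (hg : ContDiffOn ℝ p g {0}ᶜ)
    (hh : ∀ t : ℝ, 0 < t → ∀ x, g (t • x) = (t ^ m)⁻¹ • g x) :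
    ∃ C : ℝ, 0 ≤ C ∧ ∀ j ≤ p, ∀ x ≠ 0, ‖iteratedFDeriv ℝ j g x‖ * ‖x‖ ^ (m + j) ≤ C := by
  have : ProperSpace E := FiniteDimensional.proper ℝ E
  have ho : IsOpen ({0}ᶜ : Set E) := isOpen_compl_singleton
  have hb : ∀ j : ℕ, ∃ C : ℝ, 0 ≤ C ∧ (j ≤ p → ∀ x ∈ Metric.sphere (0 : E) 1,
      ‖iteratedFDeriv ℝ j g x‖ ≤ C) := by
    intro j
    by_cases hj : j ≤ p
    · have hc : ContinuousOn (iteratedFDeriv ℝ j g) {0}ᶜ :=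
        (hg.continuousOn_iteratedFDerivWithin (by exact_mod_cast hj) ho.uniqueDiffOn).congr
          fun x hx => (iteratedFDerivWithin_of_isOpen _ ho hx).symm
      obtain ⟨C, hC⟩ := (isCompact_sphere (0 : E) 1).exists_bound_of_continuousOn
        (hc.mono fun x hx h => by simp [mem_singleton_iff.1 h] at hx)
      exact ⟨max C 0, le_max_right _ _, fun _ x hx => (hC x hx).trans (le_max_left _ _)⟩
    · exact ⟨0, le_rfl, fun h => absurd h hj⟩
  choose C hC0 hC using hb
  refine ⟨∑ j ∈ Finset.range (p + 1), C j, Finset.sum_nonneg fun j _ => hC0 j,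
    fun j hj x hx => ?_⟩
  have hxp : 0 < ‖x‖ := norm_pos_iff.2 hx
  -- Rescale to the unit sphere, which is compact; the `j`-th derivative is homogeneous of degree
  -- `-(m + j)`.
  set t := ‖x‖⁻¹ with ht
  have htp : 0 < t := inv_pos.2 hxp
  set L : E →L[ℝ] E := t • ContinuousLinearMap.id ℝ E with hL
  have hLx : L x = t • x := by simp [hL]
  have hpre : (L ⁻¹' {0}ᶜ : Set E) = {0}ᶜ := by
    ext y; simp [hL, htp.ne']
  have htx : t • x ≠ 0 := smul_ne_zero htp.ne' hx
  have h1 := L.iteratedFDerivWithin_comp_right hg ho.uniqueDiffOn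
    (by rw [hpre]; exact ho.uniqueDiffOn) (x := x) (by rw [hLx]; exact htx) (i := j)
    (by exact_mod_cast hj)
  rw [hpre, iteratedFDerivWithin_of_isOpen _ ho hx, hLx,
    iteratedFDerivWithin_of_isOpen _ ho htx] at h1
  have h2 : g ∘ L = (t ^ m)⁻¹ • g := by
    ext y; simp [hL, hh t htp]
  have h3 : (iteratedFDeriv ℝ j g (t • x)).compContinuousLinearMap (fun _ => L) =
      t ^ j • iteratedFDeriv ℝ j g (t • x) := by
    ext v
    simp only [ContinuousMultilinearMap.compContinuousLinearMap_apply, hL,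
      smul_apply, ContinuousLinearMap.id_apply]
    rw [ContinuousMultilinearMap.map_smul_univ]
    simp
  rw [h2, h3, iteratedFDeriv_const_smul_apply
    ((hg.contDiffAt (ho.mem_nhds hx)).of_le (by exact_mod_cast hj))] at h1
  have h4 : iteratedFDeriv ℝ j g x = t ^ (m + j) • iteratedFDeriv ℝ j g (t • x) := by
    rw [pow_add, mul_smul, ← h1, smul_smul, mul_inv_cancel₀ (pow_ne_zero _ htp.ne'), one_smul]
  rw [h4, norm_smul, Real.norm_of_nonneg (by positivity), ht, inv_pow, mul_right_comm,
    inv_mul_cancel₀ (by positivity), one_mul, ← ht]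
  refine (hC j hj _ ?_).trans
    (Finset.single_le_sum (f := C) (fun j _ => hC0 j) (Finset.mem_range.2 (by omega)))
  rw [mem_sphere_zero_iff_norm, norm_smul, Real.norm_of_nonneg htp.le, ht, inv_mul_cancel₀ hxp.ne']

end

/-! ### Smooth kernels against densities vanishing on the zero set -/

section

/-- A weak kernel which is `C^p` off the diagonal, with derivatives in the first variable of order
`j` having a singularity of order `d + j`. -/
structure IsSmoothKernel {E : Type*} [NormedAddCommGroup E] [NormedSpace ℝ E] (p d : ℕ) (W : Set E)
    (k : E → E → ℂ) : Prop extends IsWeakKernel d W k where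
  contDiffOn : ContDiffOn ℝ p (fun q : E × E => k q.1 q.2) ((W ×ˢ W) ∩ {q | q.1 ≠ q.2})
  derivBound : ∃ C : ℝ, 0 ≤ C ∧ ∀ j ≤ p, ∀ z ∈ W, ∀ ζ ∈ W, z ≠ ζ →
    ‖iteratedFDeriv ℝ j (fun z => k z ζ) z‖ * ‖z - ζ‖ ^ (d + j) ≤ C

theorem exists_norm_iteratedFDeriv_le {E F : Type*} [NormedAddCommGroup E] [NormedSpace ℝ E]
    [NormedAddCommGroup F] [NormedSpace ℝ F] {p : ℕ} {h : E → F} {V : Set E} (hV : IsOpen V)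
    (hh : ContDiffOn ℝ p h V) {z₀ : E} (hz₀ : z₀ ∈ V) :
    ∃ D : ℝ, 1 ≤ D ∧ ∀ᶠ z in 𝓝 z₀, ∀ i ≤ p, ‖iteratedFDeriv ℝ i h z‖ ≤ D := by
  have hb : ∀ i, ∃ D : ℝ, 0 ≤ D ∧ (i ≤ p → ∀ᶠ z in 𝓝 z₀, ‖iteratedFDeriv ℝ i h z‖ ≤ D) := by
    intro i
    by_cases hi : i ≤ p
    · have hc : ContinuousOn (iteratedFDeriv ℝ i h) V :=
        (hh.continuousOn_iteratedFDerivWithin (by exact_mod_cast hi) hV.uniqueDiffOn).congr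
          fun x hx => (iteratedFDerivWithin_of_isOpen _ hV hx).symm
      have h1 := (hc.continuousAt (hV.mem_nhds hz₀)).norm.eventually_lt_const
        (lt_add_one ‖iteratedFDeriv ℝ i h z₀‖)
      exact ⟨‖iteratedFDeriv ℝ i h z₀‖ + 1, by positivity, fun _ => h1.mono fun z hz => hz.le⟩
    · exact ⟨0, le_rfl, fun h => absurd h hi⟩
  choose D hD0 hD using hb
  -- The added 1 gives `1 ≤ D`, hence `D ≤ D ^ i` for `i ≥ 1`, the form in which the chain rule
  -- estimate takes these bounds.
  refine ⟨1 + ∑ i ∈ Finset.range (p + 1), D i,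
    le_add_of_nonneg_right (Finset.sum_nonneg fun i _ => hD0 i), ?_⟩
  have h2 : ∀ᶠ z in 𝓝 z₀, ∀ i ∈ Finset.range (p + 1), ‖iteratedFDeriv ℝ i h z‖ ≤ D i := by
    rw [Filter.eventually_all_finset]
    intro i hi
    exact hD i (by have := Finset.mem_range.1 hi; omega)
  filter_upwards [h2] with z hz i hi
  have hi' : i ∈ Finset.range (p + 1) := Finset.mem_range.2 (by omega)
  have := Finset.single_le_sum (f := D) (fun j _ => hD0 j) hi'
  have := hz i hi'
  linarith

variable {E : Type} [NormedAddCommGroup E] [NormedSpace ℝ E] {p : ℕ} {U W : Set E} {f : E → ℝ}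
  [FiniteDimensional ℝ E] [MeasurableSpace E] [BorelSpace E] {d l : ℕ} {k : E → E → ℂ} {u : E → ℂ}

omit [FiniteDimensional ℝ E] [MeasurableSpace E] [BorelSpace E] in
theorem LevelData.isOpen_ne_zero (S : LevelData p U W f) : IsOpen {ζ | ζ ∈ W ∧ f ζ ≠ 0} :=
  (S.continuousOn.mono S.subset).isOpen_inter_preimage S.isOpen_W isOpen_compl_singleton

theorem LevelData.restrict_ne_zero (S : LevelData p U W f) (hd : Module.finrank ℝ E = d + 1) :
    (μHE[d + 1] : Measure E).restrict {ζ | ζ ∈ W ∧ f ζ ≠ 0} = μHE[d + 1].restrict W := by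
  refine Measure.restrict_congr_set ?_
  have h1 := (ae_restrict_iff' S.isOpen_W.measurableSet).1 (S.ae_ne_zero hd)
  filter_upwards [h1] with z hz
  exact propext ⟨fun h => h.1, fun h => ⟨h, hz h⟩⟩

/-- The kernel singularities along the zero set are compensated by the vanishing of `u`. -/
theorem LevelData.isTight (S : LevelData p U W f) (hd : Module.finrank ℝ E = d + 1)
    (hl : 2 * (d + p) < 2 * l + (d + 1)) (hu : MemLp u 2 (μHE[d + 1].restrict W))
    (hul : MemLp (fun z => u z / ((|f z| ^ l : ℝ) : ℂ)) 2 (μHE[d + 1].restrict W))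
    {N : Set E} {π : E → E} (hπ : ∀ z ∈ N, π z ∈ W ∧ f (π z) = 0) (C₁ : ℝ≥0) :
    IsTight N (fun z ζ => C₁ * ((‖π z - ζ‖ ^ (d + p))⁻¹ * ‖u ζ‖))
      ((μHE[d + 1] : Measure E).restrict {ζ | ζ ∈ W ∧ f ζ ≠ 0}) := by
  have hHaarE : (μHE[d + 1] : Measure E).IsAddHaarMeasure := by
    rw [← hd]; infer_instance
  have : ProperSpace E := FiniteDimensional.proper ℝ E
  obtain ⟨L, hL0, hL⟩ := S.exists_lipschitzOnWith
  obtain ⟨R, hR⟩ := S.isBounded.subset_ball 0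
  have hu1 : Integrable u ((μHE[d + 1] : Measure E).restrict {ζ | ζ ∈ W ∧ f ζ ≠ 0}) := by
    rw [S.restrict_ne_zero hd]; exact integrableOn_of_memLp_two S hu
  set O₁ := {ζ | ζ ∈ W ∧ f ζ ≠ 0} with hO₁
  have hO₁o : IsOpen O₁ := S.isOpen_ne_zero
  set μ := (μHE[d + 1] : Measure E).restrict O₁ with hμ
  have hfin : IsFiniteMeasure μ := ⟨by
    rw [Measure.restrict_apply_univ]
    exact (S.isBounded.subset fun z hz => hz.1).measure_lt_top⟩
  have hfm : AEMeasurable f μ :=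
    (S.continuousOn.mono fun z hz => S.subset hz.1).aemeasurable hO₁o.measurableSet
  have hlip : ∀ z ∈ N, ∀ ζ ∈ O₁, ‖f ζ‖ₑ ≤ L * ‖π z - ζ‖ₑ := by
    intro z hz ζ hζ
    have := hL (subset_closure hζ.1) (subset_closure (hπ z hz).1)
    rwa [edist_comm ζ, edist_eq_enorm_sub, edist_eq_enorm_sub, (hπ z hz).2, sub_zero] at this
  have hne : ∀ z ∈ N, ∀ ζ ∈ O₁, π z ≠ ζ := by
    rintro z hz ζ hζ rfl
    exact hζ.2 (hπ z hz).2
  set R' : ℝ≥0 := 1 + 2 * R.toNNReal with hR'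
  have hRle : ∀ z ∈ N, ∀ ζ ∈ O₁, ‖π z - ζ‖ₑ ≤ R' := by
    intro z hz ζ hζ
    have h1 := mem_ball_zero_iff.1 (hR (hπ z hz).1)
    have h2 := mem_ball_zero_iff.1 (hR hζ.1)
    rw [← ofReal_norm, ENNReal.ofReal_le_iff_le_toReal ENNReal.coe_ne_top, ENNReal.coe_toReal, hR']
    push_cast
    rw [Real.coe_toNNReal R ((norm_nonneg _).trans h1.le)]
    have := norm_sub_le (π z) ζ
    linarith
  -- Truncated subtraction: `m = 0` when `l ≥ d + p`. As `|f ζ| ≤ L |π z - ζ|`, the factor `|f| ^ l`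
  -- lowers the singularity from order `d + p` to order `m`, and `hl` gives `2 m < d + 1`, so the
  -- squared kernel is integrable uniformly in `z`.
  set m := d + p - l with hm
  obtain ⟨M, hM⟩ := exists_lintegral_ball_inv_enorm_sub_rpow_le (μHE[d + 1] : Measure E)
    (s := ((2 * m : ℕ) : ℝ)) (by positivity) (by rw [hd]; exact_mod_cast (by omega)) R
  set b : E → ℝ≥0∞ := fun ζ => ‖u ζ / ((|f ζ| ^ l : ℝ) : ℂ)‖ₑ with hb
  have hbm : AEMeasurable b μ := by
    rw [hμ, S.restrict_ne_zero hd]; exact hul.1.enorm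
  have hb2 : ∫⁻ ζ, b ζ ^ (2 : ℝ) ∂μ ≠ ∞ := by
    have h1 := hul.2
    rw [eLpNorm_eq_lintegral_rpow_enorm_toReal (by norm_num) (by norm_num),
      ← S.restrict_ne_zero hd] at h1
    simpa [hb, hμ, hO₁] using h1.ne
  -- These sets stay away from the zero set, where the poles `π z` lie; on them the kernel is at
  -- most `(L (i + 1)) ^ (d + p)`.
  set Y : ℕ → Set E := fun i => O₁ ∩ f ⁻¹' {t | ((i : ℝ) + 1)⁻¹ < |t|} with hY
  have hYo : ∀ i, IsOpen (Y i) := fun i =>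
    (S.continuousOn.mono fun z hz => S.subset hz.1).isOpen_inter_preimage hO₁o
      (isOpen_lt continuous_const continuous_abs)
  -- The complements decrease to a null set for `μ`, so the tails of the square integral of `u / |f|
  -- ^ l` tend to 0. Through Cauchy–Schwarz they provide the small constants.
  have htail : Tendsto (fun i => ∫⁻ ζ in (Y i)ᶜ, b ζ ^ (2 : ℝ) ∂μ) atTop (𝓝 0) := by
    refine tendsto_setLIntegral_zero hb2 ?_
    have h1 : μ (⋂ i, (Y i)ᶜ) = 0 := by
      rw [hμ, Measure.restrict_apply (MeasurableSet.iInter fun i => (hYo i).measurableSet.compl)]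
      convert measure_empty (μ := (μHE[d + 1] : Measure E))
      refine eq_empty_of_forall_notMem fun ζ ⟨h2, h3⟩ => ?_
      obtain ⟨i, hi⟩ := exists_nat_one_div_lt (abs_pos.2 h3.2)
      exact mem_iInter.1 h2 i ⟨h3, by simpa using hi⟩
    rw [← h1]
    refine tendsto_measure_iInter_atTop (fun i => (hYo i).measurableSet.compl.nullMeasurableSet)
      (fun i j hij => compl_subset_compl.2 fun ζ hζ => ⟨hζ.1, ?_⟩) ⟨0, measure_ne_top _ _⟩
    refine lt_of_le_of_lt ?_ (show ((i : ℝ) + 1)⁻¹ < |f ζ| from hζ.2)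
    have : (i : ℝ) ≤ j := by exact_mod_cast hij
    gcongr
  set A : ℝ≥0 := L ^ l * R' ^ l with hA
  refine ⟨Y, fun i ζ => C₁ * ((L * ((i : ℝ) + 1)) ^ (d + p) * ‖u ζ‖),
    fun i => (C₁ * (((A : ℝ≥0∞) ^ (2 : ℝ) * M) ^ (1 / 2 : ℝ) *
      (∫⁻ ζ in (Y i)ᶜ, b ζ ^ (2 : ℝ) ∂μ) ^ (1 / 2 : ℝ)) : ℝ≥0∞).toReal,
    fun i => (hYo i).measurableSet, fun i => ?_, fun i => ?_, ?_, fun i => ENNReal.toReal_nonneg,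
    fun i z hz => ?_⟩
  · exact ((hu1.norm.const_mul _).const_mul _).integrableOn
  · refine Eventually.of_forall fun ζ hζ z hz => ?_
    have h1 : 0 < ‖π z - ζ‖ := norm_pos_iff.2 (sub_ne_zero.2 (hne z hz ζ hζ.1))
    have h2 : |f ζ| ≤ L * ‖π z - ζ‖ := by
      have := hlip z hz ζ hζ.1
      rw [← ofReal_norm, ← ofReal_norm, ← ENNReal.ofReal_coe_nnreal, ← ENNReal.ofReal_mul (by simp),
        ENNReal.ofReal_le_ofReal_iff (by positivity)] at this
      exact this
    have h3 : ((i : ℝ) + 1)⁻¹ < |f ζ| := hζ.2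
    have h4 : ‖π z - ζ‖⁻¹ ≤ L * ((i : ℝ) + 1) := by
      rw [inv_le_iff_one_le_mul₀ h1]
      have h5 : ((i : ℝ) + 1)⁻¹ ≤ L * ‖π z - ζ‖ := h3.le.trans h2
      rw [inv_le_iff_one_le_mul₀ (by positivity)] at h5
      linarith
    beta_reduce
    rw [← inv_pow]
    gcongr
  · have h1 : Tendsto (fun i => (C₁ * (((A : ℝ≥0∞) ^ (2 : ℝ) * M) ^ (1 / 2 : ℝ) *
        (∫⁻ ζ in (Y i)ᶜ, b ζ ^ (2 : ℝ) ∂μ) ^ (1 / 2 : ℝ)) : ℝ≥0∞)) atTop (𝓝 0) := by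
      have h2 : Tendsto (fun i => (∫⁻ ζ in (Y i)ᶜ, b ζ ^ (2 : ℝ) ∂μ) ^ (1 / 2 : ℝ)) atTop
          (𝓝 0) := by
        have := ((ENNReal.continuous_rpow_const (y := 1 / 2)).tendsto 0).comp htail
        simpa [Function.comp_def] using this
      have h3 := ENNReal.Tendsto.const_mul (a := ((A : ℝ≥0∞) ^ (2 : ℝ) * M) ^ (1 / 2 : ℝ)) h2
        (Or.inr (by finiteness))
      have h4 := ENNReal.Tendsto.const_mul (a := (C₁ : ℝ≥0∞)) h3 (Or.inr (by finiteness))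
      simpa using h4
    have := (ENNReal.tendsto_toReal ENNReal.zero_ne_top).comp h1
    simpa [Function.comp_def] using this
  · have hfinb : ∫⁻ ζ in (Y i)ᶜ, b ζ ^ (2 : ℝ) ∂μ ≠ ∞ :=
      ((lintegral_mono' Measure.restrict_le_self le_rfl).trans_lt (lt_top_iff_ne_top.2 hb2)).ne
    rw [ENNReal.ofReal_toReal (by finiteness)]
    set a : E → ℝ≥0∞ := fun ζ => (‖π z - ζ‖ₑ ^ (d + p))⁻¹ * ‖f ζ‖ₑ ^ l with ha
    have ham : AEMeasurable a μ := by
      refine AEMeasurable.mul ?_ (hfm.enorm.pow_const l)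
      exact (((measurable_const.sub measurable_id).enorm.pow_const _).inv).aemeasurable
    have hae : ∀ᵐ ζ ∂μ, ζ ∈ O₁ := ae_restrict_mem hO₁o.measurableSet
    have ha2 : ∫⁻ ζ in (Y i)ᶜ, a ζ ^ (2 : ℝ) ∂μ ≤ (A : ℝ≥0∞) ^ (2 : ℝ) * M := by
      calc ∫⁻ ζ in (Y i)ᶜ, a ζ ^ (2 : ℝ) ∂μ ≤ ∫⁻ ζ, a ζ ^ (2 : ℝ) ∂μ :=
            lintegral_mono' Measure.restrict_le_self le_rfl
        _ ≤ ∫⁻ ζ, (A : ℝ≥0∞) ^ (2 : ℝ) * (‖ζ - π z‖ₑ ^ ((2 * m : ℕ) : ℝ))⁻¹ ∂μ := by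
            refine lintegral_mono_ae ?_
            filter_upwards [hae] with ζ hζ
            have hx0 : ‖π z - ζ‖ₑ ≠ 0 := enorm_ne_zero.2 (sub_ne_zero.2 (hne z hz ζ hζ))
            have hxt : ‖π z - ζ‖ₑ ≠ ∞ := enorm_ne_top
            have h1 : a ζ ≤ A * (‖π z - ζ‖ₑ ^ m)⁻¹ := by
              have hxpow : ∀ n : ℕ, ‖π z - ζ‖ₑ ^ n * (‖π z - ζ‖ₑ ^ n)⁻¹ = 1 := fun n =>
                ENNReal.mul_inv_cancel (pow_ne_zero _ hx0) (by finiteness)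
              have h2 : ‖π z - ζ‖ₑ ^ l * (‖π z - ζ‖ₑ ^ (d + p))⁻¹ ≤
                  (R' : ℝ≥0∞) ^ l * (‖π z - ζ‖ₑ ^ m)⁻¹ := by
                rcases le_total l (d + p) with h | h
                · have e : d + p = l + m := by omega
                  rw [e, pow_add, ENNReal.mul_inv (Or.inr (by finiteness))
                    (Or.inr (pow_ne_zero _ hx0)), ← mul_assoc, hxpow]
                  gcongr
                  refine one_le_pow₀ ?_
                  rw [hR']; push_cast; exact le_self_add
                · have e : m = 0 := by omega
                  have e2 : l = (l - (d + p)) + (d + p) := by omega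
                  rw [e, pow_zero, inv_one, mul_one]
                  calc ‖π z - ζ‖ₑ ^ l * (‖π z - ζ‖ₑ ^ (d + p))⁻¹
                      = ‖π z - ζ‖ₑ ^ (l - (d + p)) := by
                        conv_lhs => rw [e2, pow_add, mul_assoc, hxpow, mul_one]
                    _ ≤ (R' : ℝ≥0∞) ^ (l - (d + p)) := by
                        gcongr; exact hRle z hz ζ hζ
                    _ ≤ (R' : ℝ≥0∞) ^ l := by
                        refine pow_le_pow_right₀ ?_ (by omega)
                        rw [hR']; push_cast; exact le_self_add
              calc a ζ ≤ (‖π z - ζ‖ₑ ^ (d + p))⁻¹ * (L * ‖π z - ζ‖ₑ) ^ l := by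
                    simp only [ha]; gcongr; exact hlip z hz ζ hζ
                _ = L ^ l * (‖π z - ζ‖ₑ ^ l * (‖π z - ζ‖ₑ ^ (d + p))⁻¹) := by
                    rw [mul_pow]; ring
                _ ≤ L ^ l * ((R' : ℝ≥0∞) ^ l * (‖π z - ζ‖ₑ ^ m)⁻¹) := by gcongr
                _ = _ := by rw [hA]; push_cast; ring
            calc a ζ ^ (2 : ℝ) ≤ (A * (‖π z - ζ‖ₑ ^ m)⁻¹) ^ (2 : ℝ) := by gcongr
              _ = _ := by
                rw [ENNReal.mul_rpow_of_nonneg _ _ (by norm_num), enorm_sub_rev ζ,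
                  ENNReal.rpow_natCast, ENNReal.inv_rpow]
                norm_cast
                rw [← pow_mul, mul_comm m 2]
        _ ≤ (A : ℝ≥0∞) ^ (2 : ℝ) * M := by
            rw [lintegral_const_mul' _ _ (by finiteness)]
            gcongr
            refine le_trans ?_ (hM (π z))
            exact lintegral_mono_set fun ζ hζ => hR hζ.1
    calc ∫⁻ ζ in (Y i)ᶜ, ENNReal.ofReal (C₁ * ((‖π z - ζ‖ ^ (d + p))⁻¹ * ‖u ζ‖)) ∂μ
        = ∫⁻ ζ in (Y i)ᶜ, C₁ * (a * b) ζ ∂μ := by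
          refine lintegral_congr_ae ?_
          filter_upwards [ae_restrict_of_ae hae] with ζ hζ
          have hx : 0 < ‖π z - ζ‖ := norm_pos_iff.2 (sub_ne_zero.2 (hne z hz ζ hζ))
          have hfp : 0 < |f ζ| := abs_pos.2 hζ.2
          have e1 : a ζ = ENNReal.ofReal ((‖π z - ζ‖ ^ (d + p))⁻¹ * |f ζ| ^ l) := by
            rw [ENNReal.ofReal_mul (by positivity), ENNReal.ofReal_inv_of_pos (by positivity),
              ENNReal.ofReal_pow (norm_nonneg _), ENNReal.ofReal_pow (abs_nonneg _), ofReal_norm,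
              ← Real.norm_eq_abs, ofReal_norm]
          have e2 : b ζ = ENNReal.ofReal (‖u ζ‖ / |f ζ| ^ l) := by
            rw [hb]
            simp only
            rw [← ofReal_norm, norm_div, Complex.norm_real, Real.norm_of_nonneg (by positivity)]
          rw [Pi.mul_apply, e1, e2, ← ENNReal.ofReal_mul (by positivity),
            ← ENNReal.ofReal_coe_nnreal, ← ENNReal.ofReal_mul (by positivity)]
          congr 1
          field_simp
      _ ≤ C₁ * ((∫⁻ ζ in (Y i)ᶜ, a ζ ^ (2 : ℝ) ∂μ) ^ (1 / 2 : ℝ) *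
          (∫⁻ ζ in (Y i)ᶜ, b ζ ^ (2 : ℝ) ∂μ) ^ (1 / 2 : ℝ)) := by
          rw [lintegral_const_mul' _ _ ENNReal.coe_ne_top]
          gcongr
          exact ENNReal.lintegral_mul_le_Lp_mul_Lq _ Real.HolderConjugate.two_two
            ham.restrict hbm.restrict
      _ ≤ _ := by gcongr

end

/-! ### Regularity of potentials along the zero set -/

section

variable {E : Type} [NormedAddCommGroup E] [NormedSpace ℝ E] {p : ℕ} {U W : Set E} {f : E → ℝ}
  [FiniteDimensional ℝ E] [MeasurableSpace E] [BorelSpace E] {d l : ℕ} {k : E → E → ℂ} {u : E → ℂ}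

omit [NormedSpace ℝ E] [FiniteDimensional ℝ E] [MeasurableSpace E] [BorelSpace E] in
theorem IsSmoothKernel.isOpen_offDiag (hW : IsOpen W) :
    IsOpen ((W ×ˢ W) ∩ {q : E × E | q.1 ≠ q.2}) :=
  (hW.prod hW).inter (isOpen_ne_fun continuous_fst continuous_snd)

omit [FiniteDimensional ℝ E] [MeasurableSpace E] [BorelSpace E] in
theorem IsSmoothKernel.contDiffAt_left (hk : IsSmoothKernel p d W k) (hW : IsOpen W) {z ζ : E}
    (hz : z ∈ W) (hζ : ζ ∈ W) (h : z ≠ ζ) : ContDiffAt ℝ p (fun z => k z ζ) z := by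
  have h1 := hk.contDiffOn.contDiffAt ((IsSmoothKernel.isOpen_offDiag hW).mem_nhds
    (show (z, ζ) ∈ _ from ⟨⟨hz, hζ⟩, h⟩))
  exact ContDiffAt.comp z (g := fun q : E × E => k q.1 q.2) (f := fun z : E => (z, ζ)) h1
    (by fun_prop)

omit [FiniteDimensional ℝ E] [MeasurableSpace E] [BorelSpace E] in
/-- Bounds for the derivatives of a kernel composed with a map into the zero set of `f`. -/
theorem IsSmoothKernel.exists_norm_comp_le (hk : IsSmoothKernel p d W k) (hW : IsOpen W)
    (hWb : Bornology.IsBounded W) {N : Set E} (hN : IsOpen N) {π : E → E} (hπ : ContDiffOn ℝ p π N)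
    (hπW : MapsTo π N W) {D : ℝ} (hD1 : 1 ≤ D)
    (hD : ∀ z ∈ N, ∀ i ≤ p, ‖iteratedFDeriv ℝ i π z‖ ≤ D) :
    ∃ C : ℝ≥0, ∀ j ≤ p, ∀ z ∈ N, ∀ ζ ∈ W, (∀ y ∈ N, π y ≠ ζ) →
      ‖iteratedFDeriv ℝ j (fun z => k (π z) ζ) z‖ ≤ C * (‖π z - ζ‖ ^ (d + p))⁻¹ := by
  obtain ⟨C, hC0, hC⟩ := hk.derivBound
  obtain ⟨R, hR⟩ := hWb.subset_ball 0
  set R' : ℝ := 1 + 2 * |R| with hR'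
  have hR'1 : 1 ≤ R' := by rw [hR']; linarith [abs_nonneg R]
  refine ⟨⟨p.factorial * (C * R' ^ p) * D ^ p, by positivity⟩, fun j hj z hz ζ hζ hne => ?_⟩
  have hx : 0 < ‖π z - ζ‖ := norm_pos_iff.2 (sub_ne_zero.2 (hne z hz))
  have hxR : ‖π z - ζ‖ ≤ R' := by
    have h1 := mem_ball_zero_iff.1 (hR (hπW hz))
    have h2 := mem_ball_zero_iff.1 (hR hζ)
    have := norm_sub_le (π z) ζ
    have := le_abs_self R
    linarith
  have ho : IsOpen (W \ {ζ}) := hW.sdiff isClosed_singleton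
  have hcd : ContDiffOn ℝ p (fun z => k z ζ) (W \ {ζ}) := fun y hy =>
    (hk.contDiffAt_left hW hy.1 hζ hy.2).contDiffWithinAt
  -- The Faà di Bruno bound. The singularity of order `d + i` is weakened to order `d + p` for every
  -- `i ≤ p` by means of `‖π z - ζ‖ ≤ R'`, so one majorant serves all orders.
  have h1 := norm_iteratedFDerivWithin_comp_le (n := j) hcd hπ (by exact_mod_cast hj)
    ho.uniqueDiffOn hN.uniqueDiffOn (fun y hy => ⟨hπW hy, hne y hy⟩) hz
    (C := C * R' ^ p * (‖π z - ζ‖ ^ (d + p))⁻¹) (D := D) (fun i hi => ?_) (fun i hi1 hi => ?_)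
  · rw [iteratedFDerivWithin_of_isOpen _ hN hz] at h1
    refine h1.trans ?_
    change _ ≤ (p.factorial * (C * R' ^ p) * D ^ p) * _
    have e1 : (j.factorial : ℝ) ≤ p.factorial := by exact_mod_cast Nat.factorial_le hj
    have e2 : D ^ j ≤ D ^ p := pow_le_pow_right₀ hD1 hj
    calc (j.factorial : ℝ) * (C * R' ^ p * (‖π z - ζ‖ ^ (d + p))⁻¹) * D ^ j
        ≤ p.factorial * (C * R' ^ p * (‖π z - ζ‖ ^ (d + p))⁻¹) * D ^ p := by gcongr
      _ = _ := by ring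
  · rw [iteratedFDerivWithin_of_isOpen _ ho ⟨hπW hz, hne z hz⟩]
    have h2 := hC i (hi.trans hj) (π z) (hπW hz) ζ hζ (hne z hz)
    rw [← div_eq_mul_inv, le_div_iff₀ (by positivity)]
    have e : d + p = (d + i) + (p - i) := by omega
    rw [e, pow_add, ← mul_assoc]
    calc _ ≤ C * ‖π z - ζ‖ ^ (p - i) := by gcongr
      _ ≤ C * R' ^ (p - i) := by gcongr
      _ ≤ C * R' ^ p := by
          gcongr
          omega
  · rw [iteratedFDerivWithin_of_isOpen _ hN hz]
    refine (hD z hz i (hi.trans hj)).trans ?_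
    calc D = D ^ 1 := (pow_one D).symm
      _ ≤ D ^ i := pow_le_pow_right₀ hD1 hi1

/-- The potential of a density vanishing to high order on the zero set of `f` is `C^p` along that
zero set. -/
theorem IsSmoothKernel.exists_extension (hk : IsSmoothKernel p d W k) (S : LevelData p U W f)
    (hd : Module.finrank ℝ E = d + 1) (hl : 2 * (d + p) < 2 * l + (d + 1))
    (hu : MemLp u 2 (μHE[d + 1].restrict W))
    (hul : MemLp (fun z => u z / ((|f z| ^ l : ℝ) : ℂ)) 2 (μHE[d + 1].restrict W))
    {z₀ : E} (hz₀ : z₀ ∈ W) (hfz₀ : f z₀ = 0) :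
    ∃ V : Set E, IsOpen V ∧ z₀ ∈ V ∧ ∃ G : E → ℂ, ContDiffOn ℝ p G V ∧
      EqOn G (potential d W k u) ({z | z ∈ W ∧ f z = 0} ∩ V) ∧
      (∀ z ∈ V, z ∈ W → f z = 0 → IntegrableOn (fun ζ => k z ζ * u ζ) W (μHE[d + 1])) ∧
      ∀ X : E, fderiv ℝ f z₀ X = 0 →
        IntegrableOn (fun ζ => fderiv ℝ (fun z => k z ζ) z₀ X * u ζ) W (μHE[d + 1]) ∧
        fderiv ℝ G z₀ X = ∫ ζ in W, fderiv ℝ (fun z => k z ζ) z₀ X * u ζ ∂(μHE[d + 1]) := by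
  have hp := S.cast_p_ne_zero
  obtain ⟨c, hzc, -⟩ := exists_levelChart S.p_pos S.isOpen_U S.contDiffOn (S.subset hz₀)
    (S.fderiv_ne_zero _ (S.subset hz₀))
  have hret : c.retract z₀ = z₀ := c.retract_eq hzc hfz₀
  have hdom : z₀ ∈ c.retractDomain := c.mem_retractDomain hzc hfz₀
  have hretc : Tendsto c.retract (𝓝 z₀) (𝓝 z₀) := by
    have := (c.contDiffOn_retract.continuousOn.continuousAt
      (c.isOpen_retractDomain.mem_nhds hdom)).tendsto
    rwa [hret] at this
  obtain ⟨D, hD1, hD⟩ := exists_norm_iteratedFDeriv_le c.isOpen_retractDomain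
    c.contDiffOn_retract hdom
  obtain ⟨N, hNsub, hN, hzN⟩ := mem_nhds_iff.1 (inter_mem (inter_mem
    (c.isOpen_retractDomain.mem_nhds hdom) (c.Ψ.open_source.mem_nhds hzc))
    (inter_mem (hretc (S.isOpen_W.mem_nhds hz₀)) hD))
  -- After composition with the retraction the pole always lies on the zero set, where the vanishing
  -- of `u` compensates the singularity. The result agrees with the potential on the zero set, which
  -- is all that an extension has to do.
  set π := c.retract with hπdef
  have hπ : ∀ z ∈ N, π z ∈ W ∧ f (π z) = 0 := fun z hz =>
    ⟨(hNsub hz).2.1, c.f_retract (hNsub hz).1.1⟩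
  have hπN : ContDiffOn ℝ p π N := c.contDiffOn_retract.mono fun z hz => (hNsub hz).1.1
  obtain ⟨C, hC⟩ := hk.exists_norm_comp_le S.isOpen_W S.isBounded hN hπN (fun z hz => (hπ z hz).1)
    hD1 (fun z hz => (hNsub hz).2.2)
  have hT := S.isTight hd hl hu hul hπ C
  -- Deleting the null set `f = 0` from the domain of integration keeps `ζ` away from `π z`, so
  -- every integrand is `C^p` in `z`.
  set O₁ := {ζ | ζ ∈ W ∧ f ζ ≠ 0} with hO₁
  have hO₁o : IsOpen O₁ := S.isOpen_ne_zero
  have hμ : (μHE[d + 1] : Measure E).restrict O₁ = μHE[d + 1].restrict W := S.restrict_ne_zero hd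
  have hne : ∀ ζ ∈ O₁, ∀ z ∈ N, π z ≠ ζ := by
    rintro ζ hζ z hz rfl
    exact hζ.2 (hπ z hz).2
  have hae : ∀ᵐ ζ ∂((μHE[d + 1] : Measure E).restrict O₁), ζ ∈ O₁ :=
    ae_restrict_mem hO₁o.measurableSet
  have hjoint : ContDiffOn ℝ p (fun q : E × E => k (π q.1) q.2) (N ×ˢ O₁) :=
    hk.contDiffOn.comp (f := fun q : E × E => (π q.1, q.2))
      ((hπN.comp contDiff_fst.contDiffOn fun q hq => hq.1).prodMk contDiff_snd.contDiffOn)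
      fun q hq => ⟨⟨(hπ _ hq.1).1, hq.2.1⟩, hne _ hq.2 _ hq.1⟩
  have hcd : ∀ ζ ∈ O₁, ContDiffOn ℝ p (fun z => k (π z) ζ) N := fun ζ hζ =>
    hjoint.comp (f := fun z : E => (z, ζ)) (by fun_prop) fun z hz => ⟨hz, hζ⟩
  have hsm : ∀ j ≤ p, ∀ ζ ∈ O₁, ∀ z ∈ N, iteratedFDeriv ℝ j (fun z => u ζ • k (π z) ζ) z =
      u ζ • iteratedFDeriv ℝ j (fun z => k (π z) ζ) z := fun j hj ζ hζ z hz =>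
    iteratedFDeriv_const_smul_apply'
      (((hcd ζ hζ).contDiffAt (hN.mem_nhds hz)).of_le (by exact_mod_cast hj))
  have hum : AEStronglyMeasurable u ((μHE[d + 1] : Measure E).restrict O₁) := by
    rw [hμ]; exact hu.1
  have hg : ∀ᵐ ζ ∂((μHE[d + 1] : Measure E).restrict O₁),
      ContDiffOn ℝ p (fun z => u ζ • k (π z) ζ) N := by
    filter_upwards [hae] with ζ hζ using (hcd ζ hζ).const_smul (u ζ)
  have hm : ∀ j ≤ p, ∀ z ∈ N, AEStronglyMeasurable
      (fun ζ => iteratedFDeriv ℝ j (fun z => u ζ • k (π z) ζ) z)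
      ((μHE[d + 1] : Measure E).restrict O₁) := by
    intro j hj z hz
    have h1 : ContinuousOn (fun ζ => iteratedFDeriv ℝ j (fun z => k (π z) ζ) z) O₁ :=
      (continuousOn_iteratedFDeriv_left hj (hN.prod hO₁o) (H := fun z ζ => k (π z) ζ)
        hjoint).comp (f := fun ζ : E => (z, ζ)) (by fun_prop) fun ζ hζ => ⟨hz, hζ⟩
    refine (hum.smul (h1.aestronglyMeasurable hO₁o.measurableSet)).congr ?_
    filter_upwards [hae] with ζ hζ using (hsm j hj ζ hζ z hz).symm
  have hB : ∀ j ≤ p, ∀ᵐ ζ ∂((μHE[d + 1] : Measure E).restrict O₁), ∀ z ∈ N,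
      ‖iteratedFDeriv ℝ j (fun z => u ζ • k (π z) ζ) z‖ ≤
        C * ((‖π z - ζ‖ ^ (d + p))⁻¹ * ‖u ζ‖) := by
    intro j hj
    filter_upwards [hae] with ζ hζ z hz
    rw [hsm j hj ζ hζ z hz, norm_smul, ← mul_assoc, mul_comm]
    gcongr
    exact hC j hj z hz ζ hζ.1 (hne ζ hζ)
  have hG := hT.contDiffOn_integral hN p hg hm hB
  have hm0 : ∀ z ∈ N, AEStronglyMeasurable (fun ζ => u ζ • k (π z) ζ)
      ((μHE[d + 1] : Measure E).restrict O₁) := fun z hz => by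
    have := (continuousMultilinearCurryFin0 ℝ E ℂ).continuous.comp_aestronglyMeasurable
      (hm 0 (by omega) z hz)
    simpa [iteratedFDeriv_zero_eq_comp] using this
  have hm1 : ∀ z ∈ N, AEStronglyMeasurable (fun ζ => fderiv ℝ (fun z => u ζ • k (π z) ζ) z)
      ((μHE[d + 1] : Measure E).restrict O₁) := fun z hz => by
    have := ((continuousMultilinearCurryFin1 ℝ E ℂ).continuous.comp_aestronglyMeasurable
      (hm 1 S.p_pos z hz))
    refine this.congr (Eventually.of_forall fun ζ => ?_)
    ext v
    simp [iteratedFDeriv_succ_eq_comp_right]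
  have hB0 : ∀ᵐ ζ ∂((μHE[d + 1] : Measure E).restrict O₁), ∀ z ∈ N,
      ‖u ζ • k (π z) ζ‖ ≤ C * ((‖π z - ζ‖ ^ (d + p))⁻¹ * ‖u ζ‖) := by
    simpa using hB 0 (by omega)
  have hB1 : ∀ᵐ ζ ∂((μHE[d + 1] : Measure E).restrict O₁), ∀ z ∈ N,
      ‖fderiv ℝ (fun z => u ζ • k (π z) ζ) z‖ ≤ C * ((‖π z - ζ‖ ^ (d + p))⁻¹ * ‖u ζ‖) := by
    filter_upwards [hB 1 S.p_pos] with ζ h z hz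
    have := h z hz
    rwa [← norm_iteratedFDeriv_fderiv, norm_iteratedFDeriv_zero] at this
  have hdiff : ∀ᵐ ζ ∂((μHE[d + 1] : Measure E).restrict O₁),
      DifferentiableOn ℝ (fun z => u ζ • k (π z) ζ) N :=
    hg.mono fun ζ h => h.differentiableOn hp
  have hderiv := hT.hasFDerivAt_integral hN hm0 hm1 hB0 hB1 hdiff hzN
  have hint1 : Integrable (fun ζ => fderiv ℝ (fun z => u ζ • k (π z) ζ) z₀)
      ((μHE[d + 1] : Measure E).restrict O₁) :=
    hT.integrable (g := fun z ζ => fderiv ℝ (fun z => u ζ • k (π z) ζ) z) hm1 hB1 hzN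
  refine ⟨N, hN, hzN, fun z => ∫ ζ in O₁, u ζ • k (π z) ζ ∂(μHE[d + 1]), hG, ?_, ?_, ?_⟩
  · rintro z ⟨⟨hzW, hfz⟩, hz⟩
    have e : π z = z := c.retract_eq (hNsub hz).1.2 hfz
    simp only [e, potential, ← hμ, smul_eq_mul, mul_comm]
  · intro z hz hzW hfz
    have e : π z = z := c.retract_eq (hNsub hz).1.2 hfz
    have h1 := hT.integrable hm0 hB0 hz
    rw [IntegrableOn, ← hμ]
    simpa only [e, smul_eq_mul, mul_comm] using h1
  · intro X hX
    have hfd : DifferentiableAt ℝ f z₀ :=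
      (S.contDiffOn.contDiffAt (S.isOpen_U.mem_nhds (S.subset hz₀))).differentiableAt hp
    -- Tangential derivatives at `z₀` do not see the retraction, so in these directions the
    -- extension is differentiated as if `π` were absent.
    have hrX : fderiv ℝ π z₀ X = X := c.fderiv_retract hp hzc hfz₀ hfd hX
    have hπd : HasFDerivAt π (fderiv ℝ π z₀) z₀ :=
      ((hπN.contDiffAt (hN.mem_nhds hzN)).differentiableAt hp).hasFDerivAt
    have key : ∀ ζ ∈ O₁, fderiv ℝ (fun z => u ζ • k (π z) ζ) z₀ X =
        fderiv ℝ (fun z => k z ζ) z₀ X * u ζ := by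
      intro ζ hζ
      have hne0 : z₀ ≠ ζ := by have := hne ζ hζ z₀ hzN; rwa [hret] at this
      have h1 : HasFDerivAt (fun z => k z ζ) (fderiv ℝ (fun z => k z ζ) z₀) (π z₀) := by
        rw [hret]
        exact ((hk.contDiffAt_left S.isOpen_W hz₀ hζ.1 hne0).differentiableAt hp).hasFDerivAt
      have h2 := (h1.comp z₀ hπd).const_smul (u ζ)
      have h3 : fderiv ℝ (fun z => u ζ • k (π z) ζ) z₀ = _ := h2.fderiv
      rw [h3]
      simp [hrX, mul_comm]
    have hint2 := (ContinuousLinearMap.apply ℝ ℂ X).integrable_comp hint1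
    constructor
    · rw [IntegrableOn, ← hμ]
      refine hint2.congr ?_
      filter_upwards [hae] with ζ hζ
      exact key ζ hζ
    · rw [hderiv.fderiv, ContinuousLinearMap.integral_apply hint1, ← hμ]
      exact setIntegral_congr_fun hO₁o.measurableSet key

end

/-! ### The kernel with numerator `K₁`: the second and third assertions -/

section

variable {n : ℕ}

/-- The form `2 * n - 1 + 1` exhibits the real dimension as `d + 1`, to match the general results.
-/
theorem finrank_Cn (hn : 0 < n) : Module.finrank ℝ (Cn n) = 2 * n - 1 + 1 := by
  rw [← Module.finrank_mul_finrank ℝ ℂ]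
  simp
  omega

theorem volume_Cn (hn : 0 < n) : (volume : Measure (Cn n)) = μHE[2 * n - 1 + 1] := by
  rw [← finrank_Cn hn, InnerProductSpace.euclideanHausdorffMeasure_eq_volume]

theorem IsDiffeoFamily.levelFamily {p : ℕ} {W : TopologicalSpace.Opens (Cn n)} {f : Cn n → ℝ}
    {σs : ℝ} (hσs : 0 < σs) {φ : ℝ → Cn n → Cn n} (h : IsDiffeoFamily p (level W f) σs φ) :
    LevelFamily p (W : Set (Cn n)) f σs φ where
  pos := hσs
  joint := h.jointly_Cp
  mapsTo := fun σ hσ => (h.diffeo σ hσ).1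
  injOn := fun σ hσ => by
    obtain ⟨-, ψ, -, hinv, -⟩ := h.diffeo σ hσ
    exact hinv.1.injOn
  at_zero := fun z hz hfz => h.at_zero z ⟨hz, hfz⟩

/-- The function `‖x‖ ^ (-2m)`. -/
noncomputable def invNormPow {E : Type*} [NormedAddCommGroup E] (m : ℕ) (x : E) : ℂ :=
  (((‖x‖ ^ (2 * m))⁻¹ : ℝ) : ℂ)

theorem contDiffOn_invNormPow {E : Type*} [NormedAddCommGroup E] [InnerProductSpace ℝ E]
    {N : WithTop ℕ∞} (m : ℕ) : ContDiffOn ℝ N (invNormPow m : E → ℂ) {0}ᶜ := by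
  refine Complex.ofRealCLM.contDiff.comp_contDiffOn (ContDiffOn.inv ?_ fun x hx => ?_)
  · simp_rw [pow_mul]
    exact ((contDiff_norm_sq ℝ).pow m).contDiffOn
  · exact pow_ne_zero _ (norm_ne_zero_iff.2 hx)

theorem invNormPow_smul {E : Type*} [NormedAddCommGroup E] [NormedSpace ℝ E] (m : ℕ) {t : ℝ}
    (ht : 0 < t) (x : E) : invNormPow m (t • x) = (t ^ (2 * m))⁻¹ • invNormPow m x := by
  simp only [invNormPow, norm_smul, Real.norm_of_nonneg ht.le, mul_pow, mul_inv,
    Complex.real_smul]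
  push_cast
  ring

theorem kernel_eq (K₁ : Cn n → Cn n → ℂ) (z ζ : Cn n) :
    kernel K₁ z ζ = K₁ z ζ * invNormPow (2 * n - 1) (z - ζ) := by
  have e : 4 * n - 2 = 2 * (2 * n - 1) := by omega
  rw [kernel, invNormPow, div_eq_mul_inv, e]
  push_cast
  rfl

theorem continuousOn_kernel {p : ℕ} {U : Set (Cn n)} {K₁ : Cn n → Cn n → ℂ}
    (hK : IsNumerator p U K₁) : ContDiffOn ℝ p (fun q : Cn n × Cn n => kernel K₁ q.1 q.2)
      ((U ×ˢ U) ∩ {q | q.1 ≠ q.2}) := by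
  simp_rw [kernel_eq]
  refine (hK.1.mono inter_subset_left).mul ?_
  refine (contDiffOn_invNormPow _).comp (contDiff_fst.sub contDiff_snd).contDiffOn ?_
  intro q hq
  exact sub_ne_zero.2 hq.2

theorem isWeakKernel_kernel {p : ℕ} {U W : Set (Cn n)} (hn : 0 < n) (hWU : W ⊆ U)
    {K₁ : Cn n → Cn n → ℂ} (hK : IsNumerator p U K₁) :
    IsWeakKernel (2 * n - 1) W (kernel K₁) := by
  refine ⟨(continuousOn_kernel hK).continuousOn.mono
    (inter_subset_inter_left _ (prod_mono hWU hWU)), ?_⟩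
  obtain ⟨C, hC⟩ := hK.2
  refine ⟨C.toNNReal, fun z hz ζ hζ => ?_⟩
  have h1 : ‖K₁ z ζ‖ ≤ C.toNNReal * ‖z - ζ‖ ^ (2 * n - 1) :=
    (hC z (hWU hz) ζ (hWU hζ)).trans (by gcongr; exact Real.le_coe_toNNReal C)
  rw [kernel_eq, norm_mul, invNormPow, Complex.norm_real, Real.norm_of_nonneg (by positivity)]
  rcases eq_or_lt_of_le (norm_nonneg (z - ζ)) with h | h
  · rw [← h, zero_pow (by omega)] at *
    simp
    positivity
  · calc ‖K₁ z ζ‖ * (‖z - ζ‖ ^ (2 * (2 * n - 1)))⁻¹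
        ≤ C.toNNReal * ‖z - ζ‖ ^ (2 * n - 1) * (‖z - ζ‖ ^ (2 * (2 * n - 1)))⁻¹ := by gcongr
      _ = _ := by
        rw [two_mul (2 * n - 1), pow_add]
        field_simp

/-- Below order `2 * n - 1` this is the assumed vanishing, order 0 being part of `IsNumerator`. From
that order on, compactness of the closure bounds the derivative and the surplus powers of the
distance are bounded on `W`. -/
theorem exists_numerator_bound {p : ℕ} {U W : Set (Cn n)} (hU : IsOpen U)
    (hWb : Bornology.IsBounded W) (hWU : closure W ⊆ U) {K₁ : Cn n → Cn n → ℂ}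
    (hK : IsNumerator p U K₁) (hK' : HasNumeratorDerivBounds p W K₁) :
    ∃ C : ℝ, 0 ≤ C ∧ ∀ j ≤ p, ∀ z ∈ W, ∀ ζ ∈ W,
      ‖iteratedFDeriv ℝ j (fun z => K₁ z ζ) z‖ * ‖z - ζ‖ ^ j ≤ C * ‖z - ζ‖ ^ (2 * n - 1) := by
  set d := 2 * n - 1 with hd
  obtain ⟨R, hR⟩ := hWb.subset_ball 0
  set R' : ℝ := 1 + 2 * |R| with hR'
  have hR'1 : 1 ≤ R' := by rw [hR']; linarith [abs_nonneg R]
  have hxR : ∀ z ∈ W, ∀ ζ ∈ W, ‖z - ζ‖ ≤ R' := by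
    intro z hz ζ hζ
    have h1 := mem_ball_zero_iff.1 (hR hz)
    have h2 := mem_ball_zero_iff.1 (hR hζ)
    have := norm_sub_le z ζ
    have := le_abs_self R
    linarith
  have hcl : IsCompact (closure W) := hWb.isCompact_closure
  have hb : ∀ j, ∃ C : ℝ, 0 ≤ C ∧ (j ≤ p → ∀ z ∈ W, ∀ ζ ∈ W,
      ‖iteratedFDeriv ℝ j (fun z => K₁ z ζ) z‖ * ‖z - ζ‖ ^ j ≤ C * ‖z - ζ‖ ^ d) := by
    intro j
    by_cases hj : j ≤ p
    swap
    · exact ⟨0, le_rfl, fun h => absurd h hj⟩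
    rcases Nat.lt_or_ge j d with hjd | hjd
    · obtain ⟨C, hC⟩ : ∃ C : ℝ, ∀ z ∈ W, ∀ ζ ∈ W,
          ‖iteratedFDeriv ℝ j (fun z => K₁ z ζ) z‖ ≤ C * ‖z - ζ‖ ^ (d - j) := by
        rcases Nat.eq_zero_or_pos j with rfl | hj0
        · obtain ⟨C, hC⟩ := hK.2
          exact ⟨C, fun z hz ζ hζ => by
            simpa using hC z (hWU (subset_closure hz)) ζ (hWU (subset_closure hζ))⟩
        · obtain ⟨C, hC⟩ := hK'
          exact ⟨C, fun z hz ζ hζ => hC j hj0 hj hjd z hz ζ hζ⟩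
      refine ⟨max C 0, le_max_right _ _, fun _ z hz ζ hζ => ?_⟩
      have e : d = (d - j) + j := by omega
      calc _ ≤ C * ‖z - ζ‖ ^ (d - j) * ‖z - ζ‖ ^ j := by
            gcongr; exact hC z hz ζ hζ
        _ ≤ max C 0 * ‖z - ζ‖ ^ (d - j) * ‖z - ζ‖ ^ j := by
            gcongr; exact le_max_left _ _
        _ = _ := by
            conv_rhs => rw [e, pow_add]
            ring
    · obtain ⟨M, hM⟩ := (hcl.prod hcl).exists_bound_of_continuousOn
        ((continuousOn_iteratedFDeriv_left hj (hU.prod hU) (H := K₁) hK.1).mono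
          (prod_mono hWU hWU))
      refine ⟨max M 0 * R' ^ (j - d), by positivity, fun _ z hz ζ hζ => ?_⟩
      have e : j = (j - d) + d := by omega
      calc _ ≤ max M 0 * ‖z - ζ‖ ^ j := by
            gcongr
            exact (hM (z, ζ) ⟨subset_closure hz, subset_closure hζ⟩).trans (le_max_left _ _)
        _ = max M 0 * ‖z - ζ‖ ^ (j - d) * ‖z - ζ‖ ^ d := by
            conv_lhs => rw [e, pow_add]
            ring
        _ ≤ _ := by
            gcongr
            exact hxR z hz ζ hζ
  choose C hC0 hC using hb
  refine ⟨∑ j ∈ Finset.range (p + 1), C j, Finset.sum_nonneg fun j _ => hC0 j,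
    fun j hj z hz ζ hζ => (hC j hj z hz ζ hζ).trans ?_⟩
  gcongr
  exact Finset.single_le_sum (f := C) (fun j _ => hC0 j) (Finset.mem_range.2 (by omega))

/-- Leibniz rule: the numerator vanishes to order `d`, losing one power for each derivative, and the
denominator contributes a homogeneous function of degree `-2 * d`. -/
theorem isSmoothKernel_kernel {p : ℕ} {U W : Set (Cn n)} (hn : 0 < n) (hU : IsOpen U)
    (hW : IsOpen W) (hWb : Bornology.IsBounded W) (hWU : closure W ⊆ U) {K₁ : Cn n → Cn n → ℂ}
    (hK : IsNumerator p U K₁) (hK' : HasNumeratorDerivBounds p W K₁) :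
    IsSmoothKernel p (2 * n - 1) W (kernel K₁) := by
  have hWU' : W ⊆ U := subset_closure.trans hWU
  refine ⟨isWeakKernel_kernel hn hWU' hK, (continuousOn_kernel hK).mono
    (inter_subset_inter_left _ (prod_mono hWU' hWU')), ?_⟩
  obtain ⟨C, hC0, hC⟩ := exists_numerator_bound hU hWb hWU hK hK'
  obtain ⟨C', hC'0, hC'⟩ := exists_norm_iteratedFDeriv_le_of_homogeneous (E := Cn n) p
    (contDiffOn_invNormPow (2 * n - 1)) (fun t ht x => invNormPow_smul (2 * n - 1) ht x)
  set d := 2 * n - 1 with hd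
  refine ⟨2 ^ p * (C * C'), by positivity, fun j hj z hz ζ hζ hne => ?_⟩
  have hx : 0 < ‖z - ζ‖ := norm_pos_iff.2 (sub_ne_zero.2 hne)
  have ho : IsOpen (W \ {ζ}) := hW.sdiff isClosed_singleton
  have hzo : z ∈ W \ {ζ} := ⟨hz, hne⟩
  have hK1 : ContDiffOn ℝ p (fun z => K₁ z ζ) (W \ {ζ}) :=
    hK.1.comp (f := fun z : Cn n => (z, ζ)) (by fun_prop) fun y hy => ⟨hWU' hy.1, hWU' hζ⟩
  have hg1 : ContDiffOn ℝ p (fun z => invNormPow d (z - ζ)) (W \ {ζ}) :=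
    (contDiffOn_invNormPow d).comp (f := fun z : Cn n => z - ζ) (by fun_prop)
      fun y hy => sub_ne_zero.2 hy.2
  have h1 := norm_iteratedFDerivWithin_mul_le hK1 hg1 ho.uniqueDiffOn hzo (n := j)
    (by exact_mod_cast hj)
  have e0 : (fun z => kernel K₁ z ζ) = fun z => K₁ z ζ * invNormPow d (z - ζ) := by
    ext z; rw [kernel_eq]
  rw [iteratedFDerivWithin_of_isOpen _ ho hzo] at h1
  rw [e0]
  have h2 : ‖iteratedFDeriv ℝ j (fun z => K₁ z ζ * invNormPow d (z - ζ)) z‖ *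
      ‖z - ζ‖ ^ (2 * d + j) ≤ (2 ^ j * (C * C')) * ‖z - ζ‖ ^ d := by
    refine (mul_le_mul_of_nonneg_right h1 (by positivity)).trans ?_
    have h3 : (2 : ℝ) ^ j = ∑ i ∈ Finset.range (j + 1), (j.choose i : ℝ) := by
      exact_mod_cast (Nat.sum_range_choose j).symm
    rw [h3, Finset.sum_mul, Finset.sum_mul, Finset.sum_mul]
    refine Finset.sum_le_sum fun i hi => ?_
    have hij : i ≤ j := by have := Finset.mem_range.1 hi; omega
    rw [iteratedFDerivWithin_of_isOpen _ ho hzo, iteratedFDerivWithin_of_isOpen _ ho hzo,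
      iteratedFDeriv_comp_sub]
    have a1 := hC i (hij.trans hj) z hz ζ hζ
    have a2 := hC' (j - i) (by omega) (z - ζ) (sub_ne_zero.2 hne)
    have e : 2 * d + j = i + (2 * d + (j - i)) := by omega
    rw [e, pow_add]
    calc _ = (j.choose i : ℝ) * ((‖iteratedFDeriv ℝ i (fun z => K₁ z ζ) z‖ * ‖z - ζ‖ ^ i) *
          (‖iteratedFDeriv ℝ (j - i) (invNormPow d) (z - ζ)‖ * ‖z - ζ‖ ^ (2 * d + (j - i)))) := by
          ring
      _ ≤ (j.choose i : ℝ) * ((C * ‖z - ζ‖ ^ d) * C') := by gcongr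
      _ = _ := by ring
  -- One factor `‖z - ζ‖ ^ d` cancels and leaves a singularity of order `d + j`.
  have e : 2 * d + j = (d + j) + d := by omega
  rw [e, pow_add, ← mul_assoc] at h2
  have h4 := le_of_mul_le_mul_right h2 (by positivity)
  refine h4.trans ?_
  gcongr
  norm_num

section

variable {p : ℕ} {W U : TopologicalSpace.Opens (Cn n)} {f : Cn n → ℝ} {σs : ℝ}
  {φ : ℝ → Cn n → Cn n} {u : Cn n → ℂ} {K₁ : Cn n → Cn n → ℂ} {r : ℝ}

theorem integrableOn_ball_iff {k : Cn n → ℂ} (hr : Metric.ball (0 : Cn n) r ⊆ W) (hn : 0 < n) :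
    IntegrableOn (fun ζ => k ζ * (Metric.ball (0 : Cn n) r).indicator u ζ) W
      (μHE[2 * n - 1 + 1]) ↔ IntegrableOn (fun ζ => k ζ * u ζ) (Metric.ball 0 r) := by
  have e : (fun ζ => k ζ * (Metric.ball (0 : Cn n) r).indicator u ζ) =
      (Metric.ball (0 : Cn n) r).indicator fun ζ => k ζ * u ζ := by
    ext ζ
    by_cases h : ζ ∈ Metric.ball (0 : Cn n) r <;> simp [h]
  rw [e, IntegrableOn, integrable_indicator_iff measurableSet_ball, IntegrableOn,
    Measure.restrict_restrict measurableSet_ball, inter_eq_left.2 hr, ← volume_Cn hn]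
  rfl

/-- The restriction to the ball is moved into the density, so that the domain of integration is
always `W`. -/
theorem kernelIntegral_eq (hn : 0 < n) (hr : Metric.ball (0 : Cn n) r ⊆ W) :
    kernelIntegral K₁ u r =
      potential (2 * n - 1) W (kernel K₁) ((Metric.ball (0 : Cn n) r).indicator u) := by
  ext z
  have e : (fun ζ => kernel K₁ z ζ * (Metric.ball (0 : Cn n) r).indicator u ζ) =
      (Metric.ball (0 : Cn n) r).indicator fun ζ => kernel K₁ z ζ * u ζ := by
    ext ζ
    by_cases h : ζ ∈ Metric.ball (0 : Cn n) r <;> simp [h]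
  rw [kernelIntegral, potential, e, setIntegral_indicator measurableSet_ball,
    inter_eq_right.2 hr, volume_Cn hn]

theorem tendstoL1_of_nhds {v v₀ : Cn n → ℂ} {A : Set (Cn n)} (h : IntegrableOn v₀ A (μHE[2 * n - 1])
    ∧ (∀ᶠ σ in 𝓝 (0 : ℝ), IntegrableOn (fun z => v (φ σ z)) A (μHE[2 * n - 1])) ∧
    Tendsto (fun σ => ∫ z in A, ‖v (φ σ z) - v₀ z‖ ∂(μHE[2 * n - 1])) (𝓝 0) (𝓝 0)) :
    TendstoL1 φ v v₀ A :=
  ⟨h.1, h.2.1.filter_mono nhdsWithin_le_nhds, h.2.2.mono_left nhdsWithin_le_nhds⟩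

theorem kernelIntegral_levels (S : LevelData p (U : Set (Cn n)) W f) (hn : 0 < n)
    (F : LevelFamily p (W : Set (Cn n)) f σs φ)
    (hu : MemLp u 2 (volume.restrict (W : Set (Cn n)))) (hK : IsNumerator p (U : Set (Cn n)) K₁)
    (hr : Metric.ball (0 : Cn n) r ⊆ (W : Set (Cn n))) :
    (∀ σ : ℝ, (∀ᵐ z ∂((area n).restrict (level W f σ)),
        IntegrableOn (fun ζ => kernel K₁ z ζ * u ζ) (Metric.ball (0 : Cn n) r)) ∧
      IntegrableOn (kernelIntegral K₁ u r) (level W f σ) (area n)) ∧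
    (∀ Q : Set (Cn n), IsCompact Q → Q ⊆ level W f 0 →
      TendstoL1 φ (kernelIntegral K₁ u r) (kernelIntegral K₁ u r) Q) ∧
    (Metric.closedBall (0 : Cn n) r ⊆ (W : Set (Cn n)) →
      TendstoL1 φ (kernelIntegral K₁ u r) (kernelIntegral K₁ u r) (level W f 0)) := by
  have hk := isWeakKernel_kernel hn S.subset hK
  have hd0 : 0 < 2 * n - 1 := by omega
  have hd := finrank_Cn hn
  set u' := (Metric.ball (0 : Cn n) r).indicator u with hu'
  have hu2 : MemLp u' 2 ((μHE[2 * n - 1 + 1] : Measure (Cn n)).restrict W) := by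
    rw [← volume_Cn hn]; exact hu.indicator measurableSet_ball
  rw [kernelIntegral_eq hn hr]
  refine ⟨fun σ => ?_, fun Q hQ hQS => ?_, fun hcl => ?_⟩
  · obtain ⟨h1, h2⟩ := hk.integrableOn_level S hd0 hd hu2 σ
    refine ⟨?_, h2⟩
    filter_upwards [h1] with z hz using (integrableOn_ball_iff hr hn).1 hz
  · exact tendstoL1_of_nhds (F.tendsto_potential S hk hd0 hd hu2 hQ hQS)
  · refine tendstoL1_of_nhds (F.tendsto_potential_of_support S hk hd0 hd hu2
      (isCompact_closedBall (0 : Cn n) r) hcl fun ζ hζ => ?_)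
    exact indicator_of_notMem (fun h => hζ (Metric.ball_subset_closedBall h)) _

theorem kernelIntegral_regular {l : ℕ} (S : LevelData p (U : Set (Cn n)) W f) (hn : 0 < n)
    (hl : 2 * (2 * n - 1 + p) < 2 * l + (2 * n - 1 + 1))
    (hu : MemLp u 2 (volume.restrict (W : Set (Cn n)))) (hK : IsNumerator p (U : Set (Cn n)) K₁)
    (hK' : HasNumeratorDerivBounds p (W : Set (Cn n)) K₁)
    (hr : Metric.ball (0 : Cn n) r ⊆ (W : Set (Cn n)))
    (hul : MemLp (fun z => u z / ((|f z| ^ l : ℝ) : ℂ)) 2 (volume.restrict (W : Set (Cn n)))) :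
    (∀ z ∈ level W f 0,
      IntegrableOn (fun ζ => kernel K₁ z ζ * u ζ) (Metric.ball (0 : Cn n) r)) ∧
    IsCpOn p (kernelIntegral K₁ u r) (level W f 0) := by
  have hk := isSmoothKernel_kernel hn U.2 W.2 S.isBounded S.closure_subset hK hK'
  have hd := finrank_Cn hn
  set u' := (Metric.ball (0 : Cn n) r).indicator u with hu'
  have hu2 : MemLp u' 2 ((μHE[2 * n - 1 + 1] : Measure (Cn n)).restrict W) := by
    rw [← volume_Cn hn]; exact hu.indicator measurableSet_ball
  have hul2 : MemLp (fun z => u' z / ((|f z| ^ l : ℝ) : ℂ)) 2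
      ((μHE[2 * n - 1 + 1] : Measure (Cn n)).restrict W) := by
    rw [← volume_Cn hn]
    refine MemLp.ae_eq (Eventually.of_forall fun z => ?_)
      (hul.indicator (measurableSet_ball (x := (0 : Cn n)) (ε := r)))
    by_cases h : z ∈ Metric.ball (0 : Cn n) r <;> simp [h, hu']
  rw [kernelIntegral_eq hn hr]
  have key := fun z (hz : z ∈ level W f 0) => hk.exists_extension S hd hl hu2 hul2 hz.1 hz.2
  constructor
  · intro z hz
    obtain ⟨V, -, hzV, -, -, -, h, -⟩ := key z hz
    exact (integrableOn_ball_iff hr hn).1 (h z hzV hz.1 hz.2)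
  · intro z hz
    obtain ⟨V, hV, hzV, G, hG, hGe, -, -⟩ := key z hz
    exact ⟨V, hV, hzV, G, hG, hGe⟩

end

end

/-! ### Distributions on complex test functions and superpositions of translates -/

section

section Smear

variable {E : Type} [NormedAddCommGroup E] [NormedSpace ℝ E] [FiniteDimensional ℝ E]
  [MeasurableSpace E] [BorelSpace E] {A : Type} [MeasurableSpace A] {ν : Measure A} {c : A → ℝ}
  {m : A → E} {F : Type} [NormedAddCommGroup F] [NormedSpace ℝ F]
  [CompleteSpace F]

omit [CompleteSpace F] in
theorem aestronglyMeasurable_smear (hc : Integrable c ν) (hm : AEMeasurable m ν)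
    {s : E → F} (hs : Continuous s) (x : E) :
    AEStronglyMeasurable (fun a => c a • s (x - m a)) ν := by
  refine hc.1.smul ?_
  have h1 : Continuous fun y => s (x - y) := hs.comp (by fun_prop)
  exact h1.comp_aestronglyMeasurable hm.aestronglyMeasurable

omit [CompleteSpace F] in
theorem integrable_smear (hc : Integrable c ν) (hm : AEMeasurable m ν)
    {s : E → F} (hs : Continuous s) (hsc : HasCompactSupport s) (x : E) :
    Integrable (fun a => c a • s (x - m a)) ν := by
  obtain ⟨C, hC⟩ := hs.bounded_above_of_compact_support hsc
  refine Integrable.mono' (hc.norm.mul_const C) (aestronglyMeasurable_smear hc hm hs x)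
    (Eventually.of_forall fun a => ?_)
  rw [norm_smul]
  gcongr
  exact hC _

omit [CompleteSpace F] in
theorem hasFDerivAt_smear (hc : Integrable c ν) (hm : AEMeasurable m ν)
    {s : E → F} (hs : ContDiff ℝ 1 s) (hsc : HasCompactSupport s) (x : E) :
    HasFDerivAt (fun x => ∫ a, c a • s (x - m a) ∂ν) (∫ a, c a • fderiv ℝ s (x - m a) ∂ν) x := by
  have hs' : Continuous (fderiv ℝ s) := hs.continuous_fderiv (by simp)
  obtain ⟨C, hC⟩ := hs'.bounded_above_of_compact_support (hsc.fderiv ℝ)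
  refine hasFDerivAt_integral_of_dominated_of_fderiv_le (bound := fun a => ‖c a‖ * C)
    (F' := fun x a => c a • fderiv ℝ s (x - m a)) univ_mem
    (Eventually.of_forall fun y => aestronglyMeasurable_smear hc hm hs.continuous y)
    (integrable_smear hc hm hs.continuous hsc x) (aestronglyMeasurable_smear hc hm hs' x)
    (Eventually.of_forall fun a y _ => ?_) (hc.norm.mul_const C)
    (Eventually.of_forall fun a y _ => ?_)
  · rw [norm_smul]
    gcongr
    exact hC _
  · have h1 : HasFDerivAt s (fderiv ℝ s (y - m a)) (y - m a) :=
      (hs.differentiable (by simp) _).hasFDerivAt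
    have h2 := h1.comp y ((hasFDerivAt_id y).sub_const (m a))
    exact h2.const_smul (c a)

omit [FiniteDimensional ℝ E] [MeasurableSpace E] [BorelSpace E] [CompleteSpace F] in
theorem contDiff_one_iteratedFDeriv {s : E → F} (hs : ContDiff ℝ (⊤ : ℕ∞) s) (i : ℕ) :
    ContDiff ℝ 1 (iteratedFDeriv ℝ i s) :=
  hs.iteratedFDeriv_right (m := 1) (by exact_mod_cast le_top)

/-- Each derivative of `s` is bounded and `c` is integrable, so differentiation under the integral
is allowed at every order. The parameter space and the shifts `m` are left arbitrary in order to
cover both convolutions and integrals over segments. -/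
theorem iteratedFDeriv_smear (hc : Integrable c ν) (hm : AEMeasurable m ν)
    {s : E → F} (hs : ContDiff ℝ (⊤ : ℕ∞) s) (hsc : HasCompactSupport s) (i : ℕ) :
    iteratedFDeriv ℝ i (fun x => ∫ a, c a • s (x - m a) ∂ν) =
      fun x => ∫ a, c a • iteratedFDeriv ℝ i s (x - m a) ∂ν := by
  induction i with
  | zero =>
    ext1 x
    rw [iteratedFDeriv_zero_eq_comp, Function.comp_apply]
    refine ((continuousMultilinearCurryFin0 ℝ E F).symm.toContinuousLinearEquiv.integral_comp_comm
      (fun a => c a • s (x - m a))).symm.trans ?_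
    rfl
  | succ i ih =>
    ext1 x
    rw [iteratedFDeriv_succ_eq_comp_left, Function.comp_apply, ih,
      (hasFDerivAt_smear hc hm (contDiff_one_iteratedFDeriv hs i) (hsc.iteratedFDeriv i) x).fderiv]
    have h1 := integrable_smear hc hm ((contDiff_one_iteratedFDeriv hs i).continuous_fderiv (by simp))
      ((hsc.iteratedFDeriv (𝕜 := ℝ) i).fderiv ℝ) x
    let L : (E →L[ℝ] E [×i]→L[ℝ] F) →L[ℝ] (E [×(i + 1)]→L[ℝ] F) :=
      ⟨(continuousMultilinearCurryLeftEquiv ℝ (fun _ : Fin (i + 1) => E) F).symm.toLinearEquiv,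
        (continuousMultilinearCurryLeftEquiv ℝ (fun _ : Fin (i + 1) => E) F).symm.continuous⟩
    have h2 := L.integral_comp_comm h1
    refine Eq.trans h2.symm (integral_congr_ae (Eventually.of_forall fun a => ?_))
    simp only [map_smul]
    rfl

theorem contDiff_smear (hc : Integrable c ν) (hm : AEMeasurable m ν)
    {s : E → F} (hs : ContDiff ℝ (⊤ : ℕ∞) s) (hsc : HasCompactSupport s) :
    ContDiff ℝ (⊤ : ℕ∞) (fun x => ∫ a, c a • s (x - m a) ∂ν) := by
  refine contDiff_of_differentiable_iteratedFDeriv fun i _ x => ?_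
  rw [iteratedFDeriv_smear hc hm hs hsc]
  exact (hasFDerivAt_smear hc hm (contDiff_one_iteratedFDeriv hs i)
    (hsc.iteratedFDeriv i) x).differentiableAt

end Smear

section Eval

variable {E : Type} [NormedAddCommGroup E] [NormedSpace ℝ E] {Ω : TopologicalSpace.Opens E}

/-- A distribution as a continuous linear form. -/
noncomputable def asCLM (T : 𝓓'(Ω, ℂ)) : 𝓓(Ω, ℝ) →L[ℝ] ℂ := T

/-- The extension of a distribution to complex test functions. -/
noncomputable def complexify (T : 𝓓'(Ω, ℂ)) : 𝓓(Ω, ℂ) →L[ℝ] ℂ :=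
  (asCLM T).comp (TestFunction.postcompCLM Complex.reCLM) +
    Complex.I • (asCLM T).comp (TestFunction.postcompCLM Complex.imCLM)

theorem complexify_apply (T : 𝓓'(Ω, ℂ)) (g : 𝓓(Ω, ℂ)) :
    complexify T g = T (TestFunction.postcompCLM Complex.reCLM g) +
      Complex.I * T (TestFunction.postcompCLM Complex.imCLM g) := rfl

/-- A smooth complex function with compact support in `Ω`. -/
structure IsTest (Ω : TopologicalSpace.Opens E) (g : E → ℂ) : Prop where
  contDiff : ContDiff ℝ (⊤ : ℕ∞) g
  hasCompactSupport : HasCompactSupport g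
  tsupport_subset : tsupport g ⊆ Ω

theorem IsTest.of_support {g : E → ℂ} (hg : ContDiff ℝ (⊤ : ℕ∞) g) {K : Set E} (hK : IsCompact K)
    (hKΩ : K ⊆ Ω) (h : ∀ x ∉ K, g x = 0) : IsTest Ω g :=
  ⟨hg, HasCompactSupport.intro hK h, (closure_minimal (fun x hx => by
    by_contra hxK; exact hx (h x hxK)) hK.isClosed).trans hKΩ⟩

/-- The value of a distribution on a complex function, zero unless this is a test function. -/
noncomputable def eval (T : 𝓓'(Ω, ℂ)) (g : E → ℂ) : ℂ :=
  open Classical in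
  if h : IsTest Ω g then complexify T ⟨g, h.1, h.2, h.3⟩ else 0

theorem eval_eq (T : 𝓓'(Ω, ℂ)) {g : E → ℂ} (h : IsTest Ω g) :
    eval T g = complexify T ⟨g, h.1, h.2, h.3⟩ := dif_pos h

theorem eval_coe (T : 𝓓'(Ω, ℂ)) (g : 𝓓(Ω, ℂ)) : eval T g = complexify T g :=
  eval_eq T ⟨g.contDiff, g.hasCompactSupport, g.tsupport_subset⟩

theorem IsTest.exists_eq {g : E → ℂ} (h : IsTest Ω g) : ∃ g' : 𝓓(Ω, ℂ), (g' : E → ℂ) = g :=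
  ⟨⟨g, h.1, h.2, h.3⟩, rfl⟩

theorem IsTest.add {g h : E → ℂ} (hg : IsTest Ω g) (hh : IsTest Ω h) :
    IsTest Ω (fun x => g x + h x) := by
  obtain ⟨g', rfl⟩ := hg.exists_eq
  obtain ⟨h', rfl⟩ := hh.exists_eq
  exact ⟨(g' + h').contDiff, (g' + h').hasCompactSupport, (g' + h').tsupport_subset⟩

theorem eval_add (T : 𝓓'(Ω, ℂ)) {g h : E → ℂ} (hg : IsTest Ω g) (hh : IsTest Ω h) :
    eval T (fun x => g x + h x) = eval T g + eval T h := by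
  obtain ⟨g', rfl⟩ := hg.exists_eq
  obtain ⟨h', rfl⟩ := hh.exists_eq
  rw [eval_coe, eval_coe, ← map_add, ← eval_coe]
  rfl

theorem IsTest.const_mul {g : E → ℂ} (hg : IsTest Ω g) (a : ℂ) : IsTest Ω (fun x => a * g x) := by
  obtain ⟨g', rfl⟩ := hg.exists_eq
  exact ⟨(a • g').contDiff, (a • g').hasCompactSupport, (a • g').tsupport_subset⟩

theorem eval_const_mul (T : 𝓓'(Ω, ℂ)) {g : E → ℂ} (hg : IsTest Ω g) (a : ℂ) :
    eval T (fun x => a * g x) = a * eval T g := by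
  obtain ⟨g', rfl⟩ := hg.exists_eq
  have hr : ∀ b : ℝ, eval T (fun x => (b : ℂ) * g' x) = b * eval T g' := by
    intro b
    have h1 := map_smul (complexify T) b g'
    rw [← eval_coe, ← eval_coe, Complex.real_smul] at h1
    refine Eq.trans (congrArg (eval T) ?_) h1
    ext x
    simp
  have hI : ∀ g' : 𝓓(Ω, ℂ), eval T (fun x => Complex.I * g' x) = Complex.I * eval T g' := by
    intro g'
    have e1 : TestFunction.postcompCLM Complex.reCLM (Complex.I • g') =
        -TestFunction.postcompCLM Complex.imCLM g' := by
      ext x; simp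
    have e2 : TestFunction.postcompCLM Complex.imCLM (Complex.I • g') =
        TestFunction.postcompCLM Complex.reCLM g' := by
      ext x; simp
    have h1 := complexify_apply T (Complex.I • g')
    rw [e1, e2, ← eval_coe, map_neg] at h1
    rw [eval_coe T g', complexify_apply, mul_add, ← mul_assoc, Complex.I_mul_I]
    refine Eq.trans h1 ?_
    ring
  have ht : IsTest Ω g' := ⟨g'.contDiff, g'.hasCompactSupport, g'.tsupport_subset⟩
  have e : (fun x => a * g' x) = fun x => (a.re : ℂ) * g' x + (a.im : ℂ) * (Complex.I * g' x) := by
    ext x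
    conv_lhs => rw [← Complex.re_add_im a]
    ring
  rw [e, eval_add T (ht.const_mul _) ((ht.const_mul _).const_mul _), hr]
  have h2 : IsTest Ω (fun x => Complex.I * g' x) := ht.const_mul _
  obtain ⟨g'', hg''⟩ := h2.exists_eq
  have h3 : eval T (fun x => (a.im : ℂ) * (Complex.I * g' x)) =
      a.im * eval T (fun x => Complex.I * g' x) := by
    have h1 := map_smul (complexify T) a.im g''
    rw [← eval_coe, ← eval_coe, hg''] at h1
    rw [Complex.real_smul] at h1
    refine Eq.trans (congrArg (eval T) ?_) h1
    ext x
    simp [hg'']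
  rw [h3, hI]
  conv_rhs => rw [← Complex.re_add_im a]
  ring

theorem IsTest.sum {ι : Type*} {s : Finset ι} {g : ι → E → ℂ} (hg : ∀ i ∈ s, IsTest Ω (g i)) :
    IsTest Ω (fun x => ∑ i ∈ s, g i x) := by
  classical
  induction s using Finset.induction_on with
  | empty =>
    simp only [Finset.sum_empty]
    exact ⟨contDiff_const, HasCompactSupport.zero, by
      rw [show (fun _ : E => (0 : ℂ)) = 0 from rfl, tsupport_zero]; exact empty_subset _⟩
  | insert a s ha ih =>
    simp only [Finset.sum_insert ha]
    exact (hg a (Finset.mem_insert_self _ _)).add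
      (ih fun i hi => hg i (Finset.mem_insert_of_mem hi))

theorem eval_zero (T : 𝓓'(Ω, ℂ)) : eval T (fun _ => 0) = 0 := by
  have h : IsTest Ω (fun _ : E => (0 : ℂ)) := by
    simpa using IsTest.sum (Ω := Ω) (s := (∅ : Finset ℕ)) (g := fun _ _ => 0) (by simp)
  have := eval_const_mul T h 0
  simpa using this

theorem eval_sum (T : 𝓓'(Ω, ℂ)) {ι : Type*} {s : Finset ι} {g : ι → E → ℂ}
    (hg : ∀ i ∈ s, IsTest Ω (g i)) :
    eval T (fun x => ∑ i ∈ s, g i x) = ∑ i ∈ s, eval T (g i) := by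
  classical
  induction s using Finset.induction_on with
  | empty => simpa using eval_zero T
  | insert a s ha ih =>
    simp only [Finset.sum_insert ha]
    rw [eval_add T (hg a (Finset.mem_insert_self _ _))
      (IsTest.sum fun i hi => hg i (Finset.mem_insert_of_mem hi)),
      ih fun i hi => hg i (Finset.mem_insert_of_mem hi)]

/-- Bounded continuous functions with values in the multilinear forms of finitely many degrees. -/
def JetSpace (E : Type) [NormedAddCommGroup E] [NormedSpace ℝ E] (J : Finset ℕ) : Type :=
  Π i : J, BoundedContinuousFunction E (E [×(i : ℕ)]→L[ℝ] ℂ)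

noncomputable instance (J : Finset ℕ) : NormedAddCommGroup (JetSpace E J) :=
  inferInstanceAs (NormedAddCommGroup
    (Π i : J, BoundedContinuousFunction E (E [×(i : ℕ)]→L[ℝ] ℂ)))

noncomputable instance (J : Finset ℕ) : NormedSpace ℝ (JetSpace E J) :=
  inferInstanceAs (NormedSpace ℝ (Π i : J, BoundedContinuousFunction E (E [×(i : ℕ)]→L[ℝ] ℂ)))

instance (J : Finset ℕ) : CompleteSpace (JetSpace E J) :=
  inferInstanceAs (CompleteSpace (Π i : J, BoundedContinuousFunction E (E [×(i : ℕ)]→L[ℝ] ℂ)))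

/-- Evaluation of one component at one point. -/
noncomputable def JetSpace.evalCLM {J : Finset ℕ} (i : J) (x : E) :
    JetSpace E J →L[ℝ] (E [×(i : ℕ)]→L[ℝ] ℂ) :=
  (BoundedContinuousFunction.evalCLM ℝ x).comp
    (ContinuousLinearMap.proj (R := ℝ) (φ := fun i : J =>
      BoundedContinuousFunction E (E [×(i : ℕ)]→L[ℝ] ℂ)) i)

theorem JetSpace.ext {J : Finset ℕ} {a b : JetSpace E J}
    (h : ∀ i x, JetSpace.evalCLM i x a = JetSpace.evalCLM i x b) : a = b :=
  funext fun i => BoundedContinuousFunction.ext fun x => h i x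

theorem JetSpace.norm_le {J : Finset ℕ} {a : JetSpace E J} {M : ℝ} (hM : 0 ≤ M)
    (h : ∀ i x, ‖JetSpace.evalCLM i x a‖ ≤ M) : ‖a‖ ≤ M :=
  (pi_norm_le_iff_of_nonneg (x := (a : Π _ : J, _)) hM).2 fun i =>
    (BoundedContinuousFunction.norm_le hM).2 fun x => h i x

theorem JetSpace.norm_evalCLM_le {J : Finset ℕ} (a : JetSpace E J) (i : J) (x : E) :
    ‖JetSpace.evalCLM i x a‖ ≤ ‖a‖ :=
  (BoundedContinuousFunction.norm_coe_le_norm _ x).trans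
    (norm_le_pi_norm (a : Π i : J, BoundedContinuousFunction E (E [×(i : ℕ)]→L[ℝ] ℂ)) i)

/-- A linear form bounded by the norm of an injective linear map factors through that map. -/
theorem exists_factor {V B : Type*} [AddCommGroup V] [Module ℝ V] [NormedAddCommGroup B]
    [NormedSpace ℝ B] {j : V →ₗ[ℝ] B} (hj : Function.Injective j) {t : V →ₗ[ℝ] ℂ} {C : ℝ}
    (ht : ∀ g, ‖t g‖ ≤ C * ‖j g‖) : ∃ Λ : B →L[ℝ] ℂ, ∀ g, Λ (j g) = t g := by
  -- Hahn–Banach for real functionals, used for the real and the imaginary part of `t`.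
  have hext : ∀ L : ℂ →L[ℝ] ℝ, ∃ Λ : B →L[ℝ] ℝ, ∀ g, Λ (j g) = L (t g) := by
    intro L
    set e := LinearEquiv.ofInjective j hj
    set φ : LinearMap.range j →ₗ[ℝ] ℝ :=
      ((L : ℂ →ₗ[ℝ] ℝ).comp t).comp (e.symm : _ →ₗ[ℝ] _) with hφ
    obtain ⟨Λ, hΛ, -⟩ := exists_extension_norm_eq (𝕜 := ℝ) (LinearMap.range j)
      (φ.mkContinuous (‖L‖ * C) fun y => by
        obtain ⟨g, rfl⟩ := e.surjective y
        have e1 : φ (e g) = L (t g) := by simp [hφ]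
        rw [e1, mul_assoc]
        exact (L.le_opNorm _).trans (mul_le_mul_of_nonneg_left (ht g) (norm_nonneg _)))
    refine ⟨Λ, fun g => ?_⟩
    have := hΛ (e g)
    simpa [hφ, e] using this
  obtain ⟨Λ₁, h₁⟩ := hext Complex.reCLM
  obtain ⟨Λ₂, h₂⟩ := hext Complex.imCLM
  refine ⟨Complex.ofRealCLM.comp Λ₁ + Complex.I • Complex.ofRealCLM.comp Λ₂, fun g => ?_⟩
  have := Complex.re_add_im (t g)
  rw [add_apply, ContinuousLinearMap.comp_apply, smul_apply, ContinuousLinearMap.comp_apply, h₁, h₂]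
  rw [← this]
  simp [mul_comm]

/-- The translates of the derivatives of a smooth function with compact support. -/
noncomputable def jet (J : Finset ℕ) {g : E → ℂ} (hg : ContDiff ℝ (⊤ : ℕ∞) g)
    (hgc : HasCompactSupport g) (z : E) :
    JetSpace E J := fun i =>
  ⟨⟨fun x => iteratedFDeriv ℝ i g (x - z),
    (hg.continuous_iteratedFDeriv (m := i) (by exact_mod_cast le_top)).comp (by fun_prop)⟩, by
    obtain ⟨C, hC⟩ := (hg.continuous_iteratedFDeriv (m := (i : ℕ))
      (by exact_mod_cast le_top)).bounded_above_of_compact_support (hgc.iteratedFDeriv i)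
    exact ⟨C + C, fun x y => (dist_le_norm_add_norm _ _).trans (add_le_add (hC _) (hC _))⟩⟩

theorem jet_apply (J : Finset ℕ) {g : E → ℂ} (hg : ContDiff ℝ (⊤ : ℕ∞) g)
    (hgc : HasCompactSupport g) (z : E) (i : J) (x : E) :
    JetSpace.evalCLM i x (jet J hg hgc z) = iteratedFDeriv ℝ i g (x - z) := rfl

theorem continuous_jet (J : Finset ℕ) {g : E → ℂ} (hg : ContDiff ℝ (⊤ : ℕ∞) g)
    (hgc : HasCompactSupport g) : Continuous (jet J hg hgc) := by
  have key : ∀ i : J, Continuous fun z => (jet J hg hgc z :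
      Π i : J, BoundedContinuousFunction E (E [×(i : ℕ)]→L[ℝ] ℂ)) i := by
    intro i
    have hu : UniformContinuous (iteratedFDeriv ℝ i g) :=
      (hgc.iteratedFDeriv i).uniformContinuous_of_continuous
        (hg.continuous_iteratedFDeriv (by exact_mod_cast le_top))
    rw [Metric.continuous_iff]
    intro z ε hε
    obtain ⟨δ, hδ, h⟩ := Metric.uniformContinuous_iff.1 hu (ε / 2) (by positivity)
    refine ⟨δ, hδ, fun w hw => lt_of_le_of_lt ?_ (half_lt_self hε)⟩
    rw [BoundedContinuousFunction.dist_le (by positivity)]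
    intro x
    refine (h ?_ : dist (iteratedFDeriv ℝ i g (x - w)) (iteratedFDeriv ℝ i g (x - z)) < ε / 2).le
    rwa [dist_sub_left]
  exact continuous_pi key

theorem exists_norm_jet_le (J : Finset ℕ) {g : E → ℂ} (hg : ContDiff ℝ (⊤ : ℕ∞) g)
    (hgc : HasCompactSupport g) : ∃ M : ℝ, ∀ z, ‖jet J hg hgc z‖ ≤ M := by
  refine ⟨‖jet J hg hgc 0‖, fun z => JetSpace.norm_le (norm_nonneg _) fun i x => ?_⟩
  have h1 := (jet J hg hgc 0).norm_evalCLM_le i (x - z)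
  rwa [jet_apply, sub_zero] at h1

/-- On functions supported in a fixed compact set a distribution is represented by a continuous
linear form in finitely many derivatives. -/
theorem exists_representation (T : 𝓓'(Ω, ℂ)) {K : Set E} (hK : IsCompact K) (hKΩ : K ⊆ Ω) :
    ∃ (J : Finset ℕ) (Λ : JetSpace E J →L[ℝ] ℂ),
      ∀ (g : E → ℂ) (hg : ContDiff ℝ (⊤ : ℕ∞) g) (hgc : HasCompactSupport g) (z : E),
        (∀ x ∉ K, g (x - z) = 0) → eval T (fun x => g (x - z)) = Λ (jet J hg hgc z) := by
  classical
  set K' : TopologicalSpace.Compacts E := ⟨K, hK⟩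
  set t : 𝓓_{K'}(E, ℂ) →L[ℝ] ℂ :=
    (complexify T).comp (TestFunction.ofSupportedInCLM ℝ (K := K') hKΩ) with ht
  obtain ⟨J₀, C, -, hC⟩ := Seminorm.bound_of_continuous
    (ContDiffMapSupportedIn.withSeminorms ℝ E ℂ ⊤ K')
    ((normSeminorm ℝ ℂ).comp (t : 𝓓_{K'}(E, ℂ) →ₗ[ℝ] ℂ)) (continuous_norm.comp t.continuous)
  -- Continuity of `t` bounds it by finitely many derivative seminorms. Order 0 is added so that a
  -- function is determined by its jet, as the factorization requires.
  set J := insert 0 J₀ with hJ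
  set j : 𝓓_{K'}(E, ℂ) →ₗ[ℝ] JetSpace E J :=
    LinearMap.pi fun i : J => ContDiffMapSupportedIn.structureMapLM ℝ ⊤ (i : ℕ) with hj
  have hinj : Function.Injective j := by
    intro g h hgh
    refine ContDiffMapSupportedIn.structureMapLM_zero_injective ℝ ?_
    exact congrFun hgh ⟨0, Finset.mem_insert_self _ _⟩
  have hbound : ∀ g, ‖(t : 𝓓_{K'}(E, ℂ) →ₗ[ℝ] ℂ) g‖ ≤ C * ‖j g‖ := by
    intro g
    refine (hC g).trans ?_
    rw [smul_apply, NNReal.smul_def, smul_eq_mul]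
    gcongr
    refine Seminorm.finset_sup_apply_le (norm_nonneg _) fun i hi => ?_
    rw [ContDiffMapSupportedIn.seminorm_apply]
    exact norm_le_pi_norm (j g : Π i : J, BoundedContinuousFunction E (E [×(i : ℕ)]→L[ℝ] ℂ))
      ⟨i, Finset.mem_insert_of_mem hi⟩
  obtain ⟨Λ, hΛ⟩ := exists_factor hinj hbound
  refine ⟨J, Λ, fun g hg hgc z hz => ?_⟩
  have hgz : ContDiff ℝ (⊤ : ℕ∞) (fun x => g (x - z)) := hg.comp (contDiff_id.sub contDiff_const)
  set g' : 𝓓_{K'}(E, ℂ) := ⟨fun x => g (x - z), hgz, fun x hx => hz x hx⟩ with hg'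
  have e1 : jet J hg hgc z = j g' := by
    refine JetSpace.ext fun i x => ?_
    have h3 : JetSpace.evalCLM i x (j g') = iteratedFDeriv ℝ i (fun x => g (x - z)) x :=
      congrFun (ContDiffMapSupportedIn.structureMapLM_top_apply ℝ g') x
    rw [jet_apply, h3, iteratedFDeriv_comp_sub]
  have e2 : eval T (fun x => g (x - z)) = t g' :=
    eval_coe T (TestFunction.ofSupportedIn (K := K') hKΩ g')
  rw [e1, e2, hΛ]
  rfl

end Eval

section Fubini

variable {E : Type} [NormedAddCommGroup E] [NormedSpace ℝ E] [FiniteDimensional ℝ E]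
  [MeasurableSpace E] [BorelSpace E] {Ω : TopologicalSpace.Opens E} (T : 𝓓'(Ω, ℂ)) {K : Set E}

/-- A distribution commutes with superpositions of translates. -/
theorem eval_smear (hK : IsCompact K) (hKΩ : K ⊆ Ω) {A : Type} [MeasurableSpace A] {ν : Measure A}
    {c : A → ℝ} {m : A → E} (hc : Integrable c ν) (hm : AEMeasurable m ν) {s : E → ℂ}
    (hs : ContDiff ℝ (⊤ : ℕ∞) s) (hsc : HasCompactSupport s)
    (hsupp : ∀ a, c a ≠ 0 → ∀ x ∉ K, s (x - m a) = 0) :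
    eval T (fun x => ∫ a, c a • s (x - m a) ∂ν) = ∫ a, c a • eval T (fun x => s (x - m a)) ∂ν := by
  obtain ⟨J, Λ, hΛ⟩ := exists_representation T hK hKΩ
  have hg := contDiff_smear hc hm hs hsc
  have hg0 : ∀ x ∉ K, ∫ a, c a • s (x - m a) ∂ν = 0 := by
    intro x hx
    rw [integral_eq_zero_of_ae]
    refine Eventually.of_forall fun a => ?_
    by_cases h : c a = 0
    · simp [h]
    · simp [hsupp a h x hx]
  have hgc : HasCompactSupport (fun x => ∫ a, c a • s (x - m a) ∂ν) := HasCompactSupport.intro hK hg0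
  obtain ⟨M, hM⟩ := exists_norm_jet_le J hs hsc
  -- The jets of the translates form a Bochner integrable family in a Banach space, and a continuous
  -- linear form commutes with its integral. This is the purpose of representing `T` through jets.
  have hint : Integrable (fun a => c a • jet J hs hsc (m a)) ν := by
    refine Integrable.mono' (hc.norm.mul_const M) (hc.1.smul
      ((continuous_jet J hs hsc).comp_aestronglyMeasurable hm.aestronglyMeasurable))
      (Eventually.of_forall fun a => ?_)
    rw [norm_smul]
    gcongr
    exact hM _
  have e : jet J hg hgc 0 = ∫ a, c a • jet J hs hsc (m a) ∂ν := by
    refine JetSpace.ext fun i x => ?_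
    rw [← (JetSpace.evalCLM i x).integral_comp_comm hint, jet_apply, sub_zero,
      iteratedFDeriv_smear hc hm hs hsc]
    rfl
  have h1 := hΛ _ hg hgc 0 (fun x hx => by simpa using hg0 x hx)
  simp only [sub_zero] at h1
  rw [h1, e, ← Λ.integral_comp_comm hint]
  refine integral_congr_ae (Eventually.of_forall fun a => ?_)
  simp only [map_smul]
  by_cases h : c a = 0
  · simp [h]
  · rw [hΛ s hs hsc (m a) (hsupp a h)]

omit [FiniteDimensional ℝ E] [MeasurableSpace E] [BorelSpace E] in
-- The jet of a translate depends continuously on the shift, since the derivatives of `s` are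
-- uniformly continuous.
theorem continuousOn_eval_translate (hK : IsCompact K) (hKΩ : K ⊆ Ω) {s : E → ℂ}
    (hs : ContDiff ℝ (⊤ : ℕ∞) s) (hsc : HasCompactSupport s) {O : Set E}
    (hO : ∀ z ∈ O, ∀ x ∉ K, s (x - z) = 0) : ContinuousOn (fun z => eval T (fun x => s (x - z))) O := by
  obtain ⟨J, Λ, hΛ⟩ := exists_representation T hK hKΩ
  exact (Λ.continuous.comp (continuous_jet J hs hsc)).continuousOn.congr
    fun z hz => hΛ s hs hsc z (hO z hz)

end Fubini

end

/-! ### Smooth dependence of a distribution on translations of the test function -/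

section

section Translate

variable {E : Type} [NormedAddCommGroup E] [NormedSpace ℝ E] {Ω : TopologicalSpace.Opens E}
  {K : Set E} {s : E → ℂ} {O : Set E}

/-- The translates of `s` by the points of `O` vanish off `K`. -/
def SuppIn (s : E → ℂ) (O K : Set E) : Prop := ∀ z ∈ O, ∀ x ∉ K, s (x - z) = 0

theorem contDiff_translate (hs : ContDiff ℝ (⊤ : ℕ∞) s) (z : E) :
    ContDiff ℝ (⊤ : ℕ∞) fun x => s (x - z) := hs.comp (contDiff_id.sub contDiff_const)

theorem SuppIn.isTest (h : SuppIn s O K) (hK : IsCompact K) (hKΩ : K ⊆ Ω)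
    (hs : ContDiff ℝ (⊤ : ℕ∞) s) {z : E} (hz : z ∈ O) : IsTest Ω fun x => s (x - z) :=
  IsTest.of_support (contDiff_translate hs z) hK hKΩ (h z hz)

theorem SuppIn.fderiv_apply (h : SuppIn s O K) (hK : IsClosed K) (X : E) :
    SuppIn (fun y => fderiv ℝ s y X) O K := by
  intro z hz x hx
  have h1 : ∀ᶠ y in 𝓝 (x - z), s y = 0 := by
    have h2 : Tendsto (fun y => y + z) (𝓝 (x - z)) (𝓝 x) := by
      have : ContinuousAt (fun y : E => y + z) (x - z) := by fun_prop
      simpa [ContinuousAt] using this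
    filter_upwards [h2.eventually (hK.isOpen_compl.mem_nhds hx)] with y hy
    simpa using h z hz (y + z) hy
  have h2 : s =ᶠ[𝓝 (x - z)] fun _ => 0 := h1
  change fderiv ℝ s (x - z) X = 0
  rw [h2.fderiv_eq]
  simp

theorem contDiff_fderiv_apply_const (hs : ContDiff ℝ (⊤ : ℕ∞) s) (X : E) :
    ContDiff ℝ (⊤ : ℕ∞) fun y => fderiv ℝ s y X :=
  (hs.fderiv_right (m := (⊤ : ℕ∞)) (by exact_mod_cast le_top)).clm_apply contDiff_const

variable [FiniteDimensional ℝ E] [MeasurableSpace E] [BorelSpace E] (T : 𝓓'(Ω, ℂ))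

/-- The fundamental theorem of calculus on the segment from `z` to `z + X`, read as a superposition
of translates with weight the indicator of `(0, 1]`, so that `T` can be moved inside. -/
theorem eval_translate_add_sub (hK : IsCompact K) (hKΩ : K ⊆ Ω) (hs : ContDiff ℝ (⊤ : ℕ∞) s)
    (hsc : HasCompactSupport s) (h : SuppIn s O K) {z X : E}
    (hz : ∀ τ ∈ Icc (0 : ℝ) 1, z + τ • X ∈ O) :
    eval T (fun x => s (x - (z + X))) - eval T (fun x => s (x - z)) =
      -∫ τ in (0 : ℝ)..1, eval T (fun x => fderiv ℝ s (x - (z + τ • X)) X) := by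
  have hs1 := contDiff_fderiv_apply_const hs X
  have h1 := h.fderiv_apply hK.isClosed X
  have hc : Integrable ((Ioc (0 : ℝ) 1).indicator fun _ => (1 : ℝ)) :=
    (integrable_indicator_iff measurableSet_Ioc).2 (by simp)
  have hm : AEMeasurable (fun τ : ℝ => z + τ • X) := by
    have : Continuous (fun τ : ℝ => z + τ • X) := by fun_prop
    exact this.measurable.aemeasurable
  have key := eval_smear T hK hKΩ hc hm hs1 (hsc.fderiv_apply ℝ X) (fun a ha x hx => by
    refine h1 _ (hz a (Ioc_subset_Icc_self ?_)) x hx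
    by_contra h0
    exact ha (indicator_of_notMem h0 _))
  have e0 : ∀ g : ℝ → ℂ, ∫ τ, (Ioc (0 : ℝ) 1).indicator (fun _ => (1 : ℝ)) τ • g τ =
      ∫ τ in (0 : ℝ)..1, g τ := by
    intro g
    rw [intervalIntegral.integral_of_le zero_le_one, ← integral_indicator measurableSet_Ioc]
    congr 1
    ext τ
    by_cases hτ : τ ∈ Ioc (0 : ℝ) 1 <;> simp [hτ]
  simp only [e0] at key
  rw [← key]
  have hz0 : z ∈ O := by simpa using hz 0 (by simp)
  have hz1 : z + X ∈ O := by simpa using hz 1 (by simp)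
  have e1 : ∀ x, ∫ τ in (0 : ℝ)..1, fderiv ℝ s (x - (z + τ • X)) X =
      s (x - z) + (-1) * s (x - (z + X)) := by
    intro x
    have hd : ∀ τ ∈ uIcc (0 : ℝ) 1, HasDerivAt (fun τ : ℝ => -s (x - (z + τ • X)))
        (fderiv ℝ s (x - (z + τ • X)) X) τ := by
      intro τ _
      have h3 : HasFDerivAt s (fderiv ℝ s (x - (z + τ • X))) (x - (z + τ • X)) :=
        (hs.differentiable (by simp) _).hasFDerivAt
      have h4 : HasDerivAt (fun τ : ℝ => x - (z + τ • X)) (-X) τ := by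
        simpa using (((hasDerivAt_id τ).smul_const X).const_add z).const_sub x
      have h5 := (h3.comp_hasDerivAt τ h4).neg
      rw [map_neg, neg_neg] at h5
      exact h5
    rw [intervalIntegral.integral_eq_sub_of_hasDerivAt hd
      (Continuous.intervalIntegrable (hs1.continuous.comp (by fun_prop)) _ _)]
    simp
    ring
  simp only [e1]
  rw [eval_add T (h.isTest hK hKΩ hs hz0) ((h.isTest hK hKΩ hs hz1).const_mul _),
    eval_const_mul T (h.isTest hK hKΩ hs hz1)]
  ring

/-- The derivative of `z ↦ T (s (· - z))`. -/
noncomputable def translateDeriv (s : E → ℂ) (z : E) : E →L[ℝ] ℂ :=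
  -∑ b, (LinearMap.toContinuousLinearMap ((Module.finBasis ℝ E).coord b)).smulRight
    (eval T fun x => fderiv ℝ s (x - z) (Module.finBasis ℝ E b))

omit [MeasurableSpace E] [BorelSpace E] in
-- Linearity of `T` undoes the expansion in a basis. That expansion reduces continuity in `z` to
-- finitely many scalar functions.
theorem translateDeriv_apply (hK : IsCompact K) (hKΩ : K ⊆ Ω) (hs : ContDiff ℝ (⊤ : ℕ∞) s)
    (h : SuppIn s O K) {z : E} (hz : z ∈ O) (X : E) :
    translateDeriv T s z X = -eval T fun x => fderiv ℝ s (x - z) X := by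
  have ht : ∀ X, IsTest Ω fun x => fderiv ℝ s (x - z) X := fun X =>
    (h.fderiv_apply hK.isClosed X).isTest hK hKΩ (contDiff_fderiv_apply_const hs X) hz
  have e : (fun x => fderiv ℝ s (x - z) X) = fun x => ∑ b,
      (((Module.finBasis ℝ E).repr X b : ℝ) : ℂ) *
        fderiv ℝ s (x - z) (Module.finBasis ℝ E b) := by
    ext x
    conv_lhs => rw [← (Module.finBasis ℝ E).sum_repr X]
    simp only [map_sum, map_smul, Complex.real_smul]
  rw [e, eval_sum T fun b _ => (ht _).const_mul _]
  simp only [eval_const_mul T (ht _)]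
  simp [translateDeriv]

/-- By the segment formula the remainder is an average of the oscillation of `translateDeriv`
between `z` and `z + X`, small by continuity. -/
theorem hasFDerivAt_eval_translate (hK : IsCompact K) (hKΩ : K ⊆ Ω) (hs : ContDiff ℝ (⊤ : ℕ∞) s)
    (hsc : HasCompactSupport s) (h : SuppIn s O K) (hO : IsOpen O) {z : E} (hz : z ∈ O) :
    HasFDerivAt (fun z => eval T fun x => s (x - z)) (translateDeriv T s z) z := by
  have hcont : ContinuousOn (translateDeriv T s) O := by
    refine ContinuousOn.neg (continuousOn_finsetSum _ fun b _ => ?_)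
    have h1 := continuousOn_eval_translate T hK hKΩ
      (contDiff_fderiv_apply_const hs (Module.finBasis ℝ E b))
      (hsc.fderiv_apply ℝ _) (h.fderiv_apply hK.isClosed (Module.finBasis ℝ E b))
    exact ((ContinuousLinearMap.smulRightL ℝ E ℂ
      (LinearMap.toContinuousLinearMap ((Module.finBasis ℝ E).coord b))).continuous.comp_continuousOn
        h1)
  rw [hasFDerivAt_iff_isLittleO_nhds_zero, Asymptotics.isLittleO_iff]
  intro ε hε
  obtain ⟨δ, hδ, hb⟩ := Metric.continuousAt_iff.1 (hcont.continuousAt (hO.mem_nhds hz)) ε hε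
  obtain ⟨δ', hδ', hball⟩ := Metric.isOpen_iff.1 hO z hz
  filter_upwards [Metric.ball_mem_nhds (0 : E) (lt_min hδ hδ')] with X hX
  rw [mem_ball_zero_iff, lt_min_iff] at hX
  have hseg : ∀ τ ∈ Icc (0 : ℝ) 1, ‖τ • X‖ ≤ ‖X‖ := by
    intro τ hτ
    rw [norm_smul, Real.norm_of_nonneg hτ.1]
    exact mul_le_of_le_one_left (norm_nonneg _) hτ.2
  have hsegO : ∀ τ ∈ Icc (0 : ℝ) 1, z + τ • X ∈ O := fun τ hτ =>
    hball (by simpa using (hseg τ hτ).trans_lt hX.2)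
  have hI : ContinuousOn (fun τ : ℝ => translateDeriv T s (z + τ • X) X) (uIcc 0 1) := by
    rw [uIcc_of_le zero_le_one]
    exact (hcont.comp (by fun_prop) hsegO).clm_apply continuousOn_const
  have e : eval T (fun x => s (x - (z + X))) - eval T (fun x => s (x - z)) - translateDeriv T s z X =
      ∫ τ in (0 : ℝ)..1, (translateDeriv T s (z + τ • X) X - translateDeriv T s z X) := by
    rw [eval_translate_add_sub T hK hKΩ hs hsc h hsegO,
      intervalIntegral.integral_sub hI.intervalIntegrable (by simp), ← intervalIntegral.integral_neg]
    simp only [intervalIntegral.integral_const, sub_zero, one_smul]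
    congr 1
    refine intervalIntegral.integral_congr fun τ hτ => ?_
    rw [uIcc_of_le zero_le_one] at hτ
    exact (translateDeriv_apply T hK hKΩ hs h (hsegO τ hτ) X).symm
  rw [e]
  refine (intervalIntegral.norm_integral_le_of_norm_le_const (C := ε * ‖X‖) fun τ hτ => ?_).trans
    (by simp)
  rw [uIoc_of_le zero_le_one] at hτ
  have h1 := hb (x := z + τ • X) (by simpa using (hseg τ (Ioc_subset_Icc_self hτ)).trans_lt hX.1)
  rw [← sub_apply]
  refine (ContinuousLinearMap.le_opNorm _ _).trans ?_
  rw [dist_eq_norm] at h1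
  gcongr

theorem contDiffOn_eval_translate (hK : IsCompact K) (hKΩ : K ⊆ Ω) (hO : IsOpen O) (m : ℕ)
    (hs : ContDiff ℝ (⊤ : ℕ∞) s) (hsc : HasCompactSupport s) (h : SuppIn s O K) :
    ContDiffOn ℝ m (fun z => eval T fun x => s (x - z)) O := by
  induction m generalizing s with
  | zero => exact contDiffOn_zero.2 (continuousOn_eval_translate T hK hKΩ hs hsc h)
  | succ m ih =>
    have hd : ∀ z ∈ O, HasFDerivAt (fun z => eval T fun x => s (x - z)) (translateDeriv T s z) z :=
      fun z hz => hasFDerivAt_eval_translate T hK hKΩ hs hsc h hO hz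
    rw [Nat.cast_add, Nat.cast_one, contDiffOn_succ_iff_fderiv_of_isOpen hO]
    refine ⟨fun z hz => (hd z hz).differentiableAt.differentiableWithinAt, by simp, ?_⟩
    refine ContDiffOn.congr ?_ fun z hz => (hd z hz).fderiv
    refine ContDiffOn.neg (ContDiffOn.sum fun b _ => ?_)
    have h1 := ih (contDiff_fderiv_apply_const hs (Module.finBasis ℝ E b))
      (hsc.fderiv_apply ℝ _) (h.fderiv_apply hK.isClosed (Module.finBasis ℝ E b))
    exact (ContinuousLinearMap.smulRightL ℝ E ℂ
      (LinearMap.toContinuousLinearMap ((Module.finBasis ℝ E).coord b))).contDiff.comp_contDiffOn h1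

end Translate

end

/-! ### Antiholomorphic derivatives and the Bochner–Martinelli kernel -/

section

open scoped ENNReal NNReal ComplexConjugate

section Calculus

variable {n : ℕ}

/-- The antiholomorphic part of a real linear form. -/
noncomputable def antiPart (j : Fin n) (L : Cn n →L[ℝ] ℂ) : ℂ :=
  1 / 2 * (L (EuclideanSpace.single j 1) + Complex.I * L (EuclideanSpace.single j Complex.I))

/-- The derivative `∂g/∂z̄_j` of a function. -/
noncomputable def dbarFun (j : Fin n) (g : Cn n → ℂ) (x : Cn n) : ℂ := antiPart j (fderiv ℝ g x)

theorem antiPart_add (j : Fin n) (L M : Cn n →L[ℝ] ℂ) :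
    antiPart j (L + M) = antiPart j L + antiPart j M := by
  simp [antiPart]; ring

theorem antiPart_smul (j : Fin n) (a : ℂ) (L : Cn n →L[ℝ] ℂ) :
    antiPart j (a • L) = a * antiPart j L := by
  simp [antiPart]; ring

theorem antiPart_neg (j : Fin n) (L : Cn n →L[ℝ] ℂ) : antiPart j (-L) = -antiPart j L := by
  simp [antiPart]; ring

/-- The antilinear part of a real linear form in terms of its coefficients. -/
theorem apply_add_I_smul (L : Cn n →L[ℝ] ℂ) (X : Cn n) :
    L X + Complex.I * L (Complex.I • X) = 2 * ∑ j, conj (X j) * antiPart j L := by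
  have hsing : ∀ (j : Fin n) (a : ℂ), EuclideanSpace.single j a =
      a.re • EuclideanSpace.single j (1 : ℂ) + a.im • EuclideanSpace.single j Complex.I := by
    intro j a
    ext i
    by_cases h : i = j
    · subst h
      simpa [mul_comm] using (Complex.re_add_im a).symm
    · simp [h]
  have hX : ∀ Y : Cn n, L Y = ∑ j, ((Y j).re * L (EuclideanSpace.single j 1) +
      (Y j).im * L (EuclideanSpace.single j Complex.I)) := by
    intro Y
    have e : Y = ∑ j, EuclideanSpace.single j (Y j) := by
      ext i
      simp [Finset.sum_apply, Pi.single_apply]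
    conv_lhs => rw [e]
    rw [map_sum]
    refine Finset.sum_congr rfl fun j _ => ?_
    rw [hsing j (Y j)]
    simp
  rw [hX X, hX (Complex.I • X), Finset.mul_sum, Finset.mul_sum, ← Finset.sum_add_distrib]
  refine Finset.sum_congr rfl fun j _ => ?_
  have hc : conj (X j) = (X j).re - (X j).im * Complex.I := by
    apply Complex.ext <;> simp
  rw [hc, antiPart]
  simp
  ring_nf
  rw [Complex.I_sq]
  ring

theorem dbarFun_mul {j : Fin n} {g h : Cn n → ℂ} {x : Cn n} (hg : DifferentiableAt ℝ g x)
    (hh : DifferentiableAt ℝ h x) :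
    dbarFun j (fun x => g x * h x) x = g x * dbarFun j h x + dbarFun j g x * h x := by
  rw [dbarFun, fderiv_fun_mul hg hh, antiPart_add, antiPart_smul, antiPart_smul, mul_comm (h x)]
  rfl

theorem dbarFun_const_mul {j : Fin n} {g : Cn n → ℂ} {x : Cn n} (hg : DifferentiableAt ℝ g x)
    (a : ℂ) : dbarFun j (fun x => a * g x) x = a * dbarFun j g x := by
  rw [dbarFun, fderiv_const_mul hg, antiPart_smul]; rfl

theorem dbarFun_comp_sub_const (j : Fin n) (g : Cn n → ℂ) (z x : Cn n) :
    dbarFun j (fun x => g (x - z)) x = dbarFun j g (x - z) := by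
  rw [dbarFun, fderiv_comp_sub]; rfl

theorem dbarFun_const_sub (j : Fin n) {g : Cn n → ℂ} {z x : Cn n}
    (hg : DifferentiableAt ℝ g (z - x)) :
    dbarFun j (fun x => g (z - x)) x = -dbarFun j g (z - x) := by
  have h1 : HasFDerivAt (fun x : Cn n => z - x) (-ContinuousLinearMap.id ℝ (Cn n)) x := by
    simpa using (hasFDerivAt_id x).const_sub z
  have h2 := (hg.hasFDerivAt.comp x h1).fderiv
  have h3 : (g ∘ fun x => z - x) = fun x => g (z - x) := rfl
  rw [dbarFun, ← h3, h2, dbarFun, ← antiPart_neg]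
  congr 1
  ext v
  simp

theorem Filter.EventuallyEq.dbarFun_eq {j : Fin n} {g h : Cn n → ℂ} {x : Cn n}
    (hgh : g =ᶠ[𝓝 x] h) : dbarFun j g x = dbarFun j h x := by
  rw [dbarFun, hgh.fderiv_eq]; rfl

theorem contDiff_dbarFun (j : Fin n) {g : Cn n → ℂ} (hg : ContDiff ℝ (⊤ : ℕ∞) g) :
    ContDiff ℝ (⊤ : ℕ∞) (dbarFun j g) :=
  contDiff_const.mul ((contDiff_fderiv_apply_const hg _).add
    (contDiff_const.mul (contDiff_fderiv_apply_const hg _)))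

theorem continuous_dbarFun (j : Fin n) {g : Cn n → ℂ} (hg : ContDiff ℝ 1 g) :
    Continuous (dbarFun j g) := by
  have h1 := hg.continuous_fderiv (by simp)
  exact continuous_const.mul ((h1.clm_apply continuous_const).add
    (continuous_const.mul (h1.clm_apply continuous_const)))

theorem tsupport_dbarFun_subset (j : Fin n) (g : Cn n → ℂ) :
    tsupport (dbarFun j g) ⊆ tsupport g := by
  refine closure_minimal (fun x hx => ?_) (isClosed_tsupport g)
  by_contra h
  refine hx ?_
  have h1 : g =ᶠ[𝓝 x] fun _ => 0 := notMem_tsupport_iff_eventuallyEq.1 h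
  rw [h1.dbarFun_eq]
  simp [dbarFun, antiPart]

theorem HasCompactSupport.dbarFun (j : Fin n) {g : Cn n → ℂ} (hg : HasCompactSupport g) :
    HasCompactSupport (dbarFun j g) :=
  hg.of_isClosed_subset (isClosed_tsupport _) (tsupport_dbarFun_subset j g)

theorem norm_dbarFun_le (j : Fin n) (g : Cn n → ℂ) (x : Cn n) :
    ‖dbarFun j g x‖ ≤ ‖fderiv ℝ g x‖ := by
  have h : ∀ a : ℂ, ‖a‖ = 1 → ‖fderiv ℝ g x (EuclideanSpace.single j a)‖ ≤ ‖fderiv ℝ g x‖ := by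
    intro a ha
    refine ((fderiv ℝ g x).le_opNorm _).trans ?_
    simp [ha]
  rw [LocalReg.dbarFun, antiPart, norm_mul]
  have h1 := (norm_add_le (fderiv ℝ g x (EuclideanSpace.single j 1))
    (Complex.I * fderiv ℝ g x (EuclideanSpace.single j Complex.I)))
  rw [norm_mul, Complex.norm_I, one_mul] at h1
  have h2 := h 1 (by simp)
  have h3 := h Complex.I (by simp)
  have h4 : ‖(1 / 2 : ℂ)‖ = 1 / 2 := by simp
  rw [h4]
  linarith

/-- Integration by parts. -/
theorem integral_mul_dbarFun (j : Fin n) {g h : Cn n → ℂ} (hg : ContDiff ℝ 1 g)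
    (hh : ContDiff ℝ 1 h) (hhc : HasCompactSupport h) :
    ∫ x, g x * dbarFun j h x = -∫ x, dbarFun j g x * h x := by
  have hint : ∀ {a b : Cn n → ℂ}, Continuous a → Continuous b → HasCompactSupport b →
      Integrable fun x => a x * b x := fun ha hb hbc =>
    (ha.mul hb).integrable_of_hasCompactSupport hbc.mul_left
  have hg' : ∀ X, Continuous fun x => fderiv ℝ g x X := fun X =>
    (hg.continuous_fderiv (by simp)).clm_apply continuous_const
  have hh' : ∀ X, Continuous fun x => fderiv ℝ h x X := fun X =>
    (hh.continuous_fderiv (by simp)).clm_apply continuous_const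
  have key : ∀ X, ∫ x, g x * fderiv ℝ h x X = -∫ x, fderiv ℝ g x X * h x := fun X =>
    integral_mul_fderiv_eq_neg_fderiv_mul_of_integrable (hint (hg' X) hh.continuous hhc)
      (hint hg.continuous (hh' X) (hhc.fderiv_apply ℝ X)) (hint hg.continuous hh.continuous hhc)
      (fun x _ => hg.differentiable (by simp) x) (fun x _ => hh.differentiable (by simp) x)
  have i1 := fun X => hint hg.continuous (hh' X) (hhc.fderiv_apply ℝ X)
  have i2 := fun X => hint (hg' X) hh.continuous hhc
  have e1 : ∀ x, g x * dbarFun j h x = 1 / 2 * (g x * fderiv ℝ h x (EuclideanSpace.single j 1) +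
      Complex.I * (g x * fderiv ℝ h x (EuclideanSpace.single j Complex.I))) := by
    intro x; rw [dbarFun, antiPart]; ring
  have e2 : ∀ x, dbarFun j g x * h x = 1 / 2 * (fderiv ℝ g x (EuclideanSpace.single j 1) * h x +
      Complex.I * (fderiv ℝ g x (EuclideanSpace.single j Complex.I) * h x)) := by
    intro x; rw [dbarFun, antiPart]; ring
  simp_rw [e1, e2, integral_const_mul]
  rw [integral_add (i1 _) ((i1 _).const_mul _), integral_add (i2 _) ((i2 _).const_mul _),
    integral_const_mul, integral_const_mul, key, key]
  ring

end Calculus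

section BochnerMartinelli

variable {n : ℕ}

/-- The function `(‖x‖² + e)⁻ᵐ`. -/
noncomputable def regInvNormPow (m : ℕ) (e : ℝ) (x : Cn n) : ℂ :=
  ((((‖x‖ ^ 2 + e) ^ m)⁻¹ : ℝ) : ℂ)

theorem regInvNormPow_zero (m : ℕ) (x : Cn n) : regInvNormPow m 0 x = invNormPow m x := by
  simp [regInvNormPow, invNormPow, pow_mul]

theorem contDiffAt_regInvNormPow {N : WithTop ℕ∞} (m : ℕ) {e : ℝ} {x : Cn n}
    (hx : 0 < ‖x‖ ^ 2 + e) : ContDiffAt ℝ N (regInvNormPow m e : Cn n → ℂ) x := by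
  refine Complex.ofRealCLM.contDiff.contDiffAt.comp x (ContDiffAt.inv ?_ (pow_ne_zero _ hx.ne'))
  exact (((contDiff_norm_sq ℝ).add contDiff_const).pow m).contDiffAt

theorem inner_single (x : Cn n) (j : Fin n) (a : ℂ) :
    inner ℝ x (EuclideanSpace.single j a) = (a * conj (x j)).re := by
  rw [PiLp.inner_apply, Finset.sum_eq_single j]
  · simp [Complex.inner]
  · intro i _ hi
    simp [hi]
  · simp

theorem dbarFun_regInvNormPow (j : Fin n) (m : ℕ) {e : ℝ} {x : Cn n}
    (hx : 0 < ‖x‖ ^ 2 + e) :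
    dbarFun j (regInvNormPow m e) x = -(m * regInvNormPow (m + 1) e x * x j) := by
  have h1 : HasFDerivAt (fun x : Cn n => ‖x‖ ^ 2 + e) (2 • (innerSL ℝ x)) x :=
    (hasStrictFDerivAt_norm_sq x).hasFDerivAt.add_const e
  have h2 : HasDerivAt (fun t : ℝ => (t ^ m)⁻¹) (-(m * ((‖x‖ ^ 2 + e) ^ (m + 1))⁻¹))
      (‖x‖ ^ 2 + e) := by
    refine ((hasDerivAt_pow m (‖x‖ ^ 2 + e)).fun_inv (pow_ne_zero m hx.ne')).congr_deriv ?_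
    rcases m with _ | m
    · simp
    · simp only [Nat.add_sub_cancel]
      field_simp
      ring
  have h3' := h2.comp_hasFDerivAt x h1
  have h3 : HasFDerivAt (regInvNormPow m e) (Complex.ofRealCLM.comp
      ((-(m * ((‖x‖ ^ 2 + e) ^ (m + 1))⁻¹)) • (2 • (innerSL ℝ x)))) x :=
    Complex.ofRealCLM.hasFDerivAt.comp x h3'
  have h4 : ∀ a : ℂ, fderiv ℝ (regInvNormPow m e) x (EuclideanSpace.single j a) =
      -(m * regInvNormPow (m + 1) e x) * (2 * ((a * conj (x j)).re : ℂ)) := by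
    intro a
    rw [h3.fderiv, ← inner_single]
    simp [regInvNormPow]
  rw [dbarFun, antiPart, h4, h4]
  have h5 : (((1 : ℂ) * conj (x j)).re : ℂ) + Complex.I * ((Complex.I * conj (x j)).re : ℂ) = x j := by
    simpa [mul_comm] using Complex.re_add_im (x j)
  linear_combination (m * regInvNormPow (m + 1) e x) * (-h5)

theorem hasFDerivAt_conj_coord (j : Fin n) (x : Cn n) :
    HasFDerivAt (fun x : Cn n => conj (x j))
      ((Complex.conjCLE : ℂ →L[ℝ] ℂ).comp ((EuclideanSpace.proj j : Cn n →L[ℂ] ℂ).restrictScalars ℝ))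
      x :=
  ((Complex.conjCLE : ℂ →L[ℝ] ℂ).comp
    ((EuclideanSpace.proj j : Cn n →L[ℂ] ℂ).restrictScalars ℝ)).hasFDerivAt

theorem contDiff_conj_coord {N : WithTop ℕ∞} (j : Fin n) :
    ContDiff ℝ N (fun x : Cn n => conj (x j)) :=
  ((Complex.conjCLE : ℂ →L[ℝ] ℂ).comp
    ((EuclideanSpace.proj j : Cn n →L[ℂ] ℂ).restrictScalars ℝ)).contDiff

theorem dbarFun_conj_coord (j : Fin n) (x : Cn n) : dbarFun j (fun x : Cn n => conj (x j)) x = 1 := by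
  rw [dbarFun, (hasFDerivAt_conj_coord j x).fderiv, antiPart]
  simp
  norm_num

/-- The divergence of the regularized Bochner–Martinelli kernel. -/
theorem sum_dbarFun_reg {e : ℝ} {x : Cn n} (hx : 0 < ‖x‖ ^ 2 + e) :
    ∑ j, dbarFun j (fun x : Cn n => conj (x j) * regInvNormPow n e x) x =
      n * e * regInvNormPow (n + 1) e x := by
  have h1 : ∀ j : Fin n, dbarFun j (fun x : Cn n => conj (x j) * regInvNormPow n e x) x =
      regInvNormPow n e x - n * regInvNormPow (n + 1) e x * ((‖x j‖ ^ 2 : ℝ) : ℂ) := by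
    intro j
    rw [dbarFun_mul (hasFDerivAt_conj_coord j x).differentiableAt
      ((contDiffAt_regInvNormPow (N := 1) n hx).differentiableAt (by simp)),
      dbarFun_regInvNormPow j n hx, dbarFun_conj_coord, one_mul]
    have : ((‖x j‖ ^ 2 : ℝ) : ℂ) = conj (x j) * x j := by
      rw [Complex.conj_mul']; push_cast; rfl
    rw [this]
    ring
  simp_rw [h1]
  rw [Finset.sum_sub_distrib, ← Finset.mul_sum, ← Complex.ofReal_sum, ← EuclideanSpace.norm_sq_eq]
  simp only [Finset.sum_const, Finset.card_univ, Fintype.card_fin, nsmul_eq_mul]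
  -- The terms `n (‖x‖² + e)⁻ⁿ` and `n ‖x‖² (‖x‖² + e)⁻ⁿ⁻¹` cancel up to a factor `e`; in particular
  -- the kernel with `e = 0` has divergence 0 off the origin.
  have h2 : regInvNormPow n e x = ((‖x‖ ^ 2 + e : ℝ) : ℂ) * regInvNormPow (n + 1) e x := by
    rw [regInvNormPow, regInvNormPow, ← Complex.ofReal_mul]
    congr 1
    field_simp
    ring
  rw [h2]
  push_cast
  ring

/-- The normalizing constant of the Bochner–Martinelli kernel. -/
noncomputable def bmConst (n : ℕ) : ℂ := ∫ x : Cn n, n * regInvNormPow (n + 1) 1 x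

theorem integrable_regInvNormPow_one (hn : 0 < n) :
    Integrable (fun x : Cn n => ((((‖x‖ ^ 2 + 1) ^ (n + 1))⁻¹ : ℝ))) := by
  have h := integrable_rpow_neg_one_add_norm_sq (E := Cn n) (μ := volume) (r := 2 * (n + 1))
    (by rw [finrank_Cn hn, Nat.sub_add_cancel (by omega)]; push_cast; linarith)
  refine h.congr (Eventually.of_forall fun x => ?_)
  simp only
  rw [show (-(2 * ((n : ℝ) + 1)) / 2) = -((n + 1 : ℕ) : ℝ) by push_cast; ring,
    Real.rpow_neg (by positivity), Real.rpow_natCast, add_comm]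

theorem bmConst_ne_zero (hn : 0 < n) : bmConst n ≠ 0 := by
  have h : bmConst n = ((n * ∫ x : Cn n, ((‖x‖ ^ 2 + 1) ^ (n + 1))⁻¹ : ℝ) : ℂ) := by
    rw [bmConst, integral_const_mul]
    push_cast
    congr 1
    exact integral_ofReal
  rw [h, Complex.ofReal_ne_zero]
  refine mul_ne_zero (by exact_mod_cast hn.ne') (ne_of_gt ?_)
  refine (integral_pos_iff_support_of_nonneg (fun x => by positivity)
    (integrable_regInvNormPow_one hn)).2 ?_
  have : Function.support (fun x : Cn n => ((‖x‖ ^ 2 + 1) ^ (n + 1))⁻¹) = univ := by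
    ext x
    simp only [Function.mem_support, mem_univ, iff_true]
    positivity
  rw [this]
  exact isOpen_univ.measure_pos _ univ_nonempty

/-- The coefficients of the Bochner–Martinelli kernel. -/
noncomputable def bm (j : Fin n) (x : Cn n) : ℂ := (bmConst n)⁻¹ * (conj (x j) * invNormPow n x)

theorem contDiffOn_bm {N : WithTop ℕ∞} (j : Fin n) : ContDiffOn ℝ N (bm j) {0}ᶜ :=
  contDiffOn_const.mul ((contDiff_conj_coord j).contDiffOn.mul (contDiffOn_invNormPow n))

theorem bm_neg (j : Fin n) (x : Cn n) : bm j (-x) = -bm j x := by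
  simp [bm, invNormPow]

theorem bm_smul (j : Fin n) {t : ℝ} (ht : 0 < t) (x : Cn n) :
    bm j (t • x) = (t ^ (2 * n - 1))⁻¹ • bm j x := by
  have hn : 0 < n := Fin.pos j
  rw [bm, bm, invNormPow_smul n ht]
  have e : 2 * n = 2 * n - 1 + 1 := by omega
  have e2 : (t ^ (2 * n))⁻¹ * t = (t ^ (2 * n - 1))⁻¹ := by
    rw [e, pow_succ]
    simp only [Nat.add_sub_cancel]
    field_simp
  rw [← e2]
  simp only [PiLp.smul_apply, Complex.real_smul, map_mul, Complex.conj_ofReal]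
  push_cast
  ring

theorem norm_bm_le (j : Fin n) (x : Cn n) :
    ‖bm j x‖ ≤ ‖(bmConst n)⁻¹‖ * (‖x‖ ^ (2 * n - 1))⁻¹ := by
  have hn : 0 < n := Fin.pos j
  rw [bm, norm_mul, norm_mul, invNormPow, Complex.norm_real, RCLike.norm_conj,
    Real.norm_of_nonneg (by positivity)]
  gcongr
  rcases eq_or_ne x 0 with rfl | hx
  · simp
  · have hx' : 0 < ‖x‖ := norm_pos_iff.2 hx
    have e : 2 * n = 2 * n - 1 + 1 := by omega
    have h1 : ‖x j‖ ≤ ‖x‖ := PiLp.norm_apply_le x j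
    calc ‖x j‖ * (‖x‖ ^ (2 * n))⁻¹ ≤ ‖x‖ * (‖x‖ ^ (2 * n))⁻¹ := by gcongr
      _ = _ := by
        conv_lhs => rw [e, pow_succ]
        field_simp

theorem sum_dbarFun_bm {x : Cn n} (hx : x ≠ 0) : ∑ j, dbarFun j (bm j) x = 0 := by
  have hx' : 0 < ‖x‖ ^ 2 + (0 : ℝ) := by
    have : 0 < ‖x‖ := norm_pos_iff.2 hx
    positivity
  have h := sum_dbarFun_reg hx'
  simp only [regInvNormPow_zero, Complex.ofReal_zero, mul_zero, zero_mul] at h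
  have h1 : ∀ j : Fin n, dbarFun j (bm j) x =
      (bmConst n)⁻¹ * dbarFun j (fun x : Cn n => conj (x j) * invNormPow n x) x := by
    intro j
    refine dbarFun_const_mul ?_ _
    exact (hasFDerivAt_conj_coord j x).differentiableAt.mul
      (((contDiffOn_invNormPow (N := 1) n).contDiffAt (isOpen_compl_singleton.mem_nhds hx)).differentiableAt
        (by simp))
  simp_rw [h1, ← Finset.mul_sum, h, mul_zero]

theorem continuous_regInvNormPow (m : ℕ) {e : ℝ} (he : 0 < e) :
    Continuous (regInvNormPow m e : Cn n → ℂ) :=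
  continuous_iff_continuousAt.2 fun x =>
    (contDiffAt_regInvNormPow (N := 0) m (by positivity)).continuousAt

theorem measurable_bm (j : Fin n) : Measurable (bm j) := by
  have h1 : Measurable (invNormPow n : Cn n → ℂ) :=
    Complex.measurable_ofReal.comp ((measurable_norm.pow_const _).inv)
  exact measurable_const.mul ((contDiff_conj_coord (N := 0) j).continuous.measurable.mul h1)

theorem locallyIntegrable_inv_norm_pow (hn : 0 < n) :
    LocallyIntegrable (fun x : Cn n => (‖x‖ ^ (2 * n - 1))⁻¹) := by
  refine locallyIntegrable_of_norm_le_rpow (C := 1) (α := (2 * n - 1 : ℕ)) ?_ ?_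
    (Eventually.of_forall fun x => ?_) ?_
  · rw [finrank_Cn hn]; omega
  · rw [finrank_Cn hn]; push_cast; linarith
  · rw [Real.norm_of_nonneg (by positivity), one_mul, Real.rpow_neg (norm_nonneg _),
      Real.rpow_natCast]
  · exact ((measurable_norm.pow_const _).inv).aestronglyMeasurable

theorem locallyIntegrable_bm (j : Fin n) : LocallyIntegrable (bm j) := by
  refine ((locallyIntegrable_inv_norm_pow (Fin.pos j)).smul (‖(bmConst n)⁻¹‖)).mono
    (measurable_bm j).aestronglyMeasurable (Eventually.of_forall fun x => ?_)
  refine (norm_bm_le j x).trans (le_of_eq ?_)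
  rw [Pi.smul_apply, smul_eq_mul, Real.norm_of_nonneg (by positivity)]

/-- By scaling, the divergences of the regularized kernels form an approximate identity of mass
`bmConst n`: the Jacobian `ε ^ (2 * n)` and the factor `ε ^ 2` use up exactly the power `ε ^ (2 * n
+ 2)` from the denominator. -/
theorem integral_reg_mul {ε : ℝ} (hε : 0 < ε) (hn : 0 < n) (η : Cn n → ℂ) :
    ∫ x : Cn n, n * ((ε ^ 2 : ℝ) : ℂ) * regInvNormPow (n + 1) (ε ^ 2) x * η x =
      ∫ x : Cn n, n * regInvNormPow (n + 1) 1 x * η (ε • x) := by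
  have h := Measure.integral_comp_smul_of_nonneg (volume : Measure (Cn n))
    (fun x => n * ((ε ^ 2 : ℝ) : ℂ) * regInvNormPow (n + 1) (ε ^ 2) x * η x) ε (hR := hε.le)
  have hf : Module.finrank ℝ (Cn n) = 2 * n := by rw [finrank_Cn hn]; omega
  rw [hf] at h
  rw [← inv_smul_eq_iff₀ (inv_ne_zero (pow_ne_zero _ hε.ne')), inv_inv, ← integral_smul] at h
  rw [← h]
  refine integral_congr_ae (Eventually.of_forall fun x => ?_)
  simp only
  have e1 : regInvNormPow (n + 1) (ε ^ 2) (ε • x) =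
      (((ε ^ (2 * n + 2))⁻¹ : ℝ) : ℂ) * regInvNormPow (n + 1) 1 x := by
    rw [regInvNormPow, regInvNormPow, ← Complex.ofReal_mul, norm_smul, Real.norm_of_nonneg hε.le]
    congr 1
    rw [← mul_inv]
    congr 1
    rw [show (ε * ‖x‖) ^ 2 + ε ^ 2 = ε ^ 2 * (‖x‖ ^ 2 + 1) by ring, mul_pow]
    congr 1
    rw [← pow_mul]
    ring
  rw [e1, Complex.real_smul]
  have e2 : ((ε ^ (2 * n) : ℝ) : ℂ) * (((ε ^ 2 : ℝ) : ℂ) * (((ε ^ (2 * n + 2))⁻¹ : ℝ) : ℂ)) = 1 := by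
    rw [← Complex.ofReal_mul, ← Complex.ofReal_mul, ← Complex.ofReal_one]
    congr 1
    rw [pow_add]
    field_simp
  linear_combination (n * regInvNormPow (n + 1) 1 x * η (ε • x)) * e2

/-- The Bochner–Martinelli kernel is a fundamental solution of the `∂̄`-divergence. -/
theorem sum_integral_bm_mul_dbarFun (hn : 0 < n) {η : Cn n → ℂ} (hη : ContDiff ℝ 1 η)
    (hηc : HasCompactSupport η) : ∑ j, ∫ x, bm j x * dbarFun j η x = -η 0 := by
  set ε : ℕ → ℝ := fun k => 1 / ((k : ℝ) + 1) with hε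
  have hε0 : ∀ k, 0 < ε k := fun k => by positivity
  have hεt : Tendsto ε atTop (𝓝 0) := tendsto_one_div_add_atTop_nhds_zero_nat
  -- The regularized kernels converge to the singular one under the locally integrable majorant `‖x‖
  -- ^ (1 - 2n)`.
  have hA : Tendsto (fun k => ∑ j : Fin n, ∫ x : Cn n,
      conj (x j) * regInvNormPow n (ε k ^ 2) x * dbarFun j η x) atTop
      (𝓝 (∑ j : Fin n, ∫ x : Cn n, conj (x j) * invNormPow n x * dbarFun j η x)) := by
    refine tendsto_finsetSum _ fun j _ => ?_
    have hd := continuous_dbarFun j hη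
    refine tendsto_integral_of_dominated_convergence
      (fun x => (‖x‖ ^ (2 * n - 1))⁻¹ * ‖dbarFun j η x‖) (fun k => ?_) ?_ (fun k => ?_) ?_
    · exact (((contDiff_conj_coord (N := 0) j).continuous.mul
        (continuous_regInvNormPow n (by have := hε0 k; positivity))).mul hd).aestronglyMeasurable
    · exact (locallyIntegrable_inv_norm_pow hn).integrable_smul_right_of_hasCompactSupport
        hd.norm (HasCompactSupport.dbarFun j hηc).norm
    · refine Eventually.of_forall fun x => ?_
      rw [norm_mul, norm_mul, RCLike.norm_conj, regInvNormPow, Complex.norm_real,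
        Real.norm_of_nonneg (by positivity)]
      gcongr
      rcases eq_or_ne x 0 with rfl | hx
      · simp
      · have hx' : 0 < ‖x‖ := norm_pos_iff.2 hx
        have e : 2 * n = 2 * n - 1 + 1 := by omega
        have h1 : ‖x j‖ ≤ ‖x‖ := PiLp.norm_apply_le x j
        have h2 : ‖x‖ ^ (2 * n) ≤ (‖x‖ ^ 2 + ε k ^ 2) ^ n := by
          rw [pow_mul]
          gcongr
          have := hε0 k
          nlinarith
        calc ‖x j‖ * ((‖x‖ ^ 2 + ε k ^ 2) ^ n)⁻¹ ≤ ‖x‖ * (‖x‖ ^ (2 * n))⁻¹ := by gcongr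
          _ = _ := by
            conv_lhs => rw [e, pow_succ]
            field_simp
    · refine Eventually.of_forall fun x => ?_
      refine Tendsto.mul_const _ ?_
      rcases eq_or_ne x 0 with rfl | hx
      · simp
      · have hx' : 0 < ‖x‖ := norm_pos_iff.2 hx
        refine Tendsto.const_mul _ ?_
        rw [← regInvNormPow_zero]
        have h3 : ContinuousAt (fun t : ℝ => regInvNormPow n (t ^ 2) x) 0 := by
          unfold regInvNormPow
          refine Complex.continuous_ofReal.continuousAt.comp (ContinuousAt.inv₀ (by fun_prop) ?_)
          positivity
        have h4 := h3.tendsto.comp hεt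
        simpa [Function.comp_def] using h4
  have hB : Tendsto (fun k => -∫ x : Cn n, n * regInvNormPow (n + 1) 1 x * η (ε k • x)) atTop
      (𝓝 (-∫ x : Cn n, n * regInvNormPow (n + 1) 1 x * η 0)) := by
    refine Tendsto.neg ?_
    obtain ⟨M, hM⟩ := hη.continuous.bounded_above_of_compact_support hηc
    have hc1 := continuous_regInvNormPow (n := n) (n + 1) one_pos
    refine tendsto_integral_of_dominated_convergence
      (fun x => n * ((‖x‖ ^ 2 + 1) ^ (n + 1))⁻¹ * M) (fun k => ?_) ?_ (fun k => ?_) ?_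
    · exact ((continuous_const.mul hc1).mul
        (hη.continuous.comp (by fun_prop))).aestronglyMeasurable
    · exact ((integrable_regInvNormPow_one hn).const_mul _).mul_const _
    · refine Eventually.of_forall fun x => ?_
      rw [norm_mul, norm_mul, regInvNormPow, Complex.norm_real, Real.norm_of_nonneg (by positivity),
        Complex.norm_natCast]
      gcongr
      exact hM _
    · refine Eventually.of_forall fun x => Tendsto.const_mul _ ?_
      have h5 : ContinuousAt (fun t : ℝ => η (t • x)) 0 :=
        (hη.continuous.comp (by fun_prop)).continuousAt
      simpa [Function.comp_def] using h5.tendsto.comp hεt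
  -- Integration by parts is legitimate here because the regularized kernels are `C¹` everywhere.
  have hAB : ∀ k, ∑ j : Fin n, ∫ x : Cn n,
      conj (x j) * regInvNormPow n (ε k ^ 2) x * dbarFun j η x =
      -∫ x : Cn n, n * regInvNormPow (n + 1) 1 x * η (ε k • x) := by
    intro k
    have hk := hε0 k
    have hreg : ∀ j : Fin n, ContDiff ℝ 1
        fun x : Cn n => conj (x j) * regInvNormPow n (ε k ^ 2) x := fun j =>
      (contDiff_conj_coord j).mul (contDiff_iff_contDiffAt.2 fun x =>
        contDiffAt_regInvNormPow n (by positivity))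
    rw [← integral_reg_mul hk hn]
    simp_rw [fun j => integral_mul_dbarFun j (hreg j) hη hηc]
    rw [Finset.sum_neg_distrib, ← integral_finsetSum]
    · congr 1
      refine integral_congr_ae (Eventually.of_forall fun x => ?_)
      simp only
      rw [← Finset.sum_mul, sum_dbarFun_reg (by positivity)]
    · intro j _
      exact ((continuous_dbarFun j (hreg j)).mul hη.continuous).integrable_of_hasCompactSupport
        hηc.mul_left
  simp_rw [hAB] at hA
  have h := tendsto_nhds_unique hA hB
  rw [integral_mul_const] at h
  have h1 : ∀ j : Fin n, ∫ x, bm j x * dbarFun j η x =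
      (bmConst n)⁻¹ * ∫ x : Cn n, conj (x j) * invNormPow n x * dbarFun j η x := by
    intro j
    rw [← integral_const_mul]
    refine integral_congr_ae (Eventually.of_forall fun x => ?_)
    simp only [bm]
    ring
  simp_rw [h1, ← Finset.mul_sum, h]
  have h2 := bmConst_ne_zero hn
  rw [← bmConst]
  field_simp

end BochnerMartinelli

end

/-! ### The Bochner–Martinelli kernel truncated to a ball of radius R -/

section

variable {n : ℕ}

/-- A bump function equal to `1` on the ball of radius `1 / 2` and supported in the unit ball. -/
noncomputable def unitBump (n : ℕ) : ContDiffBump (0 : Cn n) := ⟨1 / 2, 1, by norm_num, by norm_num⟩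

/-- The dilates of a fixed bump function. -/
noncomputable def cut (R : ℝ) (x : Cn n) : ℂ := ((unitBump n (R⁻¹ • x) : ℝ) : ℂ)

theorem contDiff_unitBump {N : ℕ∞} :
    ContDiff ℝ N (fun x : Cn n => ((unitBump n x : ℝ) : ℂ)) :=
  Complex.ofRealCLM.contDiff.comp (unitBump n).contDiff

theorem contDiff_cut {N : ℕ∞} (R : ℝ) : ContDiff ℝ N (cut R : Cn n → ℂ) :=
  contDiff_unitBump.comp (contDiff_const_smul R⁻¹)

theorem cut_neg (R : ℝ) (x : Cn n) : cut R (-x) = cut R x := by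
  rw [cut, smul_neg, ContDiffBump.neg, cut]

theorem cut_eq_one {R : ℝ} (hR : 0 < R) {x : Cn n} (hx : ‖x‖ ≤ R / 2) : cut R x = 1 := by
  rw [cut, (unitBump n).one_of_mem_closedBall, Complex.ofReal_one]
  rw [mem_closedBall_zero_iff, norm_smul, norm_inv, Real.norm_of_nonneg hR.le]
  change R⁻¹ * ‖x‖ ≤ 1 / 2
  rw [inv_mul_le_iff₀ hR]
  linarith

theorem cut_eq_zero {R : ℝ} (hR : 0 < R) {x : Cn n} (hx : R ≤ ‖x‖) : cut R x = 0 := by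
  rw [cut, (unitBump n).zero_of_le_dist, Complex.ofReal_zero]
  rw [dist_zero_right, norm_smul, norm_inv, Real.norm_of_nonneg hR.le]
  change 1 ≤ R⁻¹ * ‖x‖
  rwa [le_inv_mul_iff₀ hR, mul_one]

theorem norm_cut_le (R : ℝ) (x : Cn n) : ‖cut R x‖ ≤ 1 := by
  rw [cut, Complex.norm_real, Real.norm_of_nonneg (unitBump n).nonneg]
  exact (unitBump n).le_one

theorem hasCompactSupport_cut {R : ℝ} (hR : 0 < R) : HasCompactSupport (cut R : Cn n → ℂ) :=
  HasCompactSupport.intro (isCompact_closedBall 0 R) fun x hx => cut_eq_zero hR (by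
    rw [mem_closedBall_zero_iff, not_le] at hx; exact hx.le)

/-- The derivatives of the dilates of a function with compact support. -/
theorem exists_norm_iteratedFDeriv_dilate_le {E F : Type*} [NormedAddCommGroup E] [NormedSpace ℝ E]
    [NormedAddCommGroup F] [NormedSpace ℝ F] {b : E → F} {i : ℕ} (hb : ContDiff ℝ i b)
    (hbs : HasCompactSupport b) : ∃ C : ℝ, 0 ≤ C ∧ ∀ R : ℝ, 0 < R → ∀ x : E,
      ‖iteratedFDeriv ℝ i (fun x => b (R⁻¹ • x)) x‖ * ‖x‖ ^ i ≤ C := by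
  have hc : Continuous fun x : E => ‖iteratedFDeriv ℝ i b x‖ * ‖x‖ ^ i :=
    (hb.continuous_iteratedFDeriv le_rfl).norm.mul (continuous_norm.pow i)
  have hs : HasCompactSupport fun x : E => ‖iteratedFDeriv ℝ i b x‖ * ‖x‖ ^ i :=
    (HasCompactSupport.norm (hbs.iteratedFDeriv (𝕜 := ℝ) i)).mul_right
  obtain ⟨C, hC⟩ := hc.bounded_above_of_compact_support hs
  have hC0 : 0 ≤ C := (norm_nonneg _).trans (hC 0)
  refine ⟨C, hC0, fun R hR x => ?_⟩
  set g : E →L[ℝ] E := R⁻¹ • ContinuousLinearMap.id ℝ E with hg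
  have e : (fun x => b (R⁻¹ • x)) = b ∘ g := rfl
  rw [e, g.iteratedFDeriv_comp_right hb x le_rfl]
  have h1 := ContinuousMultilinearMap.norm_compContinuousLinearMap_le
    (iteratedFDeriv ℝ i b (g x)) (fun _ : Fin i => g)
  have h2 : ‖g‖ ≤ R⁻¹ := by
    refine (norm_smul_le R⁻¹ (ContinuousLinearMap.id ℝ E)).trans ?_
    rw [norm_inv, Real.norm_of_nonneg hR.le]
    exact mul_le_of_le_one_right (by positivity) ContinuousLinearMap.norm_id_le
  have h3 := hC (g x)
  have hgx : ‖g x‖ = R⁻¹ * ‖x‖ := by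
    change ‖R⁻¹ • x‖ = _
    rw [norm_smul, norm_inv, Real.norm_of_nonneg hR.le]
  rw [norm_mul, norm_pow, norm_norm, norm_norm, hgx, mul_pow] at h3
  rw [Finset.prod_const, Finset.card_univ, Fintype.card_fin] at h1
  calc _ ≤ (‖iteratedFDeriv ℝ i b (g x)‖ * ‖g‖ ^ i) * ‖x‖ ^ i :=
        mul_le_mul_of_nonneg_right h1 (by positivity)
    _ ≤ (‖iteratedFDeriv ℝ i b (g x)‖ * R⁻¹ ^ i) * ‖x‖ ^ i := by gcongr
    _ = ‖iteratedFDeriv ℝ i b (g x)‖ * (R⁻¹ ^ i * ‖x‖ ^ i) := by ring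
    _ ≤ C := h3

theorem hasCompactSupport_unitBump :
    HasCompactSupport fun x : Cn n => ((unitBump n x : ℝ) : ℂ) := by
  refine HasCompactSupport.intro (isCompact_closedBall 0 1) fun x hx => ?_
  rw [mem_closedBall_zero_iff, not_le] at hx
  simp only [Complex.ofReal_eq_zero]
  refine (unitBump n).zero_of_le_dist ?_
  rw [dist_zero_right]
  exact hx.le

/-- Scale invariance makes the constant independent of `R`, which permits the limit of shrinking
radii behind the tangential equations. -/
theorem exists_norm_iteratedFDeriv_cut_le (n i : ℕ) : ∃ C : ℝ, 0 ≤ C ∧ ∀ R : ℝ, 0 < R → ∀ x : Cn n,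
    ‖iteratedFDeriv ℝ i (cut R) x‖ * ‖x‖ ^ i ≤ C := by
  have h : ContDiff ℝ i (fun x : Cn n => ((unitBump n x : ℝ) : ℂ)) :=
    (contDiff_unitBump (N := (⊤ : ℕ∞))).of_le (by exact_mod_cast (le_top : (i : ℕ∞) ≤ ⊤))
  obtain ⟨C, hC0, hC⟩ := exists_norm_iteratedFDeriv_dilate_le h hasCompactSupport_unitBump
  refine ⟨C, hC0, fun R hR x => ?_⟩
  have e : (fun x : Cn n => ((unitBump n (R⁻¹ • x) : ℝ) : ℂ)) = cut R := rfl
  have h1 := hC R hR x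
  rw [e] at h1
  exact h1

/-- The truncated Bochner–Martinelli kernel. -/
noncomputable def cutBM (R : ℝ) (j : Fin n) (x : Cn n) : ℂ := cut R x * bm j x

/-- The divergence of the truncated Bochner–Martinelli kernel off the origin. -/
noncomputable def cutSource (R : ℝ) (x : Cn n) : ℂ := ∑ j, dbarFun j (cut R) x * bm j x

theorem contDiffOn_cutBM {N : ℕ∞} (R : ℝ) (j : Fin n) : ContDiffOn ℝ N (cutBM R j) {0}ᶜ :=
  (contDiff_cut R).contDiffOn.mul (contDiffOn_bm j)

theorem contDiffAt_cutBM {N : ℕ∞} (R : ℝ) (j : Fin n) {x : Cn n} (hx : x ≠ 0) :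
    ContDiffAt ℝ N (cutBM R j) x :=
  (contDiffOn_cutBM R j).contDiffAt (isOpen_compl_singleton.mem_nhds hx)

theorem cutBM_neg (R : ℝ) (j : Fin n) (x : Cn n) : cutBM R j (-x) = -cutBM R j x := by
  rw [cutBM, cut_neg, bm_neg, cutBM, mul_neg]

theorem cutBM_eq_zero {R : ℝ} (hR : 0 < R) (j : Fin n) {x : Cn n} (hx : R ≤ ‖x‖) :
    cutBM R j x = 0 := by
  rw [cutBM, cut_eq_zero hR hx, zero_mul]

theorem measurable_cutBM (R : ℝ) (j : Fin n) : Measurable (cutBM R j) :=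
  (contDiff_cut (N := 0) R).continuous.measurable.mul (measurable_bm j)

theorem integrable_cutBM {R : ℝ} (hR : 0 < R) (j : Fin n) : Integrable (cutBM R j) := by
  have h := (locallyIntegrable_bm j).integrable_smul_left_of_hasCompactSupport
    (contDiff_cut (N := 0) R).continuous (hasCompactSupport_cut hR)
  exact h

theorem norm_cutBM_le (R : ℝ) (j : Fin n) (x : Cn n) :
    ‖cutBM R j x‖ ≤ ‖(bmConst n)⁻¹‖ * (‖x‖ ^ (2 * n - 1))⁻¹ := by
  rw [cutBM, norm_mul]
  exact (mul_le_of_le_one_left (norm_nonneg _) (norm_cut_le R x)).trans (norm_bm_le j x)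

/-- By the Leibniz rule the truncation preserves the order of the singularity at every derivative,
with constants independent of `R`. -/
theorem exists_norm_iteratedFDeriv_cutBM_le (p : ℕ) (j : Fin n) : ∃ C : ℝ, 0 ≤ C ∧
    ∀ R : ℝ, 0 < R → ∀ i ≤ p, ∀ x ≠ 0,
      ‖iteratedFDeriv ℝ i (cutBM R j) x‖ * ‖x‖ ^ (2 * n - 1 + i) ≤ C := by
  set d := 2 * n - 1 with hd
  choose c hc0 hc using fun i => exists_norm_iteratedFDeriv_cut_le n i
  set C₁ := ∑ i ∈ Finset.range (p + 1), c i with hC₁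
  have hcC : ∀ i ≤ p, c i ≤ C₁ := fun i hi =>
    Finset.single_le_sum (f := c) (fun i _ => hc0 i) (Finset.mem_range.2 (by omega))
  have hC₁0 : 0 ≤ C₁ := Finset.sum_nonneg fun i _ => hc0 i
  obtain ⟨C', hC'0, hC'⟩ := exists_norm_iteratedFDeriv_le_of_homogeneous (E := Cn n) p
    (contDiffOn_bm j) (fun t ht x => bm_smul j ht x)
  refine ⟨2 ^ p * (C₁ * C'), by positivity, fun R hR i hi x hx => ?_⟩
  have hx' : 0 < ‖x‖ := norm_pos_iff.2 hx
  have ho : IsOpen ({0}ᶜ : Set (Cn n)) := isOpen_compl_singleton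
  have h1 := norm_iteratedFDerivWithin_mul_le (n := i) (N := (p : ℕ∞))
    (contDiff_cut R).contDiffOn (contDiffOn_bm j) ho.uniqueDiffOn hx (by exact_mod_cast hi)
  rw [iteratedFDerivWithin_of_isOpen _ ho hx] at h1
  refine (mul_le_mul_of_nonneg_right h1 (by positivity)).trans ?_
  refine le_trans ?_ (mul_le_mul_of_nonneg_right
    (pow_le_pow_right₀ one_le_two hi : (2 : ℝ) ^ i ≤ 2 ^ p) (by positivity))
  have h3 : (2 : ℝ) ^ i = ∑ k ∈ Finset.range (i + 1), (i.choose k : ℝ) := by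
    exact_mod_cast (Nat.sum_range_choose i).symm
  rw [h3, Finset.sum_mul, Finset.sum_mul]
  refine Finset.sum_le_sum fun k hk => ?_
  have hki : k ≤ i := by have := Finset.mem_range.1 hk; omega
  rw [iteratedFDerivWithin_of_isOpen _ ho hx, iteratedFDerivWithin_of_isOpen _ ho hx]
  have a1 := (hc k R hR x).trans (hcC k (hki.trans hi))
  have a2 := hC' (i - k) (by omega) x hx
  have e : d + i = k + (d + (i - k)) := by omega
  rw [e, pow_add]
  calc _ = (i.choose k : ℝ) * ((‖iteratedFDeriv ℝ k (cut R) x‖ * ‖x‖ ^ k) *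
        (‖iteratedFDeriv ℝ (i - k) (bm j) x‖ * ‖x‖ ^ (d + (i - k)))) := by
        ring
    _ ≤ (i.choose k : ℝ) * (C₁ * C') := by gcongr

theorem isSmoothKernel_cutBM (p : ℕ) {R : ℝ} (hR : 0 < R) (j : Fin n) (W : Set (Cn n)) :
    IsSmoothKernel p (2 * n - 1) W fun z ζ => cutBM R j (z - ζ) := by
  have h : ContDiffOn ℝ p (fun q : Cn n × Cn n => cutBM R j (q.1 - q.2))
      ((W ×ˢ W) ∩ {q | q.1 ≠ q.2}) :=
    (contDiffOn_cutBM (N := p) R j).comp (contDiff_fst.sub contDiff_snd).contDiffOn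
      fun q hq => sub_ne_zero.2 hq.2
  refine ⟨⟨h.continuousOn, ‖(bmConst n)⁻¹‖₊, fun z _ ζ _ => norm_cutBM_le R j _⟩, h, ?_⟩
  obtain ⟨C, hC0, hC⟩ := exists_norm_iteratedFDeriv_cutBM_le p j
  refine ⟨C, hC0, fun i hi z _ ζ _ hne => ?_⟩
  rw [iteratedFDeriv_comp_sub]
  exact hC R hR i hi _ (sub_ne_zero.2 hne)

theorem cutSource_eq_zero_of_lt {R : ℝ} (hR : 0 < R) {x : Cn n} (hx : ‖x‖ < R / 2) :
    cutSource R x = 0 := by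
  refine Finset.sum_eq_zero fun j _ => ?_
  have h : (cut R : Cn n → ℂ) =ᶠ[𝓝 x] fun _ => 1 := by
    filter_upwards [(continuous_norm.tendsto x).eventually_lt_const hx] with y hy
    exact cut_eq_one hR hy.le
  rw [h.dbarFun_eq]
  simp [dbarFun, antiPart]

theorem cutSource_eq_zero {R : ℝ} (hR : 0 < R) {x : Cn n} (hx : R < ‖x‖) : cutSource R x = 0 := by
  refine Finset.sum_eq_zero fun j _ => ?_
  have h : (cut R : Cn n → ℂ) =ᶠ[𝓝 x] fun _ => 0 := by
    filter_upwards [(continuous_norm.tendsto x).eventually_const_lt hx] with y hy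
    exact cut_eq_zero hR hy.le
  rw [h.dbarFun_eq]
  simp [dbarFun, antiPart]

/-- The derivatives of the cutoff vanish on the ball of radius `R / 2`, so the singularity of the
kernel is never met. -/
theorem contDiff_cutSource {R : ℝ} (hR : 0 < R) :
    ContDiff ℝ (⊤ : ℕ∞) (cutSource R : Cn n → ℂ) := by
  refine contDiff_iff_contDiffAt.2 fun x => ?_
  rcases eq_or_ne x 0 with rfl | hx
  · refine (contDiffAt_const (c := (0 : ℂ))).congr_of_eventuallyEq ?_
    filter_upwards [Metric.ball_mem_nhds (0 : Cn n) (half_pos hR)] with y hy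
    exact cutSource_eq_zero_of_lt hR (by simpa using hy)
  · refine ContDiffAt.sum fun j _ => ?_
    exact (contDiff_dbarFun j (contDiff_cut R)).contDiffAt.mul
      ((contDiffOn_bm j).contDiffAt (isOpen_compl_singleton.mem_nhds hx))

theorem hasCompactSupport_cutSource {R : ℝ} (hR : 0 < R) :
    HasCompactSupport (cutSource R : Cn n → ℂ) :=
  HasCompactSupport.intro (isCompact_closedBall 0 R) fun x hx => cutSource_eq_zero hR (by
    rwa [mem_closedBall_zero_iff, not_le] at hx)

theorem sum_dbarFun_cutBM (R : ℝ) {x : Cn n} (hx : x ≠ 0) :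
    ∑ j, dbarFun j (cutBM R j) x = cutSource R x := by
  have h1 : ∀ j : Fin n, dbarFun j (cutBM R j) x =
      cut R x * dbarFun j (bm j) x + dbarFun j (cut R) x * bm j x := fun j =>
    dbarFun_mul ((contDiff_cut (N := 1) R).differentiable (by simp) x)
      (((contDiffOn_bm (N := 1) j).contDiffAt
        (isOpen_compl_singleton.mem_nhds hx)).differentiableAt (by simp))
  simp_rw [h1]
  rw [Finset.sum_add_distrib, ← Finset.mul_sum, sum_dbarFun_bm hx, mul_zero, zero_add]
  rfl

theorem cutBM_sub_eq_zero {R R' : ℝ} (hR : 0 < R) (hR' : 0 < R') (j : Fin n) {x : Cn n}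
    (hx : ‖x‖ < min R R' / 2) : cutBM R j x - cutBM R' j x = 0 := by
  have h1 : min R R' ≤ R := min_le_left _ _
  have h2 : min R R' ≤ R' := min_le_right _ _
  rw [cutBM, cutBM, cut_eq_one hR (by linarith), cut_eq_one hR' (by linarith), sub_self]

theorem eventuallyEq_cutBM_sub {R R' : ℝ} (hR : 0 < R) (hR' : 0 < R') (j : Fin n) :
    (fun x => cutBM R j x - cutBM R' j x) =ᶠ[𝓝 0] fun _ => 0 := by
  have h : 0 < min R R' / 2 := half_pos (lt_min hR hR')
  filter_upwards [Metric.ball_mem_nhds (0 : Cn n) h] with y hy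
  exact cutBM_sub_eq_zero hR hR' j (by simpa using hy)

/-- Two truncations coincide near the origin. Their difference, unlike either of them, is smooth
with compact support, so that distributions can be applied to it. -/
theorem contDiff_cutBM_sub {R R' : ℝ} (hR : 0 < R) (hR' : 0 < R') (j : Fin n) :
    ContDiff ℝ (⊤ : ℕ∞) fun x => cutBM R j x - cutBM R' j x := by
  refine contDiff_iff_contDiffAt.2 fun x => ?_
  rcases eq_or_ne x 0 with rfl | hx
  · exact (contDiffAt_const (c := (0 : ℂ))).congr_of_eventuallyEq (eventuallyEq_cutBM_sub hR hR' j)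
  · exact (contDiffAt_cutBM R j hx).sub (contDiffAt_cutBM R' j hx)

theorem sum_dbarFun_cutBM_sub {R R' : ℝ} (hR : 0 < R) (hR' : 0 < R') (x : Cn n) :
    ∑ j, dbarFun j (fun x => cutBM R j x - cutBM R' j x) x = cutSource R x - cutSource R' x := by
  rcases eq_or_ne x 0 with rfl | hx
  · rw [cutSource_eq_zero_of_lt hR (by simpa using hR),
      cutSource_eq_zero_of_lt hR' (by simpa using hR'), sub_zero]
    refine Finset.sum_eq_zero fun j _ => ?_
    rw [(eventuallyEq_cutBM_sub hR hR' j).dbarFun_eq]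
    simp [dbarFun, antiPart]
  · rw [← sum_dbarFun_cutBM R hx, ← sum_dbarFun_cutBM R' hx, ← Finset.sum_sub_distrib]
    refine Finset.sum_congr rfl fun j _ => ?_
    have h1 := (contDiffAt_cutBM (N := 1) R j hx).differentiableAt (by simp)
    have h2 := (contDiffAt_cutBM (N := 1) R' j hx).differentiableAt (by simp)
    rw [dbarFun, fderiv_fun_sub h1 h2, sub_eq_add_neg, antiPart_add, antiPart_neg,
      ← sub_eq_add_neg]
    rfl

/-- The local representation formula of a smooth function by its `∂̄`-derivatives. -/
theorem eq_sum_integral_cutBM {R : ℝ} (hR : 0 < R) (hn : 0 < n) {ψ : Cn n → ℂ}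
    (hψ : ContDiff ℝ 1 ψ) (ζ : Cn n) :
    ψ ζ = ∑ j, (∫ x, cutBM R j x * dbarFun j ψ (ζ - x)) - ∫ x, cutSource R x * ψ (ζ - x) := by
  have hsub : ContDiff ℝ 1 fun x : Cn n => ψ (ζ - x) := hψ.comp (contDiff_const.sub contDiff_id)
  have hcut : ContDiff ℝ 1 (cut R : Cn n → ℂ) := contDiff_cut R
  -- The fundamental solution is tested on `cut R x * ψ (ζ - x)`. Differentiating the reflected `ψ`
  -- produces a minus sign, and differentiating the cutoff produces `cutSource`.
  have h := sum_integral_bm_mul_dbarFun hn (hcut.mul hsub) ((hasCompactSupport_cut hR).mul_right)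
  have hi1 : ∀ j : Fin n, Integrable fun x => cutBM R j x * dbarFun j ψ (ζ - x) := by
    intro j
    have h1 := (locallyIntegrable_bm j).integrable_smul_left_of_hasCompactSupport
      (g := fun x => cut R x * dbarFun j ψ (ζ - x))
      (hcut.continuous.mul ((continuous_dbarFun j hψ).comp (by fun_prop)))
      (hasCompactSupport_cut hR).mul_right
    refine h1.congr (Eventually.of_forall fun x => ?_)
    simp only [cutBM, smul_eq_mul]
    ring
  have hi2 : ∀ j : Fin n, Integrable fun x => dbarFun j (cut R) x * bm j x * ψ (ζ - x) := by
    intro j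
    have h1 := (locallyIntegrable_bm j).integrable_smul_left_of_hasCompactSupport
      (g := fun x => dbarFun j (cut R) x * ψ (ζ - x))
      ((continuous_dbarFun j hcut).mul hsub.continuous)
      ((HasCompactSupport.dbarFun j (hasCompactSupport_cut hR)).mul_right)
    refine h1.congr (Eventually.of_forall fun x => ?_)
    simp only [smul_eq_mul]
    ring
  have e : ∀ j : Fin n, ∫ x, bm j x * dbarFun j (fun x => cut R x * ψ (ζ - x)) x =
      (∫ x, dbarFun j (cut R) x * bm j x * ψ (ζ - x)) - ∫ x, cutBM R j x * dbarFun j ψ (ζ - x) := by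
    intro j
    rw [← integral_sub (hi2 j) (hi1 j)]
    refine integral_congr_ae (Eventually.of_forall fun x => ?_)
    simp only
    rw [dbarFun_mul (hcut.differentiable (by simp) x) (hsub.differentiable (by simp) x),
      dbarFun_const_sub j (hψ.differentiable (by simp) _), cutBM]
    ring
  have e2 : ∫ x, cutSource R x * ψ (ζ - x) =
      ∑ j, ∫ x, dbarFun j (cut R) x * bm j x * ψ (ζ - x) := by
    rw [← integral_finsetSum _ fun j _ => hi2 j]
    simp_rw [cutSource, Finset.sum_mul]
  have h' : ∑ j, ∫ x, bm j x * dbarFun j (fun x => cut R x * ψ (ζ - x)) x =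
      -(cut R 0 * ψ (ζ - 0)) := h
  rw [cut_eq_one hR (by rw [norm_zero]; positivity), one_mul, sub_zero] at h'
  simp_rw [e, Finset.sum_sub_distrib] at h'
  rw [e2]
  linear_combination h'

end

/-! ### Solutions of the inhomogeneous equation and their integral formula -/

section

section LineDerivEval

variable {E : Type} [NormedAddCommGroup E] [NormedSpace ℝ E] {Ω : TopologicalSpace.Opens E}

theorem IsTest.fderiv_apply {g : E → ℂ} (hg : IsTest Ω g) (X : E) :
    IsTest Ω fun x => fderiv ℝ g x X :=
  ⟨contDiff_fderiv_apply_const hg.contDiff X, hg.hasCompactSupport.fderiv_apply ℝ X,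
    (tsupport_fderiv_apply_subset ℝ X).trans hg.tsupport_subset⟩

theorem eval_lineDeriv (T : 𝓓'(Ω, ℂ)) {g : E → ℂ} (hg : IsTest Ω g) (X : E) :
    eval (∂_{X} T) g = -eval T fun x => fderiv ℝ g x X := by
  obtain ⟨g', rfl⟩ := hg.exists_eq
  obtain ⟨d, hd⟩ := (hg.fderiv_apply X).exists_eq
  rw [← hd, eval_coe, eval_coe, complexify_apply, complexify_apply]
  have key : ∀ L : ℂ →L[ℝ] ℝ, (∂_{X} T) (TestFunction.postcompCLM L g') =
      -T (TestFunction.postcompCLM L d) := by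
    intro L
    have e : TestFunction.lineDerivCLM ℝ X (TestFunction.postcompCLM L g') =
        TestFunction.postcompCLM L d := by
      ext x
      rw [TestFunction.lineDerivCLM_apply_of_le (by simp), TestFunction.postcompCLM_apply,
        TestFunction.postcompCLM_apply, Function.comp_apply, congrFun hd x]
      have h1 : DifferentiableAt ℝ g' x := hg.contDiff.differentiable (by simp) x
      rw [(L.differentiableAt.comp x h1).lineDeriv_eq_fderiv,
        (L.hasFDerivAt.comp x h1.hasFDerivAt).fderiv]
      rfl
    rw [← e]
    rfl
  rw [key, key]
  ring

theorem eval_dist_add (S T : 𝓓'(Ω, ℂ)) (g : E → ℂ) : eval (S + T) g = eval S g + eval T g := by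
  by_cases h : IsTest Ω g
  · rw [eval_eq _ h, eval_eq _ h, eval_eq _ h, complexify_apply, complexify_apply, complexify_apply,
      add_apply, add_apply]
    ring
  · simp [eval, h]

theorem eval_dist_smul (a : ℂ) (T : 𝓓'(Ω, ℂ)) (g : E → ℂ) : eval (a • T) g = a * eval T g := by
  by_cases h : IsTest Ω g
  · rw [eval_eq _ h, eval_eq _ h, complexify_apply, complexify_apply, smul_apply, smul_apply,
      smul_eq_mul, smul_eq_mul]
    ring
  · simp [eval, h]

end LineDerivEval

variable {n : ℕ} {Ω : TopologicalSpace.Opens (Cn n)}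

theorem IsTest.dbarFun {g : Cn n → ℂ} (hg : IsTest Ω g) (j : Fin n) : IsTest Ω (dbarFun j g) :=
  ((hg.fderiv_apply _).add ((hg.fderiv_apply _).const_mul _)).const_mul _

theorem eval_dbar (T : 𝓓'(Ω, ℂ)) {g : Cn n → ℂ} (hg : IsTest Ω g) (j : Fin n) :
    eval (dbar j T) g = -eval T (LocalReg.dbarFun j g) := by
  have h1 := hg.fderiv_apply (EuclideanSpace.single j 1)
  have h2 := hg.fderiv_apply (EuclideanSpace.single j Complex.I)
  have e : eval T (LocalReg.dbarFun j g) = 1 / 2 *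
      (eval T (fun x => fderiv ℝ g x (EuclideanSpace.single j 1)) +
      Complex.I * eval T (fun x => fderiv ℝ g x (EuclideanSpace.single j Complex.I))) := by
    rw [← eval_const_mul T h2, ← eval_add T h1 (h2.const_mul _),
      ← eval_const_mul T (h1.add (h2.const_mul _))]
    rfl
  rw [e, dbar, eval_dist_smul, eval_dist_add, eval_dist_smul, eval_lineDeriv T hg,
    eval_lineDeriv T hg]
  ring

theorem IsTest.integrable_mul {g w : Cn n → ℂ} (hg : IsTest Ω g)
    (hw : LocallyIntegrableOn w Ω) : Integrable fun z => g z * w z := by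
  have h1 : IntegrableOn w (tsupport g) :=
    hw.integrableOn_compact_subset hg.tsupport_subset hg.hasCompactSupport
  have h2 : IntegrableOn (fun z => g z * w z) (tsupport g) :=
    h1.continuousOn_mul hg.contDiff.continuous.continuousOn hg.hasCompactSupport
  refine (integrableOn_iff_integrable_of_support_subset fun z hz => ?_).1 h2
  refine subset_tsupport _ fun h => hz ?_
  simp [h]

/-- `IsGivenBy` tests against real functions only; complex ones are reached through their real and
imaginary parts. -/
theorem IsGivenBy.eval_eq {T : 𝓓'(Ω, ℂ)} {w g : Cn n → ℂ} (h : IsGivenBy T w) (hg : IsTest Ω g) :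
    eval T g = ∫ z, g z * w z := by
  have hi := hg.integrable_mul h.1
  obtain ⟨g', rfl⟩ := hg.exists_eq
  have hre : ∀ L : ℂ →L[ℝ] ℝ, Integrable fun z => ((L (g' z) : ℝ) : ℂ) * w z := by
    intro L
    have ht : IsTest Ω fun z => ((L (g' z) : ℝ) : ℂ) :=
      IsTest.of_support (Complex.ofRealCLM.contDiff.comp (L.contDiff.comp hg.contDiff))
        hg.hasCompactSupport hg.tsupport_subset fun x hx => by simp [image_eq_zero_of_notMem_tsupport hx]
    exact ht.integrable_mul h.1
  rw [eval_coe, complexify_apply, h.2, h.2, ← integral_const_mul]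
  have e1 := hre Complex.reCLM
  have e2 := hre Complex.imCLM
  simp only [TestFunction.postcompCLM_apply, Function.comp_apply, Complex.real_smul]
  rw [← integral_add e1 (e2.const_mul _)]
  refine integral_congr_ae (Eventually.of_forall fun z => ?_)
  simp only [Complex.reCLM_apply, Complex.imCLM_apply]
  conv_rhs => rw [← Complex.re_add_im (g' z)]
  ring

/-- A solution of `∂̄v = w` with an integrable right-hand side for which all the truncated
Bochner–Martinelli integrals converge. -/
structure IsSolution (v : 𝓓'(Ω, ℂ)) (w : Fin n → Cn n → ℂ) : Prop where
  given : ∀ j, IsGivenBy (dbar j v) (w j)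
  integrableOn : ∀ j, IntegrableOn (w j) Ω
  good : ∀ z ∈ Ω, ∀ j, ∀ R : ℝ, 0 < R → IntegrableOn (fun ζ => cutBM R j (z - ζ) * w j ζ) Ω

/-- The representation of a solution of `∂̄v = w` by integrals over balls of radius `R`. -/
noncomputable def solFormula (v : 𝓓'(Ω, ℂ)) (w : Fin n → Cn n → ℂ) (R : ℝ) (z : Cn n) : ℂ :=
  (∑ j, ∫ ζ in Ω, cutBM R j (z - ζ) * w j ζ) - eval v fun ζ => cutSource R (ζ - z)

theorem isTest_cutSource {R : ℝ} (hR : 0 < R) {z : Cn n} (hz : Metric.closedBall z R ⊆ Ω) :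
    IsTest Ω fun ζ => cutSource R (ζ - z) :=
  IsTest.of_support (contDiff_translate (contDiff_cutSource hR) z) (isCompact_closedBall z R) hz
    fun x hx => cutSource_eq_zero hR (by
      rwa [Metric.mem_closedBall, not_le, dist_eq_norm] at hx)

theorem isTest_cutBM_sub {R R' : ℝ} (hR : 0 < R) (hR' : 0 < R') {z : Cn n}
    (hz : Metric.closedBall z R ⊆ Ω) (hz' : Metric.closedBall z R' ⊆ Ω) (j : Fin n) :
    IsTest Ω fun ζ => cutBM R j (ζ - z) - cutBM R' j (ζ - z) := by
  refine IsTest.of_support (contDiff_translate (contDiff_cutBM_sub hR hR' j) z)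
    ((isCompact_closedBall z R).union (isCompact_closedBall z R')) (union_subset hz hz')
    fun x hx => ?_
  rw [mem_union, not_or, Metric.mem_closedBall, Metric.mem_closedBall, not_le, not_le,
    dist_eq_norm] at hx
  rw [cutBM_eq_zero hR j hx.1.le, cutBM_eq_zero hR' j hx.2.le, sub_zero]

theorem eval_sub {E : Type} [NormedAddCommGroup E] [NormedSpace ℝ E]
    {Ω : TopologicalSpace.Opens E} (T : 𝓓'(Ω, ℂ)) {g h : E → ℂ} (hg : IsTest Ω g)
    (hh : IsTest Ω h) : eval T (fun x => g x - h x) = eval T g - eval T h := by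
  have h1 := eval_add T hg (hh.const_mul (-1))
  rw [eval_const_mul T hh] at h1
  simpa [sub_eq_add_neg] using h1

/-- The difference of two truncated kernels is a vector of test functions `g j` with total
divergence `cutSource R - cutSource R'`. Testing the equation for `v` on the `g j` equates the
change of the integrals with the change of the other term. -/
theorem IsSolution.solFormula_eq {v : 𝓓'(Ω, ℂ)} {w : Fin n → Cn n → ℂ} (H : IsSolution v w)
    {R R' : ℝ} (hR : 0 < R) (hR' : 0 < R') {z : Cn n} (hz : Metric.closedBall z R ⊆ Ω)
    (hz' : Metric.closedBall z R' ⊆ Ω) : solFormula v w R z = solFormula v w R' z := by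
  have hzΩ : z ∈ Ω := hz (Metric.mem_closedBall_self hR.le)
  set g : Fin n → Cn n → ℂ := fun j ζ => cutBM R j (ζ - z) - cutBM R' j (ζ - z) with hg
  have hgt : ∀ j, IsTest Ω (g j) := isTest_cutBM_sub hR hR' hz hz'
  have h1 : ∀ j, eval v (LocalReg.dbarFun j (g j)) = (∫ ζ in Ω, cutBM R j (z - ζ) * w j ζ) -
      ∫ ζ in Ω, cutBM R' j (z - ζ) * w j ζ := by
    intro j
    have h2 := eval_dbar v (hgt j) j
    rw [(H.given j).eval_eq (hgt j)] at h2
    rw [← integral_sub (H.good z hzΩ j R hR) (H.good z hzΩ j R' hR'), ← neg_eq_iff_eq_neg.2 h2,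
      ← integral_neg, ← setIntegral_eq_integral_of_forall_compl_eq_zero (s := (Ω : Set (Cn n)))]
    · refine integral_congr_ae (Eventually.of_forall fun ζ => ?_)
      simp only [hg]
      rw [← neg_sub ζ z, cutBM_neg, cutBM_neg]
      ring
    · intro ζ hζ
      rw [image_eq_zero_of_notMem_tsupport fun h => hζ ((hgt j).tsupport_subset h), zero_mul,
        neg_zero]
  have h3 := eval_sum v (s := Finset.univ) fun j _ => (hgt j).dbarFun j
  have h4 : (fun x => ∑ j, LocalReg.dbarFun j (g j) x) =
      fun ζ => cutSource R (ζ - z) - cutSource R' (ζ - z) := by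
    ext ζ
    rw [← sum_dbarFun_cutBM_sub hR hR']
    refine Finset.sum_congr rfl fun j _ => ?_
    exact dbarFun_comp_sub_const j (fun x => cutBM R j x - cutBM R' j x) z ζ
  rw [h4, eval_sub v (isTest_cutSource hR hz) (isTest_cutSource hR' hz')] at h3
  simp_rw [h1] at h3
  rw [Finset.sum_sub_distrib] at h3
  rw [solFormula, solFormula]
  linear_combination -h3

/-- The function representing a solution of `∂̄v = w`. -/
noncomputable def sol (v : 𝓓'(Ω, ℂ)) (w : Fin n → Cn n → ℂ) (z : Cn n) : ℂ :=
  open Classical in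
  if h : ∃ R : ℝ, 0 < R ∧ Metric.closedBall z R ⊆ Ω then solFormula v w h.choose z else 0

theorem IsSolution.sol_eq {v : 𝓓'(Ω, ℂ)} {w : Fin n → Cn n → ℂ} (H : IsSolution v w)
    {R : ℝ} (hR : 0 < R) {z : Cn n} (hz : Metric.closedBall z R ⊆ Ω) :
    sol v w z = solFormula v w R z := by
  have h : ∃ R : ℝ, 0 < R ∧ Metric.closedBall z R ⊆ Ω := ⟨R, hR, hz⟩
  rw [sol, dif_pos h]
  exact H.solFormula_eq h.choose_spec.1 hR h.choose_spec.2 hz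

end

/-! ### A solution is a locally integrable function -/

section

variable {n : ℕ}

theorem locallyIntegrable_cutBM {R : ℝ} (hR : 0 < R) (j : Fin n) : LocallyIntegrable (cutBM R j) :=
  (integrable_cutBM hR j).locallyIntegrable

theorem contDiff_integral_cutBM {R : ℝ} (hR : 0 < R) (j : Fin n) {ψ : Cn n → ℂ}
    (hψ : ContDiff ℝ (⊤ : ℕ∞) ψ) (hc : HasCompactSupport ψ) :
    ContDiff ℝ (⊤ : ℕ∞) fun ζ => ∫ x, cutBM R j x * ψ (ζ - x) :=
  hc.contDiff_convolution_right (ContinuousLinearMap.mul ℝ ℂ) (locallyIntegrable_cutBM hR j) hψ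

/-- The kernel is singular at the origin, so in the convolution the derivative is put on `ψ`. -/
theorem dbarFun_integral_cutBM {R : ℝ} (hR : 0 < R) (j : Fin n) {ψ : Cn n → ℂ}
    (hψ : ContDiff ℝ 1 ψ) (hc : HasCompactSupport ψ) (ζ : Cn n) :
    dbarFun j (fun ζ => ∫ x, cutBM R j x * ψ (ζ - x)) ζ =
      ∫ x, cutBM R j x * dbarFun j ψ (ζ - x) := by
  have hl := locallyIntegrable_cutBM hR j
  have h1 : ∀ X, fderiv ℝ (fun ζ => ∫ x, cutBM R j x * ψ (ζ - x)) ζ X =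
      ∫ x, cutBM R j x * fderiv ℝ ψ (ζ - x) X := by
    intro X
    have h2 := (hc.hasFDerivAt_convolution_right (ContinuousLinearMap.mul ℝ ℂ) hl hψ ζ).fderiv
    have h3 := convolution_precompR_apply (ContinuousLinearMap.mul ℝ ℂ) hl (hc.fderiv ℝ)
      (hψ.continuous_fderiv (by simp)) ζ X
    rw [← h2] at h3
    exact h3
  have hi : ∀ X, Integrable fun x => cutBM R j x * fderiv ℝ ψ (ζ - x) X := by
    intro X
    have h2 : HasCompactSupport fun a => fderiv ℝ ψ a X := hc.fderiv_apply ℝ X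
    exact h2.convolutionExists_right (ContinuousLinearMap.mul ℝ ℂ) hl
      ((hψ.continuous_fderiv (by simp)).clm_apply continuous_const) ζ
  rw [dbarFun, antiPart, h1, h1, ← integral_const_mul, ← integral_add (hi _) ((hi _).const_mul _),
    ← integral_const_mul]
  refine integral_congr_ae (Eventually.of_forall fun x => ?_)
  simp only [dbarFun, antiPart]
  ring

theorem integral_mul_comp_sub (g ψ : Cn n → ℂ) (ζ : Cn n) :
    ∫ x, g x * ψ (ζ - x) = ∫ z, ψ z * g (ζ - z) := by
  rw [← integral_sub_left_eq_self (fun z => ψ z * g (ζ - z)) volume ζ]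
  refine integral_congr_ae (Eventually.of_forall fun x => ?_)
  simp only [sub_sub_cancel]
  ring

theorem integral_mul_comp_sub_eq_zero {R : ℝ} {K : Set (Cn n)} {g ψ : Cn n → ℂ}
    (hg : ∀ x, R < ‖x‖ → g x = 0) (hψ : ∀ x ∉ K, ψ x = 0) {ζ : Cn n}
    (hζ : ζ ∉ Metric.cthickening R K) : ∫ x, g x * ψ (ζ - x) = 0 := by
  rw [integral_eq_zero_of_ae]
  refine Eventually.of_forall fun x => ?_
  by_cases h : R < ‖x‖
  · simp [hg x h]
  · rw [not_lt] at h
    have : ζ - x ∉ K := fun hK => hζ (Metric.mem_cthickening_of_dist_le ζ (ζ - x) R K hK (by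
      rw [dist_eq_norm]; simpa using h))
    simp [hψ _ this]

theorem suppIn_cutSource {R : ℝ} (hR : 0 < R) (K : Set (Cn n)) :
    SuppIn (cutSource R) K (Metric.cthickening R K) := by
  intro z hz x hx
  refine cutSource_eq_zero hR ?_
  by_contra h
  rw [not_lt] at h
  exact hx (Metric.mem_cthickening_of_dist_le x z R K hz (by rwa [dist_eq_norm]))

variable {Ω : TopologicalSpace.Opens (Cn n)} {v : 𝓓'(Ω, ℂ)} {w : Fin n → Cn n → ℂ}

theorem integrable_cutBM_prod {R : ℝ} (hR : 0 < R) (j : Fin n) {u : Cn n → ℂ}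
    (hu : IntegrableOn u Ω) :
    Integrable (fun p : Cn n × Cn n => (Ω : Set (Cn n)).indicator u p.2 * cutBM R j (p.1 - p.2))
      (volume.prod volume) :=
  ((integrable_indicator_iff Ω.isOpen.measurableSet).2 hu).convolution_integrand
    (ContinuousLinearMap.mul ℝ ℂ) (integrable_cutBM hR j)

theorem integral_indicator_mul_cutBM (R : ℝ) (j : Fin n) (u : Cn n → ℂ) (z : Cn n) :
    ∫ ζ, (Ω : Set (Cn n)).indicator u ζ * cutBM R j (z - ζ) =
      ∫ ζ in Ω, cutBM R j (z - ζ) * u ζ := by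
  rw [← integral_indicator Ω.isOpen.measurableSet]
  refine integral_congr_ae (Eventually.of_forall fun ζ => ?_)
  by_cases h : ζ ∈ (Ω : Set (Cn n)) <;> simp [h, mul_comm]

theorem integrable_potential_cutBM {R : ℝ} (hR : 0 < R) (j : Fin n) {u : Cn n → ℂ}
    (hu : IntegrableOn u Ω) : Integrable fun z => ∫ ζ in Ω, cutBM R j (z - ζ) * u ζ := by
  have h := (integrable_cutBM_prod (Ω := Ω) hR j hu).integral_prod_left
  exact h.congr (Eventually.of_forall fun z => integral_indicator_mul_cutBM R j u z)

/-- Fubini, the sign coming from the oddness of the truncated kernel. The hypothesis `hsub` matters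
because the integral over `ζ` on the right is not restricted to `Ω`. -/
theorem integral_mul_potential_cutBM {R : ℝ} (hR : 0 < R) (j : Fin n) {u : Cn n → ℂ}
    (hu : IntegrableOn u Ω) {ψ : Cn n → ℂ} (hψ : Continuous ψ) (hψc : HasCompactSupport ψ)
    (hsub : ∀ ζ ∉ Ω, ∫ x, cutBM R j x * ψ (ζ - x) = 0) :
    ∫ z, ψ z * ∫ ζ in Ω, cutBM R j (z - ζ) * u ζ =
      -∫ ζ, (∫ x, cutBM R j x * ψ (ζ - x)) * u ζ := by
  obtain ⟨M, hM⟩ := hψ.bounded_above_of_compact_support hψc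
  have h1 : Integrable (fun p : Cn n × Cn n => ψ p.1 *
      ((Ω : Set (Cn n)).indicator u p.2 * cutBM R j (p.1 - p.2))) (volume.prod volume) :=
    (integrable_cutBM_prod hR j hu).bdd_mul (c := M)
      (hψ.comp continuous_fst).aestronglyMeasurable (Eventually.of_forall fun p => hM _)
  have h2 := integral_integral_swap (f := fun z ζ => ψ z *
    ((Ω : Set (Cn n)).indicator u ζ * cutBM R j (z - ζ))) h1
  simp_rw [integral_const_mul, integral_indicator_mul_cutBM] at h2
  rw [h2, ← integral_neg]
  refine integral_congr_ae (Eventually.of_forall fun ζ => ?_)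
  simp only
  have e : ∀ z, ψ z * ((Ω : Set (Cn n)).indicator u ζ * cutBM R j (z - ζ)) =
      -((Ω : Set (Cn n)).indicator u ζ) * (ψ z * cutBM R j (ζ - z)) := by
    intro z
    rw [← neg_sub ζ z, cutBM_neg]
    ring
  simp_rw [e, integral_const_mul, ← integral_mul_comp_sub]
  by_cases h : ζ ∈ (Ω : Set (Cn n))
  · rw [indicator_of_mem h]; ring
  · rw [hsub ζ h]; simp

theorem apply_eq_eval (v : 𝓓'(Ω, ℂ)) (χ : 𝓓(Ω, ℝ)) :
    IsTest Ω (fun x => (χ x : ℂ)) ∧ v χ = eval v fun x => (χ x : ℂ) := by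
  have e : (fun x => (χ x : ℂ)) = (TestFunction.postcompCLM Complex.ofRealCLM χ : 𝓓(Ω, ℂ)) := by
    ext x
    rw [TestFunction.postcompCLM_apply]
    rfl
  set χ' : 𝓓(Ω, ℂ) := TestFunction.postcompCLM Complex.ofRealCLM χ with hχ'
  refine ⟨e ▸ ⟨χ'.contDiff, χ'.hasCompactSupport, χ'.tsupport_subset⟩, ?_⟩
  rw [e, eval_coe, complexify_apply]
  have e1 : TestFunction.postcompCLM Complex.reCLM χ' = χ := by
    ext x
    simp [hχ', TestFunction.postcompCLM_apply]
  have e2 : TestFunction.postcompCLM Complex.imCLM χ' = 0 := by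
    ext x
    simp [hχ', TestFunction.postcompCLM_apply]
  rw [e1, e2, map_zero, mul_zero, add_zero]

/-- On a small ball one radius serves all points; there the potentials are convolutions of
integrable functions and the remaining term is continuous. -/
theorem IsSolution.locallyIntegrableOn (H : IsSolution v w) : LocallyIntegrableOn (sol v w) Ω := by
  intro z hz
  obtain ⟨ε, hε, hball⟩ := Metric.isOpen_iff.1 Ω.isOpen z hz
  set R := ε / 4 with hR
  have hR0 : 0 < R := by positivity
  have hK : Metric.cthickening R (Metric.closedBall z R) ⊆ Ω := by
    rw [cthickening_closedBall hR0.le hR0.le]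
    exact (Metric.closedBall_subset_ball (by linarith)).trans hball
  have hcb : ∀ y ∈ Metric.closedBall z R, Metric.closedBall y R ⊆ (Ω : Set (Cn n)) := fun y hy x hx =>
    hK (Metric.mem_cthickening_of_dist_le x y R _ hy hx)
  refine ⟨Metric.closedBall z R, mem_nhdsWithin_of_mem_nhds (Metric.closedBall_mem_nhds z hR0), ?_⟩
  have h1 : IntegrableOn (solFormula v w R) (Metric.closedBall z R) := by
    refine Integrable.sub ?_ ?_
    · exact (integrable_finsetSum _ fun j _ =>
        integrable_potential_cutBM hR0 j (H.integrableOn j)).integrableOn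
    · exact (continuousOn_eval_translate v (isCompact_closedBall z R).cthickening hK
        (contDiff_cutSource hR0) (hasCompactSupport_cutSource hR0)
        (suppIn_cutSource hR0 _)).integrableOn_compact (isCompact_closedBall z R)
  exact h1.congr_fun (fun y hy => (H.sol_eq hR0 (hcb y hy)).symm) measurableSet_closedBall

/-- The dual of `eq_sum_integral_cutBM`: a test function is a sum of `∂̄_j`-derivatives of its
transforms minus a superposition of translates of `cutSource R`. On the former `v` is computed from
`w`, on the latter by `eval_smear`. -/
theorem IsSolution.isGivenBy (H : IsSolution v w) (hn : 0 < n) : IsGivenBy v (sol v w) := by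
  refine ⟨H.locallyIntegrableOn, fun χ => ?_⟩
  obtain ⟨ht, hv⟩ := apply_eq_eval v χ
  rw [hv]
  set ψ : Cn n → ℂ := fun x => (χ x : ℂ) with hψ
  obtain ⟨R, hR, hRΩ⟩ := ht.hasCompactSupport.isCompact.exists_cthickening_subset_open Ω.isOpen
    ht.tsupport_subset
  have hK0 : IsCompact (tsupport ψ) := ht.hasCompactSupport
  have hK : IsCompact (Metric.cthickening R (tsupport ψ)) := hK0.cthickening
  have hψ0 : ∀ x ∉ tsupport ψ, ψ x = 0 := fun x hx => image_eq_zero_of_notMem_tsupport hx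
  have hψ1 : ContDiff ℝ 1 ψ := ht.contDiff.of_le (by exact_mod_cast le_top)
  have hG0 : ∀ j, ∀ ζ ∉ Metric.cthickening R (tsupport ψ), ∫ x, cutBM R j x * ψ (ζ - x) = 0 :=
    fun j ζ hζ => integral_mul_comp_sub_eq_zero (fun x hx => cutBM_eq_zero hR j hx.le) hψ0 hζ
  have hG : ∀ j : Fin n, IsTest Ω fun ζ => ∫ x, cutBM R j x * ψ (ζ - x) := fun j =>
    IsTest.of_support (contDiff_integral_cutBM hR j ht.contDiff ht.hasCompactSupport) hK hRΩ (hG0 j)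
  have hχi : Integrable χ := χ.contDiff.continuous.integrable_of_hasCompactSupport χ.hasCompactSupport
  have hSe : (fun ζ => ∫ x, cutSource R x * ψ (ζ - x)) = fun ζ => ∫ z, χ z • cutSource R (ζ - z) := by
    ext ζ
    rw [integral_mul_comp_sub]
    rfl
  have hS : IsTest Ω fun ζ => ∫ x, cutSource R x * ψ (ζ - x) := by
    refine IsTest.of_support ?_ hK hRΩ
      fun ζ hζ => integral_mul_comp_sub_eq_zero (fun x hx => cutSource_eq_zero hR hx) hψ0 hζ
    rw [hSe]
    exact contDiff_smear hχi aemeasurable_id (contDiff_cutSource hR) (hasCompactSupport_cutSource hR)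
  have e1 : ψ = fun ζ => (∑ j, dbarFun j (fun ζ => ∫ x, cutBM R j x * ψ (ζ - x)) ζ) -
      ∫ x, cutSource R x * ψ (ζ - x) := by
    ext ζ
    simp_rw [fun j => dbarFun_integral_cutBM hR j hψ1 ht.hasCompactSupport ζ]
    exact eq_sum_integral_cutBM hR hn hψ1 ζ
  have e2 : ∀ j, eval v (dbarFun j fun ζ => ∫ x, cutBM R j x * ψ (ζ - x)) =
      ∫ z, ψ z * ∫ ζ in Ω, cutBM R j (z - ζ) * w j ζ := by
    intro j
    have h1 := eval_dbar v (hG j) j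
    rw [(H.given j).eval_eq (hG j)] at h1
    rw [integral_mul_potential_cutBM hR j (H.integrableOn j) hψ1.continuous ht.hasCompactSupport
      (fun ζ hζ => hG0 j ζ fun h => hζ (hRΩ h)), h1, neg_neg]
  have hsupp := suppIn_cutSource hR (tsupport ψ)
  have e3 : eval v (fun ζ => ∫ x, cutSource R x * ψ (ζ - x)) =
      ∫ z, ψ z * eval v fun ζ => cutSource R (ζ - z) := by
    rw [hSe]
    exact eval_smear v hK hRΩ hχi aemeasurable_id (contDiff_cutSource hR)
      (hasCompactSupport_cutSource hR) fun z hz x hx => hsupp z (subset_tsupport _ (by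
        simpa [hψ] using hz)) x hx
  have i1 : ∀ j : Fin n, Integrable fun z => ψ z * ∫ ζ in Ω, cutBM R j (z - ζ) * w j ζ := by
    intro j
    obtain ⟨M, hM⟩ := hψ1.continuous.bounded_above_of_compact_support ht.hasCompactSupport
    exact (integrable_potential_cutBM hR j (H.integrableOn j)).bdd_mul (c := M)
      hψ1.continuous.aestronglyMeasurable (Eventually.of_forall hM)
  have i2 : Integrable fun z => ψ z * eval v fun ζ => cutSource R (ζ - z) := by
    have h1 : IntegrableOn (fun z => ψ z * eval v fun ζ => cutSource R (ζ - z)) (tsupport ψ) :=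
      (hψ1.continuous.continuousOn.mul (continuousOn_eval_translate v hK hRΩ (contDiff_cutSource hR)
        (hasCompactSupport_cutSource hR) hsupp)).integrableOn_compact hK0
    refine (integrableOn_iff_integrable_of_support_subset fun z hz => ?_).1 h1
    refine subset_tsupport _ fun h => hz ?_
    simp [h]
  conv_lhs => rw [e1]
  rw [eval_sub v (IsTest.sum fun j _ => (hG j).dbarFun j) hS, eval_sum v fun j _ => (hG j).dbarFun j,
    e3]
  simp_rw [e2]
  rw [← integral_finsetSum _ fun j _ => i1 j, ← integral_sub (integrable_finsetSum _ fun j _ => i1 j) i2]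
  refine integral_congr_ae (Eventually.of_forall fun z => ?_)
  simp only
  by_cases hz : z ∈ tsupport ψ
  · rw [H.sol_eq hR fun x hx => hRΩ (Metric.mem_cthickening_of_dist_le x z R _ hz hx), solFormula,
      Complex.real_smul, ← Finset.mul_sum, ← mul_sub]
  · have h0 := hψ0 z hz
    have h1 : χ z = 0 := by simpa [hψ] using h0
    simp [h0, h1]

end

/-! ### Continuity off the zero set and L¹ convergence of solutions -/

section

variable {n : ℕ}

/-- The truncated Bochner–Martinelli potential at a point near which the density is continuous. -/
theorem integrableOn_and_continuousAt_potential {Ω : TopologicalSpace.Opens (Cn n)} {u : Cn n → ℂ}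
    (hu : IntegrableOn u Ω) {O : Set (Cn n)} (hO : IsOpen O) (hOΩ : O ⊆ Ω) (huO : ContinuousOn u O)
    {z : Cn n} (hz : z ∈ O) {R : ℝ} (hR : 0 < R) (j : Fin n) :
    IntegrableOn (fun ζ => cutBM R j (z - ζ) * u ζ) Ω ∧
      ContinuousAt (fun z => ∫ ζ in Ω, cutBM R j (z - ζ) * u ζ) z := by
  obtain ⟨ε, hε, hball⟩ := Metric.isOpen_iff.1 hO z hz
  set r := ε / 2 with hr
  have hr0 : 0 < r := by positivity
  have hcb : Metric.closedBall z r ⊆ O :=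
    (Metric.closedBall_subset_ball (by linarith)).trans hball
  -- The density is split by a cutoff around `z`. The inner part is continuous with compact support,
  -- so its potential is a continuous convolution. The outer part stays at distance at least `r / 4`
  -- from every `y` in the ball of radius `r / 4`, where the kernel is bounded.
  have hcutc : Continuous fun ζ : Cn n => cut r (ζ - z) :=
    (contDiff_cut (N := 0) r).continuous.comp (by fun_prop)
  have hg0 : ∀ ζ ∉ Metric.closedBall z r, cut r (ζ - z) * u ζ = 0 := by
    intro ζ hζ
    rw [Metric.mem_closedBall, not_le, dist_eq_norm] at hζ
    rw [cut_eq_zero hr0 hζ.le, zero_mul]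
  have hgs : tsupport (fun ζ => cut r (ζ - z) * u ζ) ⊆ Metric.closedBall z r :=
    closure_minimal (fun ζ hζ => by by_contra h; exact hζ (hg0 ζ h)) Metric.isClosed_closedBall
  have hgc : HasCompactSupport fun ζ => cut r (ζ - z) * u ζ :=
    HasCompactSupport.intro (isCompact_closedBall z r) hg0
  have hg : Continuous fun ζ => cut r (ζ - z) * u ζ :=
    ContinuousOn.continuous_of_tsupport_subset (hcutc.continuousOn.mul huO) hO (hgs.trans hcb)
  have hg0' : ∀ ζ ∉ (Ω : Set (Cn n)), cut r (ζ - z) * u ζ = 0 := fun ζ hζ =>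
    hg0 ζ fun h => hζ (hOΩ (hcb h))
  have hi1 : ∀ y, Integrable fun ζ => cutBM R j (y - ζ) * (cut r (ζ - z) * u ζ) := by
    intro y
    have h1 := (locallyIntegrable_cutBM hR j)
    have h2 := hgc.convolutionExists_right (ContinuousLinearMap.mul ℝ ℂ) h1 hg y
    have h3 := h2.integrable_swap
    exact h3
  have hc1 : Continuous fun y => ∫ ζ, cutBM R j (y - ζ) * (cut r (ζ - z) * u ζ) := by
    have h1 := hgc.continuous_convolution_right (ContinuousLinearMap.mul ℝ ℂ)
      (locallyIntegrable_cutBM hR j) hg (μ := volume)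
    refine h1.congr fun y => ?_
    refine (integral_mul_comp_sub (cutBM R j) (fun ζ => cut r (ζ - z) * u ζ) y).trans ?_
    refine integral_congr_ae (Eventually.of_forall fun ζ => ?_)
    simp only
    ring
  set d := 2 * n - 1 with hd
  set B : ℝ := ‖(bmConst n)⁻¹‖ * ((r / 4) ^ d)⁻¹ * 2 with hB
  have hbound : ∀ y ∈ Metric.ball z (r / 4), ∀ ζ,
      ‖cutBM R j (y - ζ) * ((1 - cut r (ζ - z)) * u ζ)‖ ≤ B * ‖u ζ‖ := by
    intro y hy ζ
    rw [Metric.mem_ball, dist_eq_norm] at hy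
    by_cases h : ‖ζ - z‖ ≤ r / 2
    · rw [cut_eq_one hr0 h, sub_self, zero_mul, mul_zero, norm_zero]
      positivity
    · rw [not_le] at h
      have h1 : r / 4 ≤ ‖y - ζ‖ := by
        have := norm_sub_le_norm_sub_add_norm_sub ζ y z
        rw [norm_sub_rev ζ y] at this
        linarith
      rw [norm_mul, norm_mul, ← mul_assoc]
      gcongr
      rw [hB]
      have h2 : ‖1 - cut r (ζ - z)‖ ≤ 2 := by
        refine (norm_sub_le _ _).trans ?_
        have := norm_cut_le r (ζ - z)
        rw [norm_one]; linarith
      gcongr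
      refine (norm_cutBM_le R j _).trans ?_
      gcongr
  have hm2 : ∀ y, AEStronglyMeasurable (fun ζ => cutBM R j (y - ζ) * ((1 - cut r (ζ - z)) * u ζ))
      (volume.restrict (Ω : Set (Cn n))) := by
    intro y
    refine AEStronglyMeasurable.mul ?_ (AEStronglyMeasurable.mul ?_ hu.1)
    · exact ((measurable_cutBM R j).comp (by fun_prop)).aestronglyMeasurable
    · exact (continuous_const.sub hcutc).aestronglyMeasurable
  have hi2 : ∀ y ∈ Metric.ball z (r / 4),
      IntegrableOn (fun ζ => cutBM R j (y - ζ) * ((1 - cut r (ζ - z)) * u ζ)) Ω := fun y hy =>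
    Integrable.mono' (hu.norm.const_mul B) (hm2 y) (Eventually.of_forall (hbound y hy))
  have hc2 : ContinuousAt
      (fun y => ∫ ζ in Ω, cutBM R j (y - ζ) * ((1 - cut r (ζ - z)) * u ζ)) z := by
    refine continuousAt_of_dominated (Eventually.of_forall hm2) (bound := fun ζ => B * ‖u ζ‖) ?_
      (hu.norm.const_mul B) (Eventually.of_forall fun ζ => ?_)
    · filter_upwards [Metric.ball_mem_nhds z (by positivity : 0 < r / 4)] with y hy
      exact Eventually.of_forall (hbound y hy)
    · rcases eq_or_ne ζ z with rfl | hne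
      · rw [cut_eq_one hr0 (by rw [sub_self, norm_zero]; positivity), sub_self, zero_mul]
        simp only [mul_zero]
        exact continuousAt_const
      · have h1 : ContinuousAt (cutBM R j) (z - ζ) :=
          (contDiffAt_cutBM (N := 0) R j (sub_ne_zero.2 hne.symm)).continuousAt
        exact (ContinuousAt.comp (f := fun y => y - ζ) (x := z) h1 (by fun_prop)).mul
          continuousAt_const
  have e : ∀ y ζ, cutBM R j (y - ζ) * u ζ = cutBM R j (y - ζ) * (cut r (ζ - z) * u ζ) +
      cutBM R j (y - ζ) * ((1 - cut r (ζ - z)) * u ζ) := by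
    intro y ζ; ring
  constructor
  · simp_rw [e]
    exact (hi1 z).integrableOn.add (hi2 z (Metric.mem_ball_self (by positivity)))
  · refine ContinuousAt.congr (hc1.continuousAt.add hc2) ?_
    filter_upwards [Metric.ball_mem_nhds z (by positivity : 0 < r / 4)] with y hy
    simp_rw [e y]
    rw [integral_add (hi1 y).integrableOn (hi2 y hy)]
    simp only [Pi.add_apply]
    congr 1
    refine (setIntegral_eq_integral_of_forall_compl_eq_zero (μ := volume) (s := (Ω : Set (Cn n)))
      (f := fun ζ => cutBM R j (y - ζ) * (cut r (ζ - z) * u ζ)) fun ζ hζ => ?_).symm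
    rw [hg0' ζ hζ, mul_zero]

section Data

variable {p l : ℕ} {W U : TopologicalSpace.Opens (Cn n)} {f : Cn n → ℝ} {u : Cn n → ℂ}

theorem LevelData.ae_ne_zero_volume (S : LevelData p (U : Set (Cn n)) W f) (hn : 0 < n) :
    ∀ᵐ z ∂(volume.restrict (W : Set (Cn n))), f z ≠ 0 := by
  rw [volume_Cn hn]
  exact S.ae_ne_zero (finrank_Cn hn)

/-- A function whose quotient by a power of `f` is square integrable is square integrable. -/
theorem LevelData.memLp_of_div (S : LevelData p (U : Set (Cn n)) W f) (hn : 0 < n)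
    (hu : MemLp (fun z => u z / ((|f z| ^ l : ℝ) : ℂ)) 2 (volume.restrict (W : Set (Cn n)))) :
    MemLp u 2 (volume.restrict (W : Set (Cn n))) := by
  obtain ⟨M, hM⟩ := S.isCompact_closure.exists_bound_of_continuousOn
    (S.continuousOn.mono S.closure_subset)
  have hM0 : ∀ z ∈ W, |f z| ≤ M := fun z hz => hM z (subset_closure hz)
  have hfm : AEStronglyMeasurable (fun z => ((|f z| ^ l : ℝ) : ℂ))
      (volume.restrict (W : Set (Cn n))) := by
    refine ContinuousOn.aestronglyMeasurable ?_ W.isOpen.measurableSet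
    exact Complex.continuous_ofReal.comp_continuousOn
      ((S.continuousOn.mono S.subset).abs.pow l)
  have he : ∀ᵐ z ∂(volume.restrict (W : Set (Cn n))),
      u z / ((|f z| ^ l : ℝ) : ℂ) * ((|f z| ^ l : ℝ) : ℂ) = u z := by
    filter_upwards [S.ae_ne_zero_volume hn] with z hz
    refine div_mul_cancel₀ _ ?_
    rw [Complex.ofReal_ne_zero]
    exact pow_ne_zero _ (abs_ne_zero.2 hz)
  refine MemLp.of_le_mul (c := M ^ l) hu ((hu.1.mul hfm).congr he) ?_
  filter_upwards [he, ae_restrict_mem W.isOpen.measurableSet] with z hz hzW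
  conv_lhs => rw [← hz]
  rw [norm_mul, mul_comm, Complex.norm_real, Real.norm_of_nonneg (by positivity)]
  gcongr
  exact hM0 z hzW

variable {v : 𝓓'(W, ℂ)} {w : Fin n → Cn n → ℂ}

/-- The point is the convergence of the truncated integrals at every `z`: on the zero set it comes
from the vanishing of `w`, elsewhere from the continuity of `w` near `z`. -/
theorem LevelData.isSolution (S : LevelData p (U : Set (Cn n)) W f) (hn : 0 < n)
    (hl : 2 * (2 * n - 1 + p) < 2 * l + (2 * n - 1 + 1))
    (hv : ∀ j, IsGivenBy (dbar j v) (w j))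
    (hwc : ∀ j, ContinuousOn (w j) {ζ | ζ ∈ W ∧ f ζ ≠ 0})
    (hwl : ∀ j, MemLp (fun z => w j z / ((|f z| ^ l : ℝ) : ℂ)) 2
      (volume.restrict (W : Set (Cn n)))) : IsSolution v w := by
  have h2 := fun j => S.memLp_of_div hn (hwl j)
  have hi : ∀ j, IntegrableOn (w j) W := fun j => by
    have : IsFiniteMeasure (volume.restrict (W : Set (Cn n))) :=
      ⟨by rw [Measure.restrict_apply_univ]; exact S.isBounded.measure_lt_top⟩
    exact (h2 j).integrable (by norm_num)
  refine ⟨hv, hi, fun z hz j R hR => ?_⟩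
  by_cases hfz : f z = 0
  · have h3 := h2 j
    have h4 := hwl j
    rw [volume_Cn hn] at h3 h4 ⊢
    obtain ⟨V, -, hzV, -, -, -, h, -⟩ := (isSmoothKernel_cutBM p hR j W).exists_extension S
      (finrank_Cn hn) hl h3 h4 hz hfz
    exact h z hzV hz hfz
  · exact (integrableOn_and_continuousAt_potential (hi j) S.isOpen_ne_zero (fun ζ hζ => hζ.1)
      (hwc j) ⟨hz, hfz⟩ hR j).1

/-- Near every point the solution is a sum of potentials and a smooth function. -/
theorem IsSolution.exists_local {Ω : TopologicalSpace.Opens (Cn n)} {v : 𝓓'(Ω, ℂ)}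
    (H : IsSolution v w) {z : Cn n} (hz : z ∈ Ω) :
    ∃ R : ℝ, 0 < R ∧ Metric.closedBall z R ⊆ Ω ∧ ∃ O : Set (Cn n), IsOpen O ∧ z ∈ O ∧
      (∀ y ∈ O, sol v w y = solFormula v w R y) ∧
      (∀ m : ℕ, ContDiffOn ℝ m (fun y => eval v fun ζ => cutSource R (ζ - y)) O) ∧
      HasFDerivAt (fun y => eval v fun ζ => cutSource R (ζ - y))
        (translateDeriv v (cutSource R) z) z ∧
      ∀ X, translateDeriv v (cutSource R) z X =
        -eval v fun x => fderiv ℝ (cutSource R) (x - z) X := by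
  obtain ⟨ε, hε, hball⟩ := Metric.isOpen_iff.1 Ω.isOpen z hz
  set R := ε / 4 with hR
  have hR0 : 0 < R := by positivity
  have hK : Metric.cthickening R (Metric.closedBall z R) ⊆ Ω := by
    rw [cthickening_closedBall hR0.le hR0.le]
    exact (Metric.closedBall_subset_ball (by linarith)).trans hball
  have hKc : IsCompact (Metric.cthickening R (Metric.closedBall z R)) :=
    (isCompact_closedBall z R).cthickening
  have hs : SuppIn (cutSource R) (Metric.ball z R) (Metric.cthickening R (Metric.closedBall z R)) :=
    fun y hy => suppIn_cutSource hR0 _ y (Metric.ball_subset_closedBall hy)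
  have hz0 : z ∈ Metric.ball z R := Metric.mem_ball_self hR0
  have h1 := contDiff_cutSource (n := n) hR0
  have h2 := hasCompactSupport_cutSource (n := n) hR0
  refine ⟨R, hR0, (Metric.closedBall_subset_ball (by linarith)).trans hball, Metric.ball z R,
    Metric.isOpen_ball, hz0, fun y hy => H.sol_eq hR0 fun x hx => hK ?_,
    fun m => contDiffOn_eval_translate v hKc hK Metric.isOpen_ball m h1 h2 hs,
    hasFDerivAt_eval_translate v hKc hK h1 h2 hs Metric.isOpen_ball hz0,
    fun X => translateDeriv_apply v hKc hK h1 hs hz0 X⟩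
  exact Metric.mem_cthickening_of_dist_le x y R _ (Metric.ball_subset_closedBall hy) hx

theorem LevelData.continuousOn_sol (S : LevelData p (U : Set (Cn n)) W f) (H : IsSolution v w)
    (hwc : ∀ j, ContinuousOn (w j) {ζ | ζ ∈ W ∧ f ζ ≠ 0}) :
    ContinuousOn (sol v w) {ζ | ζ ∈ W ∧ f ζ ≠ 0} := by
  intro z hz
  obtain ⟨R, hR, -, O, hO, hzO, hsol, hθ, -⟩ := H.exists_local hz.1
  refine ContinuousAt.continuousWithinAt ?_
  refine ContinuousAt.congr (f := solFormula v w R) ?_ ?_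
  · refine ContinuousAt.sub (tendsto_finsetSum _ fun j _ => ?_)
      ((hθ 0).continuousOn.continuousAt (hO.mem_nhds hzO))
    exact (integrableOn_and_continuousAt_potential (H.integrableOn j) S.isOpen_ne_zero
      (fun ζ hζ => hζ.1) (hwc j) hz hR j).2
  · filter_upwards [hO.mem_nhds hzO] with y hy using (hsol y hy).symm

end Data

section Convergence

variable {φ : ℝ → Cn n → Cn n} {g g₀ h h₀ : Cn n → ℂ} {A : Set (Cn n)}

theorem TendstoL1.sub (hg : TendstoL1 φ g g₀ A) (hh : TendstoL1 φ h h₀ A) :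
    TendstoL1 φ (fun z => g z - h z) (fun z => g₀ z - h₀ z) A := by
  refine ⟨hg.1.sub hh.1, ?_, ?_⟩
  · filter_upwards [hg.2.1, hh.2.1] with σ h1 h2 using h1.sub h2
  · have h3 := hg.2.2.add hh.2.2
    rw [add_zero] at h3
    refine tendsto_of_tendsto_of_tendsto_of_le_of_le' tendsto_const_nhds h3
      (Eventually.of_forall fun σ => integral_nonneg fun z => norm_nonneg _) ?_
    filter_upwards [hg.2.1, hh.2.1] with σ h1 h2
    have h4 := (h1.sub hg.1).norm
    have h5 := (h2.sub hh.1).norm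
    have h6 := integral_add h4 h5
    simp only [Pi.sub_apply] at h6 h4 h5
    rw [← h6]
    refine integral_mono ((h1.sub h2).sub (hg.1.sub hh.1)).norm (h4.add h5) fun z => ?_
    change ‖g (φ σ z) - h (φ σ z) - (g₀ z - h₀ z)‖ ≤ ‖g (φ σ z) - g₀ z‖ + ‖h (φ σ z) - h₀ z‖
    rw [sub_sub_sub_comm]
    exact norm_sub_le _ _

theorem TendstoL1.zero : TendstoL1 φ (fun _ => 0) (fun _ => 0) A :=
  ⟨integrableOn_zero, Eventually.of_forall fun _ => integrableOn_zero, by simp⟩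

theorem TendstoL1.sum {ι : Type*} {s : Finset ι} {g g₀ : ι → Cn n → ℂ}
    (hg : ∀ i ∈ s, TendstoL1 φ (g i) (g₀ i) A) :
    TendstoL1 φ (fun z => ∑ i ∈ s, g i z) (fun z => ∑ i ∈ s, g₀ i z) A := by
  classical
  induction s using Finset.induction_on with
  | empty => simpa using TendstoL1.zero
  | insert a s ha ih =>
    have h1 := ih fun i hi => hg i (Finset.mem_insert_of_mem hi)
    have h2 := (hg a (Finset.mem_insert_self _ _)).sub (TendstoL1.zero.sub h1)
    simpa [Finset.sum_insert ha] using h2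

theorem TendstoL1.congr (hg : TendstoL1 φ g g₀ A) (hA : MeasurableSet A)
    (h1 : ∀ᶠ σ in 𝓝[≠] (0 : ℝ), ∀ z ∈ A, g (φ σ z) = h (φ σ z)) (h2 : EqOn g₀ h₀ A) :
    TendstoL1 φ h h₀ A := by
  refine ⟨hg.1.congr_fun h2 hA, ?_, hg.2.2.congr' ?_⟩
  · filter_upwards [hg.2.1, h1] with σ h3 h4 using h3.congr_fun h4 hA
  · filter_upwards [h1] with σ h4
    exact setIntegral_congr_fun hA fun z hz => by simp only [h4 z hz, h2 hz]

variable {p : ℕ} {W U : TopologicalSpace.Opens (Cn n)} {f : Cn n → ℝ} {σs : ℝ}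

theorem LevelFamily.eventually_mapsTo (F : LevelFamily p (W : Set (Cn n)) f σs φ) (hp : 0 < p)
    {Q O : Set (Cn n)} (hQ : IsCompact Q) (hQS : Q ⊆ level W f 0) (hO : IsOpen O) (hQO : Q ⊆ O) :
    ∀ᶠ σ in 𝓝 (0 : ℝ), ∀ z ∈ Q, φ σ z ∈ O := by
  have h := hQ.eventually_forall_of_forall_eventually (x₀ := (0 : ℝ))
    (P := fun σ z => z ∈ level W f 0 → φ σ z ∈ O) fun z hz => by
      obtain ⟨N, hN, hzN, hev⟩ := F.exists_nhds (by exact_mod_cast hp.ne') (hQS hz).1 (hQS hz).2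
        (hO.mem_nhds (hQO hz))
      filter_upwards [prod_mem_nhds hev (hN.mem_nhds hzN)] with q hq hqS
      exact (hq.1 q.2 hq.2 hqS.1 hqS.2).1
  filter_upwards [h] with σ hσ z hz using hσ z hz (hQS hz)

/-- For small `σ` the map `φ σ` carries `Q` into `K`, where `g` is bounded, and `Q` has finite area:
dominated convergence. -/
theorem LevelFamily.tendstoL1_of_continuousOn (F : LevelFamily p (W : Set (Cn n)) f σs φ)
    (S : LevelData p (U : Set (Cn n)) W f) (hn : 0 < n) {Q K : Set (Cn n)} (hQ : IsCompact Q)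
    (hQS : Q ⊆ level W f 0) (hK : IsCompact K) (hQK : Q ⊆ interior K) (hg : ContinuousOn g K) :
    TendstoL1 φ g g Q := by
  have hmap := F.eventually_mapsTo S.p_pos hQ hQS isOpen_interior hQK
  have hQm : MeasurableSet Q := hQ.isClosed.measurableSet
  have hQK' : Q ⊆ K := hQK.trans interior_subset
  obtain ⟨M, hM⟩ := hK.exists_bound_of_continuousOn hg
  obtain ⟨C, hC⟩ := S.exists_area_level_le (finrank_Cn hn) (by omega)
  have hfin : IsFiniteMeasure ((area n).restrict Q) := ⟨by
    rw [Measure.restrict_apply_univ]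
    exact ((measure_mono hQS).trans (hC 0)).trans_lt ENNReal.coe_lt_top⟩
  have hfin' : IsFiniteMeasure ((μHE[2 * n - 1] : Measure (Cn n)).restrict Q) := hfin
  have hm : AEStronglyMeasurable g ((area n).restrict Q) :=
    (hg.mono hQK').aestronglyMeasurable hQm
  have hi : IntegrableOn g Q (area n) := by
    refine Integrable.mono' (integrable_const M) hm ?_
    filter_upwards [ae_restrict_mem hQm] with z hz using hM z (hQK' hz)
  have hmσ : ∀ᶠ σ in 𝓝 (0 : ℝ), AEStronglyMeasurable (fun z => g (φ σ z)) ((area n).restrict Q) := by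
    filter_upwards [hmap, F.eventually_mem] with σ h1 h2
    exact (hg.comp ((F.continuousOn h2).mono hQS)
      fun z hz => interior_subset (h1 z hz)).aestronglyMeasurable hQm
  refine tendstoL1_of_nhds ⟨hi, ?_, ?_⟩
  · filter_upwards [hmap, hmσ] with σ h1 h2
    refine Integrable.mono' (integrable_const M) h2 ?_
    filter_upwards [ae_restrict_mem hQm] with z hz using hM _ (interior_subset (h1 z hz))
  · have key : Tendsto (fun σ => ∫ z in Q, ‖g (φ σ z) - g z‖ ∂(area n)) (𝓝 0)
        (𝓝 (∫ z in Q, ‖(0 : ℂ)‖ ∂(area n))) := ?_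
    · simp only [norm_zero, integral_zero] at key
      exact key
    refine tendsto_integral_filter_of_dominated_convergence (fun _ => M + M) ?_ ?_
      (integrable_const _) ?_
    · filter_upwards [hmσ] with σ h1 using (h1.sub hm).norm
    · filter_upwards [hmap] with σ h1
      filter_upwards [ae_restrict_mem hQm] with z hz
      rw [norm_norm]
      exact (norm_sub_le _ _).trans (add_le_add (hM _ (interior_subset (h1 z hz))) (hM z (hQK' hz)))
    · filter_upwards [ae_restrict_mem hQm] with z hz
      have h1 := F.tendsto (hQS hz).1 (hQS hz).2
      have h2 : ContinuousAt g z := hg.continuousAt (mem_interior_iff_mem_nhds.1 (hQK hz))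
      have h3 := ((h2.tendsto.comp h1).sub_const (g z)).norm
      rw [sub_self] at h3
      exact h3

/-- One radius `R` is admissible on a compact neighbourhood of `Q`, so there the solution is a sum
of potentials with weak kernels minus a continuous function. -/
theorem LevelFamily.tendstoL1_sol (F : LevelFamily p (W : Set (Cn n)) f σs φ)
    (S : LevelData p (U : Set (Cn n)) W f) (hn : 0 < n) {v : 𝓓'(W, ℂ)} {w : Fin n → Cn n → ℂ}
    (H : IsSolution v w) (hw : ∀ j, MemLp (w j) 2 (volume.restrict (W : Set (Cn n))))
    {Q : Set (Cn n)} (hQ : IsCompact Q) (hQS : Q ⊆ level W f 0) :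
    TendstoL1 φ (sol v w) (sol v w) Q := by
  have hQm : MeasurableSet Q := hQ.isClosed.measurableSet
  obtain ⟨K, hK, hQK, hKW⟩ := exists_compact_between hQ W.isOpen fun z hz => (hQS hz).1
  obtain ⟨R, hR, hRW⟩ := hK.exists_cthickening_subset_open W.isOpen hKW
  have hcb : ∀ y ∈ K, Metric.closedBall y R ⊆ (W : Set (Cn n)) := fun y hy x hx =>
    hRW (Metric.mem_cthickening_of_dist_le x y R _ hy hx)
  have hθ := F.tendstoL1_of_continuousOn S hn hQ hQS hK hQK
    (continuousOn_eval_translate v hK.cthickening hRW (contDiff_cutSource hR)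
      (hasCompactSupport_cutSource hR) (suppIn_cutSource hR K))
  have hP : ∀ j, TendstoL1 φ (fun z => ∫ ζ in W, cutBM R j (z - ζ) * w j ζ)
      (fun z => ∫ ζ in W, cutBM R j (z - ζ) * w j ζ) Q := by
    intro j
    have h1 := hw j
    rw [volume_Cn hn] at h1 ⊢
    exact tendstoL1_of_nhds (F.tendsto_potential S
      (isSmoothKernel_cutBM p hR j W).toIsWeakKernel (by omega) (finrank_Cn hn) h1 hQ hQS)
  refine ((TendstoL1.sum (s := Finset.univ) fun j _ => hP j).sub hθ).congr hQm ?_ fun z hz => ?_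
  · filter_upwards [(F.eventually_mapsTo S.p_pos hQ hQS isOpen_interior hQK).filter_mono
      nhdsWithin_le_nhds] with σ hσ z hz
    exact (H.sol_eq hR (hcb _ (interior_subset (hσ z hz)))).symm
  · exact (H.sol_eq hR (hcb _ (interior_subset (hQK hz)))).symm

end Convergence

end

/-! ### Closed forms under the truncated transform -/

section

open scoped ENNReal NNReal ComplexConjugate

variable {n : ℕ}

theorem measurable_dbarFun (j : Fin n) (g : Cn n → ℂ) : Measurable (dbarFun j g) :=
  measurable_const.mul ((measurable_fderiv_apply_const ℝ g _).add
    (measurable_const.mul (measurable_fderiv_apply_const ℝ g _)))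

theorem ae_ne_point (hn : 0 < n) (z : Cn n) (Ω : Set (Cn n)) :
    ∀ᵐ ζ ∂(volume.restrict Ω), ζ ≠ z := by
  have : Nonempty (Fin n) := ⟨⟨0, hn⟩⟩
  exact ae_restrict_of_ae (compl_mem_ae_iff.2 (measure_singleton z))

/-- Integrals against singular kernels supported in shrinking balls. -/
theorem integrableOn_and_tendsto_shrinking (hn : 0 < n) {Ω : Set (Cn n)} {z : Cn n}
    {w : Cn n → ℂ} (hw : IntegrableOn (fun ζ => (‖z - ζ‖ ^ (2 * n))⁻¹ * ‖w ζ‖) Ω)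
    (hwm : AEStronglyMeasurable w (volume.restrict Ω)) {a : ℝ → Cn n → ℂ}
    (ham : ∀ R, Measurable (a R)) {C : ℝ}
    (haC : ∀ R, 0 < R → ∀ x ≠ 0, ‖a R x‖ ≤ C * (‖x‖ ^ (2 * n))⁻¹)
    (ha0 : ∀ R, 0 < R → ∀ x, R < ‖x‖ → a R x = 0) :
    (∀ R, 0 < R → IntegrableOn (fun ζ => a R (ζ - z) * w ζ) Ω) ∧
      Tendsto (fun R => ∫ ζ in Ω, a R (ζ - z) * w ζ) (𝓝[>] 0) (𝓝 0) := by
  have hm : ∀ R, AEStronglyMeasurable (fun ζ => a R (ζ - z) * w ζ) (volume.restrict Ω) := fun R =>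
    ((ham R).comp (measurable_id.sub_const z)).aestronglyMeasurable.mul hwm
  have hb : ∀ R, 0 < R → ∀ᵐ ζ ∂(volume.restrict Ω),
      ‖a R (ζ - z) * w ζ‖ ≤ C * ((‖z - ζ‖ ^ (2 * n))⁻¹ * ‖w ζ‖) := by
    intro R hR
    filter_upwards [ae_ne_point hn z Ω] with ζ hζ
    rw [norm_mul, ← mul_assoc, norm_sub_rev z ζ]
    gcongr
    exact haC R hR _ (sub_ne_zero.2 hζ)
  refine ⟨fun R hR => Integrable.mono' (hw.const_mul C) (hm R) (hb R hR), ?_⟩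
  have key : Tendsto (fun R => ∫ ζ in Ω, a R (ζ - z) * w ζ) (𝓝[>] 0)
      (𝓝 (∫ ζ in Ω, (0 : ℂ))) := ?_
  · simpa using key
  refine tendsto_integral_filter_of_dominated_convergence
    (fun ζ => C * ((‖z - ζ‖ ^ (2 * n))⁻¹ * ‖w ζ‖)) (Eventually.of_forall hm) ?_
    (hw.const_mul C) ?_
  · filter_upwards [self_mem_nhdsWithin] with R hR using hb R hR
  · filter_upwards [ae_ne_point hn z Ω] with ζ hζ
    have h1 : 0 < ‖ζ - z‖ := norm_pos_iff.2 (sub_ne_zero.2 hζ)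
    refine tendsto_const_nhds.congr' ?_
    filter_upwards [Ioo_mem_nhdsGT h1] with R hR
    rw [ha0 R hR.1 _ hR.2, zero_mul]

theorem exists_norm_dbarFun_cutBM_le (k j : Fin n) : ∃ C : ℝ, 0 ≤ C ∧ ∀ R : ℝ, 0 < R → ∀ x ≠ 0,
    ‖dbarFun k (cutBM R j) x‖ ≤ C * (‖x‖ ^ (2 * n))⁻¹ := by
  have hn : 0 < n := Fin.pos j
  obtain ⟨C, hC0, hC⟩ := exists_norm_iteratedFDeriv_cutBM_le 1 j
  refine ⟨C, hC0, fun R hR x hx => (norm_dbarFun_le k _ x).trans ?_⟩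
  have h := hC R hR 1 le_rfl x hx
  rw [norm_iteratedFDeriv_one, Nat.sub_add_cancel (by omega)] at h
  have hx' : 0 < ‖x‖ := norm_pos_iff.2 hx
  rwa [← div_eq_mul_inv, le_div_iff₀ (by positivity)]

theorem dbarFun_cutBM_eq_zero {R : ℝ} (hR : 0 < R) (k j : Fin n) {x : Cn n} (hx : R < ‖x‖) :
    dbarFun k (cutBM R j) x = 0 := by
  have h : (cutBM R j) =ᶠ[𝓝 x] fun _ => 0 := by
    filter_upwards [(continuous_norm.tendsto x).eventually_const_lt hx] with y hy
    exact cutBM_eq_zero hR j hy.le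
  rw [h.dbarFun_eq]
  simp [dbarFun, antiPart]

/-- Derivatives of an odd function are even. This reconciles the argument `z - ζ` of the potentials
with the argument `ζ - z` of the test functions. -/
theorem dbarFun_cutBM_neg (R : ℝ) (k j : Fin n) {x : Cn n} (hx : x ≠ 0) :
    dbarFun k (cutBM R j) (-x) = dbarFun k (cutBM R j) x := by
  have hd : DifferentiableAt ℝ (cutBM R j) (0 - x) :=
    (contDiffAt_cutBM (N := 1) R j (by simpa using hx)).differentiableAt (by simp)
  have h := dbarFun_const_sub k hd
  have e : (fun x => cutBM R j (0 - x)) = fun x => (-1 : ℂ) * cutBM R j x := by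
    ext y
    rw [zero_sub, cutBM_neg, neg_one_mul]
  rw [e, dbarFun_const_mul ((contDiffAt_cutBM (N := 1) R j hx).differentiableAt (by simp)),
    zero_sub] at h
  linear_combination h

theorem dbarFun_cutBM_sub_apply (R R' : ℝ) (k j : Fin n) {z ζ : Cn n} (h : ζ ≠ z) :
    dbarFun k (fun ζ => cutBM R j (ζ - z) - cutBM R' j (ζ - z)) ζ =
      dbarFun k (cutBM R j) (ζ - z) - dbarFun k (cutBM R' j) (ζ - z) := by
  have hd : ∀ R, DifferentiableAt ℝ (cutBM R j) (ζ - z) := fun R =>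
    (contDiffAt_cutBM (N := 1) R j (sub_ne_zero.2 h)).differentiableAt (by simp)
  rw [dbarFun_comp_sub_const k (fun x => cutBM R j x - cutBM R' j x) z ζ, dbarFun,
    fderiv_fun_sub (hd R) (hd R'), sub_eq_add_neg, antiPart_add, antiPart_neg, ← sub_eq_add_neg]
  rfl

/-- Off the origin the source is the divergence of the truncated kernel, hence of order `2 * n`
uniformly in `R`. -/
theorem exists_norm_cutSource_le (n : ℕ) : ∃ C : ℝ, ∀ R : ℝ, 0 < R → ∀ x : Cn n, x ≠ 0 →
    ‖cutSource R x‖ ≤ C * (‖x‖ ^ (2 * n))⁻¹ := by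
  choose C hC0 hC using fun j : Fin n => exists_norm_dbarFun_cutBM_le j j
  refine ⟨∑ j, C j, fun R hR x hx => ?_⟩
  rw [← sum_dbarFun_cutBM R hx, Finset.sum_mul]
  exact norm_sum_le_of_le _ fun j _ => hC j R hR x hx

section Closed

variable {Ω : TopologicalSpace.Opens (Cn n)} {w : Fin n → Cn n → ℂ}

theorem IsTest.setIntegral_mul {g : Cn n → ℂ} (hg : IsTest Ω g) (u : Cn n → ℂ) :
    ∫ ζ in Ω, g ζ * u ζ = ∫ ζ, g ζ * u ζ :=
  setIntegral_eq_integral_of_forall_compl_eq_zero (μ := volume) (s := (Ω : Set (Cn n)))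
    (f := fun ζ => g ζ * u ζ) fun ζ hζ => by
      rw [image_eq_zero_of_notMem_tsupport fun h => hζ (hg.tsupport_subset h), zero_mul]

/-- The derivative of the truncated Bochner–Martinelli transform of a closed form. -/
theorem sum_integral_dbarFun_cutBM (hcl : ∀ j k g, IsTest Ω g →
      ∫ ζ, dbarFun j g ζ * w k ζ = ∫ ζ, dbarFun k g ζ * w j ζ)
    (hwm : ∀ j, AEStronglyMeasurable (w j) (volume.restrict (Ω : Set (Cn n))))
    {z : Cn n} (hw : ∀ j, IntegrableOn (fun ζ => (‖z - ζ‖ ^ (2 * n))⁻¹ * ‖w j ζ‖) Ω)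
    {R : ℝ} (hR : 0 < R) (hz : Metric.closedBall z R ⊆ Ω) (k : Fin n) :
    (∀ j, IntegrableOn (fun ζ => dbarFun k (cutBM R j) (z - ζ) * w j ζ) Ω) ∧
    ∑ j, ∫ ζ in Ω, dbarFun k (cutBM R j) (z - ζ) * w j ζ =
      ∫ ζ in Ω, cutSource R (ζ - z) * w k ζ := by
  have hn : 0 < n := Fin.pos k
  choose C hC0 hC using fun j : Fin n => exists_norm_dbarFun_cutBM_le k j
  obtain ⟨C', hC'⟩ := exists_norm_cutSource_le n
  have hne := ae_ne_point hn z (Ω : Set (Cn n))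
  have h1 := fun j => integrableOn_and_tendsto_shrinking hn (hw j) (hwm j)
    (a := fun R => dbarFun k (cutBM R j)) (fun R => measurable_dbarFun k _) (hC j)
    fun R hR x hx => dbarFun_cutBM_eq_zero hR k j hx
  have hsm : ∀ R : ℝ, Measurable (cutSource R : Cn n → ℂ) := fun R =>
    Finset.measurable_fun_sum _ fun j _ => (measurable_dbarFun j _).mul (measurable_bm j)
  have h2 := integrableOn_and_tendsto_shrinking hn (hw k) (hwm k) (a := cutSource) hsm hC'
    fun R hR x hx => cutSource_eq_zero hR hx
  have heven : ∀ j, (fun ζ => dbarFun k (cutBM R j) (z - ζ) * w j ζ) =ᵐ[volume.restrict Ω]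
      fun ζ => dbarFun k (cutBM R j) (ζ - z) * w j ζ := by
    intro j
    filter_upwards [hne] with ζ hζ
    rw [← neg_sub ζ z, dbarFun_cutBM_neg R k j (sub_ne_zero.2 hζ)]
  refine ⟨fun j => ((h1 j).1 R hR).congr (heven j).symm, ?_⟩
  -- The difference of the kernels for `R` and `δ` consists of test functions, so closedness may be
  -- used: `∂̄_k` of the `j`-th one against `w j` becomes `∂̄_j` of it against `w k`, and the sum
  -- over `j` is a difference of sources.
  have hstep : ∀ δ, 0 < δ → δ < R →
      (∑ j, ∫ ζ in Ω, dbarFun k (cutBM R j) (ζ - z) * w j ζ) -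
        ∑ j, ∫ ζ in Ω, dbarFun k (cutBM δ j) (ζ - z) * w j ζ =
      (∫ ζ in Ω, cutSource R (ζ - z) * w k ζ) - ∫ ζ in Ω, cutSource δ (ζ - z) * w k ζ := by
    intro δ hδ hδR
    have ht := isTest_cutBM_sub hR hδ hz ((Metric.closedBall_subset_closedBall hδR.le).trans hz)
    set g : Fin n → Cn n → ℂ := fun j ζ => cutBM R j (ζ - z) - cutBM δ j (ζ - z) with hg
    have hsum : ∀ ζ, ∑ j, dbarFun j (g j) ζ = cutSource R (ζ - z) - cutSource δ (ζ - z) := by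
      intro ζ
      rw [← sum_dbarFun_cutBM_sub hR hδ]
      exact Finset.sum_congr rfl fun j _ =>
        dbarFun_comp_sub_const j (fun x => cutBM R j x - cutBM δ j x) z ζ
    have hint : ∀ j, IntegrableOn (fun ζ => dbarFun j (g j) ζ * w k ζ) Ω := by
      intro j
      choose D hD0 hD using fun j : Fin n => exists_norm_dbarFun_cutBM_le j j
      have h3 := integrableOn_and_tendsto_shrinking hn (hw k) (hwm k)
        (a := fun R => dbarFun j (cutBM R j)) (fun R => measurable_dbarFun j _) (hD j)
        fun R hR x hx => dbarFun_cutBM_eq_zero hR j j hx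
      refine ((h3.1 R hR).sub (h3.1 δ hδ)).congr ?_
      filter_upwards [hne] with ζ hζ
      rw [Pi.sub_apply, ← sub_mul]
      congr 1
      exact (dbarFun_cutBM_sub_apply R δ j j hζ).symm
    rw [← Finset.sum_sub_distrib, ← integral_sub (h2.1 R hR) (h2.1 δ hδ)]
    have e1 : ∀ j, (∫ ζ in Ω, dbarFun k (cutBM R j) (ζ - z) * w j ζ) -
        ∫ ζ in Ω, dbarFun k (cutBM δ j) (ζ - z) * w j ζ =
        ∫ ζ in Ω, dbarFun j (g j) ζ * w k ζ := by
      intro j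
      rw [← integral_sub ((h1 j).1 R hR) ((h1 j).1 δ hδ), ((ht j).dbarFun j).setIntegral_mul,
        hcl j k _ (ht j), ← ((ht j).dbarFun k).setIntegral_mul]
      refine integral_congr_ae ?_
      filter_upwards [hne] with ζ hζ
      rw [← sub_mul]
      congr 1
      exact (dbarFun_cutBM_sub_apply R δ k j hζ).symm
    simp_rw [e1]
    rw [← integral_finsetSum _ fun j _ => hint j]
    refine integral_congr_ae (Eventually.of_forall fun ζ => ?_)
    simp only
    rw [← Finset.sum_mul, hsum, sub_mul]
  -- As `δ → 0` the terms with `δ` disappear: their kernels live in shrinking balls, and `‖z - ζ‖ ^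
  -- (-2n) ‖w j ζ‖` is integrable.
  have h3 : Tendsto (fun δ => ∑ j, ∫ ζ in Ω, dbarFun k (cutBM δ j) (ζ - z) * w j ζ)
      (𝓝[>] 0) (𝓝 0) := by
    have := tendsto_finsetSum Finset.univ fun j _ => (h1 j).2
    simpa using this
  have h4 := tendsto_nhds_unique_of_eventuallyEq
    (h3.const_sub (∑ j, ∫ ζ in Ω, dbarFun k (cutBM R j) (ζ - z) * w j ζ))
    (h2.2.const_sub (∫ ζ in Ω, cutSource R (ζ - z) * w k ζ)) (by
      filter_upwards [Ioo_mem_nhdsGT hR] with δ hδ using hstep δ hδ.1 hδ.2)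
  rw [sub_zero, sub_zero] at h4
  rw [← h4]
  exact Finset.sum_congr rfl fun j _ => integral_congr_ae (heven j)

end Closed

end

/-! ### The tangential Cauchy–Riemann equations -/

section

open scoped ENNReal NNReal ComplexConjugate

variable {n : ℕ} {p l : ℕ} {W U : TopologicalSpace.Opens (Cn n)} {f : Cn n → ℝ}

/-- Tightness over the single point `z`. The order `2 * n = d + 1` is at most `d + p` since `p ≥ 1`,
and the surplus `p - 1` powers of the distance are bounded by `D ^ (p - 1)`. -/
theorem LevelData.integrableOn_inv_norm_pow_mul (S : LevelData p (U : Set (Cn n)) W f) (hn : 0 < n)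
    (hl : 2 * (2 * n - 1 + p) < 2 * l + (2 * n - 1 + 1)) {u : Cn n → ℂ}
    (hu : MemLp (fun z => u z / ((|f z| ^ l : ℝ) : ℂ)) 2 (volume.restrict (W : Set (Cn n))))
    {z : Cn n} (hz : z ∈ W) (hfz : f z = 0) :
    IntegrableOn (fun ζ => (‖z - ζ‖ ^ (2 * n))⁻¹ * ‖u ζ‖) W := by
  have hu2 := S.memLp_of_div hn hu
  have hp := S.p_pos
  rw [volume_Cn hn] at hu hu2 ⊢
  obtain ⟨D, hD⟩ := S.isBounded.subset_ball z
  have hT := S.isTight (finrank_Cn hn) hl hu2 hu (N := {z}) (π := id)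
    (by rintro y rfl; exact ⟨hz, hfz⟩) (D.toNNReal ^ (p - 1))
  rw [S.restrict_ne_zero (finrank_Cn hn)] at hT
  refine hT.integrable (g := fun z ζ => (‖z - ζ‖ ^ (2 * n))⁻¹ * ‖u ζ‖) (fun y _ => ?_) ?_
    (mem_singleton z)
  · refine AEStronglyMeasurable.mul ?_ hu2.1.norm
    exact (((measurable_const.sub measurable_id).norm.pow_const _).inv).aestronglyMeasurable
  · filter_upwards [ae_restrict_mem W.isOpen.measurableSet] with ζ hζ y hy
    rw [mem_singleton_iff] at hy
    subst hy
    have hD' : ‖y - ζ‖ ≤ D := by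
      have := hD hζ
      rw [Metric.mem_ball', dist_eq_norm] at this
      exact this.le
    have hD0 : 0 ≤ D := (norm_nonneg _).trans hD'
    rw [norm_mul, norm_norm, norm_inv, norm_pow, norm_norm, ← mul_assoc]
    gcongr
    push_cast
    rw [Real.coe_toNNReal D hD0, id]
    rcases (norm_nonneg (y - ζ)).eq_or_lt with h0 | h0
    · rw [← h0, zero_pow (by omega), inv_zero]
      positivity
    · rw [← div_eq_mul_inv, le_div_iff₀ (by positivity), show 2 * n - 1 + p = 2 * n + (p - 1) by omega,
        pow_add, inv_mul_cancel_left₀ (by positivity)]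
      gcongr

/-- The equation `∂̄w = 0` in terms of test functions. -/
theorem integral_dbarFun_mul_comm {Ω : TopologicalSpace.Opens (Cn n)} {ω : Fin n → 𝓓'(Ω, ℂ)}
    {w : Fin n → Cn n → ℂ} (hω : ∀ j, IsGivenBy (ω j) (w j))
    (hcl : ∀ j k, dbar j (ω k) = dbar k (ω j)) (j k : Fin n) {g : Cn n → ℂ} (hg : IsTest Ω g) :
    ∫ ζ, dbarFun j g ζ * w k ζ = ∫ ζ, dbarFun k g ζ * w j ζ := by
  rw [← (hω k).eval_eq (hg.dbarFun j), ← (hω j).eval_eq (hg.dbarFun k)]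
  have h1 := eval_dbar (ω k) hg j
  rw [hcl j k, eval_dbar (ω j) hg k] at h1
  exact (neg_injective h1).symm

theorem IsTest.mono {g : Cn n → ℂ} {Ω Ω' : TopologicalSpace.Opens (Cn n)} (hg : IsTest Ω g)
    (h : (Ω : Set (Cn n)) ⊆ Ω') : IsTest Ω' g :=
  ⟨hg.1, hg.2, hg.3.trans h⟩

theorem apply_I_smul_of_antiPart_eq_zero {L : Cn n →L[ℝ] ℂ} (X : Cn n)
    (h : L X + Complex.I * L (Complex.I • X) = 0) : L (Complex.I • X) = Complex.I * L X := by
  linear_combination (-Complex.I) * h + L (Complex.I • X) * Complex.I_sq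

/-- The solution of `∂̄v = w` is `C^p` along the zero set of `f` and satisfies the tangential
Cauchy–Riemann equations there. -/
theorem LevelData.exists_extension_sol (S : LevelData p (U : Set (Cn n)) W f) (hn : 0 < n)
    (hl : 2 * (2 * n - 1 + p) < 2 * l + (2 * n - 1 + 1)) {v : 𝓓'(W, ℂ)} {w : Fin n → Cn n → ℂ}
    (H : IsSolution v w)
    (hw : ∀ j, MemLp (fun z => w j z / ((|f z| ^ l : ℝ) : ℂ)) 2
      (volume.restrict (W : Set (Cn n))))
    (hcl : ∀ j k g, IsTest W g → ∫ ζ, dbarFun j g ζ * w k ζ = ∫ ζ, dbarFun k g ζ * w j ζ)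
    {z : Cn n} (hz : z ∈ level W f 0) :
    ∃ V : Set (Cn n), IsOpen V ∧ z ∈ V ∧ ∃ G : Cn n → ℂ, ContDiffOn ℝ p G V ∧
      EqOn G (sol v w) (level W f 0 ∩ V) ∧
      ∀ X : Cn n, fderiv ℝ f z X = 0 → fderiv ℝ f z (Complex.I • X) = 0 →
        fderiv ℝ G z (Complex.I • X) = Complex.I * fderiv ℝ G z X := by
  obtain ⟨R, hR, hRW, O, hO, hzO, hsol, hθ, hθ', hθX⟩ := H.exists_local hz.1
  have hw2 := fun j => S.memLp_of_div hn (hw j)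
  have key : ∀ j, ∃ V : Set (Cn n), IsOpen V ∧ z ∈ V ∧ ∃ G : Cn n → ℂ, ContDiffOn ℝ p G V ∧
      EqOn G (fun y => ∫ ζ in W, cutBM R j (y - ζ) * w j ζ) (level W f 0 ∩ V) ∧
      ∀ X : Cn n, fderiv ℝ f z X = 0 →
        IntegrableOn (fun ζ => fderiv ℝ (cutBM R j) (z - ζ) X * w j ζ) W ∧
        fderiv ℝ G z X = ∫ ζ in W, fderiv ℝ (cutBM R j) (z - ζ) X * w j ζ := by
    intro j
    have h1 := hw2 j
    have h2 := hw j
    rw [volume_Cn hn] at h1 h2 ⊢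
    obtain ⟨V, hV, hzV, G, hG, hGe, -, hX⟩ := (isSmoothKernel_cutBM p hR j W).exists_extension S
      (finrank_Cn hn) hl h1 h2 hz.1 hz.2
    refine ⟨V, hV, hzV, G, hG, hGe, fun X hfX => ?_⟩
    have h3 := hX X hfX
    simp only [fderiv_comp_sub] at h3
    exact h3
  choose V hV hzV G hG hGe hGX using key
  have hdom := fun j => S.integrableOn_inv_norm_pow_mul hn hl (hw j) hz.1 hz.2
  have hcle := fun k => sum_integral_dbarFun_cutBM hcl (fun j => (hw2 j).1) hdom hR hRW k
  set θ : Cn n → ℂ := fun y => eval v fun ζ => cutSource R (ζ - y) with hθdef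
  have hVo : IsOpen (O ∩ ⋂ j, V j) := hO.inter (isOpen_iInter_of_finite hV)
  have hzm : z ∈ O ∩ ⋂ j, V j := ⟨hzO, mem_iInter.2 hzV⟩
  have hGd : ∀ j, DifferentiableAt ℝ (G j) z := fun j =>
    ((hG j).contDiffAt ((hV j).mem_nhds (hzV j))).differentiableAt S.cast_p_ne_zero
  refine ⟨O ∩ ⋂ j, V j, hVo, hzm, fun y => (∑ j, G j y) - θ y, ?_, ?_, fun X hX hIX => ?_⟩
  · refine ContDiffOn.sub (ContDiffOn.sum fun j _ => (hG j).mono fun y hy => mem_iInter.1 hy.2 j)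
      ((hθ p).mono inter_subset_left)
  · intro y hy
    rw [hsol y hy.2.1, solFormula]
    simp only
    congr 1
    exact Finset.sum_congr rfl fun j _ => hGe j ⟨hy.1, mem_iInter.1 hy.2.2 j⟩
  · have hL : ∀ Y, fderiv ℝ (fun y => (∑ j, G j y) - θ y) z Y =
        (∑ j, fderiv ℝ (G j) z Y) - translateDeriv v (cutSource R) z Y := by
      intro Y
      rw [fderiv_fun_sub (DifferentiableAt.fun_sum fun j _ => hGd j) hθ'.differentiableAt,
        fderiv_fun_sum fun j _ => hGd j, hθ'.fderiv]
      simp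
    refine apply_I_smul_of_antiPart_eq_zero X ?_
    -- Both `X` and `i X` are tangent to the level set, so both derivatives of `G j` are integrals
    -- of kernel derivatives, and they combine into the antilinear part of the differential of the
    -- kernel.
    have hG2 : ∀ j, fderiv ℝ (G j) z X + Complex.I * fderiv ℝ (G j) z (Complex.I • X) =
        2 * ∑ k, conj (X k) * ∫ ζ in W, dbarFun k (cutBM R j) (z - ζ) * w j ζ := by
      intro j
      rw [(hGX j X hX).2, (hGX j _ hIX).2, ← integral_const_mul,
        ← integral_add (hGX j X hX).1 ((hGX j _ hIX).1.const_mul _)]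
      simp_rw [← integral_const_mul]
      rw [← integral_finsetSum _ fun k _ => ((hcle k).1 j).const_mul _, ← integral_const_mul]
      refine integral_congr_ae (Eventually.of_forall fun ζ => ?_)
      have h1 := apply_add_I_smul (fderiv ℝ (cutBM R j) (z - ζ)) X
      simp only
      simp_rw [← mul_assoc]
      rw [← Finset.sum_mul, ← add_mul, h1, mul_assoc]
      rfl
    have hT2 := apply_add_I_smul (translateDeriv v (cutSource R) z) X
    -- By the equation for `v`, the antilinear part of the smooth term is the integral of the source
    -- against `w k`. The potentials give the same quantity by `sum_integral_dbarFun_cutBM`, and the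
    -- two enter with opposite signs.
    have hT3 : ∀ k, antiPart k (translateDeriv v (cutSource R) z) =
        ∫ ζ in W, cutSource R (ζ - z) * w k ζ := by
      intro k
      have ht := isTest_cutSource hR hRW
      have h1 := eval_dbar v ht k
      rw [(H.given k).eval_eq ht, ← ht.setIntegral_mul] at h1
      rw [h1, antiPart, hθX, hθX]
      have ha := ht.fderiv_apply (EuclideanSpace.single k (1 : ℂ))
      have hb := ht.fderiv_apply (EuclideanSpace.single k Complex.I)
      have e : dbarFun k (fun ζ => cutSource R (ζ - z)) = fun x => 1 / 2 *
          (fderiv ℝ (fun ζ => cutSource R (ζ - z)) x (EuclideanSpace.single k (1 : ℂ)) +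
          Complex.I * fderiv ℝ (fun ζ => cutSource R (ζ - z)) x
            (EuclideanSpace.single k Complex.I)) := rfl
      rw [e, eval_const_mul v (ha.add (hb.const_mul _)), eval_add v ha (hb.const_mul _),
        eval_const_mul v hb]
      simp only [fderiv_comp_sub]
      ring
    rw [hL, hL]
    have h4 : ∀ a b c d : ℂ, a - b + Complex.I * (c - d) =
        (a + Complex.I * c) - (b + Complex.I * d) := fun a b c d => by ring
    rw [h4, hT2, Finset.mul_sum, ← Finset.sum_add_distrib]
    simp_rw [hG2, hT3, ← (hcle _).2]
    rw [← Finset.mul_sum, Finset.sum_comm]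
    simp_rw [← Finset.mul_sum]
    exact sub_self _

end

end LocalReg

/-! ### Assembly of the four assertions -/

theorem lemma4p1 (n p l : ℕ) (hp : 0 < p) (hl : 0 < l)
    (hln : (3 * n / 2 - 1 : ℝ) < l) (hpl : (p : ℝ) < l - 3 * n / 2 + 1)
    (W U : TopologicalSpace.Opens (Cn n)) (hW0 : (0 : Cn n) ∈ W)
    (hWb : Bornology.IsBounded (W : Set (Cn n)))
    (hWU : closure (W : Set (Cn n)) ⊆ (U : Set (Cn n)))
    (f : Cn n → ℝ) (hf : ContDiffOn ℝ p f (U : Set (Cn n))) (hf0 : f 0 = 0)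
    (hdf : ∀ z ∈ U, fderiv ℝ f z ≠ 0)
    (σs : ℝ) (hσs : 0 < σs) (φ : ℝ → Cn n → Cn n)
    (hφ : IsDiffeoFamily p (level W f) σs φ) :
    -- (1)
    (∀ (α : ℝ) (u : Cn n → ℂ), 1 < α →
      AEStronglyMeasurable u (volume.restrict (W : Set (Cn n))) →
      IntegrableOn (fun z => u z / ((|f z| ^ α : ℝ) : ℂ)) (W : Set (Cn n)) →
      ∃ s : ℕ → ℝ, (∀ ν, 0 < s ν ∧ s ν < σs) ∧ Tendsto s atTop (𝓝 0) ∧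
        (∀ ν, IntegrableOn u (level W f (s ν)) (area n)) ∧
        Tendsto (fun ν => ∫ z in level W f (s ν), ‖u z‖ ∂(area n)) atTop (𝓝 0)) ∧
    -- (2)
    (∀ (u : Cn n → ℂ) (K₁ : Cn n → Cn n → ℂ) (r : ℝ),
      MemLp u 2 (volume.restrict (W : Set (Cn n))) →
      IsNumerator p (U : Set (Cn n)) K₁ →
      0 < r → Metric.ball (0 : Cn n) r ⊆ (W : Set (Cn n)) →
      (∀ σ : ℝ,
        (∀ᵐ z ∂((area n).restrict (level W f σ)),
          IntegrableOn (fun ζ => kernel K₁ z ζ * u ζ) (Metric.ball (0 : Cn n) r)) ∧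
        IntegrableOn (kernelIntegral K₁ u r) (level W f σ) (area n)) ∧
      (∀ Q : Set (Cn n), IsCompact Q → Q ⊆ level W f 0 →
        TendstoL1 φ (kernelIntegral K₁ u r) (kernelIntegral K₁ u r) Q) ∧
      (Metric.closedBall (0 : Cn n) r ⊆ (W : Set (Cn n)) →
        TendstoL1 φ (kernelIntegral K₁ u r) (kernelIntegral K₁ u r) (level W f 0))) ∧
    -- (3)
    (∀ (u : Cn n → ℂ) (K₁ : Cn n → Cn n → ℂ) (r : ℝ),
      MemLp u 2 (volume.restrict (W : Set (Cn n))) →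
      IsNumerator p (U : Set (Cn n)) K₁ →
      HasNumeratorDerivBounds p (W : Set (Cn n)) K₁ →
      0 < r → Metric.ball (0 : Cn n) r ⊆ (W : Set (Cn n)) →
      MemLp (fun z => u z / ((|f z| ^ l : ℝ) : ℂ)) 2 (volume.restrict (W : Set (Cn n))) →
      (∀ z ∈ level W f 0,
        IntegrableOn (fun ζ => kernel K₁ z ζ * u ζ) (Metric.ball (0 : Cn n) r)) ∧
      IsCpOn p (kernelIntegral K₁ u r) (level W f 0)) ∧
    -- (4)
    (∀ (ω : Fin n → 𝓓'(U, ℂ)) (w : Fin n → Cn n → ℂ) (v : 𝓓'(W, ℂ)),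
      (∀ j, IsGivenBy (ω j) (w j)) →
      (∀ j k, dbar j (ω k) = dbar k (ω j)) →
      (∀ j, ContDiffOn ℝ (p - 1 : ℕ) (w j) ((U : Set (Cn n)) \ {z | f z = 0})) →
      (∀ j, MemLp (fun z => w j z / ((|f z| ^ l : ℝ) : ℂ)) 2
        (volume.restrict (U : Set (Cn n)))) →
      (∀ j, IsGivenBy (dbar j v) (w j)) →
      ∃ h v₀ : Cn n → ℂ, IsGivenBy v h ∧
        ContinuousOn h ((W : Set (Cn n)) \ level W f 0) ∧
        (∀ Q : Set (Cn n), IsCompact Q → Q ⊆ level W f 0 → TendstoL1 φ h v₀ Q) ∧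
        IsCpOn p v₀ (level W f 0) ∧ IsCR f v₀ (level W f 0)) := by
  -- For `n = 0` the space is a point and `df` would vanish at the origin.
  have hn : 0 < n := by
    rcases Nat.eq_zero_or_pos n with rfl | h
    · exact absurd (Subsingleton.elim _ _) (hdf 0 (hWU (subset_closure hW0)))
    · exact h
  have S : LevelData p (U : Set (Cn n)) (W : Set (Cn n)) f :=
    ⟨hp, U.2, W.2, hWb, hWU, hf, hdf⟩
  have F := hφ.levelFamily hσs
  -- With `d = 2 * n - 1` this is the condition of `LevelData.isTight`. It amounts to `p < l - n +
  -- 1`, which follows from the assumed bound because `3 n / 2 ≥ n`.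
  have hpl' : 2 * (2 * n - 1 + p) < 2 * l + (2 * n - 1 + 1) := by
    have h1 : (2 * p + 3 * n : ℝ) < 2 * l + 2 := by linarith
    have h2 : 2 * p + 3 * n < 2 * l + 2 := by exact_mod_cast h1
    omega
  refine ⟨fun α u hα hu hui => ?_, fun u K₁ r hu hK hr hrW => ?_,
    fun u K₁ r hu hK hK' hr hrW hul => ?_, fun ω w v hω hcl hw hwl hv => ?_⟩
  · rw [volume_Cn hn] at hu hui
    exact S.exists_seq_small_level (finrank_Cn hn) hα hu hui hσs
  · exact kernelIntegral_levels S hn F hu hK hrW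
  · exact kernelIntegral_regular S hn hpl' hu hK hK' hrW hul
  · have hwlW := fun j => (hwl j).mono_measure (Measure.restrict_mono S.subset le_rfl)
    -- Since `p - 1` may be 0, the only regularity of the coefficients that is used is continuity
    -- off the zero set.
    have hwc : ∀ j, ContinuousOn (w j) {ζ | ζ ∈ W ∧ f ζ ≠ 0} := fun j =>
      (hw j).continuousOn.mono fun z hz => ⟨S.subset hz.1, hz.2⟩
    have H := S.isSolution hn hpl' hv hwc hwlW
    have key := fun z (hz : z ∈ level W f 0) => S.exists_extension_sol hn hpl' H hwlW
      (fun j k g hg => integral_dbarFun_mul_comm hω hcl j k (hg.mono S.subset)) hz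
    -- One function serves as `h` and as `v₀`: the integral formula defines `sol` at every point,
    -- including those of the null set `f = 0`.
    refine ⟨sol v w, sol v w, H.isGivenBy hn,
      (S.continuousOn_sol H hwc).mono fun z hz => ⟨hz.1, fun h => hz.2 ⟨hz.1, h⟩⟩,
      fun Q hQ hQS => F.tendstoL1_sol S hn H (fun j => S.memLp_of_div hn (hwlW j)) hQ hQS,
      fun z hz => ?_, fun z hz => ?_⟩
    · obtain ⟨V, hV, hzV, G, hG, hGe, -⟩ := key z hz
      exact ⟨V, hV, hzV, G, hG, hGe⟩
    · obtain ⟨V, hV, hzV, G, hG, hGe, hX⟩ := key z hz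
      exact ⟨V, hV, hzV, G, hG.of_le (by exact_mod_cast hp), hGe, hX⟩
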